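/- Conventions. A homomorphism of bicategories is a pseudofunctor. Let $\mathcal B$ be a bicategory, with associativity constraint $a:(h\circ g)\circ f\cong h\circ(g\circ f)$ and unit constraints $l:1\circ f\cong f$, $r:f\circ 1\cong f$. A \emph{lax bidiagram of bicategories} $\mathcal L:\mathcal B^{\mathrm{op}}\to\mathbf{Bicat}$ is a contravariant lax functor of tricategories from $\mathcal B$ (with identity 3-cells) to the tricategory of bicategories whose coherence modifications are all invertible. It consists of bicategories $\mathcal L_b$, homomorphisms $f^*:\mathcal L_b\to\mathcal L_a$ for the 1-cells $f:a\to b$, pseudo transformations $\alpha^*:f^*\Rightarrow g^*$ for the 2-cells $\alpha:f\Rightarrow g$, pseudo transformations $\chi_{g,f}:f^*g^*\Rightarrow(g\circ f)^*$ and $\chi_b:1_{\mathcal L_b}\Rightarrow 1_b^*$, and invertible modifications $$\xi:\beta^*\circ\alpha^*\cong(\beta\cdot\alpha)^*,\quad \xi:1_{f^*}\cong 1_f^*,\quad \chi:(\beta\circ\alpha)^*\circ\chi\cong\chi\circ(\alpha^*\beta^*),$$ $$\omega:a^*\circ(\chi\circ f^*\chi)\cong\chi\circ\chi h^*,\quad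 \gamma:l^*\circ(\chi\circ f^*\chi)\cong 1_{f^*},\quad \delta:r^*\circ(\chi\circ\chi f^*)\cong 1_{f^*},$$ subject to the usual coherence conditions: associativity and unit conditions for $\xi$, compatibility of $\chi$ with vertical composition and identities, naturality of $\omega,\gamma,\delta$, the pentagon for $\omega$ and the triangle for $\omega,\gamma,\delta$. The \emph{Grothendieck construction} $\int_{\mathcal B}\mathcal L$ has as objects the pairs $(x,a)$ with $a\in\mathcal B$ and $x\in\mathcal L_a$, as 1-cells $(x,a)\to(y,b)$ the pairs $(u,f)$ with $f:a\to b$ and $u:x\to f^*y$, and as 2-cells $(u,f)\Rightarrow(v,g)$ the pairs $(\phi,\alpha)$ with $\alpha:f\Rightarrow g$ and $\phi:\alpha^*y\circ u\Rightarrow v$. Horizontal composition of 1-cells is $(u',f')\circ(u,f)=(\chi z\circ(f^*u'\circ u),f'\circ f)$ for $(x,a)\xrightarrow{(u,f)}(y,b)\xrightarrow{(u',f')}(z,c)$, the identity of $(x,a)$ is $(\chi x,1_a)$, and the compositions of 2-cells and the constraints are obtained by pasting with $\xi$, $\chi$, $\omega$, $\gamma$ and $\delta$. The \emph{classifying space}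 $\mathrm B\mathcal A$ of a small bicategory $\mathcal A$ is the geometric realization of its (non-unitary) geometric nerve, the simplicial set whose $n$-simplices are all lax functors $[n]\to\mathcal A$. A homomorphism $F$ induces a continuous map $\mathrm BF$ by composition. Statement. Let $\mathcal C$ be a small category with an initial object $0$, regarded as a bicategory whose 2-cells are all identities, let $0_a:0\to a$ be the unique morphism, and let $\mathcal L:\mathcal C^{\mathrm{op}}\to\mathbf{Bicat}$ be a lax bidiagram of small bicategories. Then $\int_{\mathcal C}\mathcal L$ is a bicategory, and there are homomorphisms $$J:\mathcal L_0\to\int_{\mathcal C}\mathcal L,\qquad K:\int_{\mathcal C}\mathcal L\to\mathcal L_0,$$ where $J$ is given by $Jx=(x,0)$, $J(u:x\to y)=(\chi y\circ u,1_0)$ and, on a 2-cell $\phi:u\Rightarrow v$, by $\phi$ whiskered with $\chi y$ and composed with $\xi^{-1}:1_{1_0}^*\cong 1_{1_0^*}$; and $K$ is given by $K(x,a)=0_a^*x$, $K((u,f):(x,a)\to(y,b))=\chi y\circ 0_a^*u$ (using $f\circ 0_a=0_b$) and, on a 2-cell $(\phi,1_f)$, by $0_a^*\phi$ composed with the isomorphism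 $1_{0_a^*f^*y}\cong 0_a^*1_f^*y$ induced by $\xi$ and whiskered with $\chi y$. Their constraints are the canonical ones obtained by pasting with the structure cells of $\mathcal L$. The induced map $$\mathrm BJ:\mathrm B\mathcal L_0\longrightarrow\mathrm B\!\int_{\mathcal C}\mathcal L$$ is a homotopy equivalence, with homotopy inverse $\mathrm BK$. -/

import Mathlib

open CategoryTheory Bicategory

universe w₁ w₂ v₁ v₂ u₁ u₂ u

set_option linter.checkUnivs false

namespace LaxBidiagrams

section Squares

variable {B : Type u₁} [Bicategory.{w₁, v₁} B] {C : Type u₂} [Bicategory.{w₂, v₂} C]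

/-- Horizontal pasting of two squares that commute up to invertible 2-cells: the naturality
cell of a vertical composite of pseudo transformations. -/
def sqComp {x x' y y' z z' : B} {f : x ⟶ x'} {g : y ⟶ y'} {h : z ⟶ z'}
    {p : x ⟶ y} {p' : x' ⟶ y'} {q : y ⟶ z} {q' : y' ⟶ z'}
    (m : f ≫ p' ≅ p ≫ g) (n : g ≫ q' ≅ q ≫ h) : f ≫ p' ≫ q' ≅ (p ≫ q) ≫ h :=
  (α_ _ _ _).symm ≪≫ whiskerRightIso m q' ≪≫ α_ _ _ _ ≪≫ whiskerLeftIso p n ≪≫ (α_ _ _ _).symm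

/-- The image of a square under a homomorphism: the naturality cell of `H θ`. -/
def sqMap (H : B ⥤ᵖ C) {x x' y y' : B} {f : x ⟶ x'} {g : y ⟶ y'} {p : x ⟶ y} {p' : x' ⟶ y'}
    (m : f ≫ p' ≅ p ≫ g) : H.map f ≫ H.map p' ≅ H.map p ≫ H.map g :=
  (H.mapComp f p').symm ≪≫ H.map₂Iso m ≪≫ H.mapComp p g

/-- The naturality cell of an identity transformation. -/
def sqId {x x' : B} (f : x ⟶ x') : f ≫ 𝟙 x' ≅ 𝟙 x ≫ f :=
  ρ_ f ≪≫ (λ_ f).symm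

/-- The condition for a modification at one 1-cell: `m` and `n` are the naturality cells of the
source and of the target, and `σ`, `σ'` are the components of the modification. -/
def SqCompat {x x' y y' : B} {f : x ⟶ x'} {g : y ⟶ y'} {p q : x ⟶ y} {p' q' : x' ⟶ y'}
    (m : f ≫ p' ≅ p ≫ g) (n : f ≫ q' ≅ q ≫ g) (σ : p ≅ q) (σ' : p' ≅ q') : Prop :=
  f ◁ σ'.hom ≫ n.hom = m.hom ≫ σ.hom ▷ g

/-- Horizontal composition of 2-cells. -/
def hcomp₂ {a b c : B} {f f' : a ⟶ b} {g g' : b ⟶ c} (α : f ⟶ f') (β : g ⟶ g') :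
    f ≫ g ⟶ f' ≫ g' :=
  α ▷ g ≫ f' ◁ β

end Squares

/-- The bicategories, homomorphisms and pseudo transformations of a lax bidiagram. Composition
is written in diagrammatic order: `f ≫ g` is `g ∘ f`. -/
structure LaxBidiagramCore (B : Type u₁) [Bicategory.{w₁, v₁} B] where
  fib : B → Type u₂
  [fibBicategory : ∀ b, Bicategory.{w₂, v₂} (fib b)]
  /-- the homomorphism `f^*` -/
  pull {a b : B} (f : a ⟶ b) : fib b ⥤ᵖ fib a
  /-- the pseudo transformation `α^* : f^* ⇒ g^*` -/
  pull₂ {a b : B} {f g : a ⟶ b} (α : f ⟶ g) : Pseudofunctor.StrongTrans (pull f) (pull g)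
  /-- the pseudo transformation `χ : f^* g^* ⇒ (g ∘ f)^*` -/
  chi {a b c : B} (f : a ⟶ b) (g : b ⟶ c) :
    Pseudofunctor.StrongTrans ((pull g).comp (pull f)) (pull (f ≫ g))
  /-- the pseudo transformation `χ : 1 ⇒ 1_a^*` -/
  unit (a : B) : Pseudofunctor.StrongTrans (Pseudofunctor.id (fib a)) (pull (𝟙 a))

attribute [instance] LaxBidiagramCore.fibBicategory

namespace LaxBidiagramCore

variable {B : Type u₁} [Bicategory.{w₁, v₁} B] (L : LaxBidiagramCore.{w₁, w₂, v₁, v₂, u₁, u₂} B)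

def cell {a b : B} {f g : a ⟶ b} (α : f ⟶ g) (y : L.fib b) :
    (L.pull f).obj y ⟶ (L.pull g).obj y :=
  (L.pull₂ α).app y

def cellNat {a b : B} {f g : a ⟶ b} (α : f ⟶ g) {y y' : L.fib b} (v : y ⟶ y') :
    (L.pull f).map v ≫ L.cell α y' ≅ L.cell α y ≫ (L.pull g).map v :=
  (L.pull₂ α).naturality v

def chiApp {a b c : B} (f : a ⟶ b) (g : b ⟶ c) (z : L.fib c) :
    (L.pull f).obj ((L.pull g).obj z) ⟶ (L.pull (f ≫ g)).obj z :=
  (L.chi f g).app z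

def chiNat {a b c : B} (f : a ⟶ b) (g : b ⟶ c) {z z' : L.fib c} (w : z ⟶ z') :
    (L.pull f).map ((L.pull g).map w) ≫ L.chiApp f g z' ≅
      L.chiApp f g z ≫ (L.pull (f ≫ g)).map w :=
  (L.chi f g).naturality w

def unitApp (a : B) (x : L.fib a) : x ⟶ (L.pull (𝟙 a)).obj x :=
  (L.unit a).app x

def unitNat (a : B) {x y : L.fib a} (u : x ⟶ y) :
    u ≫ L.unitApp a y ≅ L.unitApp a x ≫ (L.pull (𝟙 a)).map u :=
  (L.unit a).naturality u

/-- The component at `z` of the composite `f^* g^* ⇒ h^* g^* ⇒ h^* k^*`, in the order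
`(α^* k^*) ∘ (f^* β^*)`. -/
abbrev cell₂ {a b c : B} {f h : a ⟶ b} {g k : b ⟶ c} (α : f ⟶ h) (β : g ⟶ k) (z : L.fib c) :
    (L.pull f).obj ((L.pull g).obj z) ⟶ (L.pull h).obj ((L.pull k).obj z) :=
  (L.pull f).map (L.cell β z) ≫ L.cell α ((L.pull k).obj z)

def cell₂Nat {a b c : B} {f h : a ⟶ b} {g k : b ⟶ c} (α : f ⟶ h) (β : g ⟶ k)
    {z z' : L.fib c} (w : z ⟶ z') :
    (L.pull f).map ((L.pull g).map w) ≫ L.cell₂ α β z' ≅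
      L.cell₂ α β z ≫ (L.pull h).map ((L.pull k).map w) :=
  sqComp (sqMap (L.pull f) (L.cellNat β w)) (L.cellNat α ((L.pull k).map w))

/-- Equal 2-cells induce isomorphic (indeed equal) 1-cells. -/
def cellEq {a b : B} {f g : a ⟶ b} {α β : f ⟶ g} (h : α = β) (y : L.fib b) :
    L.cell α y ≅ L.cell β y :=
  eqToIso (by rw [h])

end LaxBidiagramCore

/-- The core together with the invertible modifications `ξ`, `χ`, `ω`, `γ`, `δ`, given by their
components, which are compatible with the naturality cells of the source and of the target. -/
structure LaxBidiagramData (B : Type u₁) [Bicategory.{w₁, v₁} B] extends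
    LaxBidiagramCore.{w₁, w₂, v₁, v₂, u₁, u₂} B where
  /-- `ξ : β^* ∘ α^* ≅ (β · α)^*` -/
  xi {a b : B} {f g h : a ⟶ b} (α : f ⟶ g) (β : g ⟶ h) (y : fib b) :
    toLaxBidiagramCore.cell α y ≫ toLaxBidiagramCore.cell β y ≅
      toLaxBidiagramCore.cell (α ≫ β) y
  xi_natural {a b : B} {f g h : a ⟶ b} (α : f ⟶ g) (β : g ⟶ h) {y y' : fib b} (v : y ⟶ y') :
    SqCompat (sqComp (toLaxBidiagramCore.cellNat α v) (toLaxBidiagramCore.cellNat β v))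
      (toLaxBidiagramCore.cellNat (α ≫ β) v) (xi α β y) (xi α β y')
  /-- `ξ : 1_{f^*} ≅ 1_f^*` -/
  xiId {a b : B} (f : a ⟶ b) (y : fib b) :
    𝟙 ((pull f).obj y) ≅ toLaxBidiagramCore.cell (𝟙 f) y
  xiId_natural {a b : B} (f : a ⟶ b) {y y' : fib b} (v : y ⟶ y') :
    SqCompat (sqId ((pull f).map v)) (toLaxBidiagramCore.cellNat (𝟙 f) v) (xiId f y) (xiId f y')
  /-- `χ : (β ∘ α)^* ∘ χ ≅ χ ∘ (α^* β^*)` -/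
  chi₂ {a b c : B} {f h : a ⟶ b} {g k : b ⟶ c} (α : f ⟶ h) (β : g ⟶ k) (z : fib c) :
    toLaxBidiagramCore.chiApp f g z ≫ toLaxBidiagramCore.cell (hcomp₂ α β) z ≅
      toLaxBidiagramCore.cell₂ α β z ≫ toLaxBidiagramCore.chiApp h k z
  chi₂_natural {a b c : B} {f h : a ⟶ b} {g k : b ⟶ c} (α : f ⟶ h) (β : g ⟶ k)
      {z z' : fib c} (w : z ⟶ z') :
    SqCompat
      (sqComp (toLaxBidiagramCore.chiNat f g w) (toLaxBidiagramCore.cellNat (hcomp₂ α β) w))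
      (sqComp (toLaxBidiagramCore.cell₂Nat α β w) (toLaxBidiagramCore.chiNat h k w))
      (chi₂ α β z) (chi₂ α β z')
  /-- `ω : a^* ∘ (χ ∘ f^* χ) ≅ χ ∘ χ h^*` -/
  omega {a b c d : B} (f : a ⟶ b) (g : b ⟶ c) (h : c ⟶ d) (t : fib d) :
    ((pull f).map (toLaxBidiagramCore.chiApp g h t) ≫ toLaxBidiagramCore.chiApp f (g ≫ h) t) ≫
        toLaxBidiagramCore.cell (α_ f g h).inv t ≅
      toLaxBidiagramCore.chiApp f g ((pull h).obj t) ≫ toLaxBidiagramCore.chiApp (f ≫ g) h t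
  omega_natural {a b c d : B} (f : a ⟶ b) (g : b ⟶ c) (h : c ⟶ d) {t t' : fib d} (k : t ⟶ t') :
    SqCompat
      (sqComp
        (sqComp (sqMap (pull f) (toLaxBidiagramCore.chiNat g h k))
          (toLaxBidiagramCore.chiNat f (g ≫ h) k))
        (toLaxBidiagramCore.cellNat (α_ f g h).inv k))
      (sqComp (toLaxBidiagramCore.chiNat f g ((pull h).map k))
        (toLaxBidiagramCore.chiNat (f ≫ g) h k))
      (omega f g h t) (omega f g h t')
  /-- `γ : l^* ∘ (χ ∘ f^* χ) ≅ 1_{f^*}` -/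
  gamma {a b : B} (f : a ⟶ b) (y : fib b) :
    ((pull f).map (toLaxBidiagramCore.unitApp b y) ≫ toLaxBidiagramCore.chiApp f (𝟙 b) y) ≫
        toLaxBidiagramCore.cell (ρ_ f).hom y ≅
      𝟙 ((pull f).obj y)
  gamma_natural {a b : B} (f : a ⟶ b) {y y' : fib b} (v : y ⟶ y') :
    SqCompat
      (sqComp
        (sqComp (sqMap (pull f) (toLaxBidiagramCore.unitNat b v))
          (toLaxBidiagramCore.chiNat f (𝟙 b) v))
        (toLaxBidiagramCore.cellNat (ρ_ f).hom v))
      (sqId ((pull f).map v)) (gamma f y) (gamma f y')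
  /-- `δ : r^* ∘ (χ ∘ χ f^*) ≅ 1_{f^*}` -/
  delta {a b : B} (f : a ⟶ b) (y : fib b) :
    (toLaxBidiagramCore.unitApp a ((pull f).obj y) ≫ toLaxBidiagramCore.chiApp (𝟙 a) f y) ≫
        toLaxBidiagramCore.cell (λ_ f).hom y ≅
      𝟙 ((pull f).obj y)
  delta_natural {a b : B} (f : a ⟶ b) {y y' : fib b} (v : y ⟶ y') :
    SqCompat
      (sqComp
        (sqComp (toLaxBidiagramCore.unitNat a ((pull f).map v))
          (toLaxBidiagramCore.chiNat (𝟙 a) f v))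
        (toLaxBidiagramCore.cellNat (λ_ f).hom v))
      (sqId ((pull f).map v)) (delta f y) (delta f y')

namespace LaxBidiagramData

open LaxBidiagramCore

variable {B : Type u₁} [Bicategory.{w₁, v₁} B] (L : LaxBidiagramData.{w₁, w₂, v₁, v₂, u₁, u₂} B)

/-- The isomorphism `ξ` for a commutative triangle of 2-cells. -/
def xiTri {a b : B} {f g h : a ⟶ b} {α : f ⟶ g} {β : g ⟶ h} {γ : f ⟶ h} (e : α ≫ β = γ)
    (y : L.fib b) : L.cell α y ≫ L.cell β y ≅ L.cell γ y :=
  L.xi α β y ≪≫ L.cellEq e y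

/-- The isomorphism `ξ` for a commutative square of 2-cells. -/
def xiSq {a b : B} {f g g' h : a ⟶ b} {α : f ⟶ g} {β : g ⟶ h} {α' : f ⟶ g'} {β' : g' ⟶ h}
    (e : α ≫ β = α' ≫ β') (y : L.fib b) :
    L.cell α y ≫ L.cell β y ≅ L.cell α' y ≫ L.cell β' y :=
  L.xiTri e y ≪≫ (L.xi α' β' y).symm

/-- The modification `χ` for a 2-cell whiskered by `f` on the source side. -/
def chiL {a b c : B} (f : a ⟶ b) {g g' : b ⟶ c} (α : g ⟶ g') (z : L.fib c) :
    L.chiApp f g z ≫ L.cell (f ◁ α) z ≅ (L.pull f).map (L.cell α z) ≫ L.chiApp f g' z :=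
  whiskerLeftIso (L.chiApp f g z) (L.cellEq (by simp [hcomp₂]) z) ≪≫ L.chi₂ (𝟙 f) α z ≪≫
    whiskerRightIso
      (whiskerLeftIso ((L.pull f).map (L.cell α z)) (L.xiId f ((L.pull g').obj z)).symm ≪≫ ρ_ _)
      (L.chiApp f g' z)

/-- The modification `χ` for a 2-cell whiskered by `h` on the target side. -/
def chiR {b c d : B} {g g' : b ⟶ c} (α : g ⟶ g') (h : c ⟶ d) (z : L.fib d) :
    L.chiApp g h z ≫ L.cell (α ▷ h) z ≅ L.cell α ((L.pull h).obj z) ≫ L.chiApp g' h z :=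
  whiskerLeftIso (L.chiApp g h z) (L.cellEq (by simp [hcomp₂]) z) ≪≫ L.chi₂ α (𝟙 h) z ≪≫
    whiskerRightIso
      (whiskerRightIso
        ((L.pull g).map₂Iso (L.xiId h z).symm ≪≫ (L.pull g).mapId ((L.pull h).obj z))
        (L.cell α ((L.pull h).obj z)) ≪≫ λ_ _)
      (L.chiApp g' h z)

end LaxBidiagramData

/-- The coherence conditions of a lax bidiagram. Equations of modifications are written
componentwise, and the symbol `⊗≫` inserts associativity and unit constraints. -/
structure LaxBidiagramData.IsCoherent {B : Type u₁} [Bicategory.{w₁, v₁} B]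
    (L : LaxBidiagramData.{w₁, w₂, v₁, v₂, u₁, u₂} B) : Prop where
  /-- The modifications `ξ` are associative. -/
  xi_assoc {a b : B} {f g h k : a ⟶ b} (α : f ⟶ g) (β : g ⟶ h) (ζ : h ⟶ k) (y : L.fib b) :
    (L.xi α β y).hom ▷ L.cell ζ y ≫
        (L.xiTri (Category.assoc α β ζ) y).hom =
      (α_ _ _ _).hom ≫ L.cell α y ◁ (L.xi β ζ y).hom ≫ (L.xi α (β ≫ ζ) y).hom
  /-- Unit condition for `ξ`: an identity 2-cell first. -/
  xi_id_left {a b : B} {f g : a ⟶ b} (α : f ⟶ g) (y : L.fib b) :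
    (L.xiId f y).hom ▷ L.cell α y ≫
        (L.xiTri (Category.id_comp α) y).hom =
      (λ_ (L.cell α y)).hom
  /-- Unit condition for `ξ`: an identity 2-cell last. -/
  xi_id_right {a b : B} {f g : a ⟶ b} (α : f ⟶ g) (y : L.fib b) :
    L.cell α y ◁ (L.xiId g y).hom ≫
        (L.xiTri (Category.comp_id α) y).hom =
      (ρ_ (L.cell α y)).hom
  /-- The modifications `χ` are compatible with vertical composition. -/
  chi₂_comp {a b c : B} {f f' f'' : a ⟶ b} {g g' g'' : b ⟶ c} (α : f ⟶ f') (α' : f' ⟶ f'')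
      (β : g ⟶ g') (β' : g' ⟶ g'') (z : L.fib c) :
    (L.chi₂ α β z).hom ▷ L.cell (hcomp₂ α' β') z ⊗≫
        L.cell₂ α β z ◁ (L.chi₂ α' β' z).hom ⊗≫
        (L.pull f).map (L.cell β z) ◁
          (L.cellNat α (L.cell β' z)).inv ▷
            (L.cell α' ((L.pull g'').obj z) ≫
              L.chiApp f'' g'' z) ⊗≫
        (((L.pull f).mapComp (L.cell β z) (L.cell β' z)).inv ≫
            (L.pull f).map₂ (L.xi β β' z).hom) ▷
          (L.cell α ((L.pull g'').obj z) ≫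
            L.cell α' ((L.pull g'').obj z) ≫
              L.chiApp f'' g'' z) ⊗≫
        (L.pull f).map (L.cell (β ≫ β') z) ◁
          (L.xi α α' ((L.pull g'').obj z)).hom ▷ L.chiApp f'' g'' z ⊗≫
        𝟙 (L.cell₂ (α ≫ α') (β ≫ β') z ≫
          L.chiApp f'' g'' z) =
      (α_ _ _ _).hom ≫
        L.chiApp f g z ◁
          (L.xiTri (γ := hcomp₂ (α ≫ α') (β ≫ β'))
            (by simp [hcomp₂, whisker_exchange_assoc]) z).hom ≫
        (L.chi₂ (α ≫ α') (β ≫ β') z).hom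
  /-- The modifications `χ` are compatible with identity 2-cells. -/
  chi₂_id {a b c : B} (f : a ⟶ b) (g : b ⟶ c) (z : L.fib c) :
    L.chiApp f g z ◁
          ((L.xiId (f ≫ g) z).hom ≫ (L.cellEq
            (by simp [hcomp₂] : 𝟙 (f ≫ g) = hcomp₂ (𝟙 f) (𝟙 g)) z).hom) ≫
        (L.chi₂ (𝟙 f) (𝟙 g) z).hom =
      𝟙 (L.chiApp f g z ≫ 𝟙 _) ⊗≫
        (((L.pull f).mapId ((L.pull g).obj z)).inv ≫ (L.pull f).map₂ (L.xiId g z).hom) ▷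
          L.chiApp f g z ⊗≫
        (L.pull f).map (L.cell (𝟙 g) z) ◁
          (L.xiId f ((L.pull g).obj z)).hom ▷ L.chiApp f g z ⊗≫
        𝟙 (L.cell₂ (𝟙 f) (𝟙 g) z ≫ L.chiApp f g z)
  /-- The modifications `ω` are natural in the three 1-cells. -/
  omega_naturality {a b c d : B} {f f' : a ⟶ b} {g g' : b ⟶ c} {h h' : c ⟶ d}
      (α : f ⟶ f') (β : g ⟶ g') (ζ : h ⟶ h') (t : L.fib d) :
    𝟙 ((((L.pull f).map (L.chiApp g h t) ≫
          L.chiApp f (g ≫ h) t) ≫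
          L.cell (α_ f g h).inv t) ≫
          L.cell (hcomp₂ (hcomp₂ α β) ζ) t) ⊗≫
        ((L.pull f).map (L.chiApp g h t) ≫
          L.chiApp f (g ≫ h) t) ◁
          (L.xiSq (α := (α_ f g h).inv) (β := hcomp₂ (hcomp₂ α β) ζ)
            (α' := hcomp₂ α (hcomp₂ β ζ)) (β' := (α_ f' g' h').inv)
            (by simp [hcomp₂]) t).hom ⊗≫
        (L.pull f).map (L.chiApp g h t) ◁ (L.chi₂ α (hcomp₂ β ζ) t).hom ▷
          L.cell (α_ f' g' h').inv t ⊗≫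
        (((L.pull f).mapComp (L.chiApp g h t)
              (L.cell (hcomp₂ β ζ) t)).inv ≫
            (L.pull f).map₂ (L.chi₂ β ζ t).hom ≫
            ((L.pull f).mapComp (L.cell₂ β ζ t)
              (L.chiApp g' h' t)).hom) ▷
          (L.cell α ((L.pull (g' ≫ h')).obj t) ≫
            L.chiApp f' (g' ≫ h') t ≫
              L.cell (α_ f' g' h').inv t) ⊗≫
        (L.pull f).map (L.cell₂ β ζ t) ◁
          (L.cellNat α (L.chiApp g' h' t)).hom ▷
            (L.chiApp f' (g' ≫ h') t ≫
              L.cell (α_ f' g' h').inv t) ⊗≫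
        ((L.pull f).mapComp ((L.pull g).map (L.cell ζ t))
            (L.cell β ((L.pull h').obj t))).hom ▷
          (L.cell α ((L.pull g').obj ((L.pull h').obj t)) ≫
            (L.pull f').map (L.chiApp g' h' t) ≫
            L.chiApp f' (g' ≫ h') t ≫
              L.cell (α_ f' g' h').inv t) ⊗≫
        ((L.pull f).map ((L.pull g).map (L.cell ζ t)) ≫
          L.cell₂ α β ((L.pull h').obj t)) ◁ (L.omega f' g' h' t).hom =
      (L.omega f g h t).hom ▷ L.cell (hcomp₂ (hcomp₂ α β) ζ) t ⊗≫
        L.chiApp f g ((L.pull h).obj t) ◁ (L.chi₂ (hcomp₂ α β) ζ t).hom ⊗≫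
        (L.chiNat f g (L.cell ζ t)).inv ▷
          (L.cell (hcomp₂ α β) ((L.pull h').obj t) ≫
            L.chiApp (f' ≫ g') h' t) ⊗≫
        (L.pull f).map ((L.pull g).map (L.cell ζ t)) ◁
          (L.chi₂ α β ((L.pull h').obj t)).hom ▷ L.chiApp (f' ≫ g') h' t ⊗≫
        𝟙 (((L.pull f).map ((L.pull g).map (L.cell ζ t)) ≫
            L.cell₂ α β ((L.pull h').obj t)) ≫
          L.chiApp f' g' ((L.pull h').obj t) ≫
            L.chiApp (f' ≫ g') h' t)
  /-- The pentagon for `ω`. -/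
  omega_pentagon {a b c d e : B} (f : a ⟶ b) (g : b ⟶ c) (h : c ⟶ d) (k : d ⟶ e) (s : L.fib e) :
    𝟙 ((((L.pull f).map ((L.pull g).map (L.chiApp h k s)) ≫
          (L.pull f).map (L.chiApp g (h ≫ k) s)) ≫
          L.chiApp f (g ≫ h ≫ k) s) ≫
        L.cell (f ◁ (α_ g h k).inv) s ≫
        L.cell (α_ f (g ≫ h) k).inv s ≫
        L.cell ((α_ f g h).inv ▷ k) s) ⊗≫
      (((L.pull f).map ((L.pull g).map (L.chiApp h k s)) ≫
          (L.pull f).map (L.chiApp g (h ≫ k) s)) ≫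
          L.chiApp f (g ≫ h ≫ k) s) ◁
        (L.cell (f ◁ (α_ g h k).inv) s ◁
            (L.xi (α_ f (g ≫ h) k).inv ((α_ f g h).inv ▷ k) s).hom ≫
          (L.xiSq (α' := (α_ f g (h ≫ k)).inv) (β' := (α_ (f ≫ g) h k).inv)
            (by simp) s).hom) ⊗≫
      (L.pull f).map ((L.pull g).map (L.chiApp h k s)) ◁
        (L.omega f g (h ≫ k) s).hom ▷ L.cell (α_ (f ≫ g) h k).inv s ⊗≫
      (L.chiNat f g (L.chiApp h k s)).hom ▷
        (L.chiApp (f ≫ g) (h ≫ k) s ≫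
          L.cell (α_ (f ≫ g) h k).inv s) ⊗≫
      L.chiApp f g ((L.pull h).obj ((L.pull k).obj s)) ◁
        (L.omega (f ≫ g) h k s).hom =
    𝟙 ((((L.pull f).map ((L.pull g).map (L.chiApp h k s)) ≫
          (L.pull f).map (L.chiApp g (h ≫ k) s)) ≫
          L.chiApp f (g ≫ h ≫ k) s) ≫
        L.cell (f ◁ (α_ g h k).inv) s ≫
        L.cell (α_ f (g ≫ h) k).inv s ≫
        L.cell ((α_ f g h).inv ▷ k) s) ⊗≫
      ((L.pull f).map ((L.pull g).map (L.chiApp h k s)) ≫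
          (L.pull f).map (L.chiApp g (h ≫ k) s)) ◁
        (L.chiL f (α_ g h k).inv s).hom ▷
        (L.cell (α_ f (g ≫ h) k).inv s ≫
          L.cell ((α_ f g h).inv ▷ k) s) ⊗≫
      ((((L.pull f).mapComp ((L.pull g).map (L.chiApp h k s))
              (L.chiApp g (h ≫ k) s)).inv ▷
            (L.pull f).map (L.cell (α_ g h k).inv s)) ≫
          ((L.pull f).mapComp ((L.pull g).map (L.chiApp h k s) ≫
              L.chiApp g (h ≫ k) s)
            (L.cell (α_ g h k).inv s)).inv ≫
          (L.pull f).map₂ (L.omega g h k s).hom ≫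
          ((L.pull f).mapComp (L.chiApp g h ((L.pull k).obj s))
            (L.chiApp (g ≫ h) k s)).hom) ▷
        (L.chiApp f ((g ≫ h) ≫ k) s ≫
          L.cell (α_ f (g ≫ h) k).inv s ≫
          L.cell ((α_ f g h).inv ▷ k) s) ⊗≫
      (L.pull f).map (L.chiApp g h ((L.pull k).obj s)) ◁
        (L.omega f (g ≫ h) k s).hom ▷ L.cell ((α_ f g h).inv ▷ k) s ⊗≫
      ((L.pull f).map (L.chiApp g h ((L.pull k).obj s)) ≫
          L.chiApp f (g ≫ h) ((L.pull k).obj s)) ◁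
        (L.chiR (α_ f g h).inv k s).hom ⊗≫
      (L.omega f g h ((L.pull k).obj s)).hom ▷ L.chiApp ((f ≫ g) ≫ h) k s ⊗≫
      𝟙 (L.chiApp f g ((L.pull h).obj ((L.pull k).obj s)) ≫
        L.chiApp (f ≫ g) h ((L.pull k).obj s) ≫
          L.chiApp ((f ≫ g) ≫ h) k s)
  /-- The modifications `δ` are natural in the 1-cell. -/
  delta_naturality {a b : B} {f g : a ⟶ b} (α : f ⟶ g) (y : L.fib b) :
    𝟙 ((L.unitApp a ((L.pull f).obj y) ≫ L.chiApp (𝟙 a) f y) ≫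
        L.cell (𝟙 a ◁ α) y ≫ L.cell (λ_ g).hom y) ⊗≫
      (L.unitApp a ((L.pull f).obj y) ≫ L.chiApp (𝟙 a) f y) ◁
        (L.xiSq (α := 𝟙 a ◁ α) (β := (λ_ g).hom) (α' := (λ_ f).hom) (β' := α) (by simp) y).hom ⊗≫
      (L.delta f y).hom ▷ L.cell α y ⊗≫
      𝟙 (L.cell α y) =
    𝟙 ((L.unitApp a ((L.pull f).obj y) ≫ L.chiApp (𝟙 a) f y) ≫
        L.cell (𝟙 a ◁ α) y ≫ L.cell (λ_ g).hom y) ⊗≫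
      L.unitApp a ((L.pull f).obj y) ◁
        (L.chiL (𝟙 a) α y).hom ▷ L.cell (λ_ g).hom y ⊗≫
      (L.unitNat a (L.cell α y)).inv ▷
        (L.chiApp (𝟙 a) g y ≫ L.cell (λ_ g).hom y) ⊗≫
      L.cell α y ◁ (L.delta g y).hom ⊗≫
      𝟙 (L.cell α y)
  /-- The modifications `γ` are natural in the 1-cell. -/
  gamma_naturality {a b : B} {f g : a ⟶ b} (α : f ⟶ g) (y : L.fib b) :
    𝟙 (((L.pull f).map (L.unitApp b y) ≫ L.chiApp f (𝟙 b) y) ≫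
        L.cell (α ▷ 𝟙 b) y ≫ L.cell (ρ_ g).hom y) ⊗≫
      ((L.pull f).map (L.unitApp b y) ≫ L.chiApp f (𝟙 b) y) ◁
        (L.xiSq (α := α ▷ 𝟙 b) (β := (ρ_ g).hom) (α' := (ρ_ f).hom) (β' := α) (by simp) y).hom ⊗≫
      (L.gamma f y).hom ▷ L.cell α y ⊗≫
      𝟙 (L.cell α y) =
    𝟙 (((L.pull f).map (L.unitApp b y) ≫ L.chiApp f (𝟙 b) y) ≫
        L.cell (α ▷ 𝟙 b) y ≫ L.cell (ρ_ g).hom y) ⊗≫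
      (L.pull f).map (L.unitApp b y) ◁
        (L.chiR α (𝟙 b) y).hom ▷ L.cell (ρ_ g).hom y ⊗≫
      (L.cellNat α (L.unitApp b y)).hom ▷
        (L.chiApp g (𝟙 b) y ≫ L.cell (ρ_ g).hom y) ⊗≫
      L.cell α y ◁ (L.gamma g y).hom ⊗≫
      𝟙 (L.cell α y)
  /-- The triangle for `ω`, `γ` and `δ`. -/
  omega_triangle {a b c : B} (f : a ⟶ b) (g : b ⟶ c) (z : L.fib c) :
    𝟙 ((L.pull f).map (L.unitApp b ((L.pull g).obj z)) ≫
        ((L.pull f).map (L.chiApp (𝟙 b) g z) ≫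
          L.chiApp f (𝟙 b ≫ g) z) ≫
        L.cell (f ◁ (λ_ g).hom) z) ⊗≫
      ((L.pull f).map (L.unitApp b ((L.pull g).obj z)) ≫
        ((L.pull f).map (L.chiApp (𝟙 b) g z) ≫
          L.chiApp f (𝟙 b ≫ g) z)) ◁
        (L.xiTri (α := (α_ f (𝟙 b) g).inv) (β := (ρ_ f).hom ▷ g)
          (γ := f ◁ (λ_ g).hom) (by simp) z).inv ⊗≫
      (L.pull f).map (L.unitApp b ((L.pull g).obj z)) ◁
        (L.omega f (𝟙 b) g z).hom ▷ L.cell ((ρ_ f).hom ▷ g) z ⊗≫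
      ((L.pull f).map (L.unitApp b ((L.pull g).obj z)) ≫
        L.chiApp f (𝟙 b) ((L.pull g).obj z)) ◁
        (L.chiR (ρ_ f).hom g z).hom ⊗≫
      (L.gamma f ((L.pull g).obj z)).hom ▷ L.chiApp f g z ⊗≫
      𝟙 (L.chiApp f g z) =
    𝟙 ((L.pull f).map (L.unitApp b ((L.pull g).obj z)) ≫
        ((L.pull f).map (L.chiApp (𝟙 b) g z) ≫
          L.chiApp f (𝟙 b ≫ g) z) ≫
        L.cell (f ◁ (λ_ g).hom) z) ⊗≫
      ((L.pull f).map (L.unitApp b ((L.pull g).obj z)) ≫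
        (L.pull f).map (L.chiApp (𝟙 b) g z)) ◁
        (L.chiL f (λ_ g).hom z).hom ⊗≫
      ((((L.pull f).mapComp (L.unitApp b ((L.pull g).obj z))
              (L.chiApp (𝟙 b) g z)).inv ▷
            (L.pull f).map (L.cell (λ_ g).hom z)) ≫
          ((L.pull f).mapComp (L.unitApp b ((L.pull g).obj z) ≫
              L.chiApp (𝟙 b) g z)
            (L.cell (λ_ g).hom z)).inv ≫
          (L.pull f).map₂ (L.delta g z).hom ≫ ((L.pull f).mapId ((L.pull g).obj z)).hom) ▷
        L.chiApp f g z ⊗≫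
      𝟙 (L.chiApp f g z)

/-- A lax bidiagram of bicategories `L : Bᵒᵖ → Bicat`: a contravariant lax functor of
tricategories from `B` to the tricategory of bicategories, with invertible coherence
modifications. -/
structure LaxBidiagram (B : Type u₁) [Bicategory.{w₁, v₁} B] extends
    LaxBidiagramData.{w₁, w₂, v₁, v₂, u₁, u₂} B where
  coherent : toLaxBidiagramData.IsCoherent

section BicategoryData

/-- The data of a bicategory whose hom-categories are given: horizontal composition of 2-cells
and the constraints. -/
structure BicategoryData (B : Type u₁) [CategoryStruct.{v₁} B]
    [∀ a b : B, Category.{w₁} (a ⟶ b)] where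
  hcomp {a b c : B} {f f' : a ⟶ b} {g g' : b ⟶ c} (η : f ⟶ f') (θ : g ⟶ g') : f ≫ g ⟶ f' ≫ g'
  associator {a b c d : B} (f : a ⟶ b) (g : b ⟶ c) (h : c ⟶ d) : (f ≫ g) ≫ h ≅ f ≫ g ≫ h
  leftUnitor {a b : B} (f : a ⟶ b) : 𝟙 a ≫ f ≅ f
  rightUnitor {a b : B} (f : a ⟶ b) : f ≫ 𝟙 b ≅ f

/-- Bénabou's axioms of a bicategory: horizontal composition is functorial, the constraints are
natural, and the pentagon and the triangle commute. -/
structure BicategoryData.IsBicategory {B : Type u₁} [CategoryStruct.{v₁} B]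
    [∀ a b : B, Category.{w₁} (a ⟶ b)] (S : BicategoryData.{w₁, v₁, u₁} B) : Prop where
  hcomp_id {a b c : B} (f : a ⟶ b) (g : b ⟶ c) : S.hcomp (𝟙 f) (𝟙 g) = 𝟙 (f ≫ g)
  hcomp_comp {a b c : B} {f f' f'' : a ⟶ b} {g g' g'' : b ⟶ c} (η : f ⟶ f') (η' : f' ⟶ f'')
    (θ : g ⟶ g') (θ' : g' ⟶ g'') :
    S.hcomp (η ≫ η') (θ ≫ θ') = S.hcomp η θ ≫ S.hcomp η' θ'
  associator_naturality {a b c d : B} {f f' : a ⟶ b} {g g' : b ⟶ c} {h h' : c ⟶ d}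
    (η : f ⟶ f') (θ : g ⟶ g') (ι : h ⟶ h') :
    S.hcomp (S.hcomp η θ) ι ≫ (S.associator f' g' h').hom =
      (S.associator f g h).hom ≫ S.hcomp η (S.hcomp θ ι)
  leftUnitor_naturality {a b : B} {f f' : a ⟶ b} (η : f ⟶ f') :
    S.hcomp (𝟙 (𝟙 a)) η ≫ (S.leftUnitor f').hom = (S.leftUnitor f).hom ≫ η
  rightUnitor_naturality {a b : B} {f f' : a ⟶ b} (η : f ⟶ f') :
    S.hcomp η (𝟙 (𝟙 b)) ≫ (S.rightUnitor f').hom = (S.rightUnitor f).hom ≫ η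
  pentagon {a b c d e : B} (f : a ⟶ b) (g : b ⟶ c) (h : c ⟶ d) (i : d ⟶ e) :
    S.hcomp (S.associator f g h).hom (𝟙 i) ≫
        (S.associator f (g ≫ h) i).hom ≫ S.hcomp (𝟙 f) (S.associator g h i).hom =
      (S.associator (f ≫ g) h i).hom ≫ (S.associator f g (h ≫ i)).hom
  triangle {a b c : B} (f : a ⟶ b) (g : b ⟶ c) :
    (S.associator f (𝟙 b) g).hom ≫ S.hcomp (𝟙 f) (S.leftUnitor g).hom =
      S.hcomp (S.rightUnitor f).hom (𝟙 g)

/-- Mathlib's bicategory associated with bicategory data that satisfy Bénabou's axioms. -/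
abbrev BicategoryData.IsBicategory.toBicategory {B : Type u₁} [CategoryStruct.{v₁} B]
    [∀ a b : B, Category.{w₁} (a ⟶ b)] {S : BicategoryData.{w₁, v₁, u₁} B}
    (hS : S.IsBicategory) : Bicategory.{w₁, v₁} B where
  whiskerLeft f _ _ η := S.hcomp (𝟙 f) η
  whiskerRight η h := S.hcomp η (𝟙 h)
  associator := S.associator
  leftUnitor := S.leftUnitor
  rightUnitor := S.rightUnitor
  whiskerLeft_id f g := hS.hcomp_id f g
  whiskerLeft_comp f _ _ _ η θ := by rw [← hS.hcomp_comp, Category.id_comp]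
  id_whiskerLeft η := by
    rw [← Category.assoc, ← hS.leftUnitor_naturality, Category.assoc, Iso.hom_inv_id,
      Category.comp_id]
  comp_whiskerLeft f g _ _ η := by
    rw [← Category.assoc, ← hS.associator_naturality, Category.assoc, Iso.hom_inv_id,
      Category.comp_id, hS.hcomp_id]
  id_whiskerRight f g := hS.hcomp_id f g
  comp_whiskerRight η θ i := by rw [← hS.hcomp_comp, Category.id_comp]
  whiskerRight_id η := by
    rw [← Category.assoc, ← hS.rightUnitor_naturality, Category.assoc, Iso.hom_inv_id,
      Category.comp_id]
  whiskerRight_comp η g h := by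
    rw [hS.associator_naturality, hS.hcomp_id, Iso.inv_hom_id_assoc]
  whisker_assoc f _ _ η h := by
    rw [← Category.assoc, ← hS.associator_naturality, Category.assoc, Iso.hom_inv_id,
      Category.comp_id]
  whisker_exchange η θ := by
    rw [← hS.hcomp_comp, ← hS.hcomp_comp]
    simp only [Category.id_comp, Category.comp_id]
  pentagon f g h i := hS.pentagon f g h i
  triangle f g := hS.triangle f g

end BicategoryData

section Homomorphisms

/-- The data of a homomorphism (pseudofunctor): its action on cells and its invertible
constraints. -/
structure HomomorphismData (B : Type u₁) [CategoryStruct.{v₁} B]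
    [∀ a b : B, Category.{w₁} (a ⟶ b)] (C : Type u₂) [CategoryStruct.{v₂} C]
    [∀ a b : C, Category.{w₂} (a ⟶ b)] where
  obj : B → C
  map {a b : B} (f : a ⟶ b) : obj a ⟶ obj b
  map₂ {a b : B} {f g : a ⟶ b} (η : f ⟶ g) : map f ⟶ map g
  mapId (a : B) : map (𝟙 a) ≅ 𝟙 (obj a)
  mapComp {a b c : B} (f : a ⟶ b) (g : b ⟶ c) : map (f ≫ g) ≅ map f ≫ map g

/-- The axioms of a homomorphism of bicategories. -/
structure HomomorphismData.IsHomomorphism {B : Type u₁} [Bicategory.{w₁, v₁} B]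
    {C : Type u₂} [Bicategory.{w₂, v₂} C] (F : HomomorphismData B C) : Prop where
  map₂_id {a b : B} (f : a ⟶ b) : F.map₂ (𝟙 f) = 𝟙 (F.map f)
  map₂_comp {a b : B} {f g h : a ⟶ b} (η : f ⟶ g) (θ : g ⟶ h) :
    F.map₂ (η ≫ θ) = F.map₂ η ≫ F.map₂ θ
  map₂_whisker_left {a b c : B} (f : a ⟶ b) {g h : b ⟶ c} (η : g ⟶ h) :
    F.map₂ (f ◁ η) = (F.mapComp f g).hom ≫ F.map f ◁ F.map₂ η ≫ (F.mapComp f h).inv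
  map₂_whisker_right {a b c : B} {f g : a ⟶ b} (η : f ⟶ g) (h : b ⟶ c) :
    F.map₂ (η ▷ h) = (F.mapComp f h).hom ≫ F.map₂ η ▷ F.map h ≫ (F.mapComp g h).inv
  map₂_associator {a b c d : B} (f : a ⟶ b) (g : b ⟶ c) (h : c ⟶ d) :
    F.map₂ (α_ f g h).hom = (F.mapComp (f ≫ g) h).hom ≫ (F.mapComp f g).hom ▷ F.map h ≫
      (α_ (F.map f) (F.map g) (F.map h)).hom ≫ F.map f ◁ (F.mapComp g h).inv ≫
      (F.mapComp f (g ≫ h)).inv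
  map₂_left_unitor {a b : B} (f : a ⟶ b) :
    F.map₂ (λ_ f).hom = (F.mapComp (𝟙 a) f).hom ≫ (F.mapId a).hom ▷ F.map f ≫ (λ_ (F.map f)).hom
  map₂_right_unitor {a b : B} (f : a ⟶ b) :
    F.map₂ (ρ_ f).hom = (F.mapComp f (𝟙 b)).hom ≫ F.map f ◁ (F.mapId b).hom ≫ (ρ_ (F.map f)).hom

/-- Mathlib's pseudofunctor associated with homomorphism data that satisfy the axioms. -/
def HomomorphismData.IsHomomorphism.toPseudofunctor {B : Type u₁} [Bicategory.{w₁, v₁} B]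
    {C : Type u₂} [Bicategory.{w₂, v₂} C] {F : HomomorphismData B C} (h : F.IsHomomorphism) :
    B ⥤ᵖ C where
  obj := F.obj
  map := F.map
  map₂ := F.map₂
  mapId := F.mapId
  mapComp := F.mapComp
  map₂_id := h.map₂_id
  map₂_comp := h.map₂_comp
  map₂_whisker_left := h.map₂_whisker_left
  map₂_whisker_right := h.map₂_whisker_right
  map₂_associator := h.map₂_associator
  map₂_left_unitor := h.map₂_left_unitor
  map₂_right_unitor := h.map₂_right_unitor

end Homomorphisms

section Grothendieck

open LaxBidiagramCore LaxBidiagramData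

variable {B : Type u₁} [Bicategory.{w₁, v₁} B]

/-- Objects `(x, a)` of the Grothendieck construction `∫_B L`. -/
structure Groth (L : LaxBidiagram.{w₁, w₂, v₁, v₂, u₁, u₂} B) where
  base : B
  fiber : L.fib base

namespace Groth

variable {L : LaxBidiagram.{w₁, w₂, v₁, v₂, u₁, u₂} B}

/-- 1-cells `(u, f) : (x, a) ⟶ (y, b)`, with `u : x ⟶ f^* y`. -/
structure Hom (X Y : Groth L) where
  base : X.base ⟶ Y.base
  fiber : X.fiber ⟶ (L.pull base).obj Y.fiber

/-- The identity 1-cell is `(χ x, 1_a)`, and the composite of `(u, f)` and `(u', f')` is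
`(χ z ∘ (f^* u' ∘ u), f' ∘ f)`. -/
instance : CategoryStruct (Groth L) where
  Hom := Hom
  id X := ⟨𝟙 X.base, L.unitApp X.base X.fiber⟩
  comp {_ _ Z} U V := ⟨U.base ≫ V.base,
    (U.fiber ≫ (L.pull U.base).map V.fiber) ≫ L.chiApp U.base V.base Z.fiber⟩

/-- 2-cells `(φ, α) : (u, f) ⟶ (v, g)`, with `φ : α^* y ∘ u ⟶ v`. -/
@[ext]
structure Hom₂ {X Y : Groth L} (U V : X ⟶ Y) where
  base : Hom.base U ⟶ Hom.base V
  fiber : Hom.fiber U ≫ L.cell base Y.fiber ⟶ Hom.fiber V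

theorem cellEq_fiber {X Y : Groth L} {U V : X ⟶ Y} {Φ Ψ : Hom₂ U V} (h : Φ.base = Ψ.base)
    (h' : Φ.fiber = Hom.fiber U ◁ (L.cellEq h Y.fiber).hom ≫ Ψ.fiber) : Φ = Ψ := by
  cases Φ with | mk p φ =>
  cases Ψ with | mk q ψ =>
  dsimp only at h
  subst h
  simp [cellEq] at h'
  rw [h']

/-- Vertical composition of 2-cells. -/
def vcomp {X Y : Groth L} {U V W : X ⟶ Y} (Φ : Hom₂ U V) (Ψ : Hom₂ V W) : Hom₂ U W where
  base := Φ.base ≫ Ψ.base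
  fiber := Hom.fiber U ◁ (L.xi Φ.base Ψ.base Y.fiber).inv ⊗≫
    Φ.fiber ▷ L.cell Ψ.base Y.fiber ≫ Ψ.fiber

/-- The identity 2-cell. -/
def vid {X Y : Groth L} (U : X ⟶ Y) : Hom₂ U U where
  base := 𝟙 (Hom.base U)
  fiber := Hom.fiber U ◁ (L.xiId (Hom.base U) Y.fiber).inv ≫ (ρ_ (Hom.fiber U)).hom

theorem vid_vcomp {X Y : Groth L} {U V : X ⟶ Y} (Φ : Hom₂ U V) : vcomp (vid U) Φ = Φ := by
  refine cellEq_fiber (Category.id_comp Φ.base) ?_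
  have h := L.coherent.xi_id_left Φ.base Y.fiber
  have h' : (L.xi (𝟙 (Hom.base U)) Φ.base Y.fiber).inv ≫
      (L.xiId (Hom.base U) Y.fiber).inv ▷ L.cell Φ.base Y.fiber =
      (L.cellEq (Category.id_comp Φ.base) Y.fiber).hom ≫ (λ_ _).inv := by
    rw [Iso.eq_comp_inv, Category.assoc, ← h]
    simp [xiTri]
  calc
    _ = Hom.fiber U ◁ ((L.xi (𝟙 (Hom.base U)) Φ.base Y.fiber).inv ≫
          (L.xiId (Hom.base U) Y.fiber).inv ▷ L.cell Φ.base Y.fiber) ⊗≫ Φ.fiber := by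
      simp only [vcomp, vid]; bicategory
    _ = _ := by rw [h']; bicategory

theorem vcomp_vid {X Y : Groth L} {U V : X ⟶ Y} (Φ : Hom₂ U V) : vcomp Φ (vid V) = Φ := by
  refine cellEq_fiber (Category.comp_id Φ.base) ?_
  have h := L.coherent.xi_id_right Φ.base Y.fiber
  have h' : (L.xi Φ.base (𝟙 (Hom.base V)) Y.fiber).inv ≫
      L.cell Φ.base Y.fiber ◁ (L.xiId (Hom.base V) Y.fiber).inv =
      (L.cellEq (Category.comp_id Φ.base) Y.fiber).hom ≫ (ρ_ _).inv := by
    rw [Iso.eq_comp_inv, Category.assoc, ← h]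
    simp [xiTri]
  calc
    _ = Hom.fiber U ◁ (L.xi Φ.base (𝟙 (Hom.base V)) Y.fiber).inv ⊗≫
          (Φ.fiber ▷ L.cell (𝟙 (Hom.base V)) Y.fiber ≫
            Hom.fiber V ◁ (L.xiId (Hom.base V) Y.fiber).inv) ⊗≫ 𝟙 _ := by
      simp only [vcomp, vid]; bicategory
    _ = Hom.fiber U ◁ ((L.xi Φ.base (𝟙 (Hom.base V)) Y.fiber).inv ≫
          L.cell Φ.base Y.fiber ◁ (L.xiId (Hom.base V) Y.fiber).inv) ⊗≫ Φ.fiber := by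
      rw [← whisker_exchange]; bicategory
    _ = _ := by rw [h']; bicategory

theorem vcomp_assoc {X Y : Groth L} {U V W T : X ⟶ Y} (Φ : Hom₂ U V) (Ψ : Hom₂ V W)
    (Θ : Hom₂ W T) : vcomp (vcomp Φ Ψ) Θ = vcomp Φ (vcomp Ψ Θ) := by
  have e : (Φ.base ≫ Ψ.base) ≫ Θ.base = Φ.base ≫ Ψ.base ≫ Θ.base := Category.assoc _ _ _
  refine cellEq_fiber e ?_
  have h := L.coherent.xi_assoc Φ.base Ψ.base Θ.base Y.fiber
  have h' : (L.xi (Φ.base ≫ Ψ.base) Θ.base Y.fiber).inv ≫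
      (L.xi Φ.base Ψ.base Y.fiber).inv ▷ L.cell Θ.base Y.fiber =
      (L.cellEq e Y.fiber).hom ≫
        (L.xi Φ.base (Ψ.base ≫ Θ.base) Y.fiber).inv ≫
        L.cell Φ.base Y.fiber ◁ (L.xi Ψ.base Θ.base Y.fiber).inv ≫ (α_ _ _ _).inv := by
    have h₂ : whiskerRightIso (L.xi Φ.base Ψ.base Y.fiber) (L.cell Θ.base Y.fiber) ≪≫
        L.xi (Φ.base ≫ Ψ.base) Θ.base Y.fiber ≪≫ L.cellEq e Y.fiber =
      α_ _ _ _ ≪≫ whiskerLeftIso _ (L.xi Ψ.base Θ.base Y.fiber) ≪≫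
        L.xi Φ.base (Ψ.base ≫ Θ.base) Y.fiber := by
      ext; simpa [xiTri] using h
    have h₃ := congrArg Iso.inv h₂
    simp only [Iso.trans_inv, Category.assoc, whiskerRightIso_inv, whiskerLeftIso_inv,
      Iso.inv_comp_eq] at h₃
    exact (Iso.inv_comp_eq _).2 h₃
  calc
    _ = Hom.fiber U ◁ ((L.xi (Φ.base ≫ Ψ.base) Θ.base Y.fiber).inv ≫
          (L.xi Φ.base Ψ.base Y.fiber).inv ▷ L.cell Θ.base Y.fiber) ⊗≫
          Φ.fiber ▷ L.cell Ψ.base Y.fiber ▷ L.cell Θ.base Y.fiber ⊗≫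
          Ψ.fiber ▷ L.cell Θ.base Y.fiber ≫ Θ.fiber := by
      simp only [vcomp]; bicategory
    _ = Hom.fiber U ◁ ((L.cellEq e Y.fiber).hom ≫
          (L.xi Φ.base (Ψ.base ≫ Θ.base) Y.fiber).inv) ⊗≫
          ((Hom.fiber U ≫ L.cell Φ.base Y.fiber) ◁ (L.xi Ψ.base Θ.base Y.fiber).inv ≫
          Φ.fiber ▷ (L.cell Ψ.base Y.fiber ≫ L.cell Θ.base Y.fiber)) ⊗≫
          Ψ.fiber ▷ L.cell Θ.base Y.fiber ≫ Θ.fiber := by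
      rw [h']; bicategory
    _ = _ := by
      rw [whisker_exchange]; simp only [vcomp]; bicategory

/-- The hom-categories of the Grothendieck construction. -/
instance (X Y : Groth L) : Category (X ⟶ Y) where
  Hom := Hom₂
  id := vid
  comp := vcomp
  id_comp := vid_vcomp
  comp_id := vcomp_vid
  assoc := vcomp_assoc

theorem cellEq_whiskerRight {a b : B} {f g h : a ⟶ b} {α β : f ⟶ g} (e : α = β) (ζ : g ⟶ h)
    {θ : f ⟶ h} (e' : β ≫ ζ = θ) (y : L.fib b) :
    (L.cellEq e y).hom ▷ L.cell ζ y ≫ (L.xiTri e' y).hom = (L.xiTri (e ▸ e') y).hom := by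
  subst e
  simp [cellEq]

theorem whiskerLeft_cellEq {a b : B} {f g h : a ⟶ b} (ζ : f ⟶ g) {α β : g ⟶ h} (e : α = β)
    {θ : f ⟶ h} (e' : ζ ≫ β = θ) (y : L.fib b) :
    L.cell ζ y ◁ (L.cellEq e y).hom ≫ (L.xiTri e' y).hom = (L.xiTri (e ▸ e') y).hom := by
  subst e
  simp [cellEq]

theorem xi_assoc' {a b : B} {f g h k : a ⟶ b} (α : f ⟶ g) (β : g ⟶ h) (ζ : h ⟶ k)
    {αβ : f ⟶ h} {βζ : g ⟶ k} {αβζ : f ⟶ k} (e₁ : α ≫ β = αβ) (e₂ : β ≫ ζ = βζ)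
    (e₃ : αβ ≫ ζ = αβζ) (e₄ : α ≫ βζ = αβζ) (y : L.fib b) :
    (L.xiTri e₁ y).hom ▷ L.cell ζ y ≫ (L.xiTri e₃ y).hom =
      (α_ _ _ _).hom ≫ L.cell α y ◁ (L.xiTri e₂ y).hom ≫ (L.xiTri e₄ y).hom := by
  subst e₁ e₂ e₄
  have h := L.coherent.xi_assoc α β ζ y
  simpa [xiTri, cellEq] using h

theorem xi_zigzag {a b : B} {f g : a ⟶ b} (α : f ≅ g) (y : L.fib b) :
    ((L.xiTri α.hom_inv_id y).hom ≫ (L.xiId f y).inv) ▷ L.cell α.hom y ≫ (λ_ _).hom =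
      (α_ _ _ _).hom ≫ L.cell α.hom y ◁ ((L.xiTri α.inv_hom_id y).hom ≫ (L.xiId g y).inv) ≫
        (ρ_ _).hom := by
  rw [← L.coherent.xi_id_left, ← L.coherent.xi_id_right]
  have h := xi_assoc' α.hom α.inv α.hom α.hom_inv_id α.inv_hom_id (Category.id_comp α.hom)
    (Category.comp_id α.hom) y
  simpa using h

/-- An invertible 2-cell from its invertible components. -/
def isoMk {X Y : Groth L} {U V : X ⟶ Y} (α : Hom.base U ≅ Hom.base V)
    (φ : Hom.fiber U ≫ L.cell α.hom Y.fiber ≅ Hom.fiber V) : U ≅ V where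
  hom := Hom₂.mk α.hom φ.hom
  inv := Hom₂.mk α.inv (φ.inv ▷ L.cell α.inv Y.fiber ⊗≫
    Hom.fiber U ◁ ((L.xiTri α.hom_inv_id Y.fiber).hom ≫ (L.xiId _ Y.fiber).inv) ≫
      (ρ_ (Hom.fiber U)).hom)
  hom_inv_id := by
    refine cellEq_fiber (Φ := vcomp _ _) (Ψ := vid U) α.hom_inv_id ?_
    calc
      _ = Hom.fiber U ◁ (L.xi α.hom α.inv Y.fiber).inv ⊗≫
            (φ.hom ≫ φ.inv) ▷ L.cell α.inv Y.fiber ⊗≫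
            Hom.fiber U ◁ ((L.xiTri α.hom_inv_id Y.fiber).hom ≫ (L.xiId _ Y.fiber).inv) ≫
              (ρ_ (Hom.fiber U)).hom := by
        simp only [vcomp]; bicategory
      _ = Hom.fiber U ◁ ((L.xi α.hom α.inv Y.fiber).inv ≫
            (L.xiTri α.hom_inv_id Y.fiber).hom ≫ (L.xiId _ Y.fiber).inv) ≫
              (ρ_ (Hom.fiber U)).hom := by
        rw [φ.hom_inv_id]; bicategory
      _ = _ := by simp [xiTri, vid]; rfl
  inv_hom_id := by
    refine cellEq_fiber (Φ := vcomp _ _) (Ψ := vid V) α.inv_hom_id ?_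
    calc
      _ = Hom.fiber V ◁ (L.xi α.inv α.hom Y.fiber).inv ⊗≫
            φ.inv ▷ L.cell α.inv Y.fiber ▷ L.cell α.hom Y.fiber ⊗≫
            Hom.fiber U ◁ (((L.xiTri α.hom_inv_id Y.fiber).hom ≫ (L.xiId _ Y.fiber).inv) ▷
              L.cell α.hom Y.fiber ≫ (λ_ _).hom) ≫ φ.hom := by
        simp only [vcomp]; bicategory
      _ = Hom.fiber V ◁ (L.xi α.inv α.hom Y.fiber).inv ⊗≫
            (φ.inv ▷ (L.cell α.inv Y.fiber ≫ L.cell α.hom Y.fiber) ≫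
            (Hom.fiber U ≫ L.cell α.hom Y.fiber) ◁ ((L.xiTri α.inv_hom_id Y.fiber).hom ≫
              (L.xiId _ Y.fiber).inv)) ⊗≫ φ.hom := by
        rw [xi_zigzag]; bicategory
      _ = Hom.fiber V ◁ ((L.xi α.inv α.hom Y.fiber).inv ≫ (L.xiTri α.inv_hom_id Y.fiber).hom ≫
              (L.xiId _ Y.fiber).inv) ⊗≫ φ.inv ≫ φ.hom := by
        rw [← whisker_exchange]; bicategory
      _ = _ := by rw [φ.inv_hom_id]; simp [xiTri, vid, bicategoricalComp]; rfl

/-- Horizontal composition of 2-cells. -/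
def hcomp {X Y Z : Groth L} {U V : X ⟶ Y} {U' V' : Y ⟶ Z} (Φ : Hom₂ U V) (Φ' : Hom₂ U' V') :
    Hom₂ (U ≫ U') (V ≫ V') where
  base := hcomp₂ Φ.base Φ'.base
  fiber :=
    𝟙 (((Hom.fiber U ≫ (L.pull (Hom.base U)).map (Hom.fiber U')) ≫
        L.chiApp (Hom.base U) (Hom.base U') Z.fiber) ≫
      L.cell (hcomp₂ Φ.base Φ'.base) Z.fiber) ⊗≫
    (Hom.fiber U ≫ (L.pull (Hom.base U)).map (Hom.fiber U')) ◁
      (L.chi₂ Φ.base Φ'.base Z.fiber).hom ⊗≫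
    Hom.fiber U ◁
      (((L.pull (Hom.base U)).mapComp (Hom.fiber U') (L.cell Φ'.base Z.fiber)).inv ≫
        (L.pull (Hom.base U)).map₂ Φ'.fiber) ▷
      (L.cell Φ.base ((L.pull (Hom.base V')).obj Z.fiber) ≫
        L.chiApp (Hom.base V) (Hom.base V') Z.fiber) ⊗≫
    Hom.fiber U ◁ (L.cellNat Φ.base (Hom.fiber V')).hom ▷
      L.chiApp (Hom.base V) (Hom.base V') Z.fiber ⊗≫
    Φ.fiber ▷ ((L.pull (Hom.base V)).map (Hom.fiber V') ≫
      L.chiApp (Hom.base V) (Hom.base V') Z.fiber) ⊗≫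
    𝟙 ((Hom.fiber V ≫ (L.pull (Hom.base V)).map (Hom.fiber V')) ≫
      L.chiApp (Hom.base V) (Hom.base V') Z.fiber)

/-- The associativity constraint. -/
def associator {X Y Z T : Groth L} (U : X ⟶ Y) (V : Y ⟶ Z) (W : Z ⟶ T) :
    (U ≫ V) ≫ W ≅ U ≫ V ≫ W :=
  let f := Hom.base U
  let g := Hom.base V
  let h := Hom.base W
  let u := Hom.fiber U
  let v := Hom.fiber V
  let w := Hom.fiber W
  let t := T.fiber
  (isoMk (U := U ≫ V ≫ W) (V := (U ≫ V) ≫ W) (α_ f g h).symm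
    (Iso.refl (((u ≫ (L.pull f).map ((v ≫ (L.pull g).map w) ≫ L.chiApp g h t)) ≫
        L.chiApp f (g ≫ h) t) ≫ L.cell (α_ f g h).inv t) ≪⊗≫
      whiskerRightIso (whiskerLeftIso u
          ((L.pull f).mapComp (v ≫ (L.pull g).map w) (L.chiApp g h t) ≪≫
            whiskerRightIso ((L.pull f).mapComp v ((L.pull g).map w))
              ((L.pull f).map (L.chiApp g h t))))
        (L.chiApp f (g ≫ h) t ≫ L.cell (α_ f g h).inv t) ≪⊗≫
      whiskerLeftIso (u ≫ (L.pull f).map v ≫ (L.pull f).map ((L.pull g).map w))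
        (L.omega f g h t) ≪⊗≫
      whiskerLeftIso (u ≫ (L.pull f).map v)
        (whiskerRightIso (L.chiNat f g w) (L.chiApp (f ≫ g) h t)) ≪⊗≫
      Iso.refl ((((u ≫ (L.pull f).map v) ≫ L.chiApp f g Z.fiber) ≫ (L.pull (f ≫ g)).map w) ≫
        L.chiApp (f ≫ g) h t))).symm

/-- The unit constraint `U ≫ 𝟙 Y ≅ U`. -/
def rightUnitor {X Y : Groth L} (U : X ⟶ Y) : U ≫ 𝟙 Y ≅ U :=
  let f := Hom.base U
  let u := Hom.fiber U
  isoMk (U := U ≫ 𝟙 Y) (V := U) (ρ_ f)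
    (Iso.refl (((u ≫ (L.pull f).map (L.unitApp Y.base Y.fiber)) ≫
        L.chiApp f (𝟙 Y.base) Y.fiber) ≫ L.cell (ρ_ f).hom Y.fiber) ≪⊗≫
      whiskerLeftIso u (L.gamma f Y.fiber) ≪⊗≫
      Iso.refl u)

/-- The unit constraint `𝟙 X ≫ U ≅ U`. -/
def leftUnitor {X Y : Groth L} (U : X ⟶ Y) : 𝟙 X ≫ U ≅ U :=
  let f := Hom.base U
  let u := Hom.fiber U
  isoMk (U := 𝟙 X ≫ U) (V := U) (λ_ f)
    (whiskerRightIso (whiskerRightIso (L.unitNat X.base u).symm (L.chiApp (𝟙 X.base) f Y.fiber))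
        (L.cell (λ_ f).hom Y.fiber) ≪⊗≫
      whiskerLeftIso u (L.delta f Y.fiber) ≪⊗≫
      Iso.refl u)

end Groth

/-- Horizontal composition and the constraints of the Grothendieck construction `∫_B L`. -/
def grothData (L : LaxBidiagram.{w₁, w₂, v₁, v₂, u₁, u₂} B) : BicategoryData (Groth L) where
  hcomp := Groth.hcomp
  associator := Groth.associator
  leftUnitor := Groth.leftUnitor
  rightUnitor := Groth.rightUnitor

/-- The embedding `J(L, a) : L_a ⟶ ∫_B L`. -/
def embeddingJ (L : LaxBidiagram.{w₁, w₂, v₁, v₂, u₁, u₂} B) (a : B) :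
    HomomorphismData (L.fib a) (Groth L) where
  obj x := ⟨a, x⟩
  map {_ y} u := Groth.Hom.mk (𝟙 a) (u ≫ L.unitApp a y)
  map₂ {_ y u _} φ := Groth.Hom₂.mk (𝟙 (𝟙 a))
    ((u ≫ L.unitApp a y) ◁ (L.xiId (𝟙 a) y).inv ≫ (ρ_ (u ≫ L.unitApp a y)).hom ≫
      φ ▷ L.unitApp a y)
  mapId x :=
    (Groth.isoMk (X := ⟨a, x⟩) (Y := ⟨a, x⟩) (U := 𝟙 (⟨a, x⟩ : Groth L))
      (V := Groth.Hom.mk (𝟙 a) (𝟙 x ≫ L.unitApp a x))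
      (Iso.refl (𝟙 a))
      (whiskerLeftIso (L.unitApp a x) (L.xiId (𝟙 a) x).symm ≪⊗≫
        Iso.refl (𝟙 x ≫ L.unitApp a x))).symm
  mapComp {x y z} u v :=
    let U : (⟨a, x⟩ : Groth L) ⟶ ⟨a, y⟩ := Groth.Hom.mk (𝟙 a) (u ≫ L.unitApp a y)
    let V : (⟨a, y⟩ : Groth L) ⟶ ⟨a, z⟩ := Groth.Hom.mk (𝟙 a) (v ≫ L.unitApp a z)
    let W : (⟨a, x⟩ : Groth L) ⟶ ⟨a, z⟩ := Groth.Hom.mk (𝟙 a) ((u ≫ v) ≫ L.unitApp a z)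
    (Groth.isoMk (U := U ≫ V) (V := W) (ρ_ (𝟙 a))
      (Iso.refl ((((u ≫ L.unitApp a y) ≫ (L.pull (𝟙 a)).map (v ≫ L.unitApp a z)) ≫
          L.chiApp (𝟙 a) (𝟙 a) z) ≫ L.cell (ρ_ (𝟙 a)).hom z) ≪⊗≫
        whiskerLeftIso (u ≫ L.unitApp a y)
          (whiskerRightIso ((L.pull (𝟙 a)).mapComp v (L.unitApp a z))
            (L.chiApp (𝟙 a) (𝟙 a) z ≫ L.cell (ρ_ (𝟙 a)).hom z)) ≪⊗≫
        whiskerLeftIso ((u ≫ L.unitApp a y) ≫ (L.pull (𝟙 a)).map v) (L.gamma (𝟙 a) z) ≪⊗≫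
        whiskerLeftIso u (L.unitNat a v).symm ≪⊗≫
        Iso.refl ((u ≫ v) ≫ L.unitApp a z))).symm

end Grothendieck

section Initial

open LaxBidiagramCore LaxBidiagramData

variable {C : Type u₁} [Category.{v₁} C]
  (L : LaxBidiagram.{v₁, w₂, v₁, v₂, u₁, u₂} (LocallyDiscrete C))

/-- The component `χ z : f^* g^* z ⟶ h^* z` for a commutative triangle. -/
def chiTo {a b c : LocallyDiscrete C} {f : a ⟶ b} {g : b ⟶ c} {h : a ⟶ c} (e : f ≫ g = h)
    (z : L.fib c) : (L.pull f).obj ((L.pull g).obj z) ⟶ (L.pull h).obj z :=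
  e ▸ L.chiApp f g z

def chiToNat {a b c : LocallyDiscrete C} {f : a ⟶ b} {g : b ⟶ c} {h : a ⟶ c} (e : f ≫ g = h)
    {z z' : L.fib c} (w : z ⟶ z') :
    (L.pull f).map ((L.pull g).map w) ≫ chiTo L e z' ≅ chiTo L e z ≫ (L.pull h).map w :=
  match h, e with
  | _, rfl => L.chiNat f g w

def chiToIso {a b c : LocallyDiscrete C} {f : a ⟶ b} {g : b ⟶ c} {h : a ⟶ c} (e : f ≫ g = h)
    (η : f ≫ g ⟶ h) (z : L.fib c) : L.chiApp f g z ≫ L.cell η z ≅ chiTo L e z :=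
  match h, e, η with
  | _, rfl, η =>
    whiskerLeftIso (L.chiApp f g z)
      (L.cellEq (Subsingleton.elim η (𝟙 (f ≫ g))) z ≪≫ (L.xiId (f ≫ g) z).symm) ≪≫ ρ_ _

/-- All 2-cells of `C` are identities, and this is `χ z ≅ χ z ∘ k^*(1_f^* z)`. -/
def chiToCell {a b c : LocallyDiscrete C} (k : a ⟶ b) {f g : b ⟶ c} {h : a ⟶ c}
    (e : k ≫ f = h) (e' : k ≫ g = h) (η : f ⟶ g) (z : L.fib c) :
    chiTo L e z ≅ (L.pull k).map (L.cell η z) ≫ chiTo L e' z :=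
  match g, e', η, LocallyDiscrete.eq_of_hom η with
  | _, _, η, rfl =>
    (λ_ (chiTo L e z)).symm ≪≫
      whiskerRightIso (((L.pull k).mapId ((L.pull f).obj z)).symm ≪≫
        (L.pull k).map₂Iso (L.xiId f z ≪≫ L.cellEq (Subsingleton.elim (𝟙 f) η) z))
        (chiTo L e z)

def omegaTo {a b c d : LocallyDiscrete C} (k : a ⟶ b) (f : b ⟶ c) (g : c ⟶ d) {p : a ⟶ c}
    {q : a ⟶ d} (e₁ : k ≫ f = p) (e₂ : k ≫ f ≫ g = q) (e₃ : p ≫ g = q) (t : L.fib d) :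
    (L.pull k).map (L.chiApp f g t) ≫ chiTo L e₂ t ≅
      chiTo L e₁ ((L.pull g).obj t) ≫ chiTo L e₃ t :=
  match p, q, e₁, e₂, e₃ with
  | _, _, rfl, e₂, rfl =>
    whiskerLeftIso ((L.pull k).map (L.chiApp f g t)) (chiToIso L e₂ (α_ k f g).inv t).symm ≪⊗≫
      L.omega k f g t

variable {z : C} (hz : Limits.IsInitial z)

/-- The unique 1-cell `0_a`. -/
def fromInitial (a : LocallyDiscrete C) : LocallyDiscrete.mk z ⟶ a :=
  ⟨hz.to a.as⟩

theorem fromInitial_comp {a b : LocallyDiscrete C} (f : a ⟶ b) :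
    fromInitial hz a ≫ f = fromInitial hz b :=
  Discrete.ext (hz.hom_ext _ _)

/-- `K : ∫_C L ⟶ L_0`, with `K(x, a) = 0_a^* x`, for the initial object `0` of `C`. -/
def retractionK : HomomorphismData (Groth L) (L.fib (LocallyDiscrete.mk z)) where
  obj X := (L.pull (fromInitial hz X.base)).obj X.fiber
  map {X Y} U := (L.pull (fromInitial hz X.base)).map (Groth.Hom.fiber U) ≫
    chiTo L (fromInitial_comp hz (Groth.Hom.base U)) Y.fiber
  map₂ {X Y U V} Φ :=
    let k := fromInitial hz X.base
    (L.pull k).map (Groth.Hom.fiber U) ◁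
        (chiToCell L k (fromInitial_comp hz (Groth.Hom.base U))
          (fromInitial_comp hz (Groth.Hom.base V)) (Groth.Hom₂.base Φ) Y.fiber).hom ⊗≫
      (((L.pull k).mapComp (Groth.Hom.fiber U) (L.cell (Groth.Hom₂.base Φ) Y.fiber)).inv ≫
          (L.pull k).map₂ (Groth.Hom₂.fiber Φ)) ▷
        chiTo L (fromInitial_comp hz (Groth.Hom.base V)) Y.fiber
  mapId X :=
    let k := fromInitial hz X.base
    whiskerLeftIso ((L.pull k).map (L.unitApp X.base X.fiber))
        (chiToIso L (fromInitial_comp hz (𝟙 X.base)) (ρ_ k).hom X.fiber).symm ≪⊗≫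
      L.gamma k X.fiber
  mapComp {X Y Z} U V :=
    let k := fromInitial hz X.base
    let f := Groth.Hom.base U
    let g := Groth.Hom.base V
    let u := Groth.Hom.fiber U
    let v := Groth.Hom.fiber V
    whiskerRightIso
        ((L.pull k).mapComp (u ≫ (L.pull f).map v) (L.chiApp f g Z.fiber) ≪≫
          whiskerRightIso ((L.pull k).mapComp u ((L.pull f).map v))
            ((L.pull k).map (L.chiApp f g Z.fiber)))
        (chiTo L (fromInitial_comp hz (f ≫ g)) Z.fiber) ≪⊗≫
      whiskerLeftIso ((L.pull k).map u ≫ (L.pull k).map ((L.pull f).map v))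
        (omegaTo L k f g (fromInitial_comp hz f) (fromInitial_comp hz (f ≫ g))
          (fromInitial_comp hz g) Z.fiber) ≪⊗≫
      whiskerLeftIso ((L.pull k).map u)
        (whiskerRightIso (chiToNat L (fromInitial_comp hz f) v)
          (chiTo L (fromInitial_comp hz g) Z.fiber)) ≪⊗≫
      Iso.refl (((L.pull k).map u ≫ chiTo L (fromInitial_comp hz f) Y.fiber) ≫
        (L.pull (fromInitial hz Y.base)).map v ≫ chiTo L (fromInitial_comp hz g) Z.fiber)

end Initial

section Nerve

variable {B : Type u₁} [Bicategory.{w₁, v₁} B]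

/-- Precomposition of a geometric simplex with a monotone map. -/
def simplexReindex {m n : ℕ} (σ : Fin (m + 1) →o Fin (n + 1))
    (F : LocallyDiscrete (Fin (n + 1)) ⥤ᴸ B) : LocallyDiscrete (Fin (m + 1)) ⥤ᴸ B where
  obj i := F.obj ⟨σ i.as⟩
  map f := F.map ⟨homOfLE (σ.monotone (leOfHom f.as))⟩
  map₂ η := F.map₂ (eqToHom (by rw [LocallyDiscrete.eq_of_hom η]))
  mapId i := F.mapId ⟨σ i.as⟩
  mapComp f g := F.mapComp ⟨homOfLE (σ.monotone (leOfHom f.as))⟩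
    ⟨homOfLE (σ.monotone (leOfHom g.as))⟩
  map₂_id f := F.map₂_id _
  map₂_comp η θ := by
    rw [← F.map₂_comp]; congr 1
  mapComp_naturality_left η g := F.mapComp_naturality_left _ _
  mapComp_naturality_right f _ _ η := F.mapComp_naturality_right _ _
  map₂_associator f g h := F.map₂_associator _ _ _
  map₂_leftUnitor f := F.map₂_leftUnitor _
  map₂_rightUnitor f := F.map₂_rightUnitor _

/-- The geometric nerve of a bicategory, whose `n`-simplices are the lax functors
`[n] ⟶ B`. -/
def geometricNerve (B : Type u) [Bicategory.{u, u} B] : SSet.{u} where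
  obj n := LocallyDiscrete (Fin (n.unop.len + 1)) ⥤ᴸ B
  map σ := ↾fun F => simplexReindex σ.unop.toOrderHom F
  map_id n := by rfl
  map_comp σ τ := by rfl

/-- The simplicial map induced by a lax functor. -/
def geometricNerveMap {B C : Type u} [Bicategory.{u, u} B] [Bicategory.{u, u} C] (F : B ⥤ᴸ C) :
    geometricNerve B ⟶ geometricNerve C where
  app n := ↾fun G => LaxFunctor.comp G F
  naturality m n σ := by rfl

/-- The classifying space of a bicategory: the geometric realization of its geometric nerve. -/
noncomputable def classifyingSpace (B : Type u) [Bicategory.{u, u} B] : TopCat.{u} :=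
  SSet.toTop.obj (geometricNerve B)

/-- The continuous map of classifying spaces induced by a lax functor. -/
noncomputable def classifyingMap {B C : Type u} [Bicategory.{u, u} B] [Bicategory.{u, u} C]
    (F : B ⥤ᴸ C) : C(classifyingSpace B, classifyingSpace C) :=
  (SSet.toTop.map (geometricNerveMap F)).hom

end Nerve
end LaxBidiagrams

/-! ### Structure cells over triangles and tetrahedra of the base -/

namespace LaxBidiagrams

section Simplices

open LaxBidiagramCore LaxBidiagramData

variable {C : Type u₁} [Category.{v₁} C]
  (L : LaxBidiagram.{v₁, w₂, v₁, v₂, u₁, u₂} (LocallyDiscrete C))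

/-! The homomorphisms J and K are inverse to each other up to lax transformations 1 ⇒ KJ and JK ⇒ 1,
and a lax transformation between lax functors induces a homotopy between the maps of classifying
spaces. The first transformation has the component χ x : x → 1_0^* x at x, where 0_0 = 1_0
(`unitTrans`); the second has the component (1, 0_a) : (0_a^* x, 0) → (x, a) at (x, a)
(`counitTrans`). Invertibility of these components plays no role.

Every 2-cell of the base is an identity, so every 2-cell of the Grothendieck construction comes from
a unique 2-cell of a fibre (`vert`), and all equations can be checked in the fibres. There a 1-cell
v : y → g^* z extends along f to `ext v` : f^* y → (g ∘ f)^* z, namely f^* v followed by χ, and the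
composite of (u, f) and (v, g) is u followed by `ext v`. The essential cell is `extComp`, which
compares the extension of such a composite with the composite of the extensions; it is pasted from ω
and the naturality of χ. It satisfies `extComp_pentagon`, by the pentagon for ω, and `extComp_unit`,
by the triangle for ω, γ and δ. Both are used twice. Whiskered with one more 1-cell they are the
pentagon and the triangle of the Grothendieck construction; for extension along 0_a they are the
associativity and left unit conditions of K, because K(u, f) is the extension of u along 0_a. The
other unit conditions are not among the hypotheses. They are read off from identities that hold in
every bicategory, once the Grothendieck construction is known to be one (`starAssoc_starLeft`,
`starAssoc_starRight`, `starLeft_unitApp`).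

Equations such as (f ≫ g) ≫ h = f ≫ g ≫ h in the base are not definitional. Each structure cell is
therefore restated for 1-cells that are provably equal to the composites in question. Eliminating
these equations returns the given coherence condition. Identifying parallel 1-cells instead turns
the 2-cells of the base into endomorphisms, whose 1-cells in the fibres are trivialized by ξ
(`cellEndo`) and then dropped.

For the homotopy, a simplex X : [n] → A and a monotone map φ : [n] → [1] yield a simplex of B that
is F ∘ X where φ is 0 and G ∘ X where φ is 1, with the transformation inserted in the 1-cells that
cross over (`nerveCylinder`). On realizations the prism Δⁿ × I is the union of the simplices spanned
by the chains of [n] × [1], on which the maps are prescribed and glued (`exists_desc_chains`). The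
homotopy is then a map |X| → C(I, |Y|), obtained from the adjunction between realization and
singular complex (`homotopic_toTop_map`). -/

theorem chiTo_rfl {a b c : LocallyDiscrete C} {f : a ⟶ b} {g : b ⟶ c} (e : f ≫ g = f ≫ g)
    (z : L.fib c) : chiTo L e z = L.chiApp f g z :=
  rfl

theorem chiToNat_natural {a b c : LocallyDiscrete C} {f : a ⟶ b} {g : b ⟶ c} {h : a ⟶ c}
    (e : f ≫ g = h) {z z' : L.fib c} {w w' : z ⟶ z'} (φ : w ⟶ w') :
    (L.pull f).map₂ ((L.pull g).map₂ φ) ▷ chiTo L e z' ≫ (chiToNat L e w').hom =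
      (chiToNat L e w).hom ≫ chiTo L e z ◁ (L.pull h).map₂ φ := by
  subst e
  exact (L.chi f g).naturality_naturality φ

theorem chiToNat_comp {a b c : LocallyDiscrete C} {f : a ⟶ b} {g : b ⟶ c} {h : a ⟶ c}
    (e : f ≫ g = h) {z z' z'' : L.fib c} (w : z ⟶ z') (w' : z' ⟶ z'') :
    (chiToNat L e (w ≫ w')).hom ≫ chiTo L e z ◁ ((L.pull h).mapComp w w').hom =
      ((L.pull f).map₂ ((L.pull g).mapComp w w').hom ≫
        ((L.pull f).mapComp ((L.pull g).map w) ((L.pull g).map w')).hom) ▷ chiTo L e z'' ≫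
      (α_ _ _ _).hom ≫ (L.pull f).map ((L.pull g).map w) ◁ (chiToNat L e w').hom ≫
      (α_ _ _ _).inv ≫ (chiToNat L e w).hom ▷ (L.pull h).map w' ≫ (α_ _ _ _).hom := by
  subst e
  exact (L.chi f g).naturality_comp w w'

/-- An endomorphism 2-cell of the locally discrete base acts trivially. -/
def cellEndo {a b : LocallyDiscrete C} {f : a ⟶ b} (η : f ⟶ f) (y : L.fib b) :
    L.cell η y ≅ 𝟙 ((L.pull f).obj y) :=
  L.cellEq (Subsingleton.elim η (𝟙 f)) y ≪≫ (L.xiId f y).symm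

theorem cellEq_cellEndo {a b : LocallyDiscrete C} {f : a ⟶ b} {η θ : f ⟶ f} (h : η = θ)
    (y : L.fib b) : (L.cellEq h y).hom ≫ (cellEndo L θ y).hom = (cellEndo L η y).hom := by
  subst h
  simp [cellEq]

/-- Change of the composite in `chiTo`. -/
def chiToPost {a b c : LocallyDiscrete C} {f : a ⟶ b} {g : b ⟶ c} {h h' : a ⟶ c}
    (e : f ≫ g = h) (e' : f ≫ g = h') (η : h ⟶ h') (z : L.fib c) :
    chiTo L e z ≫ L.cell η z ≅ chiTo L e' z :=
  match h, e, η with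
  | _, rfl, η => chiToIso L e' η z

theorem chiToPost_endo {a b c : LocallyDiscrete C} {f : a ⟶ b} {g : b ⟶ c} {h : a ⟶ c}
    (e : f ≫ g = h) (η : h ⟶ h) (z : L.fib c) :
    chiToPost L e e η z = whiskerLeftIso (chiTo L e z) (cellEndo L η z) ≪≫ ρ_ _ := by
  subst e
  rfl

/-- `ω` for a tetrahedron of the base. -/
def omegaTet {a b c d : LocallyDiscrete C} {f : a ⟶ b} {g : b ⟶ c} {h : c ⟶ d} {p : a ⟶ c}
    {q : b ⟶ d} {r : a ⟶ d} (e₁ : f ≫ g = p) (e₂ : g ≫ h = q) (e₃ : p ≫ h = r)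
    (e₄ : f ≫ q = r) (t : L.fib d) :
    (L.pull f).map (chiTo L e₂ t) ≫ chiTo L e₄ t ≅
      chiTo L e₁ ((L.pull h).obj t) ≫ chiTo L e₃ t :=
  match q, e₂, e₄ with
  | _, rfl, e₄ => omegaTo L f g h e₁ e₄ e₃ t

/-- `ω` for 1-cells that are equal to the composites. -/
def omegaCell {a b c d : LocallyDiscrete C} {f : a ⟶ b} {g : b ⟶ c} {h : c ⟶ d} {p : a ⟶ c}
    {q : b ⟶ d} {r r' : a ⟶ d} (e₁ : f ≫ g = p) (e₂ : g ≫ h = q) (e₃ : p ≫ h = r')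
    (e₄ : f ≫ q = r) (η : r ⟶ r') (t : L.fib d) :
    ((L.pull f).map (chiTo L e₂ t) ≫ chiTo L e₄ t) ≫ L.cell η t ≅
      chiTo L e₁ ((L.pull h).obj t) ≫ chiTo L e₃ t :=
  match p, q, r, r', e₁, e₂, e₃, e₄, η with
  | _, _, _, _, rfl, rfl, rfl, rfl, η =>
    whiskerLeftIso _ (L.cellEq (Subsingleton.elim η _) t) ≪≫ L.omega f g h t

/-- `omegaTo` is `L.omega` preceded by the inverse of `chiToIso`, and `chiToPost` cancels that
inverse. The equation `e₄'` is the one that cannot be eliminated: it becomes associativity in the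
base. -/
theorem omegaCell_eq {a b c d : LocallyDiscrete C} {f : a ⟶ b} {g : b ⟶ c} {h : c ⟶ d}
    {p : a ⟶ c} {q : b ⟶ d} {r r' : a ⟶ d} (e₁ : f ≫ g = p) (e₂ : g ≫ h = q) (e₃ : p ≫ h = r')
    (e₄ : f ≫ q = r) (e₄' : f ≫ q = r') (η : r ⟶ r') (t : L.fib d) :
    omegaCell L e₁ e₂ e₃ e₄ η t = α_ _ _ _ ≪≫
      whiskerLeftIso ((L.pull f).map (chiTo L e₂ t)) (chiToPost L e₄ e₄' η t) ≪≫
      omegaTet L e₁ e₂ e₃ e₄' t := by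
  subst e₁ e₂ e₃ e₄
  obtain rfl : η = (α_ f g h).inv := Subsingleton.elim _ _
  ext
  simp only [omegaCell, omegaTet, omegaTo, chiToPost, cellEq, bicategoricalIsoComp, chiTo_rfl]
  simp

theorem omegaCell_endo {a b c d : LocallyDiscrete C} {f : a ⟶ b} {g : b ⟶ c} {h : c ⟶ d}
    {p : a ⟶ c} {q : b ⟶ d} {r : a ⟶ d} (e₁ : f ≫ g = p) (e₂ : g ≫ h = q) (e₃ : p ≫ h = r)
    (e₄ : f ≫ q = r) (η : r ⟶ r) (t : L.fib d) :
    (omegaCell L e₁ e₂ e₃ e₄ η t).hom = _ ◁ (cellEndo L η t).hom ≫ (ρ_ _).hom ≫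
      (omegaTet L e₁ e₂ e₃ e₄ t).hom := by
  rw [omegaCell_eq L e₁ e₂ e₃ e₄ e₄, chiToPost_endo]
  simp

/-- `χ` for a 2-cell whiskered by `k` on the source side. -/
def chiCellL {a b c : LocallyDiscrete C} (k : a ⟶ b) {g g' : b ⟶ c} {h h' : a ⟶ c}
    (e : k ≫ g = h) (e' : k ≫ g' = h') (α : g ⟶ g') (β : h ⟶ h') (z : L.fib c) :
    chiTo L e z ≫ L.cell β z ≅ (L.pull k).map (L.cell α z) ≫ chiTo L e' z :=
  match h, h', e, e', β with
  | _, _, rfl, rfl, β =>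
    whiskerLeftIso _ (L.cellEq (Subsingleton.elim β _) z) ≪≫ L.chiL k α z

/-- `χ` for a 2-cell whiskered by `k` on the target side. -/
def chiCellR {a b c : LocallyDiscrete C} {f f' : a ⟶ b} (k : b ⟶ c) {h h' : a ⟶ c}
    (e : f ≫ k = h) (e' : f' ≫ k = h') (α : f ⟶ f') (β : h ⟶ h') (z : L.fib c) :
    chiTo L e z ≫ L.cell β z ≅ L.cell α ((L.pull k).obj z) ≫ chiTo L e' z :=
  match h, h', e, e', β with
  | _, _, rfl, rfl, β =>
    whiskerLeftIso _ (L.cellEq (Subsingleton.elim β _) z) ≪≫ L.chiR α k z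

/-- The coherence condition `chi₂_id`, solved for χ. -/
theorem chi₂_id_hom {a b c : LocallyDiscrete C} (f : a ⟶ b) (g : b ⟶ c)
    (z : L.fib c) :
    (L.chi₂ (𝟙 f) (𝟙 g) z).hom = L.chiApp f g z ◁ (cellEndo L (hcomp₂ (𝟙 f) (𝟙 g)) z).hom ⊗≫
        (((L.pull f).mapId ((L.pull g).obj z)).inv ≫ (L.pull f).map₂ (L.xiId g z).hom) ▷
          L.chiApp f g z ⊗≫
        (L.pull f).map (L.cell (𝟙 g) z) ◁
          (L.xiId f ((L.pull g).obj z)).hom ▷ L.chiApp f g z ⊗≫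
        𝟙 (L.cell₂ (𝟙 f) (𝟙 g) z ≫ L.chiApp f g z) := by
  have h := L.coherent.chi₂_id f g z
  have h₁ : (L.xiId (f ≫ g) z).hom ≫ (L.cellEq
      (by simp [hcomp₂] : 𝟙 (f ≫ g) = hcomp₂ (𝟙 f) (𝟙 g)) z).hom =
      (cellEndo L (hcomp₂ (𝟙 f) (𝟙 g)) z).inv := by
    simp [cellEndo, cellEq]
  rw [h₁, ← whiskerLeftIso_inv, Iso.inv_comp_eq] at h
  rw [h]
  simp only [whiskerLeftIso_hom]
  bicategory

/-- Over identities χ is determined by `chi₂_id_hom`. The copy of `xiId k` that occurs there cancels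
against the inverse copy in the definition of `chiL`. -/
theorem chiCellL_endo {a b c : LocallyDiscrete C} (k : a ⟶ b) {g : b ⟶ c} {h : a ⟶ c}
    (e : k ≫ g = h) (α : g ⟶ g) (β : h ⟶ h) (z : L.fib c) :
    (chiCellL L k e e α β z).hom = chiTo L e z ◁ (cellEndo L β z).hom ⊗≫
      (((L.pull k).mapId _).inv ≫ (L.pull k).map₂ (cellEndo L α z).inv) ▷ chiTo L e z := by
  subst e
  obtain rfl : α = 𝟙 _ := Subsingleton.elim _ _
  have h₁ : (L.xiId g z).hom = (cellEndo L (𝟙 g) z).inv := by simp [cellEndo, cellEq]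
  simp only [chiCellL, chiL, Iso.trans_hom, whiskerLeftIso_hom, whiskerRightIso_hom,
    chi₂_id_hom, chiTo_rfl, h₁]
  calc
    _ = L.chiApp k g z ◁ ((L.cellEq (Subsingleton.elim β (k ◁ 𝟙 g)) z).hom ≫
          (L.cellEq (Subsingleton.elim (k ◁ 𝟙 g) (hcomp₂ (𝟙 k) (𝟙 g))) z).hom ≫
          (cellEndo L (hcomp₂ (𝟙 k) (𝟙 g)) z).hom) ⊗≫
          (((L.pull k).mapId _).inv ≫ (L.pull k).map₂ (cellEndo L (𝟙 g) z).inv) ▷ L.chiApp k g z ⊗≫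
          (L.pull k).map (L.cell (𝟙 g) z) ◁ ((L.xiId k ((L.pull g).obj z)).hom ≫
            (L.xiId k ((L.pull g).obj z)).inv) ▷ L.chiApp k g z ⊗≫ 𝟙 _ := by
      simp only [Iso.symm_hom]
      bicategory
    _ = _ := by
      rw [cellEq_cellEndo, cellEq_cellEndo, Iso.hom_inv_id]
      bicategory

theorem chiCellR_endo {a b c : LocallyDiscrete C} {f : a ⟶ b} (k : b ⟶ c) {h : a ⟶ c}
    (e : f ≫ k = h) (α : f ⟶ f) (β : h ⟶ h) (z : L.fib c) :
    (chiCellR L k e e α β z).hom = chiTo L e z ◁ (cellEndo L β z).hom ⊗≫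
      (cellEndo L α ((L.pull k).obj z)).inv ▷ chiTo L e z := by
  subst e
  obtain rfl : α = 𝟙 _ := Subsingleton.elim _ _
  have h₁ : (L.xiId f ((L.pull k).obj z)).hom = (cellEndo L (𝟙 f) ((L.pull k).obj z)).inv := by
    simp [cellEndo, cellEq]
  simp only [chiCellR, chiR, Iso.trans_hom, whiskerLeftIso_hom, whiskerRightIso_hom,
    chi₂_id_hom, chiTo_rfl, h₁]
  calc
    _ = L.chiApp f k z ◁ ((L.cellEq (Subsingleton.elim β (𝟙 f ▷ k)) z).hom ≫
          (L.cellEq (Subsingleton.elim (𝟙 f ▷ k) (hcomp₂ (𝟙 f) (𝟙 k))) z).hom ≫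
          (cellEndo L (hcomp₂ (𝟙 f) (𝟙 k)) z).hom) ⊗≫
          (((L.pull f).mapId _).inv ≫ (L.pull f).map₂ (L.xiId k z).hom) ▷ L.chiApp f k z ⊗≫
          ((L.pull f).map (L.cell (𝟙 k) z) ◁ (cellEndo L (𝟙 f) ((L.pull k).obj z)).inv ≫
            ((L.pull f).map₂ (L.xiId k z).inv ≫ ((L.pull f).mapId _).hom) ▷ L.cell (𝟙 f) _) ▷
              L.chiApp f k z ⊗≫ 𝟙 _ := by
      simp only [PrelaxFunctor.map₂Iso_hom, Iso.symm_hom]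
      bicategory
    _ = L.chiApp f k z ◁ ((L.cellEq (Subsingleton.elim β (𝟙 f ▷ k)) z).hom ≫
          (L.cellEq (Subsingleton.elim (𝟙 f ▷ k) (hcomp₂ (𝟙 f) (𝟙 k))) z).hom ≫
          (cellEndo L (hcomp₂ (𝟙 f) (𝟙 k)) z).hom) ⊗≫
          (((L.pull f).mapId _).inv ≫ ((L.pull f).map₂ (L.xiId k z).hom ≫
            (L.pull f).map₂ (L.xiId k z).inv) ≫ ((L.pull f).mapId _).hom) ▷ L.chiApp f k z ⊗≫
          (cellEndo L (𝟙 f) ((L.pull k).obj z)).inv ▷ L.chiApp f k z ⊗≫ 𝟙 _ := by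
      -- Interchange brings the image of `xiId k` next to the image of its inverse, from which the
      -- trivialization of `α` had separated it.
      rw [whisker_exchange]
      bicategory
    _ = _ := by
      rw [cellEq_cellEndo, cellEq_cellEndo, ← PrelaxFunctor.map₂_comp, Iso.hom_inv_id,
        PrelaxFunctor.map₂_id, Category.id_comp, Iso.inv_hom_id]
      bicategory

/-- An endomorphism in the base is an identity, so this is the unit condition `xi_id_left`:
trivializing a composite is trivializing the factors in turn. -/
theorem xiTri_endo {a b : LocallyDiscrete C} {f : a ⟶ b} {α β γ : f ⟶ f} (e : α ≫ β = γ)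
    (y : L.fib b) :
    (L.xiTri e y).hom ≫ (cellEndo L γ y).hom =
      (cellEndo L α y).hom ▷ L.cell β y ≫ (λ_ _).hom ≫ (cellEndo L β y).hom := by
  obtain rfl : α = 𝟙 _ := Subsingleton.elim _ _
  have h := L.coherent.xi_id_left β y
  have h₁ : (L.xiId f y).hom = (cellEndo L (𝟙 f) y).inv := by
    simp [cellEndo, cellEq]
  rw [h₁, ← whiskerRightIso_inv, Iso.inv_comp_eq] at h
  have h₂ : L.xiTri e y = L.xiTri (Category.id_comp β) y ≪≫
      L.cellEq ((Category.id_comp β).symm.trans e) y := by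
    obtain rfl : γ = β := Subsingleton.elim _ _
    ext
    simp [cellEq]
  rw [h₂, Iso.trans_hom, h, Category.assoc, cellEq_cellEndo]
  simp

theorem xiSq_endo {a b : LocallyDiscrete C} {f : a ⟶ b} {α β α' β' : f ⟶ f}
    (e : α ≫ β = α' ≫ β') (y : L.fib b) :
    (L.xiSq e y).hom ≫ (cellEndo L α' y).hom ▷ L.cell β' y ≫ (λ_ _).hom ≫
        (cellEndo L β' y).hom =
      (cellEndo L α y).hom ▷ L.cell β y ≫ (λ_ _).hom ≫ (cellEndo L β y).hom := by
  rw [← xiTri_endo L e y, ← xiTri_endo L (rfl : α' ≫ β' = _) y]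
  simp [xiSq, xiTri, cellEq]

end Simplices
end LaxBidiagrams

/-! ### Removal of identity cells, and the pentagon for ω -/

namespace LaxBidiagrams

section Drop

variable {B : Type u₁} [Bicategory.{w₁, v₁} B]

/-- Right whiskering with a 1-cell that is isomorphic to an identity does nothing. -/
theorem whiskerRight_drop {x y : B} {c : y ⟶ y} (ν : c ⟶ 𝟙 y) {u v : x ⟶ y} (φ : u ⟶ v) :
    φ ▷ c ≫ v ◁ ν ≫ (ρ_ v).hom = u ◁ ν ≫ (ρ_ u).hom ≫ φ := by
  rw [← whisker_exchange_assoc, rightUnitor_naturality]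

/-- The first side of the pentagon in a general bicategory. Here `c` stands for the 1-cell induced
by an identity of the base and `ν` for its trivialization. By `whiskerRight_drop` all
trivializations can be performed at the start, which leaves the pasting without `c`; `h` and `h'`
say how ξ interacts with them. -/
theorem drop_pentagon_left {x₀ x₁ x₂ y z₁ z₂ : B} {c c' : y ⟶ y} (ν : c ⟶ 𝟙 y)
    (ν' : c' ⟶ 𝟙 y) (ξ : c ≫ c ⟶ c') (ξ' : c ≫ c' ⟶ c ≫ c)
    (h : ξ ≫ ν' = ν ▷ c ≫ (λ_ _).hom ≫ ν)
    (h' : ξ' ≫ ν ▷ c ≫ (λ_ _).hom ≫ ν = ν ▷ c' ≫ (λ_ _).hom ≫ ν')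
    {F : x₀ ⟶ x₁} {G : x₁ ⟶ x₂} {H : x₂ ⟶ y} {F' : x₁ ⟶ z₁} {H' : z₁ ⟶ y} {E : x₀ ⟶ z₂}
    {G' : z₂ ⟶ z₁} {K : z₂ ⟶ y}
    (O₁ : G ≫ H ⟶ F' ≫ H') (N : F ≫ F' ⟶ E ≫ G') (O₂ : G' ≫ H' ⟶ K) :
    𝟙 (((F ≫ G) ≫ H) ≫ c ≫ c ≫ c) ⊗≫ ((F ≫ G) ≫ H) ◁ (c ◁ ξ ≫ ξ') ⊗≫
        F ◁ ((G ≫ H) ◁ ν ≫ (ρ_ _).hom ≫ O₁) ▷ c ⊗≫ N ▷ (H' ≫ c) ⊗≫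
        E ◁ ((G' ≫ H') ◁ ν ≫ (ρ_ _).hom ≫ O₂) =
      ((F ≫ G) ≫ H) ◁ (ν ▷ (c ≫ c) ≫ (λ_ _).hom ≫ ν ▷ c ≫ (λ_ _).hom ≫ ν) ⊗≫
        F ◁ O₁ ⊗≫ N ▷ H' ⊗≫ E ◁ O₂ := by
  calc
    _ = ((F ≫ G) ≫ H) ◁ (c ◁ ξ ≫ ξ' ≫ ν ▷ c ≫ (λ_ _).hom) ⊗≫
        ((F ◁ O₁ ⊗≫ N ▷ H' ⊗≫ 𝟙 (E ≫ G' ≫ H')) ▷ c ≫ (E ≫ G' ≫ H') ◁ ν ≫ (ρ_ _).hom) ⊗≫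
        E ◁ O₂ := by bicategory
    _ = ((F ≫ G) ≫ H) ◁ (c ◁ ξ ≫ (ξ' ≫ ν ▷ c ≫ (λ_ _).hom ≫ ν)) ⊗≫
        F ◁ O₁ ⊗≫ N ▷ H' ⊗≫ E ◁ O₂ := by
      rw [whiskerRight_drop]; bicategory
    _ = ((F ≫ G) ≫ H) ◁ ((c ◁ ξ ≫ ν ▷ c') ≫ (λ_ _).hom ≫ ν') ⊗≫
        F ◁ O₁ ⊗≫ N ▷ H' ⊗≫ E ◁ O₂ := by
      rw [h']; bicategory
    _ = ((F ≫ G) ≫ H) ◁ (ν ▷ (c ≫ c) ≫ (λ_ _).hom ≫ ξ ≫ ν') ⊗≫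
        F ◁ O₁ ⊗≫ N ▷ H' ⊗≫ E ◁ O₂ := by
      rw [whisker_exchange]; bicategory
    _ = _ := by rw [h]

/-- The second side of the pentagon. The 1-cell `e` is created by the χ of a whiskered 2-cell and
trivialized by the following ω, so `ν'` cancels. The 1-cell `d`, created by `M` under a
homomorphism, is left for `map₂_drop`. -/
theorem drop_pentagon_right {x₀ x₂ y w₁ w₃ : B} {c : y ⟶ y} (ν : c ⟶ 𝟙 y)
    {d : x₂ ⟶ x₂} {e : w₃ ⟶ w₃} (ν' : e ≅ 𝟙 w₃)
    {A : x₀ ⟶ x₂} {H : x₂ ⟶ y} {Q : x₀ ⟶ w₁} {G : w₁ ⟶ x₂} {R : w₁ ⟶ w₃} {S : w₃ ⟶ y}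
    {W : x₀ ⟶ w₃} (M : 𝟙 x₂ ⟶ d) (P : A ≫ d ⟶ Q ≫ G) (O₃ : G ≫ H ⟶ R ≫ S) (O₄ : Q ≫ R ⟶ W) :
    𝟙 ((A ≫ H) ≫ c ≫ c ≫ c) ⊗≫ A ◁ (H ◁ ν ⊗≫ M ▷ H) ▷ (c ≫ c) ⊗≫ P ▷ (H ≫ c ≫ c) ⊗≫
        Q ◁ ((G ≫ H) ◁ ν ≫ (ρ_ _).hom ≫ O₃) ▷ c ⊗≫
        (Q ≫ R) ◁ (S ◁ ν ⊗≫ ν'.inv ▷ S) ⊗≫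
        ((Q ≫ R) ◁ ν'.hom ≫ (ρ_ _).hom ≫ O₄) ▷ S ⊗≫ 𝟙 (W ≫ S) =
      (A ≫ H) ◁ (ν ▷ (c ≫ c) ≫ (λ_ _).hom ≫ ν ▷ c ≫ (λ_ _).hom ≫ ν) ⊗≫
        ((ρ_ A).inv ≫ A ◁ M ≫ P) ▷ H ⊗≫ Q ◁ O₃ ⊗≫ O₄ ▷ S ⊗≫ 𝟙 (W ≫ S) := by
  let Θ₁ : A ≫ H ⟶ Q ≫ G ≫ H := ((ρ_ A).inv ≫ A ◁ M ≫ P) ▷ H ≫ (α_ _ _ _).hom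
  let Θ₂ : Q ≫ G ≫ H ⟶ (Q ≫ R) ≫ S := Q ◁ O₃ ≫ (α_ _ _ _).inv
  calc
    _ = 𝟙 ((A ≫ H) ≫ c ≫ c ≫ c) ⊗≫ ((A ≫ H) ◁ ν ≫ (ρ_ _).hom) ▷ (c ≫ c) ⊗≫
        (Θ₁ ▷ c ≫ (Q ≫ G ≫ H) ◁ ν ≫ (ρ_ _).hom) ▷ c ≫
        (Θ₂ ▷ c ≫ ((Q ≫ R) ≫ S) ◁ ν ≫ (ρ_ _).hom) ⊗≫
        ((Q ≫ R) ◁ (ν'.inv ≫ ν'.hom) ≫ (ρ_ _).hom ≫ O₄) ▷ S ⊗≫ 𝟙 (W ≫ S) := by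
      simp only [Θ₁, Θ₂]; bicategory
    _ = 𝟙 ((A ≫ H) ≫ c ≫ c ≫ c) ⊗≫ ((A ≫ H) ◁ ν ≫ (ρ_ _).hom) ▷ (c ≫ c) ⊗≫
        ((A ≫ H) ◁ ν ≫ (ρ_ _).hom) ▷ c ≫
        ((Θ₁ ▷ c ≫ (Q ≫ G ≫ H) ◁ ν) ≫ (ρ_ _).hom) ≫ Θ₂ ⊗≫ O₄ ▷ S ⊗≫ 𝟙 (W ≫ S) := by
      rw [whiskerRight_drop ν Θ₁, whiskerRight_drop ν Θ₂, Iso.inv_hom_id]; bicategory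
    _ = _ := by
      rw [Category.assoc (Θ₁ ▷ c), whiskerRight_drop ν Θ₁]; simp only [Θ₁, Θ₂]; bicategory

variable {D : Type u₂} [Bicategory.{w₂, v₂} D]

/-- Naturality of `mapComp` in its second argument carries the image of `ν` to the image of its
inverse; what remains is the right unit condition of the homomorphism. -/
theorem map₂_drop (H : B ⥤ᵖ D) {x y : B} (u : x ⟶ y) {c : y ⟶ y} (ν : c ≅ 𝟙 y) :
    H.map u ◁ ((H.mapId y).inv ≫ H.map₂ ν.inv) ≫ (H.mapComp u c).inv ≫
      H.map₂ (u ◁ ν.hom ≫ (ρ_ u).hom) = (ρ_ (H.map u)).hom := by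
  rw [PrelaxFunctor.map₂_comp, H.map₂_whisker_left, H.map₂_right_unitor]
  simp only [Category.assoc, Iso.inv_hom_id_assoc, ← Bicategory.whiskerLeft_comp_assoc]
  rw [← PrelaxFunctor.map₂_comp_assoc]
  simp
end Drop

section Simplices

open LaxBidiagramCore LaxBidiagramData

variable {C : Type u₁} [Category.{v₁} C]
  (L : LaxBidiagram.{v₁, w₂, v₁, v₂, u₁, u₂} (LocallyDiscrete C))

theorem whiskerLeftIso_cellEq_trans {a b : LocallyDiscrete C} {f g : a ⟶ b} {α : f ⟶ g}
    (h : α = α) {y : L.fib b} {x : L.fib a} (u : x ⟶ (L.pull f).obj y)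
    {v : x ⟶ (L.pull g).obj y} (i : u ≫ L.cell α y ≅ v) :
    whiskerLeftIso u (L.cellEq h y) ≪≫ i = i := by
  ext
  simp [cellEq]

theorem omegaCell_rfl {a b c d : LocallyDiscrete C} (f : a ⟶ b) (g : b ⟶ c) (h : c ⟶ d)
    (e₁ : f ≫ g = f ≫ g) (e₂ : g ≫ h = g ≫ h) (e₃ : (f ≫ g) ≫ h = (f ≫ g) ≫ h)
    (e₄ : f ≫ g ≫ h = f ≫ g ≫ h) (t : L.fib d) :
    omegaCell L e₁ e₂ e₃ e₄ (α_ f g h).inv t = L.omega f g h t :=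
  whiskerLeftIso_cellEq_trans L _ _ _

theorem chiCellL_rfl {a b c : LocallyDiscrete C} (k : a ⟶ b) {g g' : b ⟶ c} (e : k ≫ g = k ≫ g)
    (e' : k ≫ g' = k ≫ g') (α : g ⟶ g') (z : L.fib c) :
    chiCellL L k e e' α (k ◁ α) z = L.chiL k α z :=
  whiskerLeftIso_cellEq_trans L _ _ _

theorem chiCellR_rfl {a b c : LocallyDiscrete C} {f f' : a ⟶ b} (k : b ⟶ c) (e : f ≫ k = f ≫ k)
    (e' : f' ≫ k = f' ≫ k) (α : f ⟶ f') (z : L.fib c) :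
    chiCellR L k e e' α (α ▷ k) z = L.chiR α k z :=
  whiskerLeftIso_cellEq_trans L _ _ _

-- All composites and all 2-cells of the base are variables. Eliminating the equations turns the
-- statement into the coherence condition `omega_pentagon`; taking the parallel 1-cells equal and
-- the 2-cells to be identities gives the pentagon over a single 4-simplex.
set_option maxHeartbeats 1000000 in
theorem omegaCell_pentagon {a b c d e : LocallyDiscrete C} {f : a ⟶ b} {g : b ⟶ c} {h : c ⟶ d}
    {k : d ⟶ e} {p : a ⟶ c} {q : b ⟶ d} {s : c ⟶ e} {m₀ m₁ : b ⟶ e} {l₀ l₁ : a ⟶ d}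
    {t₀ t₁ t₂ t₃ t₄ : a ⟶ e} (ep : f ≫ g = p) (eq : g ≫ h = q) (es : h ≫ k = s)
    (em₀ : g ≫ s = m₀) (em₁ : q ≫ k = m₁) (el₀ : f ≫ q = l₀) (el₁ : p ≫ h = l₁)
    (et₀ : f ≫ m₀ = t₀) (et₁ : f ≫ m₁ = t₁) (et₂ : l₀ ≫ k = t₂) (et₃ : l₁ ≫ k = t₃)
    (et₄ : p ≫ s = t₄) (μ : m₀ ⟶ m₁) (ν : l₀ ⟶ l₁) (τ₁ : t₀ ⟶ t₁) (τ₂ : t₁ ⟶ t₂) (τ₃ : t₂ ⟶ t₃)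
    (τ₄ : t₀ ⟶ t₄) (τ₅ : t₄ ⟶ t₃) (y : L.fib e) :
    𝟙 ((((L.pull f).map ((L.pull g).map (chiTo L es y)) ≫
          (L.pull f).map (chiTo L em₀ y)) ≫ chiTo L et₀ y) ≫
        L.cell τ₁ y ≫ L.cell τ₂ y ≫ L.cell τ₃ y) ⊗≫
      (((L.pull f).map ((L.pull g).map (chiTo L es y)) ≫
          (L.pull f).map (chiTo L em₀ y)) ≫ chiTo L et₀ y) ◁
        (L.cell τ₁ y ◁ (L.xi τ₂ τ₃ y).hom ≫
          (L.xiSq (Subsingleton.elim (τ₁ ≫ τ₂ ≫ τ₃) (τ₄ ≫ τ₅)) y).hom) ⊗≫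
      (L.pull f).map ((L.pull g).map (chiTo L es y)) ◁
        (omegaCell L ep em₀ et₄ et₀ τ₄ y).hom ▷ L.cell τ₅ y ⊗≫
      (chiToNat L ep (chiTo L es y)).hom ▷ (chiTo L et₄ y ≫ L.cell τ₅ y) ⊗≫
      chiTo L ep ((L.pull h).obj ((L.pull k).obj y)) ◁ (omegaCell L el₁ es et₃ et₄ τ₅ y).hom =
    𝟙 ((((L.pull f).map ((L.pull g).map (chiTo L es y)) ≫
          (L.pull f).map (chiTo L em₀ y)) ≫ chiTo L et₀ y) ≫
        L.cell τ₁ y ≫ L.cell τ₂ y ≫ L.cell τ₃ y) ⊗≫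
      ((L.pull f).map ((L.pull g).map (chiTo L es y)) ≫ (L.pull f).map (chiTo L em₀ y)) ◁
        (chiCellL L f et₀ et₁ μ τ₁ y).hom ▷ (L.cell τ₂ y ≫ L.cell τ₃ y) ⊗≫
      ((((L.pull f).mapComp ((L.pull g).map (chiTo L es y)) (chiTo L em₀ y)).inv ▷
            (L.pull f).map (L.cell μ y)) ≫
          ((L.pull f).mapComp ((L.pull g).map (chiTo L es y) ≫ chiTo L em₀ y)
            (L.cell μ y)).inv ≫
          (L.pull f).map₂ (omegaCell L eq es em₁ em₀ μ y).hom ≫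
          ((L.pull f).mapComp (chiTo L eq ((L.pull k).obj y)) (chiTo L em₁ y)).hom) ▷
        (chiTo L et₁ y ≫ L.cell τ₂ y ≫ L.cell τ₃ y) ⊗≫
      (L.pull f).map (chiTo L eq ((L.pull k).obj y)) ◁
        (omegaCell L el₀ em₁ et₂ et₁ τ₂ y).hom ▷ L.cell τ₃ y ⊗≫
      ((L.pull f).map (chiTo L eq ((L.pull k).obj y)) ≫ chiTo L el₀ ((L.pull k).obj y)) ◁
        (chiCellR L k et₂ et₃ ν τ₃ y).hom ⊗≫
      (omegaCell L ep eq el₁ el₀ ν ((L.pull k).obj y)).hom ▷ chiTo L et₃ y ⊗≫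
      𝟙 (chiTo L ep ((L.pull h).obj ((L.pull k).obj y)) ≫
        chiTo L el₁ ((L.pull k).obj y) ≫ chiTo L et₃ y) := by
  subst ep eq es em₀ em₁ el₀ el₁ et₀ et₁ et₂ et₃ et₄
  obtain rfl : μ = (α_ g h k).inv := Subsingleton.elim _ _
  obtain rfl : ν = (α_ f g h).inv := Subsingleton.elim _ _
  obtain rfl : τ₁ = f ◁ (α_ g h k).inv := Subsingleton.elim _ _
  obtain rfl : τ₂ = (α_ f (g ≫ h) k).inv := Subsingleton.elim _ _
  obtain rfl : τ₃ = (α_ f g h).inv ▷ k := Subsingleton.elim _ _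
  obtain rfl : τ₄ = (α_ f g (h ≫ k)).inv := Subsingleton.elim _ _
  obtain rfl : τ₅ = (α_ (f ≫ g) h k).inv := Subsingleton.elim _ _
  have key := L.coherent.omega_pentagon f g h k y
  rw [omegaCell_rfl, omegaCell_rfl, omegaCell_rfl, omegaCell_rfl, omegaCell_rfl, chiCellL_rfl,
    chiCellR_rfl]
  exact key

set_option maxHeartbeats 2000000 in
/-- The pentagon for `ω` in a 4-simplex of the base. -/
theorem omegaTet_pentagon {a b c d e : LocallyDiscrete C} {f : a ⟶ b} {g : b ⟶ c} {h : c ⟶ d}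
    {k : d ⟶ e} {p : a ⟶ c} {q : b ⟶ d} {s : c ⟶ e} {m : b ⟶ e} {l : a ⟶ d} {t : a ⟶ e}
    (ep : f ≫ g = p) (eq : g ≫ h = q) (es : h ≫ k = s) (em₀ : g ≫ s = m) (em₁ : q ≫ k = m)
    (el₀ : f ≫ q = l) (el₁ : p ≫ h = l) (et₀ : f ≫ m = t) (et₃ : l ≫ k = t)
    (et₄ : p ≫ s = t) (y : L.fib e) :
    𝟙 (((L.pull f).map ((L.pull g).map (chiTo L es y)) ≫
          (L.pull f).map (chiTo L em₀ y)) ≫ chiTo L et₀ y) ⊗≫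
      (L.pull f).map ((L.pull g).map (chiTo L es y)) ◁ (omegaTet L ep em₀ et₄ et₀ y).hom ⊗≫
      (chiToNat L ep (chiTo L es y)).hom ▷ chiTo L et₄ y ⊗≫
      chiTo L ep ((L.pull h).obj ((L.pull k).obj y)) ◁ (omegaTet L el₁ es et₃ et₄ y).hom =
    (((L.pull f).mapComp ((L.pull g).map (chiTo L es y)) (chiTo L em₀ y)).inv ≫
          (L.pull f).map₂ (omegaTet L eq es em₁ em₀ y).hom ≫
          ((L.pull f).mapComp (chiTo L eq ((L.pull k).obj y)) (chiTo L em₁ y)).hom) ▷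
        chiTo L et₀ y ⊗≫
      (L.pull f).map (chiTo L eq ((L.pull k).obj y)) ◁ (omegaTet L el₀ em₁ et₃ et₀ y).hom ⊗≫
      (omegaTet L ep eq el₁ el₀ ((L.pull k).obj y)).hom ▷ chiTo L et₃ y ⊗≫
      𝟙 (chiTo L ep ((L.pull h).obj ((L.pull k).obj y)) ≫
        chiTo L el₁ ((L.pull k).obj y) ≫ chiTo L et₃ y) := by
  -- The second use of the general statement: the five composites a → e are all `t`, and every
  -- 2-cell of the base is an identity.
  have key := omegaCell_pentagon L ep eq es em₀ em₁ el₀ el₁ et₀ et₀ et₃ et₃ et₄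
    (𝟙 m) (𝟙 l) (𝟙 t) (𝟙 t) (𝟙 t) (𝟙 t) (𝟙 t) y
  rw [omegaCell_endo L ep em₀ et₄ et₀, omegaCell_endo L el₁ es et₃ et₄,
    omegaCell_endo L eq es em₁ em₀, omegaCell_endo L el₀ em₁ et₃ et₀,
    omegaCell_endo L ep eq el₁ el₀, chiCellL_endo L f et₀, chiCellR_endo L k et₃] at key
  rw [drop_pentagon_left (cellEndo L (𝟙 t) y).hom (cellEndo L (𝟙 t ≫ 𝟙 t) y).hom
    (h := by simpa [xiTri, cellEq] using xiTri_endo L (rfl : 𝟙 t ≫ 𝟙 t = _) y)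
    (h' := xiSq_endo L _ y)] at key
  have r := drop_pentagon_right
    (cellEndo L (𝟙 t) y).hom (cellEndo L (𝟙 l) ((L.pull k).obj y))
    (A := (L.pull f).map ((L.pull g).map (chiTo L es y)) ≫ (L.pull f).map (chiTo L em₀ y))
    (((L.pull f).mapId ((L.pull m).obj y)).inv ≫ (L.pull f).map₂ (cellEndo L (𝟙 m) y).inv)
    (((L.pull f).mapComp ((L.pull g).map (chiTo L es y)) (chiTo L em₀ y)).inv ▷
          (L.pull f).map (L.cell (𝟙 m) y) ≫
        ((L.pull f).mapComp ((L.pull g).map (chiTo L es y) ≫ chiTo L em₀ y)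
          (L.cell (𝟙 m) y)).inv ≫
        (L.pull f).map₂ (((L.pull g).map (chiTo L es y) ≫ chiTo L em₀ y) ◁
          (cellEndo L (𝟙 m) y).hom ≫ (ρ_ _).hom ≫ (omegaTet L eq es em₁ em₀ y).hom) ≫
        ((L.pull f).mapComp (chiTo L eq ((L.pull k).obj y)) (chiTo L em₁ y)).hom)
    (omegaTet L el₀ em₁ et₃ et₀ y).hom (omegaTet L ep eq el₁ el₀ ((L.pull k).obj y)).hom
  -- The identity cell of `m` is inserted outside `f^*` and removed inside it; by `map₂_drop` the
  -- two operations cancel.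
  have hM : (ρ_ _).inv ≫ ((L.pull f).map ((L.pull g).map (chiTo L es y)) ≫
        (L.pull f).map (chiTo L em₀ y)) ◁
        (((L.pull f).mapId ((L.pull m).obj y)).inv ≫ (L.pull f).map₂ (cellEndo L (𝟙 m) y).inv) ≫
      (((L.pull f).mapComp ((L.pull g).map (chiTo L es y)) (chiTo L em₀ y)).inv ▷
          (L.pull f).map (L.cell (𝟙 m) y) ≫
        ((L.pull f).mapComp ((L.pull g).map (chiTo L es y) ≫ chiTo L em₀ y)
          (L.cell (𝟙 m) y)).inv ≫
        (L.pull f).map₂ (((L.pull g).map (chiTo L es y) ≫ chiTo L em₀ y) ◁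
          (cellEndo L (𝟙 m) y).hom ≫ (ρ_ _).hom ≫ (omegaTet L eq es em₁ em₀ y).hom) ≫
        ((L.pull f).mapComp (chiTo L eq ((L.pull k).obj y)) (chiTo L em₁ y)).hom) =
      ((L.pull f).mapComp ((L.pull g).map (chiTo L es y)) (chiTo L em₀ y)).inv ≫
          (L.pull f).map₂ (omegaTet L eq es em₁ em₀ y).hom ≫
          ((L.pull f).mapComp (chiTo L eq ((L.pull k).obj y)) (chiTo L em₁ y)).hom := by
    have hd := map₂_drop (L.pull f) ((L.pull g).map (chiTo L es y) ≫ chiTo L em₀ y)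
      (cellEndo L (𝟙 m) y)
    rw [whisker_exchange_assoc, ← Category.assoc (_ ◁ (cellEndo L (𝟙 m) y).hom),
      PrelaxFunctor.map₂_comp (L.pull f).toPrelaxFunctor (_ ≫ _)]
    simp only [Category.assoc]
    rw [reassoc_of% hd]
    simp
  rw [hM] at r
  have r' := congrArg (· ≫ (α_ _ _ _).hom) r
  -- Both sides begin by trivializing the three identity cells; this is invertible and can be
  -- cancelled.
  let θ : L.cell (𝟙 t) y ≫ L.cell (𝟙 t) y ≫ L.cell (𝟙 t) y ≅ 𝟙 _ :=
    whiskerRightIso (cellEndo L (𝟙 t) y) _ ≪≫ λ_ _ ≪≫ whiskerRightIso (cellEndo L (𝟙 t) y) _ ≪≫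
      λ_ _ ≪≫ cellEndo L (𝟙 t) y
  rw [← cancel_epi ((((L.pull f).map ((L.pull g).map (chiTo L es y)) ≫
    (L.pull f).map (chiTo L em₀ y)) ≫ chiTo L et₀ y) ◁ θ.hom ≫ (ρ_ _).hom)]
  refine Eq.trans (Eq.trans ?_ key) (Eq.trans ?_ (r'.trans ?_)) <;>
    (try simp only [θ, Iso.trans_hom, whiskerRightIso_hom]) <;> bicategory

end Simplices
end LaxBidiagrams

/-! ### Naturality of ω and γ, and the triangle -/

namespace LaxBidiagrams

section Drop

variable {B : Type u₁} [Bicategory.{w₁, v₁} B]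

/-- The modification condition for a source that ends with a trivializable 1-cell `c` implies the
one without it: precompose with the invertible trivialization and slide it past `m`. Hypothesis `hn`
says that the trivialization is itself natural. -/
theorem sqCompat_drop {x x' y y' : B} {f : x ⟶ x'} {g : y ⟶ y'} {p q : x ⟶ y} {p' q' : x' ⟶ y'}
    {c : y ⟶ y} {c' : y' ⟶ y'} (ν : c ≅ 𝟙 y) (ν' : c' ≅ 𝟙 y') (m : f ≫ p' ≅ p ≫ g)
    (n : g ≫ c' ≅ c ≫ g) (k : f ≫ q' ≅ q ≫ g) (σ : p ≅ q) (σ' : p' ≅ q')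
    {τ : p ≫ c ≅ q} {τ' : p' ≫ c' ≅ q'} (hτ : τ.hom = p ◁ ν.hom ≫ (ρ_ p).hom ≫ σ.hom)
    (hτ' : τ'.hom = p' ◁ ν'.hom ≫ (ρ_ p').hom ≫ σ'.hom)
    (hn : n.hom ≫ ν.hom ▷ g = g ◁ ν'.hom ≫ (ρ_ g).hom ≫ (λ_ g).inv)
    (h : SqCompat (sqComp m n) k τ τ') : SqCompat m k σ σ' := by
  unfold SqCompat at *
  rw [hτ, hτ'] at h
  rw [← cancel_epi (f ◁ (p' ◁ ν'.hom ≫ (ρ_ p').hom))]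
  calc
    _ = f ◁ (p' ◁ ν'.hom ≫ (ρ_ p').hom ≫ σ'.hom) ≫ k.hom := by simp
    _ = 𝟙 _ ⊗≫ m.hom ▷ c' ⊗≫ p ◁ (n.hom ≫ ν.hom ▷ g) ⊗≫ σ.hom ▷ g := by
      rw [h]; simp only [sqComp, Iso.trans_hom, Iso.symm_hom, whiskerLeftIso_hom,
        whiskerRightIso_hom]; bicategory
    _ = 𝟙 _ ⊗≫ (m.hom ▷ c' ≫ (p ≫ g) ◁ ν'.hom ≫ (ρ_ _).hom) ⊗≫ σ.hom ▷ g := by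
      rw [hn]; bicategory
    _ = _ := by rw [whiskerRight_drop]; bicategory

theorem drop_triangle_left {x₁ y z : B} {c c' : y ⟶ y} (ν : c ⟶ 𝟙 y) (ν' : c' ⟶ 𝟙 y)
    {d : z ⟶ z} (κ : d ≅ 𝟙 z) (ξ : c' ⟶ c ≫ c)
    (h : ξ ≫ ν ▷ c ≫ (λ_ _).hom ≫ ν = ν')
    {U : z ⟶ x₁} {G : x₁ ⟶ y} {P : x₁ ⟶ z} {R : z ⟶ y}
    (O : G ⟶ P ≫ R) (Γ : U ≫ P ⟶ 𝟙 z) :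
    𝟙 (U ≫ G ≫ c') ⊗≫ (U ≫ G) ◁ ξ ⊗≫ U ◁ (G ◁ ν ≫ (ρ_ _).hom ≫ O) ▷ c ⊗≫
        (U ≫ P) ◁ (R ◁ ν ⊗≫ κ.inv ▷ R) ⊗≫ ((U ≫ P) ◁ κ.hom ≫ (ρ_ _).hom ≫ Γ) ▷ R ⊗≫ 𝟙 R =
      𝟙 (U ≫ G ≫ c') ⊗≫ (U ≫ G) ◁ ν' ⊗≫ U ◁ O ⊗≫ Γ ▷ R ⊗≫ 𝟙 R := by
  calc
    _ = 𝟙 (U ≫ G ≫ c') ⊗≫ (U ≫ G) ◁ (ξ ≫ ν ▷ c ≫ (λ_ _).hom) ⊗≫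
        ((U ◁ O) ▷ c ≫ (U ≫ P ≫ R) ◁ ν ≫ (ρ_ _).hom) ⊗≫
        ((U ≫ P) ◁ (κ.inv ≫ κ.hom) ≫ (ρ_ _).hom ≫ Γ) ▷ R ⊗≫ 𝟙 R := by bicategory
    _ = 𝟙 (U ≫ G ≫ c') ⊗≫ (U ≫ G) ◁ (ξ ≫ ν ▷ c ≫ (λ_ _).hom ≫ ν) ⊗≫
        (U ◁ O) ⊗≫ Γ ▷ R ⊗≫ 𝟙 R := by
      rw [whiskerRight_drop, Iso.inv_hom_id]; bicategory
    _ = _ := by rw [h]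

end Drop

section Simplices

open LaxBidiagramCore LaxBidiagramData

variable {C : Type u₁} [Category.{v₁} C]
  (L : LaxBidiagram.{v₁, w₂, v₁, v₂, u₁, u₂} (LocallyDiscrete C))

/-- The endomorphism is an identity, and ξ : 1 ≅ 1_f^* is a modification. -/
theorem cellNat_endo {a b : LocallyDiscrete C} {f : a ⟶ b} (η : f ⟶ f) {y y' : L.fib b}
    (v : y ⟶ y') :
    (L.cellNat η v).hom ≫ (cellEndo L η y).hom ▷ (L.pull f).map v =
      (L.pull f).map v ◁ (cellEndo L η y').hom ≫ (ρ_ _).hom ≫ (λ_ _).inv := by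
  obtain rfl : η = 𝟙 _ := Subsingleton.elim _ _
  have h := L.xiId_natural f v
  unfold SqCompat at h
  have h₁ : ∀ y, cellEndo L (𝟙 f) y = (L.xiId f y).symm := by
    intro y; ext; simp [cellEndo, cellEq]
  rw [h₁, h₁, Iso.symm_hom, Iso.symm_hom, ← whiskerRightIso_inv, Iso.comp_inv_eq,
    ← whiskerLeftIso_inv, Category.assoc, Iso.eq_inv_comp]
  simpa [sqId] using h

theorem omegaTet_natural {a b c d : LocallyDiscrete C} {f : a ⟶ b} {g : b ⟶ c} {h : c ⟶ d}
    {p : a ⟶ c} {q : b ⟶ d} {r : a ⟶ d} (e₁ : f ≫ g = p) (e₂ : g ≫ h = q) (e₃ : p ≫ h = r)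
    (e₄ : f ≫ q = r) {t t' : L.fib d} (k : t ⟶ t') :
    SqCompat (sqComp (sqMap (L.pull f) (chiToNat L e₂ k)) (chiToNat L e₄ k))
      (sqComp (chiToNat L e₁ ((L.pull h).map k)) (chiToNat L e₃ k))
      (omegaTet L e₁ e₂ e₃ e₄ t) (omegaTet L e₁ e₂ e₃ e₄ t') := by
  -- With `r'` and `η` free the equations can be eliminated, and the claim becomes `omega_natural`.
  -- It is then used for `r' = r` and the identity.
  have key : ∀ {r' : a ⟶ d} (e₃ : p ≫ h = r') (η : r ⟶ r'),
      SqCompat (sqComp (sqComp (sqMap (L.pull f) (chiToNat L e₂ k)) (chiToNat L e₄ k))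
        (L.cellNat η k)) (sqComp (chiToNat L e₁ ((L.pull h).map k)) (chiToNat L e₃ k))
        (omegaCell L e₁ e₂ e₃ e₄ η t) (omegaCell L e₁ e₂ e₃ e₄ η t') := by
    intro r' e₃ η
    subst e₁ e₂ e₃ e₄
    obtain rfl : η = (α_ f g h).inv := Subsingleton.elim _ _
    rw [omegaCell_rfl, omegaCell_rfl]
    exact L.omega_natural f g h k
  exact sqCompat_drop (cellEndo L (𝟙 r) t) (cellEndo L (𝟙 r) t') _ _ _ _ _
    (omegaCell_endo L e₁ e₂ e₃ e₄ (𝟙 r) t) (omegaCell_endo L e₁ e₂ e₃ e₄ (𝟙 r) t')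
    (cellNat_endo L (𝟙 r) k) (key e₃ (𝟙 r))

/-- `γ` for a 1-cell that is equal to the composite with an identity. -/
def gammaCell {a b : LocallyDiscrete C} {f r : a ⟶ b} (e : f ≫ 𝟙 b = r) (η : r ⟶ f) (y : L.fib b) :
    ((L.pull f).map (L.unitApp b y) ≫ chiTo L e y) ≫ L.cell η y ≅ 𝟙 ((L.pull f).obj y) :=
  match r, e, η with
  | _, rfl, η => whiskerLeftIso _ (L.cellEq (Subsingleton.elim η _) y) ≪≫ L.gamma f y

/-- `γ` for a degenerate triangle of the base. -/
def gammaTri {a b : LocallyDiscrete C} {f : a ⟶ b} (e : f ≫ 𝟙 b = f) (y : L.fib b) :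
    (L.pull f).map (L.unitApp b y) ≫ chiTo L e y ≅ 𝟙 ((L.pull f).obj y) :=
  whiskerLeftIso ((L.pull f).map (L.unitApp b y)) (chiToIso L e (ρ_ f).hom y).symm ≪⊗≫
    L.gamma f y

theorem gammaCell_eq {a b : LocallyDiscrete C} {f r : a ⟶ b} (e : f ≫ 𝟙 b = r) (e' : f ≫ 𝟙 b = f)
    (η : r ⟶ f) (y : L.fib b) :
    gammaCell L e η y = α_ _ _ _ ≪≫ whiskerLeftIso _ (chiToPost L e e' η y) ≪≫
      gammaTri L e' y := by
  subst e
  obtain rfl : η = (ρ_ f).hom := Subsingleton.elim _ _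
  ext
  simp only [gammaCell, gammaTri, chiToPost, cellEq, bicategoricalIsoComp, chiTo_rfl]
  simp

theorem gammaCell_endo {a b : LocallyDiscrete C} {f : a ⟶ b} (e : f ≫ 𝟙 b = f) (η : f ⟶ f)
    (y : L.fib b) :
    (gammaCell L e η y).hom = _ ◁ (cellEndo L η y).hom ≫ (ρ_ _).hom ≫ (gammaTri L e y).hom := by
  rw [gammaCell_eq L e e, chiToPost_endo]
  simp

theorem gammaTri_natural {a b : LocallyDiscrete C} {f : a ⟶ b} (e : f ≫ 𝟙 b = f) {y y' : L.fib b}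
    (v : y ⟶ y') :
    SqCompat (sqComp (sqMap (L.pull f) (L.unitNat b v)) (chiToNat L e v))
      (sqId ((L.pull f).map v)) (gammaTri L e y) (gammaTri L e y') := by
  have key : ∀ {r : a ⟶ b} (e : f ≫ 𝟙 b = r) (η : r ⟶ f),
      SqCompat (sqComp (sqComp (sqMap (L.pull f) (L.unitNat b v)) (chiToNat L e v))
        (L.cellNat η v)) (sqId ((L.pull f).map v)) (gammaCell L e η y) (gammaCell L e η y') := by
    intro r e η
    subst e
    obtain rfl : η = (ρ_ f).hom := Subsingleton.elim _ _
    have h₁ : ∀ y, gammaCell L rfl (ρ_ f).hom y = L.gamma f y :=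
      fun y => whiskerLeftIso_cellEq_trans L _ _ _
    rw [h₁, h₁]
    exact L.gamma_natural f v
  exact sqCompat_drop (cellEndo L (𝟙 f) y) (cellEndo L (𝟙 f) y') _ _ _ _ _
    (gammaCell_endo L e (𝟙 f) y) (gammaCell_endo L e (𝟙 f) y') (cellNat_endo L (𝟙 f) v)
    (key e (𝟙 f))

/-- `δ` for a 1-cell that is equal to the composite with an identity. -/
def deltaCell {a b : LocallyDiscrete C} {f r : a ⟶ b} (e : 𝟙 a ≫ f = r) (η : r ⟶ f) (y : L.fib b) :
    (L.unitApp a ((L.pull f).obj y) ≫ chiTo L e y) ≫ L.cell η y ≅ 𝟙 ((L.pull f).obj y) :=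
  match r, e, η with
  | _, rfl, η => whiskerLeftIso _ (L.cellEq (Subsingleton.elim η _) y) ≪≫ L.delta f y

/-- `δ` for a degenerate triangle of the base. -/
def deltaTri {a b : LocallyDiscrete C} {f : a ⟶ b} (e : 𝟙 a ≫ f = f) (y : L.fib b) :
    L.unitApp a ((L.pull f).obj y) ≫ chiTo L e y ≅ 𝟙 ((L.pull f).obj y) :=
  whiskerLeftIso (L.unitApp a ((L.pull f).obj y)) (chiToIso L e (λ_ f).hom y).symm ≪⊗≫
    L.delta f y

theorem deltaCell_eq {a b : LocallyDiscrete C} {f r : a ⟶ b} (e : 𝟙 a ≫ f = r) (e' : 𝟙 a ≫ f = f)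
    (η : r ⟶ f) (y : L.fib b) :
    deltaCell L e η y = α_ _ _ _ ≪≫ whiskerLeftIso _ (chiToPost L e e' η y) ≪≫
      deltaTri L e' y := by
  subst e
  obtain rfl : η = (λ_ f).hom := Subsingleton.elim _ _
  ext
  simp only [deltaCell, deltaTri, chiToPost, cellEq, bicategoricalIsoComp, chiTo_rfl]
  simp

theorem deltaCell_endo {a b : LocallyDiscrete C} {f : a ⟶ b} (e : 𝟙 a ≫ f = f) (η : f ⟶ f)
    (y : L.fib b) :
    (deltaCell L e η y).hom = _ ◁ (cellEndo L η y).hom ≫ (ρ_ _).hom ≫ (deltaTri L e y).hom := by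
  rw [deltaCell_eq L e e, chiToPost_endo]
  simp

/-- As for the pentagon, with 1-cells and 2-cells of the base free: the equations are eliminated to
reach the given triangle condition, and the identities are substituted afterwards. -/
theorem omegaCell_triangle {a b c : LocallyDiscrete C} {f p : a ⟶ b} {g q : b ⟶ c}
    {r r' t : a ⟶ c} (e₁ : f ≫ 𝟙 b = p) (e₂ : 𝟙 b ≫ g = q) (e₃ : p ≫ g = r') (e₄ : f ≫ q = r)
    (e₅ : f ≫ g = t) (φ : p ⟶ f) (ψ : q ⟶ g) (τ₁ : r ⟶ r') (τ₂ : r' ⟶ t) (τ : r ⟶ t)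
    (z : L.fib c) :
    𝟙 ((L.pull f).map (L.unitApp b ((L.pull g).obj z)) ≫
        ((L.pull f).map (chiTo L e₂ z) ≫ chiTo L e₄ z) ≫ L.cell τ z) ⊗≫
      ((L.pull f).map (L.unitApp b ((L.pull g).obj z)) ≫
        ((L.pull f).map (chiTo L e₂ z) ≫ chiTo L e₄ z)) ◁
        (L.xiTri (Subsingleton.elim (τ₁ ≫ τ₂) τ) z).inv ⊗≫
      (L.pull f).map (L.unitApp b ((L.pull g).obj z)) ◁
        (omegaCell L e₁ e₂ e₃ e₄ τ₁ z).hom ▷ L.cell τ₂ z ⊗≫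
      ((L.pull f).map (L.unitApp b ((L.pull g).obj z)) ≫ chiTo L e₁ ((L.pull g).obj z)) ◁
        (chiCellR L g e₃ e₅ φ τ₂ z).hom ⊗≫
      (gammaCell L e₁ φ ((L.pull g).obj z)).hom ▷ chiTo L e₅ z ⊗≫
      𝟙 (chiTo L e₅ z) =
    𝟙 ((L.pull f).map (L.unitApp b ((L.pull g).obj z)) ≫
        ((L.pull f).map (chiTo L e₂ z) ≫ chiTo L e₄ z) ≫ L.cell τ z) ⊗≫
      ((L.pull f).map (L.unitApp b ((L.pull g).obj z)) ≫ (L.pull f).map (chiTo L e₂ z)) ◁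
        (chiCellL L f e₄ e₅ ψ τ z).hom ⊗≫
      ((((L.pull f).mapComp (L.unitApp b ((L.pull g).obj z)) (chiTo L e₂ z)).inv ▷
            (L.pull f).map (L.cell ψ z)) ≫
          ((L.pull f).mapComp (L.unitApp b ((L.pull g).obj z) ≫ chiTo L e₂ z)
            (L.cell ψ z)).inv ≫
          (L.pull f).map₂ (deltaCell L e₂ ψ z).hom ≫ ((L.pull f).mapId ((L.pull g).obj z)).hom) ▷
        chiTo L e₅ z ⊗≫
      𝟙 (chiTo L e₅ z) := by
  subst e₁ e₂ e₃ e₄ e₅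
  obtain rfl : φ = (ρ_ f).hom := Subsingleton.elim _ _
  obtain rfl : ψ = (λ_ g).hom := Subsingleton.elim _ _
  obtain rfl : τ₁ = (α_ f (𝟙 b) g).inv := Subsingleton.elim _ _
  obtain rfl : τ₂ = (ρ_ f).hom ▷ g := Subsingleton.elim _ _
  obtain rfl : τ = f ◁ (λ_ g).hom := Subsingleton.elim _ _
  have h₁ : ∀ y, gammaCell L rfl (ρ_ f).hom y = L.gamma f y :=
    fun y => whiskerLeftIso_cellEq_trans L _ _ _
  have h₂ : deltaCell L rfl (λ_ g).hom z = L.delta g z := whiskerLeftIso_cellEq_trans L _ _ _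
  rw [omegaCell_rfl, chiCellL_rfl, chiCellR_rfl, h₁, h₂]
  exact L.coherent.omega_triangle f g z

set_option maxHeartbeats 1000000 in
/-- The triangle for `ω`, `γ` and `δ` in a degenerate tetrahedron of the base. -/
theorem omegaTet_triangle {a b c : LocallyDiscrete C} {f : a ⟶ b} {g : b ⟶ c}
    {t : a ⟶ c} (e₁ : f ≫ 𝟙 b = f) (e₂ : 𝟙 b ≫ g = g) (e : f ≫ g = t) (z : L.fib c) :
    (L.pull f).map (L.unitApp b ((L.pull g).obj z)) ◁ (omegaTet L e₁ e₂ e e z).hom ⊗≫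
      (gammaTri L e₁ ((L.pull g).obj z)).hom ▷ chiTo L e z ⊗≫ 𝟙 (chiTo L e z) =
    𝟙 _ ⊗≫ (((L.pull f).mapComp (L.unitApp b ((L.pull g).obj z)) (chiTo L e₂ z)).inv ≫
          (L.pull f).map₂ (deltaTri L e₂ z).hom ≫ ((L.pull f).mapId ((L.pull g).obj z)).hom) ▷
        chiTo L e z ⊗≫ 𝟙 (chiTo L e z) := by
  have key := omegaCell_triangle L e₁ e₂ e e e (𝟙 f) (𝟙 g) (𝟙 t) (𝟙 t) (𝟙 t) z
  rw [omegaCell_endo L e₁ e₂ e e, gammaCell_endo L e₁, deltaCell_endo L e₂,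
    chiCellL_endo L f e, chiCellR_endo L g e] at key
  have l := drop_triangle_left (cellEndo L (𝟙 t) z).hom (cellEndo L (𝟙 t) z).hom
    (cellEndo L (𝟙 f) ((L.pull g).obj z))
    (L.xiTri (Subsingleton.elim (𝟙 t ≫ 𝟙 t) (𝟙 t)) z).inv
    (by rw [Iso.inv_comp_eq]; exact (xiTri_endo L _ z).symm)
    (U := (L.pull f).map (L.unitApp b ((L.pull g).obj z)))
    (omegaTet L e₁ e₂ e e z).hom (gammaTri L e₁ ((L.pull g).obj z)).hom
  have hd := map₂_drop (L.pull f) (L.unitApp b ((L.pull g).obj z) ≫ chiTo L e₂ z)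
      (cellEndo L (𝟙 g) z)
  have hM : (ρ_ _).inv ≫ ((L.pull f).map (L.unitApp b ((L.pull g).obj z)) ≫
        (L.pull f).map (chiTo L e₂ z)) ◁
        (((L.pull f).mapId ((L.pull g).obj z)).inv ≫ (L.pull f).map₂ (cellEndo L (𝟙 g) z).inv) ≫
      ((L.pull f).mapComp (L.unitApp b ((L.pull g).obj z)) (chiTo L e₂ z)).inv ▷
            (L.pull f).map (L.cell (𝟙 g) z) ≫
          ((L.pull f).mapComp (L.unitApp b ((L.pull g).obj z) ≫ chiTo L e₂ z)
            (L.cell (𝟙 g) z)).inv ≫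
          (L.pull f).map₂ ((L.unitApp b ((L.pull g).obj z) ≫ chiTo L e₂ z) ◁
            (cellEndo L (𝟙 g) z).hom ≫ (ρ_ _).hom ≫ (deltaTri L e₂ z).hom) ≫
          ((L.pull f).mapId ((L.pull g).obj z)).hom =
      ((L.pull f).mapComp (L.unitApp b ((L.pull g).obj z)) (chiTo L e₂ z)).inv ≫
          (L.pull f).map₂ (deltaTri L e₂ z).hom ≫ ((L.pull f).mapId ((L.pull g).obj z)).hom := by
    rw [whisker_exchange_assoc, ← Category.assoc (_ ◁ (cellEndo L (𝟙 g) z).hom),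
      PrelaxFunctor.map₂_comp (L.pull f).toPrelaxFunctor (_ ≫ _)]
    simp only [Category.assoc]
    rw [reassoc_of% hd]
    simp
  rw [← cancel_epi (((L.pull f).map (L.unitApp b ((L.pull g).obj z)) ≫
    ((L.pull f).map (chiTo L e₂ z) ≫ chiTo L e z)) ◁ (cellEndo L (𝟙 t) z).hom ≫ (ρ_ _).hom)]
  rw [← cancel_epi (α_ _ _ _).inv]
  rw [← hM]
  refine Eq.trans (Eq.trans ?_ l.symm) (Eq.trans ?_ (key.trans ?_)) <;> bicategory

end Simplices
end LaxBidiagrams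

/-! ### Extension of 1-cells along a 1-cell of the base -/

namespace LaxBidiagrams

section Tail

variable {B : Type u₁} [Bicategory.{w₁, v₁} B] {C : Type u₂} [Bicategory.{w₂, v₂} C]

theorem map₂_associator_inv_mapComp (F : B ⥤ᵖ C) {x y z t : B} (f : x ⟶ y) (g : y ⟶ z)
    (h : z ⟶ t) :
    F.map₂ (α_ f g h).inv ≫ (F.mapComp (f ≫ g) h).hom ≫ (F.mapComp f g).hom ▷ F.map h =
      (F.mapComp f (g ≫ h)).hom ≫ F.map f ◁ (F.mapComp g h).hom ≫ (α_ _ _ _).inv := by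
  have h₁ := F.map₂_associator f g h
  have h₂ : F.map₂ (α_ f g h).inv ≫ F.map₂ (α_ f g h).hom = 𝟙 _ := by
    rw [← F.map₂_comp]; simp
  rw [← cancel_epi (F.map₂ (α_ f g h).hom), ← Category.assoc, ← F.map₂_comp, Iso.hom_inv_id,
    F.map₂_id, h₁]
  simp

/-- Splitting off the first factor under a homomorphism, in front of a 1-cell `c`. -/
def tailComp (F : B ⥤ᵖ C) {x y z : B} (a : x ⟶ y) (v : y ⟶ z) {t : C} (c : F.obj z ⟶ t) :
    F.map (a ≫ v) ≫ c ≅ F.map a ≫ F.map v ≫ c :=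
  whiskerRightIso (F.mapComp a v) c ≪≫ α_ _ _ _

theorem tailComp_natural_left (F : B ⥤ᵖ C) {x y z : B} {a a' : x ⟶ y} (φ : a ⟶ a') (v : y ⟶ z)
    {t : C} (c : F.obj z ⟶ t) :
    F.map₂ (φ ▷ v) ▷ c ≫ (tailComp F a' v c).hom =
      (tailComp F a v c).hom ≫ F.map₂ φ ▷ (F.map v ≫ c) := by
  simp [tailComp, F.map₂_whisker_right]

theorem tailComp_natural_right (F : B ⥤ᵖ C) {x y z : B} (a : x ⟶ y) {v v' : y ⟶ z} (φ : v ⟶ v')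
    {t : C} (c : F.obj z ⟶ t) :
    F.map₂ (a ◁ φ) ▷ c ≫ (tailComp F a v' c).hom =
      (tailComp F a v c).hom ≫ F.map a ◁ F.map₂ φ ▷ c := by
  simp [tailComp, F.map₂_whisker_left]

theorem tailComp_assoc (F : B ⥤ᵖ C) {x y z w : B} (a : x ⟶ y) (b : y ⟶ z) (v : z ⟶ w)
    {t : C} (c : F.obj w ⟶ t) :
    F.map₂ (α_ a b v).inv ▷ c ≫ (tailComp F (a ≫ b) v c).hom ≫
        (F.mapComp a b).hom ▷ (F.map v ≫ c) =
      (tailComp F a (b ≫ v) c).hom ≫ F.map a ◁ (tailComp F b v c).hom ≫ (α_ _ _ _).inv := by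
  have h := map₂_associator_inv_mapComp F a b v
  calc
    _ = (F.map₂ (α_ a b v).inv ≫ (F.mapComp (a ≫ b) v).hom ≫ (F.mapComp a b).hom ▷ F.map v) ▷ c ≫
        (α_ _ _ _).hom := by simp [tailComp]
    _ = _ := by rw [h]; simp only [tailComp, Iso.trans_hom, whiskerRightIso_hom]; bicategory

theorem tailComp_assoc_hom (F : B ⥤ᵖ C) {x y z w : B} (a : x ⟶ y) (b : y ⟶ z) (v : z ⟶ w)
    {t : C} (c : F.obj w ⟶ t) :
    F.map₂ (α_ a b v).hom ▷ c ≫ (tailComp F a (b ≫ v) c).hom ≫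
        F.map a ◁ (tailComp F b v c).hom =
      (tailComp F (a ≫ b) v c).hom ≫ (F.mapComp a b).hom ▷ (F.map v ≫ c) ≫ (α_ _ _ _).hom := by
  have h := tailComp_assoc F a b v c
  rw [← cancel_epi (F.map₂ (α_ a b v).inv ▷ c), ← comp_whiskerRight_assoc, ← F.map₂_comp,
    Iso.inv_hom_id, F.map₂_id, reassoc_of% h]
  simp

end Tail

section Simplices

open LaxBidiagramCore LaxBidiagramData

variable {C : Type u₁} [Category.{v₁} C]
  (L : LaxBidiagram.{v₁, w₂, v₁, v₂, u₁, u₂} (LocallyDiscrete C))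

/-- The fibre part of the composite of two 1-cells of the Grothendieck construction. -/
abbrev star {a b c : LocallyDiscrete C} {f : a ⟶ b} {g : b ⟶ c} {h : a ⟶ c} (e : f ≫ g = h)
    {x : L.fib a} {y : L.fib b} {z : L.fib c} (u : x ⟶ (L.pull f).obj y)
    (v : y ⟶ (L.pull g).obj z) : x ⟶ (L.pull h).obj z :=
  (u ≫ (L.pull f).map v) ≫ chiTo L e z

/-- The extension of `v : y ⟶ g^* z` to `f^* y ⟶ h^* z`. -/
abbrev ext {a b c : LocallyDiscrete C} {f : a ⟶ b} {g : b ⟶ c} {h : a ⟶ c} (e : f ≫ g = h)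
    {y : L.fib b} {z : L.fib c} (v : y ⟶ (L.pull g).obj z) :
    (L.pull f).obj y ⟶ (L.pull h).obj z :=
  (L.pull f).map v ≫ chiTo L e z

/-- The extension of a 2-cell. -/
abbrev ext₂ {a b c : LocallyDiscrete C} {f : a ⟶ b} {g : b ⟶ c} {h : a ⟶ c} (e : f ≫ g = h)
    {y : L.fib b} {z : L.fib c} {v v' : y ⟶ (L.pull g).obj z} (φ : v ⟶ v') :
    ext L e v ⟶ ext L e v' :=
  (L.pull f).map₂ φ ▷ chiTo L e z

theorem ext₂_comp {a b c : LocallyDiscrete C} {f : a ⟶ b} {g : b ⟶ c} {h : a ⟶ c} (e : f ≫ g = h)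
    {y : L.fib b} {z : L.fib c} {v v' v'' : y ⟶ (L.pull g).obj z} (φ : v ⟶ v') (ψ : v' ⟶ v'') :
    ext₂ L e (φ ≫ ψ) = ext₂ L e φ ≫ ext₂ L e ψ := by
  simp [ext₂]

theorem ext₂_id {a b c : LocallyDiscrete C} {f : a ⟶ b} {g : b ⟶ c} {h : a ⟶ c} (e : f ≫ g = h)
    {y : L.fib b} {z : L.fib c} (v : y ⟶ (L.pull g).obj z) :
    ext₂ L e (𝟙 v) = 𝟙 (ext L e v) := by
  simp [ext₂]

section

variable {a b c d : LocallyDiscrete C} {k : a ⟶ b} {f : b ⟶ c} {g : c ⟶ d}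
  {p : a ⟶ c} {q : b ⟶ d} {r : a ⟶ d} (e₁ : k ≫ f = p) (e₂ : f ≫ g = q) (e₃ : p ≫ g = r)
  (e₄ : k ≫ q = r)

/-- The iterated extension. -/
def extExt {y : L.fib c} {z : L.fib d} (v : y ⟶ (L.pull g).obj z) :
    ext L e₄ (ext L e₂ v) ≅ chiTo L e₁ y ≫ ext L e₃ v :=
  tailComp (L.pull k) ((L.pull f).map v) (chiTo L e₂ z) (chiTo L e₄ z) ≪≫
    whiskerLeftIso _ (omegaTet L e₁ e₂ e₃ e₄ z) ≪≫ (α_ _ _ _).symm ≪≫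
    whiskerRightIso (chiToNat L e₁ v) (chiTo L e₃ z) ≪≫ α_ _ _ _

theorem extExt_natural {y : L.fib c} {z : L.fib d} {v v' : y ⟶ (L.pull g).obj z} (φ : v ⟶ v') :
    ext₂ L e₄ (ext₂ L e₂ φ) ≫ (extExt L e₁ e₂ e₃ e₄ v').hom =
      (extExt L e₁ e₂ e₃ e₄ v).hom ≫ chiTo L e₁ y ◁ ext₂ L e₃ φ := by
  have h₁ := tailComp_natural_left (L.pull k) ((L.pull f).map₂ φ) (chiTo L e₂ z) (chiTo L e₄ z)
  have h₂ := chiToNat_natural L e₁ φ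
  calc
    _ = (tailComp (L.pull k) ((L.pull f).map v) (chiTo L e₂ z) (chiTo L e₄ z)).hom ≫
        ((L.pull k).map₂ ((L.pull f).map₂ φ) ▷ ((L.pull k).map (chiTo L e₂ z) ≫ chiTo L e₄ z) ≫
        _ ◁ (omegaTet L e₁ e₂ e₃ e₄ z).hom) ⊗≫
        (chiToNat L e₁ v').hom ▷ chiTo L e₃ z ⊗≫ 𝟙 _ := by
      simp only [extExt, Iso.trans_hom, reassoc_of% h₁, whiskerLeftIso_hom, whiskerRightIso_hom,
        Iso.symm_hom]
      bicategory
    _ = (tailComp (L.pull k) ((L.pull f).map v) (chiTo L e₂ z) (chiTo L e₄ z)).hom ≫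
        _ ◁ (omegaTet L e₁ e₂ e₃ e₄ z).hom ⊗≫
        ((L.pull k).map₂ ((L.pull f).map₂ φ) ▷ chiTo L e₁ _ ≫ (chiToNat L e₁ v').hom) ▷
          chiTo L e₃ z ⊗≫ 𝟙 _ := by
      rw [← whisker_exchange]; bicategory
    _ = _ := by
      rw [h₂]
      simp only [extExt, Iso.trans_hom, whiskerLeftIso_hom, whiskerRightIso_hom, Iso.symm_hom]
      bicategory

/-- The naturality cells of χ respect composition of 1-cells. This splits a factor `v` off an
iterated extension, and reduces statements about extensions to the case of χ itself. -/
theorem extExt_comp {y y' : L.fib c} {z : L.fib d} (v : y ⟶ y') (s : y' ⟶ (L.pull g).obj z) :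
    (extExt L e₁ e₂ e₃ e₄ (v ≫ s)).hom ≫
        chiTo L e₁ y ◁ (tailComp (L.pull p) v s (chiTo L e₃ z)).hom =
      ext₂ L e₄ (tailComp (L.pull f) v s (chiTo L e₂ z)).hom ≫
        (tailComp (L.pull k) ((L.pull f).map v) (ext L e₂ s) (chiTo L e₄ z)).hom ≫
        (L.pull k).map ((L.pull f).map v) ◁ (extExt L e₁ e₂ e₃ e₄ s).hom ≫ (α_ _ _ _).inv ≫
        (chiToNat L e₁ v).hom ▷ ext L e₃ s ≫ (α_ _ _ _).hom := by
  have h₁ := chiToNat_comp L e₁ v s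
  have h₂ := tailComp_natural_left (L.pull k) ((L.pull f).mapComp v s).hom (chiTo L e₂ z)
    (chiTo L e₄ z)
  have h₃ := tailComp_assoc_hom (L.pull k) ((L.pull f).map v) ((L.pull f).map s) (chiTo L e₂ z)
    (chiTo L e₄ z)
  calc
    _ = (tailComp (L.pull k) ((L.pull f).map (v ≫ s)) (chiTo L e₂ z) (chiTo L e₄ z)).hom ≫
        (L.pull k).map ((L.pull f).map (v ≫ s)) ◁ (omegaTet L e₁ e₂ e₃ e₄ z).hom ⊗≫
        ((chiToNat L e₁ (v ≫ s)).hom ≫ chiTo L e₁ y ◁ ((L.pull p).mapComp v s).hom) ▷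
          chiTo L e₃ z ⊗≫ 𝟙 _ := by
      simp only [extExt, tailComp, Iso.trans_hom, whiskerLeftIso_hom, whiskerRightIso_hom,
        Iso.symm_hom]
      bicategory
    _ = (tailComp (L.pull k) ((L.pull f).map (v ≫ s)) (chiTo L e₂ z) (chiTo L e₄ z)).hom ≫
        ((L.pull k).map ((L.pull f).map (v ≫ s)) ◁ (omegaTet L e₁ e₂ e₃ e₄ z).hom ≫
        ((L.pull k).map₂ ((L.pull f).mapComp v s).hom ≫
          ((L.pull k).mapComp ((L.pull f).map v) ((L.pull f).map s)).hom) ▷ (_ ≫ _)) ⊗≫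
        (L.pull k).map ((L.pull f).map v) ◁ (chiToNat L e₁ s).hom ▷ chiTo L e₃ z ⊗≫
        (chiToNat L e₁ v).hom ▷ ext L e₃ s ⊗≫ 𝟙 _ := by
      rw [h₁]; bicategory
    _ = ((tailComp (L.pull k) ((L.pull f).map (v ≫ s)) (chiTo L e₂ z) (chiTo L e₄ z)).hom ≫
        ((L.pull k).map₂ ((L.pull f).mapComp v s).hom ▷ (_ ≫ _))) ≫
          ((L.pull k).mapComp ((L.pull f).map v) ((L.pull f).map s)).hom ▷ (_ ≫ _) ⊗≫
        ((L.pull k).map ((L.pull f).map v) ≫ (L.pull k).map ((L.pull f).map s)) ◁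
          (omegaTet L e₁ e₂ e₃ e₄ z).hom ⊗≫
        (L.pull k).map ((L.pull f).map v) ◁ (chiToNat L e₁ s).hom ▷ chiTo L e₃ z ⊗≫
        (chiToNat L e₁ v).hom ▷ ext L e₃ s ⊗≫ 𝟙 _ := by
      rw [whisker_exchange]; bicategory
    _ = ext₂ L e₄ (((L.pull f).mapComp v s).hom ▷ chiTo L e₂ z) ≫
        ((tailComp (L.pull k) ((L.pull f).map v ≫ (L.pull f).map s) (chiTo L e₂ z)
          (chiTo L e₄ z)).hom ≫ ((L.pull k).mapComp ((L.pull f).map v) ((L.pull f).map s)).hom ▷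
          ((L.pull k).map (chiTo L e₂ z) ≫ chiTo L e₄ z) ≫ (α_ _ _ _).hom) ≫
        (L.pull k).map ((L.pull f).map v) ◁ ((L.pull k).map ((L.pull f).map s) ◁
          (omegaTet L e₁ e₂ e₃ e₄ z).hom) ⊗≫
        (L.pull k).map ((L.pull f).map v) ◁ (chiToNat L e₁ s).hom ▷ chiTo L e₃ z ⊗≫
        (chiToNat L e₁ v).hom ▷ ext L e₃ s ⊗≫ 𝟙 _ := by
      rw [← h₂]; bicategory
    _ = _ := by
      rw [← h₃]
      have h₄ : (tailComp (L.pull f) v s (chiTo L e₂ z)).hom =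
        ((L.pull f).mapComp v s).hom ▷ chiTo L e₂ z ≫ (α_ _ _ _).hom := rfl
      rw [h₄, ext₂_comp]
      simp only [extExt, Iso.trans_hom, whiskerLeftIso_hom, whiskerRightIso_hom, Iso.symm_hom]
      bicategory

end

section

variable {a b c d e : LocallyDiscrete C} {k : a ⟶ b} {f : b ⟶ c} {g : c ⟶ d} {h : d ⟶ e}
  {p : a ⟶ c} {q : b ⟶ d} {s : c ⟶ e} {m : b ⟶ e} {l : a ⟶ d} {n : a ⟶ e}
  (ep : k ≫ f = p) (eq : f ≫ g = q) (es : g ≫ h = s) (em₀ : f ≫ s = m) (em₁ : q ≫ h = m)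
  (el₀ : k ≫ q = l) (el₁ : p ≫ g = l) (en₀ : k ≫ m = n) (en₃ : l ≫ h = n) (en₄ : p ≫ s = n)

/-- The pentagon for ω, with the comparison cells of `k^*` absorbed into the iterated extension of
χ. -/
theorem extExt_chiTo (t : L.fib e) :
    (extExt L ep em₀ en₄ en₀ (chiTo L es t)).hom ≫
        chiTo L ep _ ◁ (omegaTet L el₁ es en₃ en₄ t).hom =
      ext₂ L en₀ (omegaTet L eq es em₁ em₀ t).hom ≫
        (tailComp (L.pull k) (chiTo L eq _) (chiTo L em₁ t) (chiTo L en₀ t)).hom ≫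
        (L.pull k).map (chiTo L eq _) ◁ (omegaTet L el₀ em₁ en₃ en₀ t).hom ⊗≫
        (omegaTet L ep eq el₁ el₀ _).hom ▷ chiTo L en₃ t ⊗≫ 𝟙 _ := by
  have key := omegaTet_pentagon L ep eq es em₀ em₁ el₀ el₁ en₀ en₃ en₄ t
  rw [← cancel_epi ((((L.pull k).mapComp _ _).hom ▷ chiTo L en₀ t))] at key
  calc
    _ = ((L.pull k).mapComp ((L.pull f).map (chiTo L es t)) (chiTo L em₀ t)).hom ▷
          chiTo L en₀ t ≫ 𝟙 _ ⊗≫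
      (L.pull k).map ((L.pull f).map (chiTo L es t)) ◁ (omegaTet L ep em₀ en₄ en₀ t).hom ⊗≫
      (chiToNat L ep (chiTo L es t)).hom ▷ chiTo L en₄ t ⊗≫
      chiTo L ep _ ◁ (omegaTet L el₁ es en₃ en₄ t).hom := by
      simp only [extExt, tailComp, Iso.trans_hom, whiskerLeftIso_hom, whiskerRightIso_hom,
        Iso.symm_hom]
      bicategory
    _ = (((L.pull k).mapComp ((L.pull f).map (chiTo L es t)) (chiTo L em₀ t)).hom ≫
        ((L.pull k).mapComp ((L.pull f).map (chiTo L es t)) (chiTo L em₀ t)).inv) ▷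
          chiTo L en₀ t ≫
        ext₂ L en₀ (omegaTet L eq es em₁ em₀ t).hom ≫
        (tailComp (L.pull k) (chiTo L eq _) (chiTo L em₁ t) (chiTo L en₀ t)).hom ≫
        (L.pull k).map (chiTo L eq _) ◁ (omegaTet L el₀ em₁ en₃ en₀ t).hom ⊗≫
        (omegaTet L ep eq el₁ el₀ _).hom ▷ chiTo L en₃ t ⊗≫ 𝟙 _ := by
      rw [key]
      simp only [tailComp, Iso.trans_hom, whiskerRightIso_hom]
      bicategory
    _ = _ := by rw [Iso.hom_inv_id]; bicategory

-- The extension of `w` is the image of `w` followed by χ. Splitting off `w` by `extExt_comp` leaves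
-- the pentagon in the form `extExt_chiTo`, and the naturality of ω with respect to `w` accounts for
-- the rest.
set_option maxHeartbeats 2000000 in
theorem extExt_extExt {z : L.fib d} {t : L.fib e} (w : z ⟶ (L.pull h).obj t) :
    (extExt L ep em₀ en₄ en₀ (ext L es w)).hom ≫
        chiTo L ep _ ◁ (extExt L el₁ es en₃ en₄ w).hom =
      ext₂ L en₀ (extExt L eq es em₁ em₀ w).hom ≫
        (tailComp (L.pull k) (chiTo L eq z) (ext L em₁ w) (chiTo L en₀ t)).hom ≫
        (L.pull k).map (chiTo L eq z) ◁ (extExt L el₀ em₁ en₃ en₀ w).hom ≫ (α_ _ _ _).inv ≫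
        (omegaTet L ep eq el₁ el₀ z).hom ▷ ext L en₃ w ≫ (α_ _ _ _).hom := by
  have hp := extExt_chiTo L ep eq es em₀ em₁ el₀ el₁ en₀ en₃ en₄ t
  have hc := extExt_comp L ep em₀ en₄ en₀ ((L.pull g).map w) (chiTo L es t)
  have ho := omegaTet_natural L ep eq el₁ el₀ w
  unfold SqCompat at ho
  have h₁ := tailComp_natural_right (L.pull k) ((L.pull f).map ((L.pull g).map w))
    (omegaTet L eq es em₁ em₀ t).hom (chiTo L en₀ t)
  have h₂ := tailComp_assoc (L.pull k) ((L.pull f).map ((L.pull g).map w)) (chiTo L eq _)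
    (chiTo L em₁ t) (chiTo L en₀ t)
  have h₃ := tailComp_assoc_hom (L.pull k) (chiTo L eq z) ((L.pull q).map w)
    (chiTo L em₁ t) (chiTo L en₀ t)
  have h₄ := tailComp_natural_left (L.pull k) (chiToNat L eq w).hom (chiTo L em₁ t)
    (chiTo L en₀ t)
  have hB : ∀ {a b c d : LocallyDiscrete C} {k : a ⟶ b} {f : b ⟶ c} {g : c ⟶ d}
      {p : a ⟶ c} {q : b ⟶ d} {r : a ⟶ d} (e₁ : k ≫ f = p) (e₂ : f ≫ g = q) (e₃ : p ≫ g = r)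
      (e₄ : k ≫ q = r) {y : L.fib c} {z : L.fib d} (v : y ⟶ (L.pull g).obj z),
      (extExt L e₁ e₂ e₃ e₄ v).hom = (tailComp (L.pull k) ((L.pull f).map v) (chiTo L e₂ z)
        (chiTo L e₄ z)).hom ≫ _ ◁ (omegaTet L e₁ e₂ e₃ e₄ z).hom ≫ (α_ _ _ _).inv ≫
        (chiToNat L e₁ v).hom ▷ chiTo L e₃ z ≫ (α_ _ _ _).hom := fun _ _ _ _ _ _ _ => rfl
  -- Both sides are brought to the same initial pasting; the remainders are the two sides of the
  -- modification condition `ho`.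
  have e₁ : (extExt L ep em₀ en₄ en₀ (ext L es w)).hom ≫
        chiTo L ep _ ◁ (extExt L el₁ es en₃ en₄ w).hom =
      ext₂ L en₀ (tailComp (L.pull f) ((L.pull g).map w) (chiTo L es t) (chiTo L em₀ t)).hom ≫
      (tailComp (L.pull k) ((L.pull f).map ((L.pull g).map w)) (ext L em₀ (chiTo L es t))
        (chiTo L en₀ t)).hom ≫
      (L.pull k).map ((L.pull f).map ((L.pull g).map w)) ◁
        (ext₂ L en₀ (omegaTet L eq es em₁ em₀ t).hom ≫
        (tailComp (L.pull k) (chiTo L eq _) (chiTo L em₁ t) (chiTo L en₀ t)).hom ≫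
        (L.pull k).map (chiTo L eq _) ◁ (omegaTet L el₀ em₁ en₃ en₀ t).hom) ⊗≫
      ((L.pull k).map ((L.pull f).map ((L.pull g).map w)) ◁ (omegaTet L ep eq el₁ el₀ _).hom ≫
        (sqComp (chiToNat L ep ((L.pull g).map w)) (chiToNat L el₁ w)).hom) ▷
          chiTo L en₃ t ⊗≫ 𝟙 _ := by
    calc
      _ = ((extExt L ep em₀ en₄ en₀ (ext L es w)).hom ≫ chiTo L ep _ ◁
          (tailComp (L.pull p) ((L.pull g).map w) (chiTo L es t) (chiTo L en₄ t)).hom) ≫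
          chiTo L ep _ ◁ _ ◁ (omegaTet L el₁ es en₃ en₄ t).hom ⊗≫
          chiTo L ep _ ◁ (chiToNat L el₁ w).hom ▷ chiTo L en₃ t ⊗≫ 𝟙 _ := by
        rw [hB el₁]; bicategory
      _ = ext₂ L en₀ (tailComp (L.pull f) ((L.pull g).map w) (chiTo L es t)
            (chiTo L em₀ t)).hom ≫
          (tailComp (L.pull k) ((L.pull f).map ((L.pull g).map w)) (ext L em₀ (chiTo L es t))
            (chiTo L en₀ t)).hom ≫
          (L.pull k).map ((L.pull f).map ((L.pull g).map w)) ◁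
            (extExt L ep em₀ en₄ en₀ (chiTo L es t)).hom ⊗≫
          ((chiToNat L ep ((L.pull g).map w)).hom ▷ ext L en₄ (chiTo L es t) ≫
          (chiTo L ep _ ≫ _) ◁ (omegaTet L el₁ es en₃ en₄ t).hom) ⊗≫
          chiTo L ep _ ◁ (chiToNat L el₁ w).hom ▷ chiTo L en₃ t ⊗≫ 𝟙 _ := by
        rw [hc]; bicategory
      _ = ext₂ L en₀ (tailComp (L.pull f) ((L.pull g).map w) (chiTo L es t)
            (chiTo L em₀ t)).hom ≫
          (tailComp (L.pull k) ((L.pull f).map ((L.pull g).map w)) (ext L em₀ (chiTo L es t))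
            (chiTo L en₀ t)).hom ≫
          (L.pull k).map ((L.pull f).map ((L.pull g).map w)) ◁
            ((extExt L ep em₀ en₄ en₀ (chiTo L es t)).hom ≫
              chiTo L ep _ ◁ (omegaTet L el₁ es en₃ en₄ t).hom) ⊗≫
          (chiToNat L ep ((L.pull g).map w)).hom ▷ (chiTo L el₁ _ ≫ chiTo L en₃ t) ⊗≫
          chiTo L ep _ ◁ (chiToNat L el₁ w).hom ▷ chiTo L en₃ t ⊗≫ 𝟙 _ := by
        rw [← whisker_exchange]; bicategory
      _ = _ := by
        rw [hp]
        simp only [sqComp, Iso.trans_hom, whiskerLeftIso_hom, whiskerRightIso_hom, Iso.symm_hom]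
        bicategory
  have e₂ : ext₂ L en₀ (extExt L eq es em₁ em₀ w).hom ≫
        (tailComp (L.pull k) (chiTo L eq z) (ext L em₁ w) (chiTo L en₀ t)).hom ≫
        (L.pull k).map (chiTo L eq z) ◁ (extExt L el₀ em₁ en₃ en₀ w).hom ≫ (α_ _ _ _).inv ≫
        (omegaTet L ep eq el₁ el₀ z).hom ▷ ext L en₃ w ≫ (α_ _ _ _).hom =
      ext₂ L en₀ (tailComp (L.pull f) ((L.pull g).map w) (chiTo L es t) (chiTo L em₀ t)).hom ≫
      (tailComp (L.pull k) ((L.pull f).map ((L.pull g).map w)) (ext L em₀ (chiTo L es t))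
        (chiTo L en₀ t)).hom ≫
      (L.pull k).map ((L.pull f).map ((L.pull g).map w)) ◁
        (ext₂ L en₀ (omegaTet L eq es em₁ em₀ t).hom ≫
        (tailComp (L.pull k) (chiTo L eq _) (chiTo L em₁ t) (chiTo L en₀ t)).hom ≫
        (L.pull k).map (chiTo L eq _) ◁ (omegaTet L el₀ em₁ en₃ en₀ t).hom) ⊗≫
      ((sqComp (sqMap (L.pull k) (chiToNat L eq w)) (chiToNat L el₀ w)).hom ≫
        (omegaTet L ep eq el₁ el₀ z).hom ▷ (L.pull l).map w) ▷
          chiTo L en₃ t ⊗≫ 𝟙 _ := by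
    have hE : ext₂ L en₀ (extExt L eq es em₁ em₀ w).hom =
        ext₂ L en₀ (tailComp (L.pull f) ((L.pull g).map w) (chiTo L es t) (chiTo L em₀ t)).hom ≫
        ext₂ L en₀ (_ ◁ (omegaTet L eq es em₁ em₀ t).hom) ≫
        ext₂ L en₀ (α_ _ _ _).inv ≫ ext₂ L en₀ ((chiToNat L eq w).hom ▷ chiTo L em₁ t) ≫
        ext₂ L en₀ (α_ _ _ _).hom := by
      simp only [hB, ext₂_comp]
    -- The naturality cell of `χ` at `w` is moved out of `k^*`, where `sqMap` takes its place.
    have h₄' : ext₂ L en₀ ((chiToNat L eq w).hom ▷ chiTo L em₁ t) ≫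
        ext₂ L en₀ (α_ _ _ _).hom ≫
        (tailComp (L.pull k) (chiTo L eq z) (ext L em₁ w) (chiTo L en₀ t)).hom ≫
        (L.pull k).map (chiTo L eq z) ◁ (tailComp (L.pull k) ((L.pull q).map w) (chiTo L em₁ t)
          (chiTo L en₀ t)).hom =
        (tailComp (L.pull k) ((L.pull f).map ((L.pull g).map w) ≫ chiTo L eq _) (chiTo L em₁ t)
          (chiTo L en₀ t)).hom ≫ (((L.pull k).map₂ (chiToNat L eq w).hom ≫
          ((L.pull k).mapComp _ _).hom) ▷ ((L.pull k).map (chiTo L em₁ t) ≫ chiTo L en₀ t)) ≫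
          (α_ _ _ _).hom := by
      rw [h₃, reassoc_of% h₄, comp_whiskerRight, Category.assoc]
    have h₂' : ext₂ L en₀ (α_ _ _ _).inv ≫
        (tailComp (L.pull k) ((L.pull f).map ((L.pull g).map w) ≫ chiTo L eq _) (chiTo L em₁ t)
          (chiTo L en₀ t)).hom =
        (tailComp (L.pull k) ((L.pull f).map ((L.pull g).map w)) (chiTo L eq _ ≫ chiTo L em₁ t)
          (chiTo L en₀ t)).hom ≫
        (L.pull k).map ((L.pull f).map ((L.pull g).map w)) ◁
          (tailComp (L.pull k) (chiTo L eq _) (chiTo L em₁ t) (chiTo L en₀ t)).hom ≫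
        (α_ _ _ _).inv ≫ ((L.pull k).mapComp _ _).inv ▷ _ := by
      rw [← cancel_mono (((L.pull k).mapComp ((L.pull f).map ((L.pull g).map w))
        (chiTo L eq _)).hom ▷ ((L.pull k).map (chiTo L em₁ t) ≫ chiTo L en₀ t))]
      simp only [Category.assoc, ← comp_whiskerRight, Iso.inv_hom_id]
      simpa using h₂
    calc
      _ = ext₂ L en₀ (tailComp (L.pull f) ((L.pull g).map w) (chiTo L es t)
            (chiTo L em₀ t)).hom ≫
          ext₂ L en₀ (_ ◁ (omegaTet L eq es em₁ em₀ t).hom) ≫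
          ext₂ L en₀ (α_ _ _ _).inv ≫ (ext₂ L en₀ ((chiToNat L eq w).hom ▷ chiTo L em₁ t) ≫
          ext₂ L en₀ (α_ _ _ _).hom ≫
          (tailComp (L.pull k) (chiTo L eq z) (ext L em₁ w) (chiTo L en₀ t)).hom ≫
          (L.pull k).map (chiTo L eq z) ◁ (tailComp (L.pull k) ((L.pull q).map w) (chiTo L em₁ t)
            (chiTo L en₀ t)).hom) ≫ 𝟙 _ ⊗≫
          (L.pull k).map (chiTo L eq z) ◁ (L.pull k).map ((L.pull q).map w) ◁
            (omegaTet L el₀ em₁ en₃ en₀ t).hom ⊗≫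
          (L.pull k).map (chiTo L eq z) ◁ (chiToNat L el₀ w).hom ▷ chiTo L en₃ t ⊗≫
          (omegaTet L ep eq el₁ el₀ z).hom ▷ ext L en₃ w ⊗≫ 𝟙 _ := by
        rw [hE, hB el₀]
        simp only [Category.assoc]
        congr 4
        bicategory
      _ = ext₂ L en₀ (tailComp (L.pull f) ((L.pull g).map w) (chiTo L es t)
            (chiTo L em₀ t)).hom ≫
          (ext₂ L en₀ (_ ◁ (omegaTet L eq es em₁ em₀ t).hom) ≫
          (tailComp (L.pull k) ((L.pull f).map ((L.pull g).map w)) (chiTo L eq _ ≫ chiTo L em₁ t)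
            (chiTo L en₀ t)).hom) ≫
          (L.pull k).map ((L.pull f).map ((L.pull g).map w)) ◁
            (tailComp (L.pull k) (chiTo L eq _) (chiTo L em₁ t) (chiTo L en₀ t)).hom ⊗≫
          ((sqMap (L.pull k) (chiToNat L eq w)).hom ▷
            ((L.pull k).map (chiTo L em₁ t) ≫ chiTo L en₀ t) ≫
          ((L.pull k).map (chiTo L eq z) ≫ (L.pull k).map ((L.pull q).map w)) ◁
            (omegaTet L el₀ em₁ en₃ en₀ t).hom) ⊗≫
          (L.pull k).map (chiTo L eq z) ◁ (chiToNat L el₀ w).hom ▷ chiTo L en₃ t ⊗≫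
          (omegaTet L ep eq el₁ el₀ z).hom ▷ ext L en₃ w ⊗≫ 𝟙 _ := by
        rw [h₄']
        simp only [Category.assoc]
        rw [reassoc_of% h₂']
        congr 2
        simp only [sqMap, Iso.trans_hom, Iso.symm_hom, PrelaxFunctor.map₂Iso_hom]
        bicategory
      _ = _ := by
        rw [h₁, ← whisker_exchange]
        simp only [sqComp, Iso.trans_hom, whiskerLeftIso_hom, whiskerRightIso_hom, Iso.symm_hom]
        simp only [Category.assoc]
        congr 2
        bicategory
  rw [e₁, e₂, ho]

end

end Simplices
end LaxBidiagrams

/-! ### Extension of composites and its pentagon -/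

namespace LaxBidiagrams

section Simplices

open LaxBidiagramCore LaxBidiagramData

variable {C : Type u₁} [Category.{v₁} C]
  (L : LaxBidiagram.{v₁, w₂, v₁, v₂, u₁, u₂} (LocallyDiscrete C))

section

variable {a b c d : LocallyDiscrete C} {k : a ⟶ b} {f : b ⟶ c} {g : c ⟶ d}
  {p : a ⟶ c} {q : b ⟶ d} {r : a ⟶ d} (e₁ : k ≫ f = p) (e₂ : f ≫ g = q) (e₃ : p ≫ g = r)
  (e₄ : k ≫ q = r)

/-- Extension of a composite `u ≫ ext v`. -/
def extStar {x : L.fib b} {y : L.fib c} {z : L.fib d} (u : x ⟶ (L.pull f).obj y)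
    (v : y ⟶ (L.pull g).obj z) :
    ext L e₄ (u ≫ ext L e₂ v) ≅ ext L e₁ u ≫ ext L e₃ v :=
  tailComp (L.pull k) u (ext L e₂ v) (chiTo L e₄ z) ≪≫
    whiskerLeftIso _ (extExt L e₁ e₂ e₃ e₄ v) ≪≫ (α_ _ _ _).symm

theorem extStar_hom {x : L.fib b} {y : L.fib c} {z : L.fib d} (u : x ⟶ (L.pull f).obj y)
    (v : y ⟶ (L.pull g).obj z) :
    (extStar L e₁ e₂ e₃ e₄ u v).hom =
      (tailComp (L.pull k) u (ext L e₂ v) (chiTo L e₄ z)).hom ≫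
        (L.pull k).map u ◁ (extExt L e₁ e₂ e₃ e₄ v).hom ≫ (α_ _ _ _).inv :=
  rfl

theorem extStar_natural {x : L.fib b} {y : L.fib c} {z : L.fib d} {u u' : x ⟶ (L.pull f).obj y}
    {v v' : y ⟶ (L.pull g).obj z} (φ : u ⟶ u') (ψ : v ⟶ v') :
    ext₂ L e₄ (φ ▷ ext L e₂ v ≫ u' ◁ ext₂ L e₂ ψ) ≫ (extStar L e₁ e₂ e₃ e₄ u' v').hom =
      (extStar L e₁ e₂ e₃ e₄ u v).hom ≫ ext₂ L e₁ φ ▷ ext L e₃ v ≫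
        ext L e₁ u' ◁ ext₂ L e₃ ψ := by
  have h₁ := tailComp_natural_right (L.pull k) u' (ext₂ L e₂ ψ) (chiTo L e₄ z)
  have h₂ := tailComp_natural_left (L.pull k) φ (ext L e₂ v) (chiTo L e₄ z)
  have h₃ := extExt_natural L e₁ e₂ e₃ e₄ ψ
  calc
    _ = ext₂ L e₄ (φ ▷ ext L e₂ v) ≫ (ext₂ L e₄ (u' ◁ ext₂ L e₂ ψ) ≫
        (tailComp (L.pull k) u' (ext L e₂ v') (chiTo L e₄ z)).hom) ≫
        _ ◁ (extExt L e₁ e₂ e₃ e₄ v').hom ≫ (α_ _ _ _).inv := by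
      simp only [extStar, ext₂_comp, Iso.trans_hom, whiskerLeftIso_hom, Iso.symm_hom,
        Category.assoc]
    _ = (ext₂ L e₄ (φ ▷ ext L e₂ v) ≫ (tailComp (L.pull k) u' (ext L e₂ v) (chiTo L e₄ z)).hom) ≫
        (L.pull k).map u' ◁ (ext₂ L e₄ (ext₂ L e₂ ψ) ≫ (extExt L e₁ e₂ e₃ e₄ v').hom) ≫
        (α_ _ _ _).inv := by
      rw [h₁]; simp only [Category.assoc, Bicategory.whiskerLeft_comp]
    _ = (tailComp (L.pull k) u (ext L e₂ v) (chiTo L e₄ z)).hom ≫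
        ((L.pull k).map₂ φ ▷ _ ≫
        (L.pull k).map u' ◁ (extExt L e₁ e₂ e₃ e₄ v).hom) ≫
        (L.pull k).map u' ◁ chiTo L e₁ y ◁ ext₂ L e₃ ψ ≫ (α_ _ _ _).inv := by
      rw [h₂, h₃]; simp only [Category.assoc, Bicategory.whiskerLeft_comp]
    _ = _ := by
      rw [← whisker_exchange]
      simp only [extStar, Iso.trans_hom, whiskerLeftIso_hom, Iso.symm_hom]
      bicategory

/-- Extension of a composite of the Grothendieck construction. -/
def extComp {x : L.fib b} {y : L.fib c} {z : L.fib d} (u : x ⟶ (L.pull f).obj y)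
    (v : y ⟶ (L.pull g).obj z) :
    ext L e₄ (star L e₂ u v) ≅ ext L e₁ u ≫ ext L e₃ v :=
  whiskerRightIso
      ((L.pull k).mapComp (u ≫ (L.pull f).map v) (chiTo L e₂ z) ≪≫
        whiskerRightIso ((L.pull k).mapComp u ((L.pull f).map v))
          ((L.pull k).map (chiTo L e₂ z)))
      (chiTo L e₄ z) ≪⊗≫
    whiskerLeftIso ((L.pull k).map u ≫ (L.pull k).map ((L.pull f).map v))
      (omegaTet L e₁ e₂ e₃ e₄ z) ≪⊗≫
    whiskerLeftIso ((L.pull k).map u)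
      (whiskerRightIso (chiToNat L e₁ v) (chiTo L e₃ z)) ≪⊗≫
    Iso.refl (((L.pull k).map u ≫ chiTo L e₁ y) ≫ (L.pull p).map v ≫ chiTo L e₃ z)

/-- Two bracketings of one cell: `extComp` agrees with the composition constraint of K, while
`extStar` is convenient in calculations. -/
theorem extComp_eq {x : L.fib b} {y : L.fib c} {z : L.fib d} (u : x ⟶ (L.pull f).obj y)
    (v : y ⟶ (L.pull g).obj z) :
    (extComp L e₁ e₂ e₃ e₄ u v).hom =
      ext₂ L e₄ (α_ u ((L.pull f).map v) (chiTo L e₂ z)).hom ≫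
        (extStar L e₁ e₂ e₃ e₄ u v).hom := by
  have h := tailComp_assoc_hom (L.pull k) u ((L.pull f).map v) (chiTo L e₂ z) (chiTo L e₄ z)
  calc
    _ = ((tailComp (L.pull k) (u ≫ (L.pull f).map v) (chiTo L e₂ z) (chiTo L e₄ z)).hom ≫
        ((L.pull k).mapComp u ((L.pull f).map v)).hom ▷ ((L.pull k).map (chiTo L e₂ z) ≫
          chiTo L e₄ z) ≫ (α_ _ _ _).hom) ≫
        (L.pull k).map u ◁ (L.pull k).map ((L.pull f).map v) ◁ (omegaTet L e₁ e₂ e₃ e₄ z).hom ⊗≫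
        (L.pull k).map u ◁ (chiToNat L e₁ v).hom ▷ chiTo L e₃ z ⊗≫ 𝟙 _ := by
      simp only [extComp, tailComp, bicategoricalIsoComp, Iso.trans_hom, whiskerRightIso_hom,
        whiskerLeftIso_hom, Iso.refl_hom]
      bicategory
    _ = _ := by
      rw [← h]
      simp only [extStar, extExt, Iso.trans_hom, whiskerRightIso_hom,
        whiskerLeftIso_hom, Iso.symm_hom]
      bicategory

/-- Horizontal composition of fibre parts. -/
abbrev star₂ {b c d : LocallyDiscrete C} {f : b ⟶ c} {g : c ⟶ d} {q : b ⟶ d} (e₂ : f ≫ g = q)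
    {x : L.fib b} {y : L.fib c} {z : L.fib d} {u u' : x ⟶ (L.pull f).obj y}
    {v v' : y ⟶ (L.pull g).obj z} (φ : u ⟶ u') (ψ : v ⟶ v') : star L e₂ u v ⟶ star L e₂ u' v' :=
  (φ ▷ (L.pull f).map v ≫ u' ◁ (L.pull f).map₂ ψ) ▷ chiTo L e₂ z

theorem extComp_natural {x : L.fib b} {y : L.fib c} {z : L.fib d} {u u' : x ⟶ (L.pull f).obj y}
    {v v' : y ⟶ (L.pull g).obj z} (φ : u ⟶ u') (ψ : v ⟶ v') :
    ext₂ L e₄ (star₂ L e₂ φ ψ) ≫ (extComp L e₁ e₂ e₃ e₄ u' v').hom =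
      (extComp L e₁ e₂ e₃ e₄ u v).hom ≫ ext₂ L e₁ φ ▷ ext L e₃ v ≫
        ext L e₁ u' ◁ ext₂ L e₃ ψ := by
  have h : star₂ L e₂ φ ψ ≫ (α_ u' ((L.pull f).map v') (chiTo L e₂ z)).hom =
      (α_ u ((L.pull f).map v) (chiTo L e₂ z)).hom ≫ (φ ▷ ext L e₂ v ≫ u' ◁ ext₂ L e₂ ψ) := by
    simp
  rw [extComp_eq, extComp_eq, Category.assoc, ← extStar_natural, ← Category.assoc,
    ← Category.assoc, ← ext₂_comp, ← ext₂_comp, h]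

end

section

variable {a b c d e : LocallyDiscrete C} {k : a ⟶ b} {f : b ⟶ c} {g : c ⟶ d} {h : d ⟶ e}
  {p : a ⟶ c} {q : b ⟶ d} {s : c ⟶ e} {m : b ⟶ e} {l : a ⟶ d} {n : a ⟶ e}
  (ep : k ≫ f = p) (eq : f ≫ g = q) (es : g ≫ h = s) (em₀ : f ≫ s = m) (em₁ : q ≫ h = m)
  (el₀ : k ≫ q = l) (el₁ : p ≫ g = l) (en₀ : k ≫ m = n) (en₃ : l ≫ h = n) (en₄ : p ≫ s = n)

-- The pentagon is built up one 1-cell at a time. Here `v` is put in front of `extExt_extExt`, by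
-- means of `extExt_comp` and the compatibility of `tailComp` with associativity.
set_option maxHeartbeats 1000000 in
theorem extExt_extStar {y : L.fib c} {z : L.fib d} {t : L.fib e} (v : y ⟶ (L.pull g).obj z)
    (w : z ⟶ (L.pull h).obj t) :
    (extExt L ep em₀ en₄ en₀ (v ≫ ext L es w)).hom ≫
        chiTo L ep y ◁ (extStar L el₁ es en₃ en₄ v w).hom =
      ext₂ L en₀ (extStar L eq es em₁ em₀ v w).hom ≫
        (extStar L el₀ em₁ en₃ en₀ (ext L eq v) w).hom ≫
        (extExt L ep eq el₁ el₀ v).hom ▷ ext L en₃ w ≫ (α_ _ _ _).hom := by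
  have hc := extExt_comp L ep em₀ en₄ en₀ v (ext L es w)
  have he := extExt_extExt L ep eq es em₀ em₁ el₀ el₁ en₀ en₃ en₄ w
  have h₁ := tailComp_natural_right (L.pull k) ((L.pull f).map v)
    (extExt L eq es em₁ em₀ w).hom (chiTo L en₀ t)
  have h₂ := tailComp_assoc (L.pull k) ((L.pull f).map v) (chiTo L eq z) (ext L em₁ w)
    (chiTo L en₀ t)
  calc
    _ = ((extExt L ep em₀ en₄ en₀ (v ≫ ext L es w)).hom ≫
        chiTo L ep y ◁ (tailComp (L.pull p) v (ext L es w) (chiTo L en₄ t)).hom) ≫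
        chiTo L ep y ◁ ((L.pull p).map v ◁ (extExt L el₁ es en₃ en₄ w).hom ≫ (α_ _ _ _).inv) := by
      simp only [extStar, Iso.trans_hom, whiskerLeftIso_hom, Iso.symm_hom]
      bicategory
    _ = ext₂ L en₀ (tailComp (L.pull f) v (ext L es w) (chiTo L em₀ t)).hom ≫
        (tailComp (L.pull k) ((L.pull f).map v) (ext L em₀ (ext L es w)) (chiTo L en₀ t)).hom ≫
        (L.pull k).map ((L.pull f).map v) ◁ (extExt L ep em₀ en₄ en₀ (ext L es w)).hom ⊗≫
        ((chiToNat L ep v).hom ▷ ext L en₄ (ext L es w) ≫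
        (chiTo L ep y ≫ (L.pull p).map v) ◁ (extExt L el₁ es en₃ en₄ w).hom) ⊗≫ 𝟙 _ := by
      rw [hc]; bicategory
    _ = ext₂ L en₀ (tailComp (L.pull f) v (ext L es w) (chiTo L em₀ t)).hom ≫
        (tailComp (L.pull k) ((L.pull f).map v) (ext L em₀ (ext L es w)) (chiTo L en₀ t)).hom ≫
        (L.pull k).map ((L.pull f).map v) ◁ ((extExt L ep em₀ en₄ en₀ (ext L es w)).hom ≫
          chiTo L ep _ ◁ (extExt L el₁ es en₃ en₄ w).hom) ⊗≫
        (chiToNat L ep v).hom ▷ (chiTo L el₁ z ≫ ext L en₃ w) ⊗≫ 𝟙 _ := by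
      rw [← whisker_exchange]; bicategory
    _ = ext₂ L en₀ (tailComp (L.pull f) v (ext L es w) (chiTo L em₀ t)).hom ≫
        ((tailComp (L.pull k) ((L.pull f).map v) (ext L em₀ (ext L es w)) (chiTo L en₀ t)).hom ≫
        (L.pull k).map ((L.pull f).map v) ◁ ext₂ L en₀ (extExt L eq es em₁ em₀ w).hom) ≫
        (L.pull k).map ((L.pull f).map v) ◁
          (tailComp (L.pull k) (chiTo L eq z) (ext L em₁ w) (chiTo L en₀ t)).hom ≫
        (L.pull k).map ((L.pull f).map v) ◁ ((L.pull k).map (chiTo L eq z) ◁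
          (extExt L el₀ em₁ en₃ en₀ w).hom ≫ (α_ _ _ _).inv ≫
        (omegaTet L ep eq el₁ el₀ z).hom ▷ ext L en₃ w ≫ (α_ _ _ _).hom) ⊗≫
        (chiToNat L ep v).hom ▷ (chiTo L el₁ z ≫ ext L en₃ w) ⊗≫ 𝟙 _ := by
      rw [he]; bicategory
    _ = ext₂ L en₀ (tailComp (L.pull f) v (ext L es w) (chiTo L em₀ t)).hom ≫
        ext₂ L en₀ ((L.pull f).map v ◁ (extExt L eq es em₁ em₀ w).hom) ≫
        ((tailComp (L.pull k) ((L.pull f).map v) (chiTo L eq z ≫ ext L em₁ w)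
          (chiTo L en₀ t)).hom ≫
        (L.pull k).map ((L.pull f).map v) ◁
          (tailComp (L.pull k) (chiTo L eq z) (ext L em₁ w) (chiTo L en₀ t)).hom ≫
          (α_ _ _ _).inv) ≫
        ((L.pull k).map ((L.pull f).map v) ≫ (L.pull k).map (chiTo L eq z)) ◁
          (extExt L el₀ em₁ en₃ en₀ w).hom ⊗≫
        (L.pull k).map ((L.pull f).map v) ◁ ((omegaTet L ep eq el₁ el₀ z).hom ▷ ext L en₃ w) ⊗≫
        (chiToNat L ep v).hom ▷ (chiTo L el₁ z ≫ ext L en₃ w) ⊗≫ 𝟙 _ := by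
      rw [← h₁]; bicategory
    _ = ext₂ L en₀ (tailComp (L.pull f) v (ext L es w) (chiTo L em₀ t)).hom ≫
        ext₂ L en₀ ((L.pull f).map v ◁ (extExt L eq es em₁ em₀ w).hom) ≫
        ext₂ L en₀ (α_ _ _ _).inv ≫
        (tailComp (L.pull k) (ext L eq v) (ext L em₁ w) (chiTo L en₀ t)).hom ≫
        (((L.pull k).mapComp ((L.pull f).map v) (chiTo L eq z)).hom ▷ _ ≫
        ((L.pull k).map ((L.pull f).map v) ≫ (L.pull k).map (chiTo L eq z)) ◁
          (extExt L el₀ em₁ en₃ en₀ w).hom) ⊗≫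
        (L.pull k).map ((L.pull f).map v) ◁ ((omegaTet L ep eq el₁ el₀ z).hom ▷ ext L en₃ w) ⊗≫
        (chiToNat L ep v).hom ▷ (chiTo L el₁ z ≫ ext L en₃ w) ⊗≫ 𝟙 _ := by
      rw [← h₂]; bicategory
    _ = _ := by
      rw [← whisker_exchange]
      have hE : ext₂ L en₀ (extStar L eq es em₁ em₀ v w).hom =
          ext₂ L en₀ (tailComp (L.pull f) v (ext L es w) (chiTo L em₀ t)).hom ≫
          ext₂ L en₀ ((L.pull f).map v ◁ (extExt L eq es em₁ em₀ w).hom) ≫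
          ext₂ L en₀ (α_ _ _ _).inv := by
        simp only [extStar, Iso.trans_hom, ext₂_comp, whiskerLeftIso_hom, Iso.symm_hom]
      have hB : (extExt L ep eq el₁ el₀ v).hom =
        ((L.pull k).mapComp ((L.pull f).map v) (chiTo L eq z)).hom ▷ chiTo L el₀ z ⊗≫
        (L.pull k).map ((L.pull f).map v) ◁ (omegaTet L ep eq el₁ el₀ z).hom ⊗≫
        (chiToNat L ep v).hom ▷ chiTo L el₁ z ⊗≫ 𝟙 _ := by
        simp only [extExt, tailComp, Iso.trans_hom, whiskerLeftIso_hom, whiskerRightIso_hom,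
          Iso.symm_hom]
        bicategory
      rw [hE, hB]
      simp only [extStar, Iso.trans_hom, whiskerLeftIso_hom, Iso.symm_hom, Category.assoc]
      congr 4
      bicategory

/-- The last 1-cell `u` enters only through `tailComp`, since it is mapped by `k^*` alone and is not
extended further; `extExt_extStar` does the work on the remaining factors. -/
theorem extStar_pentagon {x : L.fib b} {y : L.fib c} {z : L.fib d} {t : L.fib e}
    (u : x ⟶ (L.pull f).obj y) (v : y ⟶ (L.pull g).obj z) (w : z ⟶ (L.pull h).obj t) :
    (extStar L ep em₀ en₄ en₀ u (v ≫ ext L es w)).hom ≫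
        ext L ep u ◁ (extStar L el₁ es en₃ en₄ v w).hom =
      ext₂ L en₀ (u ◁ (extStar L eq es em₁ em₀ v w).hom ≫ (α_ _ _ _).inv) ≫
        (extStar L el₀ em₁ en₃ en₀ (u ≫ ext L eq v) w).hom ≫
        (extStar L ep eq el₁ el₀ u v).hom ▷ ext L en₃ w ≫ (α_ _ _ _).hom := by
  have hs := extExt_extStar L ep eq es em₀ em₁ el₀ el₁ en₀ en₃ en₄ v w
  have h₁ := tailComp_natural_right (L.pull k) u
    (extStar L eq es em₁ em₀ v w).hom (chiTo L en₀ t)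
  have h₂ := tailComp_assoc (L.pull k) u (ext L eq v) (ext L em₁ w) (chiTo L en₀ t)
  calc
    _ = (tailComp (L.pull k) u (ext L em₀ (v ≫ ext L es w)) (chiTo L en₀ t)).hom ≫
        (L.pull k).map u ◁ ((extExt L ep em₀ en₄ en₀ (v ≫ ext L es w)).hom ≫
        chiTo L ep y ◁ (extStar L el₁ es en₃ en₄ v w).hom) ⊗≫ 𝟙 _ := by
      rw [extStar_hom L ep em₀]
      bicategory
    _ = ((tailComp (L.pull k) u (ext L em₀ (v ≫ ext L es w)) (chiTo L en₀ t)).hom ≫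
        (L.pull k).map u ◁ ext₂ L en₀ (extStar L eq es em₁ em₀ v w).hom) ≫
        (L.pull k).map u ◁ ((extStar L el₀ em₁ en₃ en₀ (ext L eq v) w).hom ≫
          (extExt L ep eq el₁ el₀ v).hom ▷ ext L en₃ w ≫ (α_ _ _ _).hom) ⊗≫ 𝟙 _ := by
      rw [hs]; bicategory
    _ = ext₂ L en₀ (u ◁ (extStar L eq es em₁ em₀ v w).hom) ≫
        ((tailComp (L.pull k) u (ext L eq v ≫ ext L em₁ w) (chiTo L en₀ t)).hom ≫
        (L.pull k).map u ◁ (tailComp (L.pull k) (ext L eq v) (ext L em₁ w)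
          (chiTo L en₀ t)).hom ≫ (α_ _ _ _).inv) ≫
        (_ ≫ _) ◁ (extExt L el₀ em₁ en₃ en₀ w).hom ⊗≫
        (L.pull k).map u ◁ ((extExt L ep eq el₁ el₀ v).hom ▷ ext L en₃ w) ⊗≫ 𝟙 _ := by
      rw [← h₁]
      rw [extStar_hom L el₀]
      bicategory
    _ = ext₂ L en₀ (u ◁ (extStar L eq es em₁ em₀ v w).hom) ≫
        ext₂ L en₀ (α_ _ _ _).inv ≫
        (tailComp (L.pull k) (u ≫ ext L eq v) (ext L em₁ w) (chiTo L en₀ t)).hom ≫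
        (((L.pull k).mapComp u (ext L eq v)).hom ▷ _ ≫
        (_ ≫ _) ◁ (extExt L el₀ em₁ en₃ en₀ w).hom) ⊗≫
        (L.pull k).map u ◁ ((extExt L ep eq el₁ el₀ v).hom ▷ ext L en₃ w) ⊗≫ 𝟙 _ := by
      rw [← h₂]; bicategory
    _ = _ := by
      rw [← whisker_exchange, ext₂_comp]
      simp only [extStar, tailComp, Iso.trans_hom, whiskerLeftIso_hom, whiskerRightIso_hom,
        Iso.symm_hom, Category.assoc]
      congr 2
      bicategory

/-- The associativity constraint of the Grothendieck construction on fibre parts. -/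
def starAssoc {x : L.fib b} {y : L.fib c} {z : L.fib d} {t : L.fib e}
    (u : x ⟶ (L.pull f).obj y) (v : y ⟶ (L.pull g).obj z) (w : z ⟶ (L.pull h).obj t) :
    star L em₁ (star L eq u v) w ≅ star L em₀ u (star L es v w) :=
  Iso.refl (star L em₁ (star L eq u v) w) ≪⊗≫
    whiskerLeftIso u (extComp L eq es em₁ em₀ v w).symm ≪⊗≫ Iso.refl (star L em₀ u (star L es v w))

/-- The central coherence of the construction. For `k = 0_a` it is the associativity condition of K;
inverted and whiskered with a 1-cell into `k^* x` it is the pentagon of the Grothendieck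
construction. -/
theorem extComp_pentagon {x : L.fib b} {y : L.fib c} {z : L.fib d} {t : L.fib e}
    (u : x ⟶ (L.pull f).obj y) (v : y ⟶ (L.pull g).obj z) (w : z ⟶ (L.pull h).obj t) :
    ext₂ L en₀ (starAssoc L eq es em₀ em₁ u v w).hom ≫
        (extComp L ep em₀ en₄ en₀ u (star L es v w)).hom ≫
        ext L ep u ◁ (extComp L el₁ es en₃ en₄ v w).hom =
      (extComp L el₀ em₁ en₃ en₀ (star L eq u v) w).hom ≫
        (extComp L ep eq el₁ el₀ u v).hom ▷ ext L en₃ w ≫ (α_ _ _ _).hom := by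
  have hp := extStar_pentagon L ep eq es em₀ em₁ el₀ el₁ en₀ en₃ en₄ u v w
  have h₁ := extStar_natural L ep em₀ en₄ en₀ (𝟙 u) (α_ v ((L.pull g).map w) (chiTo L es t)).hom
  have h₂ := extStar_natural L el₀ em₁ en₃ en₀ (α_ u ((L.pull f).map v) (chiTo L eq z)).hom (𝟙 w)
  simp only [ext₂_id, id_whiskerRight, Bicategory.whiskerLeft_id, Category.id_comp,
    Category.comp_id] at h₁ h₂
  -- By definition `starAssoc` is the inverse of `extComp` whiskered with `u`, so up to associators
  -- the two cancel.
  have h₃ : (starAssoc L eq es em₀ em₁ u v w).hom ≫ (α_ _ _ _).hom ≫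
      u ◁ ext₂ L em₀ (α_ v ((L.pull g).map w) (chiTo L es t)).hom ≫
      u ◁ (extStar L eq es em₁ em₀ v w).hom ≫ (α_ _ _ _).inv =
      (α_ _ _ _).hom ≫ (α_ u ((L.pull f).map v) (chiTo L eq z)).hom ▷ ext L em₁ w := by
    have h₄ : (starAssoc L eq es em₀ em₁ u v w).hom = 𝟙 _ ⊗≫
      u ◁ (extComp L eq es em₁ em₀ v w).inv ⊗≫ 𝟙 _ := by
      simp only [starAssoc, bicategoricalIsoComp, Iso.trans_hom, Iso.refl_hom, Iso.symm_hom,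
        whiskerLeftIso_hom]
      bicategory
    calc
      _ = (starAssoc L eq es em₀ em₁ u v w).hom ≫ (α_ _ _ _).hom ≫
        u ◁ (extComp L eq es em₁ em₀ v w).hom ≫ (α_ _ _ _).inv := by
        rw [extComp_eq L eq]; simp only [Bicategory.whiskerLeft_comp, Category.assoc]
      _ = 𝟙 _ ⊗≫ u ◁ ((extComp L eq es em₁ em₀ v w).inv ≫ (extComp L eq es em₁ em₀ v w).hom) ⊗≫
        𝟙 _ := by
        rw [h₄]; bicategory
      _ = _ := by rw [Iso.inv_hom_id]; bicategory
  calc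
    _ = ext₂ L en₀ (starAssoc L eq es em₀ em₁ u v w).hom ≫ ext₂ L en₀ (α_ _ _ _).hom ≫
        ((extStar L ep em₀ en₄ en₀ u (star L es v w)).hom ≫
        ext L ep u ◁ ext₂ L en₄ (α_ v ((L.pull g).map w) (chiTo L es t)).hom) ≫
        ext L ep u ◁ (extStar L el₁ es en₃ en₄ v w).hom := by
      rw [extComp_eq L ep, extComp_eq L el₁]
      simp only [Bicategory.whiskerLeft_comp, Category.assoc]
    _ = ext₂ L en₀ ((starAssoc L eq es em₀ em₁ u v w).hom ≫ (α_ _ _ _).hom ≫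
        u ◁ ext₂ L em₀ (α_ v ((L.pull g).map w) (chiTo L es t)).hom ≫
        u ◁ (extStar L eq es em₁ em₀ v w).hom ≫ (α_ _ _ _).inv) ≫
        (extStar L el₀ em₁ en₃ en₀ (u ≫ ext L eq v) w).hom ≫
        (extStar L ep eq el₁ el₀ u v).hom ▷ ext L en₃ w ≫ (α_ _ _ _).hom := by
      rw [← h₁, Category.assoc, hp]
      simp only [ext₂_comp, Category.assoc]
    _ = _ := by
      rw [h₃, ext₂_comp, Category.assoc, reassoc_of% h₂, extComp_eq L el₀, extComp_eq L ep eq,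
        comp_whiskerRight]
      simp only [Category.assoc]

end

end Simplices
end LaxBidiagrams

/-! ### Units and the constraints on fibre parts -/

namespace LaxBidiagrams

section Tail

variable {B : Type u₁} [Bicategory.{w₁, v₁} B] {C : Type u₂} [Bicategory.{w₂, v₂} C]

theorem tailComp_unit (F : B ⥤ᵖ C) {x y : B} (v : x ⟶ y) {t : C} (c : F.obj y ⟶ t) :
    (tailComp F v (𝟙 y) c).hom ≫ F.map v ◁ ((F.mapId y).hom ▷ c ≫ (λ_ c).hom) =
      F.map₂ (ρ_ v).hom ▷ c := by
  rw [F.map₂_right_unitor]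
  simp only [tailComp, Iso.trans_hom, whiskerRightIso_hom]
  bicategory

end Tail

section Simplices

open LaxBidiagramCore LaxBidiagramData

variable {C : Type u₁} [Category.{v₁} C]
  (L : LaxBidiagram.{v₁, w₂, v₁, v₂, u₁, u₂} (LocallyDiscrete C))

theorem star₂_id_left {b c d : LocallyDiscrete C} {f : b ⟶ c} {g : c ⟶ d} {q : b ⟶ d}
    (e : f ≫ g = q) {x : L.fib b} {y : L.fib c} {z : L.fib d} (u : x ⟶ (L.pull f).obj y)
    {v v' : y ⟶ (L.pull g).obj z} (ψ : v ⟶ v') :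
    star₂ L e (𝟙 u) ψ = (u ◁ (L.pull f).map₂ ψ) ▷ chiTo L e z := by
  simp [star₂]

theorem star₂_id_right {b c d : LocallyDiscrete C} {f : b ⟶ c} {g : c ⟶ d} {q : b ⟶ d}
    (e : f ≫ g = q) {x : L.fib b} {y : L.fib c} {z : L.fib d} {u u' : x ⟶ (L.pull f).obj y}
    (φ : u ⟶ u') (v : y ⟶ (L.pull g).obj z) :
    star₂ L e φ (𝟙 v) = (φ ▷ (L.pull f).map v) ▷ chiTo L e z := by
  simp [star₂]

section

variable {b c : LocallyDiscrete C} {g : b ⟶ c} (e : 𝟙 b ≫ g = g)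

/-- Precomposition of an extension with the unit. -/
def unitExt {y : L.fib b} {z : L.fib c} (v : y ⟶ (L.pull g).obj z) :
    L.unitApp b y ≫ ext L e v ≅ v :=
  (α_ _ _ _).symm ≪≫ whiskerRightIso (L.unitNat b v).symm (chiTo L e z) ≪≫ α_ _ _ _ ≪≫
    whiskerLeftIso v (deltaTri L e z) ≪≫ ρ_ v

theorem unitExt_natural {y : L.fib b} {z : L.fib c} {v v' : y ⟶ (L.pull g).obj z} (φ : v ⟶ v') :
    L.unitApp b y ◁ ext₂ L e φ ≫ (unitExt L e v').hom = (unitExt L e v).hom ≫ φ := by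
  have h : φ ▷ L.unitApp b _ ≫ (L.unitNat b v').hom =
      (L.unitNat b v).hom ≫ L.unitApp b y ◁ (L.pull (𝟙 b)).map₂ φ :=
    (L.unit b).naturality_naturality φ
  rw [← Iso.inv_comp_eq, ← Category.assoc, ← Iso.eq_comp_inv] at h
  calc
    _ = 𝟙 _ ⊗≫ (L.unitApp b y ◁ (L.pull (𝟙 b)).map₂ φ ≫ (L.unitNat b v').inv) ▷ chiTo L e z ⊗≫
        v' ◁ (deltaTri L e z).hom ⊗≫ 𝟙 _ := by
      simp only [unitExt, Iso.trans_hom, whiskerRightIso_hom, whiskerLeftIso_hom, Iso.symm_hom]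
      bicategory
    _ = 𝟙 _ ⊗≫ (L.unitNat b v).inv ▷ chiTo L e z ⊗≫
        (φ ▷ (L.unitApp b _ ≫ chiTo L e z) ≫ v' ◁ (deltaTri L e z).hom) ⊗≫ 𝟙 _ := by
      rw [← h]; bicategory
    _ = _ := by
      rw [← whisker_exchange]
      simp only [unitExt, Iso.trans_hom, whiskerRightIso_hom, whiskerLeftIso_hom, Iso.symm_hom]
      bicategory

-- Naturality of γ moves `v` out of the way of the unit. What is left over χ is the triangle for ω,
-- γ and δ, and its δ is the one from which `unitExt` is built.
set_option maxHeartbeats 1000000 in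
theorem extStar_unit {a : LocallyDiscrete C} {k : a ⟶ b} {r : a ⟶ c} (ek : k ≫ 𝟙 b = k)
    (e' : k ≫ g = r) {y : L.fib b} {z : L.fib c} (v : y ⟶ (L.pull g).obj z) :
    (extStar L ek e e' e' (L.unitApp b y) v).hom ≫ (gammaTri L ek y).hom ▷ ext L e' v ≫
        (λ_ (ext L e' v)).hom = ext₂ L e' (unitExt L e v).hom := by
  have hg := gammaTri_natural L ek v
  unfold SqCompat at hg
  have ht := omegaTet_triangle L ek e e' z
  have h₁ := tailComp_assoc (L.pull k) (L.unitApp b y) ((L.pull (𝟙 b)).map v) (chiTo L e z)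
    (chiTo L e' z)
  have h₂ := tailComp_natural_left (L.pull k) (L.unitNat b v).inv (chiTo L e z) (chiTo L e' z)
  have h₃ := tailComp_assoc_hom (L.pull k) v (L.unitApp b ((L.pull g).obj z)) (chiTo L e z)
    (chiTo L e' z)
  have h₄ := tailComp_natural_right (L.pull k) v (deltaTri L e z).hom (chiTo L e' z)
  have h₅ := tailComp_unit (L.pull k) v (chiTo L e' z)
  -- The naturality of γ, solved for its part without the naturality cell of the unit.
  have hg' : (L.pull k).map (L.unitApp b y) ◁ (chiToNat L ek v).hom ≫ (α_ _ _ _).inv ≫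
      (gammaTri L ek y).hom ▷ (L.pull k).map v = (α_ _ _ _).inv ≫
      (((L.pull k).mapComp (L.unitApp b y) ((L.pull (𝟙 b)).map v)).inv ≫
        (L.pull k).map₂ (L.unitNat b v).inv ≫ ((L.pull k).mapComp v _).hom) ▷ chiTo L ek _ ≫
      (α_ _ _ _).hom ≫ (L.pull k).map v ◁ (gammaTri L ek _).hom ≫ (ρ_ _).hom ≫ (λ_ _).inv := by
    have hi : (((L.pull k).mapComp (L.unitApp b y) ((L.pull (𝟙 b)).map v)).inv ≫
        (L.pull k).map₂ (L.unitNat b v).inv ≫ ((L.pull k).mapComp v _).hom) =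
        (sqMap (L.pull k) (L.unitNat b v)).inv := by
      simp [sqMap]
    have hj : (sqId ((L.pull k).map v)).hom = (ρ_ _).hom ≫ (λ_ _).inv := rfl
    rw [hi]
    rw [hj] at hg
    rw [hg]
    calc
      _ = (α_ _ _ _).inv ≫ ((sqMap (L.pull k) (L.unitNat b v)).inv ≫
          (sqMap (L.pull k) (L.unitNat b v)).hom) ▷ chiTo L ek _ ≫ (α_ _ _ _).hom ≫
          (L.pull k).map (L.unitApp b y) ◁ (chiToNat L ek v).hom ≫ (α_ _ _ _).inv ≫
          (gammaTri L ek y).hom ▷ (L.pull k).map v := by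
        rw [Iso.inv_hom_id]; bicategory
      _ = _ := by
        simp only [sqComp, Iso.trans_hom, whiskerLeftIso_hom, whiskerRightIso_hom, Iso.symm_hom]
        bicategory
  calc
    _ = ((tailComp (L.pull k) (L.unitApp b y) (ext L e v) (chiTo L e' z)).hom ≫
        (L.pull k).map (L.unitApp b y) ◁ (tailComp (L.pull k) ((L.pull (𝟙 b)).map v)
          (chiTo L e z) (chiTo L e' z)).hom ≫ (α_ _ _ _).inv) ≫
        (_ ≫ _) ◁ (omegaTet L ek e e' e' z).hom ⊗≫
        ((L.pull k).map (L.unitApp b y) ◁ (chiToNat L ek v).hom ≫ (α_ _ _ _).inv ≫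
        (gammaTri L ek y).hom ▷ (L.pull k).map v) ▷ chiTo L e' z ⊗≫ 𝟙 _ := by
      simp only [extStar, extExt, Iso.trans_hom, whiskerLeftIso_hom, whiskerRightIso_hom,
        Iso.symm_hom]
      bicategory
    _ = ext₂ L e' (α_ _ _ _).inv ≫
        (tailComp (L.pull k) (L.unitApp b y ≫ (L.pull (𝟙 b)).map v) (chiTo L e z)
          (chiTo L e' z)).hom ≫
        ((L.pull k).mapComp (L.unitApp b y) ((L.pull (𝟙 b)).map v)).hom ▷ (_ ≫ _) ≫
        ((_ ≫ _) ◁ (omegaTet L ek e e' e' z).hom ≫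
        ((((L.pull k).mapComp (L.unitApp b y) ((L.pull (𝟙 b)).map v)).inv ≫
        (L.pull k).map₂ (L.unitNat b v).inv) ≫ ((L.pull k).mapComp v _).hom) ▷
          (chiTo L ek _ ≫ chiTo L e' z)) ⊗≫
        (L.pull k).map v ◁ (gammaTri L ek _).hom ▷ chiTo L e' z ⊗≫ 𝟙 _ := by
      rw [← h₁, hg']; bicategory
    _ = ext₂ L e' (α_ _ _ _).inv ≫
        (tailComp (L.pull k) (L.unitApp b y ≫ (L.pull (𝟙 b)).map v) (chiTo L e z)
          (chiTo L e' z)).hom ≫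
        (((L.pull k).mapComp (L.unitApp b y) ((L.pull (𝟙 b)).map v)).hom ≫
        ((L.pull k).mapComp (L.unitApp b y) ((L.pull (𝟙 b)).map v)).inv) ▷ (_ ≫ _) ≫
        (L.pull k).map₂ (L.unitNat b v).inv ▷ (_ ≫ _) ≫ ((L.pull k).mapComp v _).hom ▷ (_ ≫ _) ⊗≫
        (L.pull k).map v ◁ ((L.pull k).map (L.unitApp b _) ◁ (omegaTet L ek e e' e' z).hom ⊗≫
        (gammaTri L ek _).hom ▷ chiTo L e' z ⊗≫ 𝟙 (chiTo L e' z)) := by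
      rw [whisker_exchange]; bicategory
    _ = ext₂ L e' (α_ _ _ _).inv ≫
        ((tailComp (L.pull k) (L.unitApp b y ≫ (L.pull (𝟙 b)).map v) (chiTo L e z)
          (chiTo L e' z)).hom ≫
        (L.pull k).map₂ (L.unitNat b v).inv ▷ (_ ≫ _)) ≫ ((L.pull k).mapComp v _).hom ▷ (_ ≫ _) ≫
        (α_ _ _ _).hom ⊗≫
        (L.pull k).map v ◁ (((L.pull k).mapComp (L.unitApp b ((L.pull g).obj z))
          (chiTo L e z)).inv ≫ (L.pull k).map₂ (deltaTri L e z).hom ≫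
          ((L.pull k).mapId ((L.pull g).obj z)).hom) ▷ chiTo L e' z ⊗≫ 𝟙 _ := by
      rw [Iso.hom_inv_id, ht]; bicategory
    _ = ext₂ L e' (α_ _ _ _).inv ≫ ext₂ L e' ((L.unitNat b v).inv ▷ chiTo L e z) ≫
        ((tailComp (L.pull k) (v ≫ L.unitApp b _) (chiTo L e z) (chiTo L e' z)).hom ≫
        ((L.pull k).mapComp v _).hom ▷ (_ ≫ _) ≫ (α_ _ _ _).hom) ⊗≫
        (L.pull k).map v ◁ (((L.pull k).mapComp (L.unitApp b ((L.pull g).obj z))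
          (chiTo L e z)).inv ≫ (L.pull k).map₂ (deltaTri L e z).hom ≫
          ((L.pull k).mapId ((L.pull g).obj z)).hom) ▷ chiTo L e' z ⊗≫ 𝟙 _ := by
      rw [← h₂]; bicategory
    _ = ext₂ L e' (α_ _ _ _).inv ≫ ext₂ L e' ((L.unitNat b v).inv ▷ chiTo L e z) ≫
        ext₂ L e' (α_ _ _ _).hom ≫
        (tailComp (L.pull k) v (L.unitApp b _ ≫ chiTo L e z) (chiTo L e' z)).hom ≫
        (L.pull k).map v ◁ ((((L.pull k).mapComp (L.unitApp b ((L.pull g).obj z))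
          (chiTo L e z)).hom ≫ ((L.pull k).mapComp (L.unitApp b ((L.pull g).obj z))
          (chiTo L e z)).inv) ≫ (L.pull k).map₂ (deltaTri L e z).hom ≫
          ((L.pull k).mapId ((L.pull g).obj z)).hom) ▷ chiTo L e' z ⊗≫ 𝟙 _ := by
      rw [← h₃]
      have h₆ : (tailComp (L.pull k) (L.unitApp b ((L.pull g).obj z)) (chiTo L e z)
          (chiTo L e' z)).hom = ((L.pull k).mapComp (L.unitApp b ((L.pull g).obj z))
          (chiTo L e z)).hom ▷ chiTo L e' z ≫ (α_ _ _ _).hom := rfl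
      rw [h₆]; bicategory
    _ = ext₂ L e' (α_ _ _ _).inv ≫ ext₂ L e' ((L.unitNat b v).inv ▷ chiTo L e z) ≫
        ext₂ L e' (α_ _ _ _).hom ≫
        ((tailComp (L.pull k) v (L.unitApp b _ ≫ chiTo L e z) (chiTo L e' z)).hom ≫
        (L.pull k).map v ◁ (L.pull k).map₂ (deltaTri L e z).hom ▷ chiTo L e' z) ≫
        (L.pull k).map v ◁ (((L.pull k).mapId _).hom ▷ chiTo L e' z ≫ (λ_ _).hom) := by
      rw [Iso.hom_inv_id]; bicategory
    _ = _ := by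
      rw [← h₄, Category.assoc, h₅]
      simp only [unitExt, Iso.trans_hom, ext₂_comp, Iso.symm_hom, whiskerRightIso_hom,
        whiskerLeftIso_hom]

end

section

variable {b c d e : LocallyDiscrete C} {f : b ⟶ c} {g : c ⟶ d} {h : d ⟶ e}
  {q : b ⟶ d} {s : c ⟶ e} {m : b ⟶ e}
  (eq : f ≫ g = q) (es : g ≫ h = s) (em₀ : f ≫ s = m) (em₁ : q ≫ h = m)

theorem starAssoc_hom {x : L.fib b} {y : L.fib c} {z : L.fib d} {t : L.fib e}
    (u : x ⟶ (L.pull f).obj y) (v : y ⟶ (L.pull g).obj z) (w : z ⟶ (L.pull h).obj t) :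
    (starAssoc L eq es em₀ em₁ u v w).hom = 𝟙 _ ⊗≫
      u ◁ (extComp L eq es em₁ em₀ v w).inv ⊗≫ 𝟙 _ := by
  simp only [starAssoc, bicategoricalIsoComp, Iso.trans_hom, Iso.refl_hom, Iso.symm_hom,
    whiskerLeftIso_hom]
  bicategory

theorem extComp_inv_natural {x : L.fib c} {y : L.fib d} {z : L.fib e}
    {u u' : x ⟶ (L.pull g).obj y}
    {v v' : y ⟶ (L.pull h).obj z} (φ : u ⟶ u') (ψ : v ⟶ v') :
    (extComp L eq es em₁ em₀ u v).inv ≫ ext₂ L em₀ (star₂ L es φ ψ) =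
      (ext₂ L eq φ ▷ ext L em₁ v ≫ ext L eq u' ◁ ext₂ L em₁ ψ) ≫
        (extComp L eq es em₁ em₀ u' v').inv := by
  rw [Iso.inv_comp_eq, ← Category.assoc, Iso.eq_comp_inv]
  exact extComp_natural L eq es em₁ em₀ φ ψ

theorem starAssoc_natural {x : L.fib b} {y : L.fib c} {z : L.fib d} {t : L.fib e}
    {u u' : x ⟶ (L.pull f).obj y} {v v' : y ⟶ (L.pull g).obj z} {w w' : z ⟶ (L.pull h).obj t}
    (φ : u ⟶ u') (ψ : v ⟶ v') (θ : w ⟶ w') :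
    star₂ L em₁ (star₂ L eq φ ψ) θ ≫ (starAssoc L eq es em₀ em₁ u' v' w').hom =
      (starAssoc L eq es em₀ em₁ u v w).hom ≫ star₂ L em₀ φ (star₂ L es ψ θ) := by
  have hn := extComp_inv_natural L eq es em₀ em₁ ψ θ
  calc
    _ = 𝟙 _ ⊗≫ φ ▷ (ext L eq v ≫ ext L em₁ w) ⊗≫
        u' ◁ ((ext₂ L eq ψ ▷ ext L em₁ w ≫ ext L eq v' ◁ ext₂ L em₁ θ) ≫
          (extComp L eq es em₁ em₀ v' w').inv) ⊗≫ 𝟙 _ := by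
      rw [starAssoc_hom]; bicategory
    _ = 𝟙 _ ⊗≫ (φ ▷ (ext L eq v ≫ ext L em₁ w) ≫
        u' ◁ (extComp L eq es em₁ em₀ v w).inv) ⊗≫ u' ◁ ext₂ L em₀ (star₂ L es ψ θ) ⊗≫ 𝟙 _ := by
      rw [← hn]; bicategory
    _ = _ := by
      rw [← whisker_exchange, starAssoc_hom]; bicategory

end

/-- Each associativity constraint is an inverse of `extComp` behind a 1-cell, so this is
`extComp_pentagon` with all comparison cells inverted, whiskered with `u₀`. -/
theorem starAssoc_pentagon {a b c d e : LocallyDiscrete C} {k : a ⟶ b} {f : b ⟶ c} {g : c ⟶ d}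
    {h : d ⟶ e} {p : a ⟶ c} {q : b ⟶ d} {s : c ⟶ e} {m : b ⟶ e} {l : a ⟶ d} {n : a ⟶ e}
    (ep : k ≫ f = p) (eq : f ≫ g = q) (es : g ≫ h = s) (em₀ : f ≫ s = m) (em₁ : q ≫ h = m)
    (el₀ : k ≫ q = l) (el₁ : p ≫ g = l) (en₀ : k ≫ m = n) (en₃ : l ≫ h = n) (en₄ : p ≫ s = n)
    {x₀ : L.fib a} {x : L.fib b} {y : L.fib c} {z : L.fib d} {t : L.fib e}
    (u₀ : x₀ ⟶ (L.pull k).obj x)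
    (u : x ⟶ (L.pull f).obj y) (v : y ⟶ (L.pull g).obj z) (w : z ⟶ (L.pull h).obj t) :
    star₂ L en₃ (starAssoc L ep eq el₀ el₁ u₀ u v).hom (𝟙 w) ≫
        (starAssoc L el₀ em₁ en₀ en₃ u₀ (star L eq u v) w).hom ≫
        star₂ L en₀ (𝟙 u₀) (starAssoc L eq es em₀ em₁ u v w).hom =
      (starAssoc L el₁ es en₄ en₃ (star L ep u₀ u) v w).hom ≫
        (starAssoc L ep em₀ en₀ en₄ u₀ u (star L es v w)).hom := by
  have hp := extComp_pentagon L ep eq es em₀ em₁ el₀ el₁ en₀ en₃ en₄ u v w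
  -- `extComp_pentagon` with the four comparison cells moved to the opposite sides.
  have hq : (extComp L ep eq el₁ el₀ u v).inv ▷ ext L en₃ w ≫
      (extComp L el₀ em₁ en₃ en₀ (star L eq u v) w).inv ≫
      ext₂ L en₀ (starAssoc L eq es em₀ em₁ u v w).hom = (α_ _ _ _).hom ≫
      ext L ep u ◁ (extComp L el₁ es en₃ en₄ v w).inv ≫
      (extComp L ep em₀ en₄ en₀ u (star L es v w)).inv := by
    rw [← cancel_mono (extComp L ep em₀ en₄ en₀ u (star L es v w)).hom,
      ← cancel_mono (ext L ep u ◁ (extComp L el₁ es en₃ en₄ v w).hom)]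
    simp only [Category.assoc, hp, Iso.inv_hom_id_assoc]
    rw [← comp_whiskerRight_assoc, Iso.inv_hom_id, ← Bicategory.whiskerLeft_comp, Iso.inv_hom_id]
    simp
  calc
    _ = 𝟙 _ ⊗≫ u₀ ◁ ((extComp L ep eq el₁ el₀ u v).inv ▷ ext L en₃ w ≫
      (extComp L el₀ em₁ en₃ en₀ (star L eq u v) w).inv ≫
      ext₂ L en₀ (starAssoc L eq es em₀ em₁ u v w).hom) ⊗≫ 𝟙 _ := by
      rw [starAssoc_hom L ep eq, starAssoc_hom L el₀, star₂_id_right, star₂_id_left]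
      bicategory
    _ = _ := by
      rw [hq, starAssoc_hom, starAssoc_hom]; bicategory

/-- The left unit constraint on fibre parts. -/
def starLeft {b c : LocallyDiscrete C} {g : b ⟶ c} (e : 𝟙 b ≫ g = g) {y : L.fib b} {z : L.fib c}
    (v : y ⟶ (L.pull g).obj z) : star L e (L.unitApp b y) v ≅ v :=
  α_ _ _ _ ≪≫ unitExt L e v

/-- The right unit constraint on fibre parts. -/
def starRight {a b : LocallyDiscrete C} {k : a ⟶ b} (e : k ≫ 𝟙 b = k) {x : L.fib a} {y : L.fib b}
    (u : x ⟶ (L.pull k).obj y) : star L e u (L.unitApp b y) ≅ u :=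
  α_ _ _ _ ≪≫ whiskerLeftIso u (gammaTri L e y) ≪≫ ρ_ u

theorem starLeft_natural {b c : LocallyDiscrete C} {g : b ⟶ c} (e : 𝟙 b ≫ g = g) {y : L.fib b}
    {z : L.fib c} {v v' : y ⟶ (L.pull g).obj z} (φ : v ⟶ v') :
    star₂ L e (𝟙 (L.unitApp b y)) φ ≫ (starLeft L e v').hom = (starLeft L e v).hom ≫ φ := by
  rw [starLeft, Iso.trans_hom, starLeft, Iso.trans_hom, Category.assoc, ← unitExt_natural]
  simp

theorem starRight_natural {a b : LocallyDiscrete C} {k : a ⟶ b} (e : k ≫ 𝟙 b = k) {x : L.fib a}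
    {y : L.fib b} {u u' : x ⟶ (L.pull k).obj y} (φ : u ⟶ u') :
    star₂ L e φ (𝟙 (L.unitApp b y)) ≫ (starRight L e u').hom = (starRight L e u).hom ≫ φ := by
  calc
    _ = (α_ _ _ _).hom ≫ (φ ▷ (_ ≫ _) ≫ u' ◁ (gammaTri L e y).hom) ≫ (ρ_ _).hom := by
      simp [starRight]
    _ = _ := by rw [← whisker_exchange]; simp [starRight]

/-- This serves both for the triangle of the Grothendieck construction and, with `k = 0_a`, for the
left unit condition of K. -/
theorem extComp_unit {a b c : LocallyDiscrete C} {g : b ⟶ c} (e : 𝟙 b ≫ g = g)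
    {k : a ⟶ b} {r : a ⟶ c} (ek : k ≫ 𝟙 b = k)
    (e' : k ≫ g = r) {y : L.fib b} {z : L.fib c} (v : y ⟶ (L.pull g).obj z) :
    (extComp L ek e e' e' (L.unitApp b y) v).hom ≫ (gammaTri L ek y).hom ▷ ext L e' v ≫
        (λ_ (ext L e' v)).hom = ext₂ L e' (starLeft L e v).hom := by
  rw [extComp_eq, Category.assoc, extStar_unit, ← ext₂_comp]
  rfl

theorem starAssoc_triangle {a b c : LocallyDiscrete C} {g : b ⟶ c} (e : 𝟙 b ≫ g = g)
    {k : a ⟶ b} {r : a ⟶ c} (ek : k ≫ 𝟙 b = k)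
    (e' : k ≫ g = r) {x : L.fib a} {y : L.fib b} {z : L.fib c} (u : x ⟶ (L.pull k).obj y)
    (v : y ⟶ (L.pull g).obj z) :
    (starAssoc L ek e e' e' u (L.unitApp b y) v).hom ≫ star₂ L e' (𝟙 u) (starLeft L e v).hom =
      star₂ L e' (starRight L ek u).hom (𝟙 v) := by
  have h := extComp_unit L e ek e' v
  calc
    _ = 𝟙 _ ⊗≫ u ◁ ((extComp L ek e e' e' (L.unitApp b y) v).inv ≫
        ext₂ L e' (starLeft L e v).hom) ⊗≫ 𝟙 _ := by
      rw [starAssoc_hom, star₂_id_left]; bicategory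
    _ = _ := by
      rw [← h, Iso.inv_hom_id_assoc, star₂_id_right]
      simp only [starRight, Iso.trans_hom, whiskerLeftIso_hom]
      bicategory

end Simplices
end LaxBidiagrams

/-! ### 2-cells over identities, and the constraints in terms of them -/

namespace LaxBidiagrams

section Vertical

open LaxBidiagramCore LaxBidiagramData

variable {C : Type u₁} [Category.{v₁} C]
  {L : LaxBidiagram.{v₁, w₂, v₁, v₂, u₁, u₂} (LocallyDiscrete C)}

namespace Groth

/-- The 1-cell with the given components. -/
abbrev mk₁ (X Y : Groth L) (f : X.base ⟶ Y.base) (u : X.fiber ⟶ (L.pull f).obj Y.fiber) : X ⟶ Y :=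
  Hom.mk f u

/-- A 2-cell over an identity of the base. -/
def vert {X Y : Groth L} {f : X.base ⟶ Y.base} {u u' : X.fiber ⟶ (L.pull f).obj Y.fiber}
    (φ : u ⟶ u') : (mk₁ X Y f u) ⟶ mk₁ X Y f u' :=
  Hom₂.mk (𝟙 f) (u ◁ (L.xiId f Y.fiber).inv ≫ (ρ_ u).hom ≫ φ)

theorem vert_id {X Y : Groth L} {f : X.base ⟶ Y.base} (u : X.fiber ⟶ (L.pull f).obj Y.fiber) :
    vert (𝟙 u) = 𝟙 (mk₁ X Y f u) := by
  refine Hom₂.ext rfl ?_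
  simp only [vert, Category.comp_id]
  rfl

/-- The unit condition `xi_id_left` absorbs the identity of the base, so precomposing with a 2-cell
over an identity only changes the fibre part. -/
theorem vert_vcomp {X Y : Groth L} {f : X.base ⟶ Y.base}
    {u u' : X.fiber ⟶ (L.pull f).obj Y.fiber} (φ : u ⟶ u') {V : X ⟶ Y}
    (Φ : Hom₂ (mk₁ X Y f u') V) :
    vcomp (vert φ) Φ = ⟨Φ.base, φ ▷ L.cell Φ.base Y.fiber ≫ Φ.fiber⟩ := by
  refine cellEq_fiber (Category.id_comp Φ.base) ?_
  have h := L.coherent.xi_id_left Φ.base Y.fiber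
  have h' : (L.xi (𝟙 f) Φ.base Y.fiber).inv ≫
      (L.xiId f Y.fiber).inv ▷ L.cell Φ.base Y.fiber =
      (L.cellEq (Category.id_comp Φ.base) Y.fiber).hom ≫ (λ_ _).inv := by
    rw [Iso.eq_comp_inv, Category.assoc, ← h]
    simp [xiTri]
  calc
    _ = u ◁ ((L.xi (𝟙 f) Φ.base Y.fiber).inv ≫
          (L.xiId f Y.fiber).inv ▷ L.cell Φ.base Y.fiber) ⊗≫
          φ ▷ L.cell Φ.base Y.fiber ⊗≫ Φ.fiber := by
      simp only [vcomp, vert]; bicategory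
    _ = _ := by rw [h']; bicategory

theorem vert_comp {X Y : Groth L} {f : X.base ⟶ Y.base}
    {u u' u'' : X.fiber ⟶ (L.pull f).obj Y.fiber} (φ : u ⟶ u') (ψ : u' ⟶ u'') :
    vert (φ ≫ ψ) = (vert φ ≫ vert ψ : mk₁ X Y f u ⟶ mk₁ X Y f u'') := by
  refine Eq.trans ?_ (vert_vcomp φ (vert ψ)).symm
  refine Hom₂.ext rfl (heq_of_eq ?_)
  simp only [vert]
  rw [← whisker_exchange_assoc, rightUnitor_naturality_assoc]

/-- 2-cells of the base are unique, so the base part may be replaced by an identity; the fibre part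
is corrected by ξ. -/
theorem eq_vert {X Y : Groth L} {f : X.base ⟶ Y.base}
    {u u' : X.fiber ⟶ (L.pull f).obj Y.fiber}
    (Φ : Hom₂ (mk₁ X Y f u) (mk₁ X Y f u')) : ∃ φ : u ⟶ u', Φ = vert φ := by
  have e : Φ.base = 𝟙 f := Subsingleton.elim _ _
  refine ⟨(ρ_ u).inv ≫ u ◁ ((L.xiId f Y.fiber).hom ≫ (L.cellEq e Y.fiber).inv) ≫ Φ.fiber,
    cellEq_fiber e ?_⟩
  simp [vert]

/-- Every 2-cell lies over an identity of the base. -/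
theorem vert_induction {X Y : Groth L} {motive : ∀ U V : X ⟶ Y, (U ⟶ V) → Prop}
    (h : ∀ (f : X.base ⟶ Y.base) (u u' : X.fiber ⟶ (L.pull f).obj Y.fiber) (φ : u ⟶ u'),
      motive (mk₁ X Y f u) (mk₁ X Y f u') (vert φ)) {U V : X ⟶ Y} (Φ : U ⟶ V) : motive U V Φ := by
  -- With the 1-cells taken apart as pairs, the equality of their base parts can be eliminated.
  have key : ∀ (U V : Hom X Y) (Φ : Hom₂ (X := X) (Y := Y) U V), motive U V Φ := by
    rintro ⟨f, u⟩ ⟨g, v⟩ Φ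
    obtain rfl : f = g := LocallyDiscrete.eq_of_hom Φ.base
    obtain ⟨φ, rfl⟩ := eq_vert Φ
    exact h f u v φ
  exact key U V Φ

/-- All identity cells in the definition of `hcomp` disappear: χ by `chi₂_id_hom`, the cell of `ψ`
inside `f^*` by `map₂_drop`, and the naturality cell of the identity because `xiId` is a
modification. -/
theorem hcomp_vert {X Y Z : Groth L} {f : X.base ⟶ Y.base} {g : Y.base ⟶ Z.base}
    {u u' : X.fiber ⟶ (L.pull f).obj Y.fiber} {v v' : Y.fiber ⟶ (L.pull g).obj Z.fiber}
    (φ : u ⟶ u') (ψ : v ⟶ v') :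
    hcomp (vert φ) (vert ψ) = vert (X := X) (Y := Z) (star₂ L rfl φ ψ) := by
  refine cellEq_fiber (Subsingleton.elim (hcomp₂ (𝟙 f) (𝟙 g)) (𝟙 (f ≫ g))) ?_
  have hd := map₂_drop (L.pull f) v (L.xiId g Z.fiber).symm
  have hn := L.xiId_natural f v'
  unfold SqCompat at hn
  have hs : (sqId ((L.pull f).map v')).hom = (ρ_ _).hom ≫ (λ_ _).inv := rfl
  rw [hs] at hn
  have he : (L.cellEq (Subsingleton.elim (hcomp₂ (𝟙 f) (𝟙 g)) (𝟙 (f ≫ g))) Z.fiber).hom ≫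
      (L.xiId (f ≫ g) Z.fiber).inv = (cellEndo L (hcomp₂ (𝟙 f) (𝟙 g)) Z.fiber).hom := rfl
  calc
    _ = ((u ≫ (L.pull f).map v) ≫ L.chiApp f g Z.fiber) ◁
          (cellEndo L (hcomp₂ (𝟙 f) (𝟙 g)) Z.fiber).hom ⊗≫
        u ◁ (((L.pull f).map v ◁ (((L.pull f).mapId ((L.pull g).obj Z.fiber)).inv ≫
          (L.pull f).map₂ (L.xiId g Z.fiber).hom)) ▷ 𝟙 _ ≫
        ((L.pull f).map v ≫ (L.pull f).map (L.cell (𝟙 g) Z.fiber)) ◁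
          (L.xiId f ((L.pull g).obj Z.fiber)).hom ≫
        (((L.pull f).mapComp v (L.cell (𝟙 g) Z.fiber)).inv ≫ (L.pull f).map₂
          (v ◁ (L.xiId g Z.fiber).inv ≫ (ρ_ v).hom ≫ ψ)) ▷
          L.cell (𝟙 f) ((L.pull g).obj Z.fiber)) ▷ L.chiApp f g Z.fiber ⊗≫
        u ◁ (L.cellNat (𝟙 f) v').hom ▷ L.chiApp f g Z.fiber ⊗≫
        (u ◁ (L.xiId f Y.fiber).inv ≫ (ρ_ u).hom ≫ φ) ▷ ((L.pull f).map v' ≫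
          L.chiApp f g Z.fiber) ⊗≫ 𝟙 _ := by
      change (hcomp (vert φ) (vert ψ)).fiber = _
      simp only [hcomp, vert, chi₂_id_hom]
      bicategory
    _ = ((u ≫ (L.pull f).map v) ≫ L.chiApp f g Z.fiber) ◁
          (cellEndo L (hcomp₂ (𝟙 f) (𝟙 g)) Z.fiber).hom ⊗≫
        u ◁ (((L.pull f).map v ◁ (((L.pull f).mapId ((L.pull g).obj Z.fiber)).inv ≫
          (L.pull f).map₂ (L.xiId g Z.fiber).hom) ≫
        ((L.pull f).mapComp v (L.cell (𝟙 g) Z.fiber)).inv ≫ (L.pull f).map₂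
          (v ◁ (L.xiId g Z.fiber).inv ≫ (ρ_ v).hom)) ≫ (L.pull f).map₂ ψ) ▷
          L.chiApp f g Z.fiber ⊗≫
        u ◁ ((L.pull f).map v' ◁ (L.xiId f ((L.pull g).obj Z.fiber)).hom ≫
          (L.cellNat (𝟙 f) v').hom) ▷ L.chiApp f g Z.fiber ⊗≫
        (u ◁ (L.xiId f Y.fiber).inv ≫ (ρ_ u).hom ≫ φ) ▷ ((L.pull f).map v' ≫
          L.chiApp f g Z.fiber) ⊗≫ 𝟙 _ := by
      -- Interchange separates ξ for `f` from the 2-cell inside `f^*`, so that `hd` and `hn` apply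
      -- to them individually.
      rw [whisker_exchange]
      simp only [PrelaxFunctor.map₂_comp]
      bicategory
    _ = ((u ≫ (L.pull f).map v) ≫ L.chiApp f g Z.fiber) ◁
          (cellEndo L (hcomp₂ (𝟙 f) (𝟙 g)) Z.fiber).hom ⊗≫
        (u ◁ (L.pull f).map₂ ψ ≫ ((ρ_ u).inv ≫ u ◁ ((L.xiId f Y.fiber).hom ≫
          (L.xiId f Y.fiber).inv) ≫ (ρ_ u).hom ≫ φ) ▷ (L.pull f).map v') ▷
          L.chiApp f g Z.fiber := by
      rw [Iso.symm_inv, Iso.symm_hom] at hd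
      rw [hd, hn]
      bicategory
    _ = ((u ≫ (L.pull f).map v) ≫ L.chiApp f g Z.fiber) ◁
          (cellEndo L (hcomp₂ (𝟙 f) (𝟙 g)) Z.fiber).hom ≫ (ρ_ _).hom ≫
        (u ◁ (L.pull f).map₂ ψ ≫ φ ▷ (L.pull f).map v') ▷ L.chiApp f g Z.fiber := by
      rw [Iso.hom_inv_id]
      bicategory
    _ = _ := by
      rw [whisker_exchange, ← he]
      simp only [vert, Bicategory.whiskerLeft_comp, Category.assoc]
      rfl

/-- Horizontal composition of 2-cells for 1-cells of the base that are equal to the composites. -/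
def hcompTo {X Y Z : Groth L} {f f' : X.base ⟶ Y.base} {g g' : Y.base ⟶ Z.base}
    {h h' : X.base ⟶ Z.base} (e : f ≫ g = h) (e' : f' ≫ g' = h')
    {u : X.fiber ⟶ (L.pull f).obj Y.fiber} {v : Y.fiber ⟶ (L.pull g).obj Z.fiber}
    {u' : X.fiber ⟶ (L.pull f').obj Y.fiber} {v' : Y.fiber ⟶ (L.pull g').obj Z.fiber}
    (Φ : mk₁ X Y f u ⟶ mk₁ X Y f' u') (Ψ : mk₁ Y Z g v ⟶ mk₁ Y Z g' v') :
    mk₁ X Z h (star L e u v) ⟶ mk₁ X Z h' (star L e' u' v') :=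
  match h, h', e, e' with
  | _, _, rfl, rfl => hcomp Φ Ψ

theorem hcompTo_vert {X Y Z : Groth L} {f : X.base ⟶ Y.base} {g : Y.base ⟶ Z.base}
    {h : X.base ⟶ Z.base} (e : f ≫ g = h)
    {u u' : X.fiber ⟶ (L.pull f).obj Y.fiber} {v v' : Y.fiber ⟶ (L.pull g).obj Z.fiber}
    (φ : u ⟶ u') (ψ : v ⟶ v') :
    hcompTo e e (vert φ) (vert ψ) = vert (X := X) (Y := Z) (star₂ L e φ ψ) := by
  subst e
  exact hcomp_vert φ ψ

/-- The associativity constraint over a tetrahedron of the base. -/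
def assocTet {X Y Z T : Groth L} {f : X.base ⟶ Y.base} {g : Y.base ⟶ Z.base}
    {h : Z.base ⟶ T.base} {q : X.base ⟶ Z.base} {s : Y.base ⟶ T.base} {m m' : X.base ⟶ T.base}
    (eq : f ≫ g = q) (es : g ≫ h = s) (em₀ : f ≫ s = m) (em₁ : q ≫ h = m') (η : m ≅ m')
    (u : X.fiber ⟶ (L.pull f).obj Y.fiber) (v : Y.fiber ⟶ (L.pull g).obj Z.fiber)
    (w : Z.fiber ⟶ (L.pull h).obj T.fiber) :
    mk₁ X T m' (star L em₁ (star L eq u v) w) ≅ mk₁ X T m (star L em₀ u (star L es v w)) :=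
  (isoMk (U := mk₁ X T m (star L em₀ u (star L es v w)))
    (V := mk₁ X T m' (star L em₁ (star L eq u v) w)) η
    (Iso.refl (((u ≫ (L.pull f).map ((v ≫ (L.pull g).map w) ≫ chiTo L es T.fiber)) ≫
        chiTo L em₀ T.fiber) ≫ L.cell η.hom T.fiber) ≪⊗≫
      whiskerRightIso (whiskerLeftIso u
          ((L.pull f).mapComp (v ≫ (L.pull g).map w) (chiTo L es T.fiber) ≪≫
            whiskerRightIso ((L.pull f).mapComp v ((L.pull g).map w))
              ((L.pull f).map (chiTo L es T.fiber))))
        (chiTo L em₀ T.fiber ≫ L.cell η.hom T.fiber) ≪⊗≫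
      whiskerLeftIso (u ≫ (L.pull f).map v ≫ (L.pull f).map ((L.pull g).map w))
        (omegaCell L eq es em₁ em₀ η.hom T.fiber) ≪⊗≫
      whiskerLeftIso (u ≫ (L.pull f).map v)
        (whiskerRightIso (chiToNat L eq w) (chiTo L em₁ T.fiber)) ≪⊗≫
      Iso.refl ((((u ≫ (L.pull f).map v) ≫ chiTo L eq Z.fiber) ≫ (L.pull q).map w) ≫
        chiTo L em₁ T.fiber))).symm

theorem assocTet_rfl {X Y Z T : Groth L} (f : X.base ⟶ Y.base) (g : Y.base ⟶ Z.base)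
    (h : Z.base ⟶ T.base) (u : X.fiber ⟶ (L.pull f).obj Y.fiber)
    (v : Y.fiber ⟶ (L.pull g).obj Z.fiber) (w : Z.fiber ⟶ (L.pull h).obj T.fiber) :
    assocTet (X := X) (T := T) rfl rfl rfl rfl (α_ f g h).symm u v w =
      associator (mk₁ X Y f u) (mk₁ Y Z g v) (mk₁ Z T h w) := by
  unfold assocTet
  simp only [Iso.symm_hom, omegaCell_rfl]
  rfl

/-- For a single composite `m` the base part is an identity, and `omegaCell_endo` followed by
`whiskerRight_drop` turns the fibre part into `extComp`. -/
theorem assocTet_endo {X Y Z T : Groth L} {f : X.base ⟶ Y.base} {g : Y.base ⟶ Z.base}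
    {h : Z.base ⟶ T.base} {q : X.base ⟶ Z.base} {s : Y.base ⟶ T.base} {m : X.base ⟶ T.base}
    (eq : f ≫ g = q) (es : g ≫ h = s) (em₀ : f ≫ s = m) (em₁ : q ≫ h = m) (η : m ≅ m)
    (u : X.fiber ⟶ (L.pull f).obj Y.fiber) (v : Y.fiber ⟶ (L.pull g).obj Z.fiber)
    (w : Z.fiber ⟶ (L.pull h).obj T.fiber) :
    (assocTet eq es em₀ em₁ η u v w).hom =
      vert (X := X) (Y := T) (starAssoc L eq es em₀ em₁ u v w).hom := by
  -- The constraint is defined as the inverse of a pasting with ω, so the inverse is the direction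
  -- that can be computed.
  have h₁ : (assocTet eq es em₀ em₁ η u v w).inv =
      vert (X := X) (Y := T) (starAssoc L eq es em₀ em₁ u v w).inv := by
    refine cellEq_fiber (Subsingleton.elim _ _ : η.hom = 𝟙 m) ?_
    have h₂ : (L.cellEq (Subsingleton.elim _ _ : η.hom = 𝟙 m) T.fiber).hom ≫
      (L.xiId m T.fiber).inv = (cellEndo L η.hom T.fiber).hom := rfl
    have h₃ : (starAssoc L eq es em₀ em₁ u v w).inv = 𝟙 _ ⊗≫
        u ◁ (extComp L eq es em₁ em₀ v w).hom ⊗≫ 𝟙 _ := by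
      simp only [starAssoc, bicategoricalIsoComp, Iso.trans_inv, Iso.refl_inv, Iso.symm_inv,
        whiskerLeftIso_inv]
      bicategory
    calc
      _ = 𝟙 _ ⊗≫ u ◁ (((L.pull f).mapComp (v ≫ (L.pull g).map w) (chiTo L es T.fiber)).hom ≫
            ((L.pull f).mapComp v ((L.pull g).map w)).hom ▷
              ((L.pull f).map (chiTo L es T.fiber))) ▷
          (chiTo L em₀ T.fiber ≫ L.cell η.hom T.fiber) ⊗≫
          (u ≫ (L.pull f).map v ≫ (L.pull f).map ((L.pull g).map w)) ◁
          (omegaCell L eq es em₁ em₀ η.hom T.fiber).hom ⊗≫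
          (u ≫ (L.pull f).map v) ◁ ((chiToNat L eq w).hom ▷ (chiTo L em₁ T.fiber)) ⊗≫ 𝟙 _ := by
        change ((assocTet eq es em₀ em₁ η u v w).inv).fiber = _
        simp only [assocTet, isoMk, Iso.symm_inv, bicategoricalIsoComp, Iso.trans_hom,
          Iso.refl_hom, whiskerLeftIso_hom, whiskerRightIso_hom]
        bicategory
      _ = 𝟙 _ ⊗≫ ((u ◁ (((L.pull f).mapComp (v ≫ (L.pull g).map w) (chiTo L es T.fiber)).hom ≫
            ((L.pull f).mapComp v ((L.pull g).map w)).hom ▷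
              ((L.pull f).map (chiTo L es T.fiber))) ▷ chiTo L em₀ T.fiber) ▷
              L.cell η.hom T.fiber ≫ _ ◁ (cellEndo L η.hom T.fiber).hom ≫ (ρ_ _).hom) ⊗≫
          (u ≫ (L.pull f).map v ≫ (L.pull f).map ((L.pull g).map w)) ◁
          (omegaTet L eq es em₁ em₀ T.fiber).hom ⊗≫
          (u ≫ (L.pull f).map v) ◁ ((chiToNat L eq w).hom ▷ (chiTo L em₁ T.fiber)) ⊗≫ 𝟙 _ := by
        rw [omegaCell_endo]; bicategory
      _ = ((u ≫ (L.pull f).map ((v ≫ (L.pull g).map w) ≫ chiTo L es T.fiber)) ≫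
          chiTo L em₀ T.fiber) ◁ (cellEndo L η.hom T.fiber).hom ≫ (ρ_ _).hom ≫
          (starAssoc L eq es em₀ em₁ u v w).inv := by
        rw [whiskerRight_drop, h₃]
        simp only [extComp, bicategoricalIsoComp, Iso.trans_hom,
          Iso.refl_hom, whiskerLeftIso_hom, whiskerRightIso_hom]
        bicategory
      _ = _ := by
        rw [← h₂]
        simp only [vert, Bicategory.whiskerLeft_comp, Category.assoc]
        rfl
  rw [← cancel_mono (assocTet eq es em₀ em₁ η u v w).inv, Iso.hom_inv_id, h₁, ← vert_comp,
    Iso.hom_inv_id, vert_id]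

/-- The left unit constraint over a degenerate triangle of the base. -/
def leftTri {X Y : Groth L} {f r : X.base ⟶ Y.base} (e : 𝟙 X.base ≫ f = r) (η : r ≅ f)
    (u : X.fiber ⟶ (L.pull f).obj Y.fiber) :
    mk₁ X Y r (star L e (L.unitApp X.base X.fiber) u) ≅ mk₁ X Y f u :=
  isoMk (U := mk₁ X Y r (star L e (L.unitApp X.base X.fiber) u)) (V := mk₁ X Y f u) η
    (whiskerRightIso (whiskerRightIso (L.unitNat X.base u).symm (chiTo L e Y.fiber))
        (L.cell η.hom Y.fiber) ≪⊗≫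
      whiskerLeftIso u (deltaCell L e η.hom Y.fiber) ≪⊗≫
      Iso.refl u)

theorem leftTri_rfl {X Y : Groth L} (f : X.base ⟶ Y.base)
    (u : X.fiber ⟶ (L.pull f).obj Y.fiber) :
    leftTri (X := X) (Y := Y) rfl (λ_ f) u = leftUnitor (mk₁ X Y f u) := by
  have h : deltaCell L rfl (λ_ f).hom Y.fiber = L.delta f Y.fiber :=
    whiskerLeftIso_cellEq_trans L _ _ _
  unfold leftTri
  rw [h]
  rfl

theorem leftTri_endo {X Y : Groth L} {f : X.base ⟶ Y.base} (e : 𝟙 X.base ≫ f = f) (η : f ≅ f)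
    (u : X.fiber ⟶ (L.pull f).obj Y.fiber) :
    (leftTri e η u).hom = vert (X := X) (Y := Y) (starLeft L e u).hom := by
  refine cellEq_fiber (Subsingleton.elim _ _ : η.hom = 𝟙 f) ?_
  have h₂ : (L.cellEq (Subsingleton.elim _ _ : η.hom = 𝟙 f) Y.fiber).hom ≫
      (L.xiId f Y.fiber).inv = (cellEndo L η.hom Y.fiber).hom := rfl
  calc
    _ = (((L.unitNat X.base u).inv ▷ chiTo L e Y.fiber) ▷ L.cell η.hom Y.fiber ≫
        _ ◁ (cellEndo L η.hom Y.fiber).hom ≫ (ρ_ _).hom) ⊗≫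
        u ◁ (deltaTri L e Y.fiber).hom ⊗≫ 𝟙 _ := by
      change ((leftTri e η u).hom).fiber = _
      simp only [leftTri, isoMk, Iso.symm_hom, bicategoricalIsoComp, Iso.trans_hom,
          Iso.refl_hom, whiskerLeftIso_hom, whiskerRightIso_hom, deltaCell_endo]
      bicategory
    _ = _ ◁ (cellEndo L η.hom Y.fiber).hom ≫ (ρ_ _).hom ≫ (starLeft L e u).hom := by
      rw [whiskerRight_drop]
      simp only [starLeft, unitExt, Iso.trans_hom, Iso.symm_hom,
        whiskerLeftIso_hom, whiskerRightIso_hom]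
      bicategory
    _ = _ := by
      rw [← h₂]
      simp only [vert, Bicategory.whiskerLeft_comp, Category.assoc]
      rfl

/-- The right unit constraint over a degenerate triangle of the base. -/
def rightTri {X Y : Groth L} {f r : X.base ⟶ Y.base} (e : f ≫ 𝟙 Y.base = r) (η : r ≅ f)
    (u : X.fiber ⟶ (L.pull f).obj Y.fiber) :
    mk₁ X Y r (star L e u (L.unitApp Y.base Y.fiber)) ≅ mk₁ X Y f u :=
  isoMk (U := mk₁ X Y r (star L e u (L.unitApp Y.base Y.fiber))) (V := mk₁ X Y f u) η
    (Iso.refl (((u ≫ (L.pull f).map (L.unitApp Y.base Y.fiber)) ≫ chiTo L e Y.fiber) ≫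
        L.cell η.hom Y.fiber) ≪⊗≫
      whiskerLeftIso u (gammaCell L e η.hom Y.fiber) ≪⊗≫
      Iso.refl u)

theorem rightTri_rfl {X Y : Groth L} (f : X.base ⟶ Y.base)
    (u : X.fiber ⟶ (L.pull f).obj Y.fiber) :
    rightTri (X := X) (Y := Y) rfl (ρ_ f) u = rightUnitor (mk₁ X Y f u) := by
  have h : gammaCell L rfl (ρ_ f).hom Y.fiber = L.gamma f Y.fiber :=
    whiskerLeftIso_cellEq_trans L _ _ _
  unfold rightTri
  rw [h]
  rfl

theorem rightTri_endo {X Y : Groth L} {f : X.base ⟶ Y.base} (e : f ≫ 𝟙 Y.base = f) (η : f ≅ f)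
    (u : X.fiber ⟶ (L.pull f).obj Y.fiber) :
    (rightTri e η u).hom = vert (X := X) (Y := Y) (starRight L e u).hom := by
  refine cellEq_fiber (Subsingleton.elim _ _ : η.hom = 𝟙 f) ?_
  have h₂ : (L.cellEq (Subsingleton.elim _ _ : η.hom = 𝟙 f) Y.fiber).hom ≫
      (L.xiId f Y.fiber).inv = (cellEndo L η.hom Y.fiber).hom := rfl
  calc
    _ = _ ◁ (cellEndo L η.hom Y.fiber).hom ≫ (ρ_ _).hom ≫ (starRight L e u).hom := by
      change ((rightTri e η u).hom).fiber = _
      simp only [rightTri, starRight, isoMk, bicategoricalIsoComp, Iso.trans_hom,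
          Iso.refl_hom, whiskerLeftIso_hom, gammaCell_endo]
      bicategory
    _ = _ := by
      rw [← h₂]
      simp only [vert, Bicategory.whiskerLeft_comp, Category.assoc]
      rfl

end Groth

end Vertical
end LaxBidiagrams

/-! ### The axioms of a bicategory -/

namespace LaxBidiagrams

section Vertical

open LaxBidiagramCore LaxBidiagramData

variable {C : Type u₁} [Category.{v₁} C]
  {L : LaxBidiagram.{v₁, w₂, v₁, v₂, u₁, u₂} (LocallyDiscrete C)}

namespace Groth

/-- Every 2-cell out of a given 1-cell lies over an identity of the base. -/
theorem vert_induction_from {X Y : Groth L} {f : X.base ⟶ Y.base}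
    {u : X.fiber ⟶ (L.pull f).obj Y.fiber} {motive : ∀ V : X ⟶ Y, (mk₁ X Y f u ⟶ V) → Prop}
    (h : ∀ (u' : X.fiber ⟶ (L.pull f).obj Y.fiber) (φ : u ⟶ u'),
      motive (mk₁ X Y f u') (vert φ)) {V : X ⟶ Y} (Φ : mk₁ X Y f u ⟶ V) : motive V Φ := by
  have key : ∀ (V : Hom X Y) (Φ : Hom₂ (X := X) (Y := Y) (mk₁ X Y f u) V), motive V Φ := by
    rintro ⟨g, v⟩ Φ
    obtain rfl : f = g := LocallyDiscrete.eq_of_hom Φ.base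
    obtain ⟨φ, rfl⟩ := eq_vert Φ
    exact h v φ
  exact key V Φ

theorem hcomp_id {X Y Z : Groth L} (U : X ⟶ Y) (V : Y ⟶ Z) :
    hcomp (𝟙 U : U ⟶ U) (𝟙 V : V ⟶ V) = 𝟙 (U ≫ V) := by
  have h := hcomp_vert (X := X) (Y := Y) (Z := Z) (𝟙 (Hom.fiber U)) (𝟙 (Hom.fiber V))
  rw [vert_id, vert_id] at h
  refine h.trans ?_
  have h' : star₂ L rfl (𝟙 (Hom.fiber U)) (𝟙 (Hom.fiber V)) = 𝟙 _ := by simp [star₂]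
  rw [h', vert_id]
  rfl

theorem star₂_comp {b c d : LocallyDiscrete C} {f : b ⟶ c} {g : c ⟶ d} {q : b ⟶ d}
    (e : f ≫ g = q) {x : L.fib b} {y : L.fib c} {z : L.fib d} {u u' u'' : x ⟶ (L.pull f).obj y}
    {v v' v'' : y ⟶ (L.pull g).obj z} (φ : u ⟶ u') (φ' : u' ⟶ u'') (ψ : v ⟶ v') (ψ' : v' ⟶ v'') :
    star₂ L e (φ ≫ φ') (ψ ≫ ψ') = star₂ L e φ ψ ≫ star₂ L e φ' ψ' := by
  simp only [star₂, ← comp_whiskerRight, PrelaxFunctor.map₂_comp, Category.assoc,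
    Bicategory.whiskerLeft_comp]
  congr 1
  rw [comp_whiskerRight, Category.assoc, whisker_exchange_assoc]

theorem hcomp_comp {X Y Z : Groth L} {U U' U'' : X ⟶ Y} {V V' V'' : Y ⟶ Z} (Φ : U ⟶ U')
    (Φ' : U' ⟶ U'') (Ψ : V ⟶ V') (Ψ' : V' ⟶ V'') :
    hcomp (Φ ≫ Φ') (Ψ ≫ Ψ') = (hcomp Φ Ψ ≫ hcomp Φ' Ψ' : U ≫ V ⟶ U'' ≫ V'') := by
  -- `Φ'` starts where `Φ` ends, so it has to be generalized before `Φ` is replaced by a 2-cell over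
  -- an identity.
  revert Φ'
  refine vert_induction (motive := fun U U' Φ => ∀ Φ' : U' ⟶ U'', hcomp (Φ ≫ Φ') (Ψ ≫ Ψ') =
    (hcomp Φ Ψ ≫ hcomp Φ' Ψ' : U ≫ V ⟶ U'' ≫ V'')) (fun f u u' φ Φ' => ?_) Φ
  refine vert_induction_from (motive := fun U'' Φ' => hcomp (vert φ ≫ Φ') (Ψ ≫ Ψ') =
    (hcomp (vert φ) Ψ ≫ hcomp Φ' Ψ' : mk₁ X Y f u ≫ V ⟶ U'' ≫ V'')) (fun u'' φ' => ?_) Φ'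
  clear Φ' Φ
  revert Ψ'
  refine vert_induction (motive := fun V V' Ψ => ∀ Ψ' : V' ⟶ V'',
    hcomp (vert φ ≫ vert φ') (Ψ ≫ Ψ') =
    (hcomp (vert φ) Ψ ≫ hcomp (vert φ') Ψ' : mk₁ X Y f u ≫ V ⟶ mk₁ X Y f u'' ≫ V''))
    (fun g v v' ψ Ψ' => ?_) Ψ
  refine vert_induction_from (motive := fun V'' Ψ' => hcomp (vert φ ≫ vert φ') (vert ψ ≫ Ψ') =
    (hcomp (vert φ) (vert ψ) ≫ hcomp (vert φ') Ψ' : mk₁ X Y f u ≫ mk₁ Y Z g v ⟶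
      mk₁ X Y f u'' ≫ V'')) (fun v'' ψ' => ?_) Ψ'
  rw [← vert_comp, ← vert_comp, hcomp_vert, hcomp_vert, hcomp_vert, star₂_comp]
  exact vert_comp (X := X) (Y := Z) _ _

section

variable {X Y Z T : Groth L} {f : X.base ⟶ Y.base} {g : Y.base ⟶ Z.base}
    {h : Z.base ⟶ T.base} {q : X.base ⟶ Z.base} {s : Y.base ⟶ T.base} {m m' : X.base ⟶ T.base}
    (eq : f ≫ g = q) (es : g ≫ h = s) (em₀ : f ≫ s = m) (em₁ : q ≫ h = m') (η : m ≅ m')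

theorem assocTet_natural {u u' : X.fiber ⟶ (L.pull f).obj Y.fiber}
    {v v' : Y.fiber ⟶ (L.pull g).obj Z.fiber}
    {w w' : Z.fiber ⟶ (L.pull h).obj T.fiber} (φ : u ⟶ u') (ψ : v ⟶ v') (θ : w ⟶ w') :
    vert (X := X) (Y := T) (star₂ L em₁ (star₂ L eq φ ψ) θ) ≫
        (assocTet eq es em₀ em₁ η u' v' w').hom =
      (assocTet eq es em₀ em₁ η u v w).hom ≫ vert (star₂ L em₀ φ (star₂ L es ψ θ)) := by
  obtain rfl : m = m' := LocallyDiscrete.eq_of_hom η.hom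
  rw [assocTet_endo, assocTet_endo, ← vert_comp, ← vert_comp, starAssoc_natural]

theorem associator_naturality {U U' : X ⟶ Y} {V V' : Y ⟶ Z} {W W' : Z ⟶ T} (Φ : U ⟶ U')
    (Ψ : V ⟶ V') (Θ : W ⟶ W') :
    (hcomp (hcomp Φ Ψ) Θ : (U ≫ V) ≫ W ⟶ (U' ≫ V') ≫ W') ≫ (associator U' V' W').hom =
      (associator U V W).hom ≫ hcomp Φ (hcomp Ψ Θ) := by
  refine vert_induction (motive := fun U U' Φ =>
    (hcomp (hcomp Φ Ψ) Θ : (U ≫ V) ≫ W ⟶ (U' ≫ V') ≫ W') ≫ (associator U' V' W').hom =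
      (associator U V W).hom ≫ hcomp Φ (hcomp Ψ Θ)) (fun f u u' φ => ?_) Φ
  refine vert_induction (motive := fun V V' Ψ =>
    (hcomp (hcomp (vert φ) Ψ) Θ : (mk₁ X Y f u ≫ V) ≫ W ⟶ (mk₁ X Y f u' ≫ V') ≫ W') ≫
      (associator (mk₁ X Y f u') V' W').hom =
      (associator (mk₁ X Y f u) V W).hom ≫ hcomp (vert φ) (hcomp Ψ Θ))
      (fun g v v' ψ => ?_) Ψ
  refine vert_induction (motive := fun W W' Θ =>
    (hcomp (hcomp (vert φ) (vert ψ)) Θ : (mk₁ X Y f u ≫ mk₁ Y Z g v) ≫ W ⟶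
      (mk₁ X Y f u' ≫ mk₁ Y Z g v') ≫ W') ≫
      (associator (mk₁ X Y f u') (mk₁ Y Z g v') W').hom =
      (associator (mk₁ X Y f u) (mk₁ Y Z g v) W).hom ≫ hcomp (vert φ) (hcomp (vert ψ) Θ))
      (fun h w w' θ => ?_) Θ
  have key := assocTet_natural (X := X) (T := T) (rfl : f ≫ g = _) (rfl : g ≫ h = _)
    rfl rfl (α_ f g h).symm φ ψ θ
  rw [assocTet_rfl, assocTet_rfl] at key
  rw [hcomp_vert, hcomp_vert (X := Y)]
  refine Eq.trans ?_ (key.trans ?_)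
  · congr 1
    exact hcomp_vert (X := X) (Y := Z) (Z := T) (star₂ L rfl φ ψ) θ
  · congr 1
    exact (hcomp_vert (X := X) (Y := Y) (Z := T) φ (star₂ L rfl ψ θ)).symm

end

theorem leftUnitor_naturality {X Y : Groth L} {U U' : X ⟶ Y} (Φ : U ⟶ U') :
    (hcomp (𝟙 (𝟙 X) : 𝟙 X ⟶ 𝟙 X) Φ : 𝟙 X ≫ U ⟶ 𝟙 X ≫ U') ≫ (leftUnitor U').hom =
      (leftUnitor U).hom ≫ Φ := by
  refine vert_induction (motive := fun U U' Φ =>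
    (hcomp (𝟙 (𝟙 X) : 𝟙 X ⟶ 𝟙 X) Φ : 𝟙 X ≫ U ⟶ 𝟙 X ≫ U') ≫ (leftUnitor U').hom =
      (leftUnitor U).hom ≫ Φ) (fun f u u' φ => ?_) Φ
  -- Stated for every `r`, so that it can be proved with `r = f` and applied with `r` the composite,
  -- where `leftTri` is the left unitor.
  have key : ∀ {r : X.base ⟶ Y.base} (e : 𝟙 X.base ≫ f = r) (η : r ≅ f),
      vert (X := X) (Y := Y) (star₂ L e (𝟙 (L.unitApp X.base X.fiber)) φ) ≫
        (leftTri e η u').hom = (leftTri e η u).hom ≫ vert φ := by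
    intro r e η
    obtain rfl : r = f := LocallyDiscrete.eq_of_hom η.hom
    rw [leftTri_endo, leftTri_endo, ← vert_comp, ← vert_comp, starLeft_natural]
  have h := key rfl (λ_ f)
  rw [leftTri_rfl, leftTri_rfl] at h
  refine Eq.trans ?_ h
  congr 1
  have h' := hcomp_vert (X := X) (Y := X) (Z := Y) (𝟙 (L.unitApp X.base X.fiber)) φ
  rw [vert_id] at h'
  exact h'

theorem rightUnitor_naturality {X Y : Groth L} {U U' : X ⟶ Y} (Φ : U ⟶ U') :
    (hcomp Φ (𝟙 (𝟙 Y) : 𝟙 Y ⟶ 𝟙 Y) : U ≫ 𝟙 Y ⟶ U' ≫ 𝟙 Y) ≫ (rightUnitor U').hom =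
      (rightUnitor U).hom ≫ Φ := by
  refine vert_induction (motive := fun U U' Φ =>
    (hcomp Φ (𝟙 (𝟙 Y) : 𝟙 Y ⟶ 𝟙 Y) : U ≫ 𝟙 Y ⟶ U' ≫ 𝟙 Y) ≫ (rightUnitor U').hom =
      (rightUnitor U).hom ≫ Φ) (fun f u u' φ => ?_) Φ
  have key : ∀ {r : X.base ⟶ Y.base} (e : f ≫ 𝟙 Y.base = r) (η : r ≅ f),
      vert (X := X) (Y := Y) (star₂ L e φ (𝟙 (L.unitApp Y.base Y.fiber))) ≫
        (rightTri e η u').hom = (rightTri e η u).hom ≫ vert φ := by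
    intro r e η
    obtain rfl : r = f := LocallyDiscrete.eq_of_hom η.hom
    rw [rightTri_endo, rightTri_endo, ← vert_comp, ← vert_comp, starRight_natural]
  have h := key rfl (ρ_ f)
  rw [rightTri_rfl, rightTri_rfl] at h
  refine Eq.trans ?_ h
  congr 1
  have h' := hcomp_vert (X := X) (Y := Y) (Z := Y) φ (𝟙 (L.unitApp Y.base Y.fiber))
  rw [vert_id] at h'
  exact h'

/-- The five bracketed composites W → T are kept apart, so that with reflexive equations this is the
pentagon for `associator`. The 2-cells of the base force them to be equal, and then
`starAssoc_pentagon` applies. -/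
theorem assocTet_pentagon {W X Y Z T : Groth L} {k : W.base ⟶ X.base} {f : X.base ⟶ Y.base}
    {g : Y.base ⟶ Z.base} {h : Z.base ⟶ T.base} {p : W.base ⟶ Y.base} {q : X.base ⟶ Z.base}
    {s : Y.base ⟶ T.base} {m₀ m₁ : X.base ⟶ T.base} {l₀ l₁ : W.base ⟶ Z.base}
    {n₀ n₁ n₂ n₃ n₄ : W.base ⟶ T.base} (ep : k ≫ f = p) (eq : f ≫ g = q) (es : g ≫ h = s)
    (em₀ : f ≫ s = m₀) (em₁ : q ≫ h = m₁) (el₀ : k ≫ q = l₀) (el₁ : p ≫ g = l₁)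
    (en₀ : k ≫ m₀ = n₀) (en₁ : k ≫ m₁ = n₁) (en₂ : l₀ ≫ h = n₂) (en₃ : l₁ ≫ h = n₃)
    (en₄ : p ≫ s = n₄) (μ : m₀ ≅ m₁) (ν : l₀ ≅ l₁) (τ₁ : n₁ ≅ n₂) (τ₂ : n₄ ≅ n₃) (τ₃ : n₀ ≅ n₄)
    (u₀ : W.fiber ⟶ (L.pull k).obj X.fiber) (u : X.fiber ⟶ (L.pull f).obj Y.fiber)
    (v : Y.fiber ⟶ (L.pull g).obj Z.fiber) (w : Z.fiber ⟶ (L.pull h).obj T.fiber) :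
    hcompTo en₃ en₂ (assocTet ep eq el₀ el₁ ν u₀ u v).hom (𝟙 (mk₁ Z T h w)) ≫
        (assocTet el₀ em₁ en₁ en₂ τ₁ u₀ (star L eq u v) w).hom ≫
        hcompTo en₁ en₀ (𝟙 (mk₁ W X k u₀)) (assocTet eq es em₀ em₁ μ u v w).hom =
      (assocTet el₁ es en₄ en₃ τ₂ (star L ep u₀ u) v w).hom ≫
        (assocTet ep em₀ en₀ en₄ τ₃ u₀ u (star L es v w)).hom := by
  obtain rfl : m₀ = m₁ := LocallyDiscrete.eq_of_hom μ.hom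
  obtain rfl : l₀ = l₁ := LocallyDiscrete.eq_of_hom ν.hom
  obtain rfl : n₁ = n₂ := LocallyDiscrete.eq_of_hom τ₁.hom
  obtain rfl : n₄ = n₃ := LocallyDiscrete.eq_of_hom τ₂.hom
  obtain rfl : n₀ = n₄ := LocallyDiscrete.eq_of_hom τ₃.hom
  obtain rfl : n₀ = n₁ := en₀.symm.trans en₁
  rw [assocTet_endo, assocTet_endo, assocTet_endo, assocTet_endo, assocTet_endo, ← vert_id,
    ← vert_id, hcompTo_vert, hcompTo_vert, ← vert_comp, ← vert_comp, ← vert_comp,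
    starAssoc_pentagon]

theorem assocTet_triangle {X Y Z : Groth L} {k p : X.base ⟶ Y.base} {g q : Y.base ⟶ Z.base}
    {r r' t : X.base ⟶ Z.base} (e₁ : k ≫ 𝟙 Y.base = p) (e₂ : 𝟙 Y.base ≫ g = q) (e₃ : p ≫ g = r')
    (e₄ : k ≫ q = r) (e₅ : k ≫ g = t) (η : r ≅ r') (θ : q ≅ g) (κ : p ≅ k)
    (u : X.fiber ⟶ (L.pull k).obj Y.fiber) (v : Y.fiber ⟶ (L.pull g).obj Z.fiber) :
    (assocTet e₁ e₂ e₄ e₃ η u (L.unitApp Y.base Y.fiber) v).hom ≫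
        hcompTo e₄ e₅ (𝟙 (mk₁ X Y k u)) (leftTri e₂ θ v).hom =
      hcompTo e₃ e₅ (rightTri e₁ κ u).hom (𝟙 (mk₁ Y Z g v)) := by
  obtain rfl : q = g := LocallyDiscrete.eq_of_hom θ.hom
  obtain rfl : p = k := LocallyDiscrete.eq_of_hom κ.hom
  obtain rfl : r = r' := LocallyDiscrete.eq_of_hom η.hom
  obtain rfl : r = t := e₄.symm.trans e₅
  rw [assocTet_endo, leftTri_endo, rightTri_endo, ← vert_id, ← vert_id, hcompTo_vert,
    hcompTo_vert, ← vert_comp, starAssoc_triangle]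

variable (L) in
/-- The Grothendieck construction of a lax bidiagram on a category is a bicategory. -/
theorem isBicategory : (grothData L).IsBicategory where
  hcomp_id U V := hcomp_id U V
  hcomp_comp Φ Φ' Ψ Ψ' := hcomp_comp Φ Φ' Ψ Ψ'
  associator_naturality Φ Ψ Θ := associator_naturality Φ Ψ Θ
  leftUnitor_naturality Φ := leftUnitor_naturality Φ
  rightUnitor_naturality Φ := rightUnitor_naturality Φ
  pentagon {W X Y Z T} U₀ U V V' := by
    -- All equations are reflexive and all 2-cells are associators of the base, hence the
    -- constraints are those of `grothData`.
    have key := assocTet_pentagon (W := W) (X := X) (Y := Y) (Z := Z) (T := T)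
      (k := Hom.base U₀) (f := Hom.base U) (g := Hom.base V) (h := Hom.base V')
      rfl rfl rfl rfl rfl rfl rfl rfl rfl rfl rfl rfl
      (α_ _ _ _).symm (α_ _ _ _).symm (α_ _ _ _).symm (α_ _ _ _).symm (α_ _ _ _).symm
      (Hom.fiber U₀) (Hom.fiber U) (Hom.fiber V) (Hom.fiber V')
    rw [assocTet_rfl, assocTet_rfl, assocTet_rfl, assocTet_rfl, assocTet_rfl] at key
    exact key
  triangle {X Y Z} U V := by
    have key := assocTet_triangle (X := X) (Y := Y) (Z := Z) (k := Hom.base U) (g := Hom.base V)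
      rfl rfl rfl rfl rfl (α_ _ _ _).symm (λ_ _) (ρ_ _) (Hom.fiber U) (Hom.fiber V)
    rw [assocTet_rfl, leftTri_rfl, rightTri_rfl] at key
    exact key

end Groth

end Vertical
end LaxBidiagrams

/-! ### Unit identities deduced from the bicategory -/

namespace LaxBidiagrams

section Vertical

open LaxBidiagramCore LaxBidiagramData

variable {C : Type u₁} [Category.{v₁} C]
  {L : LaxBidiagram.{v₁, w₂, v₁, v₂, u₁, u₂} (LocallyDiscrete C)}

namespace Groth

/-- The Grothendieck construction as a bicategory. -/
instance : Bicategory (Groth L) := (isBicategory L).toBicategory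

/-- The factors in front of the fibre 2-cell are invertible. This permits reading identities of the
Grothendieck construction back in the fibres. -/
theorem vert_injective {X Y : Groth L} {f : X.base ⟶ Y.base}
    {u u' : X.fiber ⟶ (L.pull f).obj Y.fiber} {φ ψ : u ⟶ u'}
    (h : vert (X := X) (Y := Y) φ = vert ψ) : φ = ψ := by
  have h' : u ◁ (L.xiId f Y.fiber).inv ≫ (ρ_ u).hom ≫ φ =
      u ◁ (L.xiId f Y.fiber).inv ≫ (ρ_ u).hom ≫ ψ := by
    injection h
  rwa [cancel_epi, cancel_epi] at h'

end Groth

open Groth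

variable (L)

/-- In every bicategory the left unitor of a composite is determined by the associator and the
unitor of the first factor. Applied to the Grothendieck construction this gives a relation between ω
and δ that is not among the coherence conditions. -/
theorem starAssoc_starLeft {a b c : LocallyDiscrete C} {f : a ⟶ b} {g : b ⟶ c} {q : a ⟶ c}
    (e : 𝟙 a ≫ f = f) (eq : f ≫ g = q) (e' : 𝟙 a ≫ q = q) {x : L.fib a} {y : L.fib b}
    {z : L.fib c} (u : x ⟶ (L.pull f).obj y) (v : y ⟶ (L.pull g).obj z) :
    (starAssoc L e eq e' eq (L.unitApp a x) u v).hom ≫ (starLeft L e' (star L eq u v)).hom =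
      star₂ L eq (starLeft L e u).hom (𝟙 v) := by
  let X : Groth L := ⟨a, x⟩
  let Y : Groth L := ⟨b, y⟩
  let Z : Groth L := ⟨c, z⟩
  have key : ∀ {f' : a ⟶ b} {q' q'' : a ⟶ c} (e : 𝟙 a ≫ f = f') (e' : 𝟙 a ≫ q = q')
      (e'' : f' ≫ g = q'') (η : q' ≅ q'') (θ : q' ≅ q) (κ : f' ≅ f),
      (assocTet (X := X) (Y := X) (Z := Y) (T := Z) e eq e' e'' η (L.unitApp a x) u v).hom ≫
        (leftTri (X := X) (Y := Z) e' θ (star L eq u v)).hom =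
      hcompTo e'' eq (leftTri (X := X) (Y := Y) e κ u).hom (𝟙 (mk₁ Y Z g v)) := by
    intro f' q' q'' e e' e'' η θ κ
    subst eq e e' e''
    have h := leftUnitor_comp (mk₁ X Y f u) (mk₁ Y Z g v)
    obtain rfl : η = (α_ _ _ _).symm := Subsingleton.elim _ _
    obtain rfl : θ = λ_ _ := Subsingleton.elim _ _
    obtain rfl : κ = λ_ _ := Subsingleton.elim _ _
    rw [assocTet_rfl, leftTri_rfl, leftTri_rfl]
    exact (Iso.eq_inv_comp _).1 h
  have h := key e e' eq (Iso.refl _) (Iso.refl _) (Iso.refl _)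
  rw [assocTet_endo, leftTri_endo, leftTri_endo, ← vert_id, hcompTo_vert, ← vert_comp] at h
  exact vert_injective h

theorem starAssoc_starRight {a b c : LocallyDiscrete C} {f : a ⟶ b} {g : b ⟶ c} {q : a ⟶ c}
    (e : g ≫ 𝟙 c = g) (eq : f ≫ g = q) (e' : q ≫ 𝟙 c = q) {x : L.fib a} {y : L.fib b}
    {z : L.fib c} (u : x ⟶ (L.pull f).obj y) (v : y ⟶ (L.pull g).obj z) :
    (starAssoc L eq e eq e' u v (L.unitApp c z)).hom ≫
        star₂ L eq (𝟙 u) (starRight L e v).hom =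
      (starRight L e' (star L eq u v)).hom := by
  let X : Groth L := ⟨a, x⟩
  let Y : Groth L := ⟨b, y⟩
  let Z : Groth L := ⟨c, z⟩
  have key : ∀ {g' : b ⟶ c} {q' q'' : a ⟶ c} (e : g ≫ 𝟙 c = g') (e' : q ≫ 𝟙 c = q')
      (e'' : f ≫ g' = q'') (η : q'' ≅ q') (θ : q' ≅ q) (κ : g' ≅ g),
      (assocTet (X := X) (Y := Y) (Z := Z) (T := Z) eq e e'' e' η u v (L.unitApp c z)).hom ≫
        hcompTo e'' eq (𝟙 (mk₁ X Y f u)) (rightTri (X := Y) (Y := Z) e κ v).hom =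
      (rightTri (X := X) (Y := Z) e' θ (star L eq u v)).hom := by
    intro f' q' q'' e e' e'' η θ κ
    subst eq e e' e''
    have h := rightUnitor_comp (mk₁ X Y f u) (mk₁ Y Z g v)
    obtain rfl : η = (α_ _ _ _).symm := Subsingleton.elim _ _
    obtain rfl : θ = ρ_ _ := Subsingleton.elim _ _
    obtain rfl : κ = ρ_ _ := Subsingleton.elim _ _
    rw [assocTet_rfl, rightTri_rfl, rightTri_rfl]
    exact h.symm
  have h := key e e' eq (Iso.refl _) (Iso.refl _) (Iso.refl _)
  rw [assocTet_endo, rightTri_endo, rightTri_endo, ← vert_id, hcompTo_vert, ← vert_comp] at h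
  exact vert_injective h

/-- The two unitors of an identity 1-cell agree in every bicategory; here this compares δ with γ. -/
theorem starLeft_unitApp {a : LocallyDiscrete C} (e : 𝟙 a ≫ 𝟙 a = 𝟙 a) (x : L.fib a) :
    (starLeft L e (L.unitApp a x)).hom = (starRight L e (L.unitApp a x)).hom := by
  let X : Groth L := ⟨a, x⟩
  have key : ∀ {r : a ⟶ a} (e : 𝟙 a ≫ 𝟙 a = r) (η : r ≅ 𝟙 a),
      (leftTri (X := X) (Y := X) e η (L.unitApp a x)).hom =
        (rightTri (X := X) (Y := X) e η (L.unitApp a x)).hom := by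
    intro r e η
    subst e
    have h := unitors_equal (a := X)
    obtain rfl : η = λ_ _ := Subsingleton.elim _ _
    rw [leftTri_rfl]
    obtain h' : λ_ (𝟙 a) = ρ_ _ := Subsingleton.elim _ _
    rw [h', rightTri_rfl]
    exact h
  have h := key e (Iso.refl _)
  rw [leftTri_endo, rightTri_endo] at h
  exact vert_injective h

theorem starAssoc_inv {b c d e : LocallyDiscrete C} {f : b ⟶ c} {g : c ⟶ d} {h : d ⟶ e}
    {q : b ⟶ d} {s : c ⟶ e} {m : b ⟶ e} (eq : f ≫ g = q) (es : g ≫ h = s) (em₀ : f ≫ s = m)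
    (em₁ : q ≫ h = m) {x : L.fib b} {y : L.fib c} {z : L.fib d} {t : L.fib e}
    (u : x ⟶ (L.pull f).obj y) (v : y ⟶ (L.pull g).obj z) (w : z ⟶ (L.pull h).obj t) :
    (starAssoc L eq es em₀ em₁ u v w).inv = 𝟙 _ ⊗≫
      u ◁ (extComp L eq es em₁ em₀ v w).hom ⊗≫ 𝟙 _ := by
  simp only [starAssoc, bicategoricalIsoComp, Iso.trans_inv, Iso.refl_inv, Iso.symm_inv,
    whiskerLeftIso_inv]
  bicategory

/-- Precomposition of a composite with the unit. -/
theorem unitExt_star {a b c : LocallyDiscrete C} {f : a ⟶ b} {g : b ⟶ c} {q : a ⟶ c}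
    (e : 𝟙 a ≫ f = f) (eq : f ≫ g = q) (e' : 𝟙 a ≫ q = q) {x : L.fib a} {y : L.fib b}
    {z : L.fib c} (u : x ⟶ (L.pull f).obj y) (v : y ⟶ (L.pull g).obj z) :
    (unitExt L e' (star L eq u v)).hom =
      L.unitApp a x ◁ (extComp L e eq eq e' u v).hom ≫ (α_ _ _ _).inv ≫
        (unitExt L e u).hom ▷ ext L eq v ≫ (α_ _ _ _).inv := by
  have h := starAssoc_starLeft L e eq e' u v
  rw [← Iso.eq_inv_comp, starAssoc_inv, star₂_id_right] at h
  simp only [starLeft, Iso.trans_hom] at h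
  rw [← Iso.eq_inv_comp] at h
  rw [h]
  bicategory

/-- `starAssoc_starRight` for an identity 1-cell `u`: the associativity constraint is then `extComp`
up to unit constraints, and whiskering with an identity is faithful. This is the right unit
condition of K. -/
theorem extComp_gamma {a b c : LocallyDiscrete C} {f : a ⟶ b} {g : b ⟶ c} {q : a ⟶ c}
    (e : g ≫ 𝟙 c = g) (eq : f ≫ g = q) (e' : q ≫ 𝟙 c = q) {y : L.fib b}
    {z : L.fib c} (v : y ⟶ (L.pull g).obj z) :
    (extComp L eq e e' eq v (L.unitApp c z)).hom ≫ ext L eq v ◁ (gammaTri L e' z).hom ≫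
      (ρ_ (ext L eq v)).hom = ext₂ L eq (starRight L e v).hom := by
  have h := starAssoc_starRight L e eq e' (𝟙 ((L.pull f).obj y)) v
  rw [← Iso.eq_inv_comp, starAssoc_inv, star₂_id_left] at h
  rw [← whiskerLeft_iff]
  refine Eq.trans ?_ (Eq.trans (congrArg (fun κ => (α_ _ _ _).inv ≫ κ ≫ (α_ _ _ _).hom)
    h.symm) ?_)
  · simp only [starRight, Iso.trans_hom, whiskerLeftIso_hom]
    bicategory
  · bicategory

/-- `starLeft_unitApp` with the common associator removed: at the unit itself γ may replace δ. -/
theorem gammaTri_unitApp {a : LocallyDiscrete C} (e : 𝟙 a ≫ 𝟙 a = 𝟙 a) (x : L.fib a) :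
    L.unitApp a x ◁ (gammaTri L e x).hom ≫ (ρ_ _).hom = (unitExt L e (L.unitApp a x)).hom := by
  have h := starLeft_unitApp L e x
  simpa [starLeft, starRight] using h.symm

end Vertical
end LaxBidiagrams

/-! ### K is a homomorphism -/

namespace LaxBidiagrams

section Retraction

open LaxBidiagramCore LaxBidiagramData Groth

variable {C : Type u₁} [Category.{v₁} C]
  (L : LaxBidiagram.{v₁, w₂, v₁, v₂, u₁, u₂} (LocallyDiscrete C))

theorem chiToCell_id {a b c : LocallyDiscrete C} (k : a ⟶ b) {f : b ⟶ c} {h : a ⟶ c}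
    (e e' : k ≫ f = h) (z : L.fib c) :
    (chiToCell L k e e' (𝟙 f) z).hom = (λ_ (chiTo L e z)).inv ≫
      (((L.pull k).mapId ((L.pull f).obj z)).inv ≫ (L.pull k).map₂ (L.xiId f z).hom) ▷
        chiTo L e z := by
  have h : chiToCell L k e e' (𝟙 f) z = (λ_ (chiTo L e z)).symm ≪≫
      whiskerRightIso (((L.pull k).mapId ((L.pull f).obj z)).symm ≪≫
        (L.pull k).map₂Iso (L.xiId f z ≪≫ L.cellEq (Subsingleton.elim (𝟙 f) (𝟙 f)) z))
        (chiTo L e z) := rfl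
  rw [h]
  simp [cellEq]

variable {z : C} (hz : Limits.IsInitial z)

/-- The definition of K inserts an identity cell through ξ and composes it with the fibre part,
where it is removed again; `map₂_drop` cancels the two. -/
theorem retractionK_map₂_vert {X Y : Groth L} {f : X.base ⟶ Y.base}
    {u u' : X.fiber ⟶ (L.pull f).obj Y.fiber} (φ : u ⟶ u') :
    (retractionK L hz).map₂ (vert (X := X) (Y := Y) φ) = ext₂ L (fromInitial_comp hz f) φ := by
  have hd := map₂_drop (L.pull (fromInitial hz X.base)) u (L.xiId f Y.fiber).symm
  calc
    _ = (L.pull (fromInitial hz X.base)).map u ◁ (chiToCell L (fromInitial hz X.base)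
          (fromInitial_comp hz f) (fromInitial_comp hz f) (𝟙 f) Y.fiber).hom ⊗≫
        (((L.pull (fromInitial hz X.base)).mapComp u (L.cell (𝟙 f) Y.fiber)).inv ≫
          (L.pull (fromInitial hz X.base)).map₂ (u ◁ (L.xiId f Y.fiber).inv ≫ (ρ_ u).hom ≫ φ)) ▷
        chiTo L (fromInitial_comp hz f) Y.fiber := rfl
    _ = 𝟙 _ ⊗≫ ((L.pull (fromInitial hz X.base)).map u ◁
          (((L.pull (fromInitial hz X.base)).mapId ((L.pull f).obj Y.fiber)).inv ≫
            (L.pull (fromInitial hz X.base)).map₂ (L.xiId f Y.fiber).symm.inv) ≫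
          ((L.pull (fromInitial hz X.base)).mapComp u (L.cell (𝟙 f) Y.fiber)).inv ≫
          (L.pull (fromInitial hz X.base)).map₂ (u ◁ (L.xiId f Y.fiber).symm.hom ≫ (ρ_ u).hom)) ▷
          chiTo L (fromInitial_comp hz f) Y.fiber ≫
        ext₂ L (fromInitial_comp hz f) φ := by
      rw [chiToCell_id, Iso.symm_hom, Iso.symm_inv, ← Category.assoc (u ◁ _),
        PrelaxFunctor.map₂_comp _ (_ ≫ _)]
      bicategory
    _ = _ := by rw [hd]; bicategory

/-- After the two bracketed composites are identified this is `extComp_pentagon` for extension along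
0_a, with two comparison cells inverted. -/
theorem retractionK_map₂_assocTet {X Y Z T : Groth L} {f : X.base ⟶ Y.base}
    {g : Y.base ⟶ Z.base}
    {h : Z.base ⟶ T.base} {q : X.base ⟶ Z.base} {s : Y.base ⟶ T.base} {m m' : X.base ⟶ T.base}
    (eq : f ≫ g = q) (es : g ≫ h = s) (em₀ : f ≫ s = m) (em₁ : q ≫ h = m') (η : m ≅ m')
    (u : X.fiber ⟶ (L.pull f).obj Y.fiber) (v : Y.fiber ⟶ (L.pull g).obj Z.fiber)
    (w : Z.fiber ⟶ (L.pull h).obj T.fiber) :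
    (retractionK L hz).map₂ (assocTet (X := X) (T := T) eq es em₀ em₁ η u v w).hom =
      (extComp L (fromInitial_comp hz q) em₁ (fromInitial_comp hz h) (fromInitial_comp hz m')
        (star L eq u v) w).hom ≫
      (extComp L (fromInitial_comp hz f) eq (fromInitial_comp hz g) (fromInitial_comp hz q)
        u v).hom ▷ ext L (fromInitial_comp hz h) w ≫ (α_ _ _ _).hom ≫
      ext L (fromInitial_comp hz f) u ◁ (extComp L (fromInitial_comp hz g) es
        (fromInitial_comp hz h) (fromInitial_comp hz s) v w).inv ≫
      (extComp L (fromInitial_comp hz f) em₀ (fromInitial_comp hz s) (fromInitial_comp hz m)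
        u (star L es v w)).inv := by
  obtain rfl : m = m' := LocallyDiscrete.eq_of_hom η.hom
  have hp := extComp_pentagon L (fromInitial_comp hz f) eq es em₀ em₁ (fromInitial_comp hz q)
    (fromInitial_comp hz g) (fromInitial_comp hz m) (fromInitial_comp hz h)
    (fromInitial_comp hz s) u v w
  rw [assocTet_endo, retractionK_map₂_vert, ← reassoc_of% hp]
  simp [← Bicategory.whiskerLeft_comp_assoc]
  rfl

theorem retractionK_map₂_leftTri {X Y : Groth L} {f r : X.base ⟶ Y.base}
    (e : 𝟙 X.base ≫ f = r) (η : r ≅ f) (u : X.fiber ⟶ (L.pull f).obj Y.fiber) :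
    (retractionK L hz).map₂ (leftTri (X := X) (Y := Y) e η u).hom =
      (extComp L (fromInitial_comp hz (𝟙 X.base)) e (fromInitial_comp hz f)
        (fromInitial_comp hz r) (L.unitApp X.base X.fiber) u).hom ≫
      (gammaTri L (fromInitial_comp hz (𝟙 X.base)) X.fiber).hom ▷
        ext L (fromInitial_comp hz f) u ≫ (λ_ _).hom := by
  obtain rfl : r = f := LocallyDiscrete.eq_of_hom η.hom
  rw [leftTri_endo, retractionK_map₂_vert, extComp_unit]

/-- Unlike the left unitor, which needs the given triangle only, this rests on the deduced identity
`extComp_gamma`. -/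
theorem retractionK_map₂_rightTri {X Y : Groth L} {f r : X.base ⟶ Y.base}
    (e : f ≫ 𝟙 Y.base = r) (η : r ≅ f) (u : X.fiber ⟶ (L.pull f).obj Y.fiber) :
    (retractionK L hz).map₂ (rightTri (X := X) (Y := Y) e η u).hom =
      (extComp L (fromInitial_comp hz f) e (fromInitial_comp hz (𝟙 Y.base))
        (fromInitial_comp hz r) u (L.unitApp Y.base Y.fiber)).hom ≫
      ext L (fromInitial_comp hz f) u ◁
        (gammaTri L (fromInitial_comp hz (𝟙 Y.base)) Y.fiber).hom ≫ (ρ_ _).hom := by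
  obtain rfl : r = f := LocallyDiscrete.eq_of_hom η.hom
  rw [rightTri_endo, retractionK_map₂_vert, extComp_gamma]

theorem retractionK_map₂_hcomp {X Y Z : Groth L} {U U' : X ⟶ Y} {V V' : Y ⟶ Z} (Φ : U ⟶ U')
    (Ψ : V ⟶ V') :
    (retractionK L hz).map₂ (hcomp Φ Ψ : U ≫ V ⟶ U' ≫ V') =
      ((retractionK L hz).mapComp U V).hom ≫
        ((retractionK L hz).map₂ Φ ▷ (retractionK L hz).map V ≫
          (retractionK L hz).map U' ◁ (retractionK L hz).map₂ Ψ) ≫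
        ((retractionK L hz).mapComp U' V').inv := by
  refine vert_induction (motive := fun U U' Φ =>
    (retractionK L hz).map₂ (hcomp Φ Ψ : U ≫ V ⟶ U' ≫ V') =
      ((retractionK L hz).mapComp U V).hom ≫
        ((retractionK L hz).map₂ Φ ▷ (retractionK L hz).map V ≫
          (retractionK L hz).map U' ◁ (retractionK L hz).map₂ Ψ) ≫
        ((retractionK L hz).mapComp U' V').inv) (fun f u u' φ => ?_) Φ
  refine vert_induction (motive := fun V V' Ψ =>
    (retractionK L hz).map₂ (hcomp (vert φ) Ψ : mk₁ X Y f u ≫ V ⟶ mk₁ X Y f u' ≫ V') =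
      ((retractionK L hz).mapComp (mk₁ X Y f u) V).hom ≫
        ((retractionK L hz).map₂ (vert φ) ▷ (retractionK L hz).map V ≫
          (retractionK L hz).map (mk₁ X Y f u') ◁ (retractionK L hz).map₂ Ψ) ≫
        ((retractionK L hz).mapComp (mk₁ X Y f u') V').inv) (fun g v v' ψ => ?_) Ψ
  have h := extComp_natural L (fromInitial_comp hz f) rfl (fromInitial_comp hz g)
    (fromInitial_comp hz (f ≫ g)) φ ψ
  have h' := retractionK_map₂_vert L hz (X := X) (Y := Z) (star₂ L rfl φ ψ)
  rw [hcomp_vert, retractionK_map₂_vert, retractionK_map₂_vert, ← Category.assoc,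
    Iso.eq_comp_inv]
  exact (congrArg (· ≫ _) h').trans h

theorem retractionK_map₂_id {X Y : Groth L} (U : X ⟶ Y) :
    (retractionK L hz).map₂ (𝟙 U) = 𝟙 _ := by
  have h := retractionK_map₂_vert L hz (X := X) (Y := Y) (𝟙 (Hom.fiber U))
  rw [vert_id, ext₂_id] at h
  exact h

/-- `K` is a homomorphism of bicategories. -/
theorem retractionK_isHomomorphism : (retractionK L hz).IsHomomorphism where
  map₂_id U := retractionK_map₂_id L hz U
  map₂_comp {X Y U V W} Φ Ψ := by
    revert Ψ
    refine vert_induction (motive := fun U V Φ => ∀ Ψ : V ⟶ W,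
      (retractionK L hz).map₂ (Φ ≫ Ψ) = (retractionK L hz).map₂ Φ ≫ (retractionK L hz).map₂ Ψ)
      (fun f u u' φ Ψ => ?_) Φ
    refine vert_induction_from (motive := fun W Ψ => (retractionK L hz).map₂ (vert φ ≫ Ψ) =
      (retractionK L hz).map₂ (vert φ) ≫ (retractionK L hz).map₂ Ψ) (fun u'' φ' => ?_) Ψ
    rw [← vert_comp, retractionK_map₂_vert, retractionK_map₂_vert, retractionK_map₂_vert,
      ext₂_comp]
    rfl
  map₂_whisker_left {X Y Z} U V V' Ψ := by
    refine (retractionK_map₂_hcomp L hz (𝟙 U) Ψ).trans ?_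
    rw [retractionK_map₂_id, id_whiskerRight, Category.id_comp]
  map₂_whisker_right {X Y Z U U'} Φ V := by
    refine (retractionK_map₂_hcomp L hz Φ (𝟙 V)).trans ?_
    rw [retractionK_map₂_id, Bicategory.whiskerLeft_id, Category.comp_id]
  map₂_associator {X Y Z T} U V W := by
    have h := retractionK_map₂_assocTet L hz (X := X) (Y := Y) (Z := Z) (T := T) rfl rfl rfl rfl
      (α_ _ _ _).symm (Hom.fiber U) (Hom.fiber V) (Hom.fiber W)
    rw [assocTet_rfl] at h
    exact h
  map₂_left_unitor {X Y} U := by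
    have h := retractionK_map₂_leftTri L hz (X := X) (Y := Y) rfl (λ_ _) (Hom.fiber U)
    rw [leftTri_rfl] at h
    exact h
  map₂_right_unitor {X Y} U := by
    have h := retractionK_map₂_rightTri L hz (X := X) (Y := Y) rfl (ρ_ _) (Hom.fiber U)
    rw [rightTri_rfl] at h
    exact h

end Retraction
end LaxBidiagrams

/-! ### Comparison cells of J in the fibre -/

namespace LaxBidiagrams

section Embedding

open LaxBidiagramCore LaxBidiagramData Groth

variable {C : Type u₁} [Category.{v₁} C]
  (L : LaxBidiagram.{v₁, w₂, v₁, v₂, u₁, u₂} (LocallyDiscrete C))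

theorem unitNat_comp_inv {a : LocallyDiscrete C} {x y t : L.fib a} (v : x ⟶ y) (w : y ⟶ t) :
    (L.unitNat a (v ≫ w)).inv = L.unitApp a x ◁ ((L.pull (𝟙 a)).mapComp v w).hom ≫
      (α_ _ _ _).inv ≫ (L.unitNat a v).inv ▷ (L.pull (𝟙 a)).map w ≫ (α_ _ _ _).hom ≫
      v ◁ (L.unitNat a w).inv ≫ (α_ _ _ _).inv := by
  have h : (L.unitNat a (v ≫ w)).hom ≫ L.unitApp a x ◁ ((L.pull (𝟙 a)).mapComp v w).hom =
      𝟙 (v ≫ w) ▷ L.unitApp a t ≫ (α_ _ _ _).hom ≫ v ◁ (L.unitNat a w).hom ≫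
        (α_ _ _ _).inv ≫ (L.unitNat a v).hom ▷ (L.pull (𝟙 a)).map w ≫ (α_ _ _ _).hom :=
    (L.unit a).naturality_comp v w
  rw [← cancel_epi (L.unitNat a (v ≫ w)).hom, Iso.hom_inv_id, reassoc_of% h]
  simp

variable {a : LocallyDiscrete C} (e : 𝟙 a ≫ 𝟙 a = 𝟙 a)

/-- The composition constraint of J is given by γ, while `unitExt` is built from δ. Naturality of
the unit reduces the comparison to `gammaTri_unitApp`. -/
theorem unitExt_comp_unitApp {x y : L.fib a} (v : x ⟶ y) :
    (unitExt L e (v ≫ L.unitApp a y)).hom =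
      L.unitApp a x ◁ ((L.pull (𝟙 a)).mapComp v (L.unitApp a y)).hom ▷ chiTo L e y ⊗≫
        (L.unitApp a x ≫ (L.pull (𝟙 a)).map v) ◁ (gammaTri L e y).hom ⊗≫
        (L.unitNat a v).inv := by
  have h := gammaTri_unitApp L e y
  calc
    _ = L.unitApp a x ◁ ((L.pull (𝟙 a)).mapComp v (L.unitApp a y)).hom ▷ chiTo L e y ⊗≫
        (L.unitNat a v).inv ▷ ext L e (L.unitApp a y) ⊗≫
        v ◁ (unitExt L e (L.unitApp a y)).hom := by
      simp only [unitExt, Iso.trans_hom, Iso.symm_hom, whiskerRightIso_hom, whiskerLeftIso_hom,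
        unitNat_comp_inv]
      bicategory
    _ = L.unitApp a x ◁ ((L.pull (𝟙 a)).mapComp v (L.unitApp a y)).hom ▷ chiTo L e y ⊗≫
        ((L.unitNat a v).inv ▷ ext L e (L.unitApp a y) ≫
        (v ≫ L.unitApp a y) ◁ (gammaTri L e y).hom) ⊗≫ 𝟙 _ := by
      rw [← h]; bicategory
    _ = _ := by
      rw [← whisker_exchange]; bicategory

/-- The comparison cell of the embedding of a fibre, on fibre parts. -/
def embComp {x y t : L.fib a} (u : x ⟶ y) (v : y ⟶ t) :
    star L e (u ≫ L.unitApp a y) (v ≫ L.unitApp a t) ≅ (u ≫ v) ≫ L.unitApp a t :=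
  α_ _ _ _ ≪≫ α_ _ _ _ ≪≫ whiskerLeftIso u (unitExt L e (v ≫ L.unitApp a t)) ≪≫
    (α_ _ _ _).symm

theorem embComp_hom {x y t : L.fib a} (u : x ⟶ y) (v : y ⟶ t) :
    (embComp L e u v).hom =
      𝟙 _ ⊗≫ u ◁ (unitExt L e (v ≫ L.unitApp a t)).hom ⊗≫ 𝟙 _ := by
  simp only [embComp, Iso.trans_hom, Iso.symm_hom, whiskerLeftIso_hom]
  bicategory

theorem embComp_natural {x y t : L.fib a} {u u' : x ⟶ y} {v v' : y ⟶ t} (φ : u ⟶ u')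
    (ψ : v ⟶ v') :
    star₂ L e (φ ▷ L.unitApp a y) (ψ ▷ L.unitApp a t) ≫ (embComp L e u' v').hom =
      (embComp L e u v).hom ≫ (φ ▷ v ≫ u' ◁ ψ) ▷ L.unitApp a t := by
  have h := unitExt_natural L e (ψ ▷ L.unitApp a t)
  calc
    _ = 𝟙 _ ⊗≫ φ ▷ (L.unitApp a y ≫ ext L e (v ≫ L.unitApp a t)) ⊗≫
        u' ◁ (L.unitApp a y ◁ ext₂ L e (ψ ▷ L.unitApp a t) ≫
          (unitExt L e (v' ≫ L.unitApp a t)).hom) ⊗≫ 𝟙 _ := by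
      rw [embComp_hom]; bicategory
    _ = 𝟙 _ ⊗≫ (φ ▷ (L.unitApp a y ≫ ext L e (v ≫ L.unitApp a t)) ≫
        u' ◁ (unitExt L e (v ≫ L.unitApp a t)).hom) ⊗≫ u' ◁ ψ ▷ L.unitApp a t ⊗≫ 𝟙 _ := by
      rw [h]; bicategory
    _ = _ := by
      rw [← whisker_exchange, embComp_hom]; bicategory

/-- The extension comparison in `unitExt_star` for `v` and `w` cancels against its inverse in the
associativity constraint; the other cells match by naturality of `unitExt`. -/
theorem embComp_assoc {x y t s : L.fib a} (u : x ⟶ y) (v : y ⟶ t) (w : t ⟶ s) :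
    star₂ L e (embComp L e u v).hom (𝟙 (w ≫ L.unitApp a s)) ≫ (embComp L e (u ≫ v) w).hom ≫
        (α_ u v w).hom ▷ L.unitApp a s =
      (starAssoc L e e e e (u ≫ L.unitApp a y) (v ≫ L.unitApp a t) (w ≫ L.unitApp a s)).hom ≫
        star₂ L e (𝟙 (u ≫ L.unitApp a y)) (embComp L e v w).hom ≫
        (embComp L e u (v ≫ w)).hom := by
  have h := unitExt_natural L e (embComp L e v w).hom
  have h' := unitExt_star L e e e (v ≫ L.unitApp a t) (w ≫ L.unitApp a s)
  symm
  calc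
    _ = 𝟙 _ ⊗≫ (u ≫ L.unitApp a y) ◁ (extComp L e e e e (v ≫ L.unitApp a t)
          (w ≫ L.unitApp a s)).inv ⊗≫
        u ◁ (L.unitApp a y ◁ ext₂ L e (embComp L e v w).hom ≫
          (unitExt L e ((v ≫ w) ≫ L.unitApp a s)).hom) ⊗≫ 𝟙 _ := by
      rw [starAssoc_hom, embComp_hom L e u, star₂_id_left]; bicategory
    _ = 𝟙 _ ⊗≫ (u ≫ L.unitApp a y) ◁ ((extComp L e e e e (v ≫ L.unitApp a t)
          (w ≫ L.unitApp a s)).inv ≫ (extComp L e e e e (v ≫ L.unitApp a t)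
          (w ≫ L.unitApp a s)).hom) ⊗≫ u ◁ (unitExt L e (v ≫ L.unitApp a t)).hom ▷
          ext L e (w ≫ L.unitApp a s) ⊗≫ u ◁ (embComp L e v w).hom ⊗≫ 𝟙 _ := by
      rw [h, h']; bicategory
    _ = _ := by
      rw [Iso.inv_hom_id, embComp_hom, embComp_hom, embComp_hom, star₂_id_right]; bicategory

theorem embComp_id_left {x y : L.fib a} (u : x ⟶ y) :
    (embComp L e (𝟙 x) u).hom ≫ (λ_ u).hom ▷ L.unitApp a y =
      star₂ L e (λ_ (L.unitApp a x)).hom (𝟙 (u ≫ L.unitApp a y)) ≫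
        (starLeft L e (u ≫ L.unitApp a y)).hom := by
  rw [embComp_hom, star₂_id_right]
  simp only [starLeft, Iso.trans_hom]
  bicategory

/-- Here γ from the right unit constraint must become the δ in `embComp`; `gammaTri_unitApp`
provides this. The left unit case is a matter of constraints only. -/
theorem embComp_id_right {x y : L.fib a} (u : x ⟶ y) :
    (embComp L e u (𝟙 y)).hom ≫ (ρ_ u).hom ▷ L.unitApp a y =
      star₂ L e (𝟙 (u ≫ L.unitApp a y)) (λ_ (L.unitApp a y)).hom ≫
        (starRight L e (u ≫ L.unitApp a y)).hom := by
  have h := unitExt_natural L e (λ_ (L.unitApp a y)).hom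
  have h' := gammaTri_unitApp L e y
  symm
  calc
    _ = 𝟙 _ ⊗≫ u ◁ (L.unitApp a y ◁ ext₂ L e (λ_ (L.unitApp a y)).hom ≫
          L.unitApp a y ◁ (gammaTri L e y).hom ≫ (ρ_ _).hom) := by
      rw [star₂_id_left]
      simp only [starRight, Iso.trans_hom, whiskerLeftIso_hom]
      bicategory
    _ = _ := by
      rw [h', h, embComp_hom]; bicategory

end Embedding
end LaxBidiagrams

/-! ### J is a homomorphism -/

namespace LaxBidiagrams

section Embedding

open LaxBidiagramCore LaxBidiagramData Groth

variable {C : Type u₁} [Category.{v₁} C]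
  (L : LaxBidiagram.{v₁, w₂, v₁, v₂, u₁, u₂} (LocallyDiscrete C)) {a : LocallyDiscrete C}

theorem embeddingJ_map₂ {x y : L.fib a} {u u' : x ⟶ y} (φ : u ⟶ u') :
    (embeddingJ L a).map₂ φ =
      vert (X := ⟨a, x⟩) (Y := ⟨a, y⟩) (f := 𝟙 a) (φ ▷ L.unitApp a y) :=
  rfl

theorem embeddingJ_mapId_inv (x : L.fib a) :
    ((embeddingJ L a).mapId x).inv =
      vert (X := ⟨a, x⟩) (Y := ⟨a, x⟩) (f := 𝟙 a) (λ_ (L.unitApp a x)).inv := by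
  refine Hom₂.ext rfl (heq_of_eq ?_)
  change (whiskerLeftIso (L.unitApp a x) (L.xiId (𝟙 a) x).symm ≪⊗≫
        Iso.refl (𝟙 x ≫ L.unitApp a x)).hom =
    L.unitApp a x ◁ (L.xiId (𝟙 a) x).inv ≫ (ρ_ _).hom ≫ (λ_ _).inv
  simp only [bicategoricalIsoComp, Iso.trans_hom, Iso.refl_hom, whiskerLeftIso_hom, Iso.symm_hom]
  bicategory

theorem embeddingJ_mapId_hom (x : L.fib a) :
    ((embeddingJ L a).mapId x).hom =
      vert (X := ⟨a, x⟩) (Y := ⟨a, x⟩) (f := 𝟙 a) (λ_ (L.unitApp a x)).hom := by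
  have h : vert (X := ⟨a, x⟩) (Y := ⟨a, x⟩) (f := 𝟙 a) (λ_ (L.unitApp a x)).inv ≫
      vert (λ_ (L.unitApp a x)).hom = 𝟙 _ := by
    rw [← vert_comp, Iso.inv_hom_id, vert_id]
  exact ((Iso.inv_comp_eq_id _).1
    ((congrArg (· ≫ vert _) (embeddingJ_mapId_inv L x)).trans h)).symm

/-- The comparison cell of the embedding of a fibre over a degenerate triangle of the base. -/
def embTri {r : a ⟶ a} (e : 𝟙 a ≫ 𝟙 a = r) (η : r ≅ 𝟙 a) {x y t : L.fib a} (u : x ⟶ y)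
    (v : y ⟶ t) :
    mk₁ (⟨a, x⟩ : Groth L) ⟨a, t⟩ r (star L e (u ≫ L.unitApp a y) (v ≫ L.unitApp a t)) ≅
      mk₁ (⟨a, x⟩ : Groth L) ⟨a, t⟩ (𝟙 a) ((u ≫ v) ≫ L.unitApp a t) :=
  Groth.isoMk (X := ⟨a, x⟩) (Y := ⟨a, t⟩)
    (U := mk₁ (⟨a, x⟩ : Groth L) ⟨a, t⟩ r (star L e (u ≫ L.unitApp a y) (v ≫ L.unitApp a t)))
    (V := mk₁ (⟨a, x⟩ : Groth L) ⟨a, t⟩ (𝟙 a) ((u ≫ v) ≫ L.unitApp a t)) η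
    (Iso.refl ((((u ≫ L.unitApp a y) ≫ (L.pull (𝟙 a)).map (v ≫ L.unitApp a t)) ≫
        chiTo L e t) ≫ L.cell η.hom t) ≪⊗≫
      whiskerLeftIso (u ≫ L.unitApp a y)
        (whiskerRightIso ((L.pull (𝟙 a)).mapComp v (L.unitApp a t))
          (chiTo L e t ≫ L.cell η.hom t)) ≪⊗≫
      whiskerLeftIso ((u ≫ L.unitApp a y) ≫ (L.pull (𝟙 a)).map v) (gammaCell L e η.hom t) ≪⊗≫
      whiskerLeftIso u (L.unitNat a v).symm ≪⊗≫
      Iso.refl ((u ≫ v) ≫ L.unitApp a t))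

theorem embTri_rfl {x y t : L.fib a} (u : x ⟶ y) (v : y ⟶ t) :
    embTri L rfl (ρ_ (𝟙 a)) u v = ((embeddingJ L a).mapComp u v).symm := by
  have h : gammaCell L rfl (ρ_ (𝟙 a)).hom t = L.gamma (𝟙 a) t :=
    whiskerLeftIso_cellEq_trans L _ _ _
  unfold embTri
  rw [h]
  rfl

/-- Dropping the identity cell leaves the pasting of γ with the naturality of the unit, and
`unitExt_comp_unitApp` identifies it with `embComp`. -/
theorem embTri_endo (e : 𝟙 a ≫ 𝟙 a = 𝟙 a) (η : 𝟙 a ≅ 𝟙 a) {x y t : L.fib a} (u : x ⟶ y)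
    (v : y ⟶ t) :
    (embTri L e η u v).hom =
      vert (X := ⟨a, x⟩) (Y := ⟨a, t⟩) (f := 𝟙 a) (embComp L e u v).hom := by
  refine cellEq_fiber (Subsingleton.elim _ _ : η.hom = 𝟙 (𝟙 a)) ?_
  have h₂ : (L.cellEq (Subsingleton.elim _ _ : η.hom = 𝟙 (𝟙 a)) t).hom ≫
      (L.xiId (𝟙 a) t).inv = (cellEndo L η.hom t).hom := rfl
  calc
    _ = (((u ≫ L.unitApp a y) ◁ ((L.pull (𝟙 a)).mapComp v (L.unitApp a t)).hom) ▷ chiTo L e t) ▷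
          L.cell η.hom t ⊗≫ (((u ≫ L.unitApp a y) ≫ (L.pull (𝟙 a)).map v ≫
            (L.pull (𝟙 a)).map (L.unitApp a t)) ≫ chiTo L e t) ◁ (cellEndo L η.hom t).hom ⊗≫
        u ◁ ((L.unitApp a y ≫ (L.pull (𝟙 a)).map v) ◁ (gammaTri L e t).hom ⊗≫
          (L.unitNat a v).inv) ⊗≫ 𝟙 ((u ≫ v) ≫ L.unitApp a t) := by
      change Hom₂.fiber (X := ⟨a, x⟩) (Y := ⟨a, t⟩)
        (U := mk₁ (⟨a, x⟩ : Groth L) ⟨a, t⟩ (𝟙 a)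
          (star L e (u ≫ L.unitApp a y) (v ≫ L.unitApp a t)))
        (V := mk₁ (⟨a, x⟩ : Groth L) ⟨a, t⟩ (𝟙 a) ((u ≫ v) ≫ L.unitApp a t))
        (embTri L e η u v).hom = _
      simp only [embTri, Groth.isoMk, Iso.symm_hom, bicategoricalIsoComp, Iso.trans_hom,
          Iso.refl_hom, whiskerLeftIso_hom, whiskerRightIso_hom, gammaCell_endo]
      bicategory
    _ = 𝟙 (star L e (u ≫ L.unitApp a y) (v ≫ L.unitApp a t) ≫ L.cell η.hom t) ⊗≫
        ((((u ≫ L.unitApp a y) ◁ ((L.pull (𝟙 a)).mapComp v (L.unitApp a t)).hom) ▷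
          chiTo L e t) ▷ L.cell η.hom t ≫ (((u ≫ L.unitApp a y) ≫ (L.pull (𝟙 a)).map v ≫
            (L.pull (𝟙 a)).map (L.unitApp a t)) ≫ chiTo L e t) ◁ (cellEndo L η.hom t).hom ≫
            (ρ_ _).hom) ⊗≫
        u ◁ ((L.unitApp a y ≫ (L.pull (𝟙 a)).map v) ◁ (gammaTri L e t).hom ⊗≫
          (L.unitNat a v).inv) ⊗≫ 𝟙 ((u ≫ v) ≫ L.unitApp a t) := by
      bicategory
    _ = (star L e (u ≫ L.unitApp a y) (v ≫ L.unitApp a t)) ◁ (cellEndo L η.hom t).hom ≫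
        (ρ_ _).hom ≫ (embComp L e u v).hom := by
      rw [embComp_hom, unitExt_comp_unitApp, whiskerRight_drop]
      bicategory
    _ = _ := by
      rw [← h₂]
      simp only [vert, Bicategory.whiskerLeft_comp, Category.assoc]
      rfl

theorem embTri_natural {r : a ⟶ a} (e : 𝟙 a ≫ 𝟙 a = r) (η : r ≅ 𝟙 a) {x y t : L.fib a}
    {u u' : x ⟶ y} {v v' : y ⟶ t} (φ : u ⟶ u') (ψ : v ⟶ v') :
    hcompTo (X := (⟨a, x⟩ : Groth L)) (Y := ⟨a, y⟩) (Z := ⟨a, t⟩) e e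
        (vert (φ ▷ L.unitApp a y)) (vert (ψ ▷ L.unitApp a t)) ≫ (embTri L e η u' v').hom =
      (embTri L e η u v).hom ≫ vert ((φ ▷ v ≫ u' ◁ ψ) ▷ L.unitApp a t) := by
  obtain rfl : r = 𝟙 a := LocallyDiscrete.eq_of_hom η.hom
  have h := congrArg (vert (X := (⟨a, x⟩ : Groth L)) (Y := ⟨a, t⟩) (f := 𝟙 a))
    (embComp_natural L e φ ψ)
  rw [vert_comp, vert_comp] at h
  rw [embTri_endo, embTri_endo, hcompTo_vert]
  exact h

theorem embTri_assoc {r m₀ m₁ : a ⟶ a} (e : 𝟙 a ≫ 𝟙 a = r) (em₀ : 𝟙 a ≫ r = m₀)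
    (em₁ : r ≫ 𝟙 a = m₁) (η : r ≅ 𝟙 a) (θ : m₀ ≅ m₁) {x y t s : L.fib a} (u : x ⟶ y)
    (v : y ⟶ t) (w : t ⟶ s) :
    hcompTo (X := (⟨a, x⟩ : Groth L)) (Y := ⟨a, t⟩) (Z := ⟨a, s⟩) em₁ e
        (embTri L e η u v).hom (𝟙 (mk₁ ⟨a, t⟩ ⟨a, s⟩ (𝟙 a) (w ≫ L.unitApp a s))) ≫
        (embTri L e η (u ≫ v) w).hom ≫ vert ((α_ u v w).hom ▷ L.unitApp a s) =
      (assocTet (X := (⟨a, x⟩ : Groth L)) (Y := ⟨a, y⟩) (Z := ⟨a, t⟩) (T := ⟨a, s⟩) e e em₀ em₁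
        θ (u ≫ L.unitApp a y) (v ≫ L.unitApp a t) (w ≫ L.unitApp a s)).hom ≫
        hcompTo (X := (⟨a, x⟩ : Groth L)) (Y := ⟨a, y⟩) (Z := ⟨a, s⟩) em₀ e
          (𝟙 (mk₁ ⟨a, x⟩ ⟨a, y⟩ (𝟙 a) (u ≫ L.unitApp a y))) (embTri L e η v w).hom ≫
        (embTri L e η u (v ≫ w)).hom := by
  obtain rfl : r = 𝟙 a := LocallyDiscrete.eq_of_hom η.hom
  obtain rfl : m₀ = m₁ := LocallyDiscrete.eq_of_hom θ.hom
  obtain rfl : 𝟙 a = m₀ := e.symm.trans em₀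
  have h := congrArg (vert (X := (⟨a, x⟩ : Groth L)) (Y := ⟨a, s⟩) (f := 𝟙 a))
    (embComp_assoc L e u v w)
  rw [vert_comp, vert_comp, vert_comp, vert_comp] at h
  rw [embTri_endo, embTri_endo, embTri_endo, embTri_endo, assocTet_endo, ← vert_id, ← vert_id,
    hcompTo_vert, hcompTo_vert]
  exact h

theorem embTri_id_left {r : a ⟶ a} (e : 𝟙 a ≫ 𝟙 a = r) (η : r ≅ 𝟙 a) {x y : L.fib a}
    (u : x ⟶ y) :
    (embTri L e η (𝟙 x) u).hom ≫ vert ((λ_ u).hom ▷ L.unitApp a y) =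
      hcompTo (X := (⟨a, x⟩ : Groth L)) (Y := ⟨a, x⟩) (Z := ⟨a, y⟩) e e
        (vert (λ_ (L.unitApp a x)).hom) (𝟙 (mk₁ ⟨a, x⟩ ⟨a, y⟩ (𝟙 a) (u ≫ L.unitApp a y))) ≫
      (leftTri (X := (⟨a, x⟩ : Groth L)) (Y := ⟨a, y⟩) e η (u ≫ L.unitApp a y)).hom := by
  obtain rfl : r = 𝟙 a := LocallyDiscrete.eq_of_hom η.hom
  have h := congrArg (vert (X := (⟨a, x⟩ : Groth L)) (Y := ⟨a, y⟩) (f := 𝟙 a))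
    (embComp_id_left L e u)
  rw [vert_comp, vert_comp] at h
  rw [embTri_endo, leftTri_endo, ← vert_id, hcompTo_vert]
  exact h

theorem embTri_id_right {r : a ⟶ a} (e : 𝟙 a ≫ 𝟙 a = r) (η : r ≅ 𝟙 a) {x y : L.fib a}
    (u : x ⟶ y) :
    (embTri L e η u (𝟙 y)).hom ≫ vert ((ρ_ u).hom ▷ L.unitApp a y) =
      hcompTo (X := (⟨a, x⟩ : Groth L)) (Y := ⟨a, y⟩) (Z := ⟨a, y⟩) e e
        (𝟙 (mk₁ ⟨a, x⟩ ⟨a, y⟩ (𝟙 a) (u ≫ L.unitApp a y))) (vert (λ_ (L.unitApp a y)).hom) ≫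
      (rightTri (X := (⟨a, x⟩ : Groth L)) (Y := ⟨a, y⟩) e η (u ≫ L.unitApp a y)).hom := by
  obtain rfl : r = 𝟙 a := LocallyDiscrete.eq_of_hom η.hom
  have h := congrArg (vert (X := (⟨a, x⟩ : Groth L)) (Y := ⟨a, y⟩) (f := 𝟙 a))
    (embComp_id_right L e u)
  rw [vert_comp, vert_comp] at h
  rw [embTri_endo, rightTri_endo, ← vert_id, hcompTo_vert]
  exact h

theorem embeddingJ_map₂_id {x y : L.fib a} (u : x ⟶ y) :
    (embeddingJ L a).map₂ (𝟙 u) = 𝟙 ((embeddingJ L a).map u) := by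
  rw [embeddingJ_map₂, id_whiskerRight, vert_id]
  rfl

theorem embeddingJ_map₂_hcomp {x y t : L.fib a} {u u' : x ⟶ y} {v v' : y ⟶ t} (φ : u ⟶ u')
    (ψ : v ⟶ v') :
    (embeddingJ L a).map₂ (φ ▷ v ≫ u' ◁ ψ) = ((embeddingJ L a).mapComp u v).hom ≫
      (hcomp ((embeddingJ L a).map₂ φ) ((embeddingJ L a).map₂ ψ) :
        (embeddingJ L a).map u ≫ (embeddingJ L a).map v ⟶
          (embeddingJ L a).map u' ≫ (embeddingJ L a).map v') ≫
      ((embeddingJ L a).mapComp u' v').inv := by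
  have h := embTri_natural L rfl (ρ_ (𝟙 a)) φ ψ
  rw [embTri_rfl, embTri_rfl] at h
  exact (Iso.inv_comp_eq _).1 h.symm

variable (a) in
/-- `J` is a homomorphism of bicategories. -/
theorem embeddingJ_isHomomorphism : (embeddingJ L a).IsHomomorphism where
  map₂_id u := embeddingJ_map₂_id L u
  map₂_comp {x y u v w} φ ψ := by
    rw [embeddingJ_map₂, comp_whiskerRight, vert_comp]
    rfl
  map₂_whisker_left {x y t} u v v' ψ := by
    have h := embeddingJ_map₂_hcomp L (𝟙 u) ψ
    rw [id_whiskerRight, Category.id_comp, embeddingJ_map₂_id] at h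
    exact h
  map₂_whisker_right {x y t u u'} φ v := by
    have h := embeddingJ_map₂_hcomp L φ (𝟙 v)
    rw [Bicategory.whiskerLeft_id, Category.comp_id, embeddingJ_map₂_id] at h
    exact h
  map₂_associator {x y t s} u v w := by
    have h := embTri_assoc L rfl rfl rfl (ρ_ (𝟙 a)) (α_ _ _ _).symm u v w
    rw [embTri_rfl, embTri_rfl, embTri_rfl, embTri_rfl, assocTet_rfl] at h
    have h' : ((embeddingJ L a).mapComp u v).inv ▷ (embeddingJ L a).map w ≫
        ((embeddingJ L a).mapComp (u ≫ v) w).inv ≫ (embeddingJ L a).map₂ (α_ u v w).hom =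
      (α_ ((embeddingJ L a).map u) ((embeddingJ L a).map v) ((embeddingJ L a).map w)).hom ≫
        (embeddingJ L a).map u ◁ ((embeddingJ L a).mapComp v w).inv ≫
        ((embeddingJ L a).mapComp u (v ≫ w)).inv := h
    rw [← h']
    simp
  map₂_left_unitor {x y} u := by
    have h := embTri_id_left L rfl (ρ_ (𝟙 a)) u
    rw [embTri_rfl, ← embeddingJ_mapId_hom] at h
    -- The constraint of J is taken over the right unitor of `𝟙 a` and the left unitor of the
    -- bicategory over the left one; in a locally discrete base they are the same 2-cell.
    have h₂ : leftTri (X := (⟨a, x⟩ : Groth L)) (Y := ⟨a, y⟩) rfl (ρ_ (𝟙 a))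
      (u ≫ L.unitApp a y) = _ := leftTri_rfl (X := (⟨a, x⟩ : Groth L)) (Y := ⟨a, y⟩) _ _
    rw [h₂] at h
    have h' : ((embeddingJ L a).mapComp (𝟙 x) u).inv ≫ (embeddingJ L a).map₂ (λ_ u).hom =
      ((embeddingJ L a).mapId x).hom ▷ (embeddingJ L a).map u ≫
        (λ_ ((embeddingJ L a).map u)).hom := h
    exact (Iso.inv_comp_eq _).1 h'
  map₂_right_unitor {x y} u := by
    have h := embTri_id_right L rfl (ρ_ (𝟙 a)) u
    rw [embTri_rfl, ← embeddingJ_mapId_hom, rightTri_rfl] at h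
    have h' : ((embeddingJ L a).mapComp u (𝟙 y)).inv ≫ (embeddingJ L a).map₂ (ρ_ u).hom =
      (embeddingJ L a).map u ◁ ((embeddingJ L a).mapId y).hom ≫
        (ρ_ ((embeddingJ L a).map u)).hom := h
    exact (Iso.inv_comp_eq _).1 h'

end Embedding
end LaxBidiagrams

/-! ### The cells of the transformations 1 ⇒ KJ and JK ⇒ 1 -/

namespace LaxBidiagrams

section Transformations

open LaxBidiagramCore LaxBidiagramData Groth

variable {C : Type u₁} [Category.{v₁} C]
  (L : LaxBidiagram.{v₁, w₂, v₁, v₂, u₁, u₂} (LocallyDiscrete C))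

section

variable {a : LocallyDiscrete C} {i : a ⟶ a} (hi : i = 𝟙 a)

/-- The component of the unit at a 1-cell that is equal to an identity. -/
def unitTo (x : L.fib a) : x ⟶ (L.pull i).obj x :=
  match i, hi with
  | _, rfl => L.unitApp a x

/-- The naturality cell of the transformation `1 ⇒ K ∘ J`. -/
def unitToNat (e : i ≫ 𝟙 a = i) {x y : L.fib a} (u : x ⟶ y) :
    unitTo L hi x ≫ ext L e (u ≫ L.unitApp a y) ≅ u ≫ unitTo L hi y :=
  match i, hi, e with
  | _, rfl, e => unitExt L e (u ≫ L.unitApp a y)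

theorem unitToNat_natural (e : i ≫ 𝟙 a = i) {x y : L.fib a} {u v : x ⟶ y} (φ : u ⟶ v) :
    (unitToNat L hi e u).hom ≫ φ ▷ unitTo L hi y =
      unitTo L hi x ◁ ext₂ L e (φ ▷ L.unitApp a y) ≫ (unitToNat L hi e v).hom := by
  subst hi
  exact (unitExt_natural L e _).symm

/-- Naturality of `unitExt` removes the unitor, and `gammaTri_unitApp` exposes γ, which cancels
against the inverse γ in the unit constraint of K. The 1-cell `i` stands for 0_0, which is only
provably an identity. -/
theorem unitToNat_id (e : i ≫ 𝟙 a = i) (x : L.fib a) :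
    unitTo L hi x ◁ ((gammaTri L e x).inv ≫ ext₂ L e (λ_ (L.unitApp a x)).inv) ≫
        (unitToNat L hi e (𝟙 x)).hom = (ρ_ (unitTo L hi x)).hom ≫ (λ_ (unitTo L hi x)).inv := by
  subst hi
  have h := unitExt_natural L e (λ_ (L.unitApp a x)).inv
  have h' := gammaTri_unitApp L e x
  change L.unitApp a x ◁ ((gammaTri L e x).inv ≫ ext₂ L e (λ_ (L.unitApp a x)).inv) ≫
    (unitExt L e (𝟙 x ≫ L.unitApp a x)).hom = (ρ_ (L.unitApp a x)).hom ≫ (λ_ _).inv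
  rw [Bicategory.whiskerLeft_comp, Category.assoc, h, ← h', Category.assoc,
    ← Bicategory.whiskerLeft_comp_assoc, Iso.inv_hom_id]
  simp

/-- By naturality `embComp` leaves the extension, `unitExt_star` produces the extension comparison
that cancels the given inverse, and the definition of `embComp` supplies the cell at `v`. -/
theorem unitToNat_comp (e : i ≫ 𝟙 a = i) (e' : 𝟙 a ≫ 𝟙 a = 𝟙 a) {x y t : L.fib a} (u : x ⟶ y)
    (v : y ⟶ t) :
    unitTo L hi x ◁ ((extComp L e e' e e (u ≫ L.unitApp a y) (v ≫ L.unitApp a t)).inv ≫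
        ext₂ L e (embComp L e' u v).hom) ≫ (unitToNat L hi e (u ≫ v)).hom =
      (α_ _ _ _).inv ≫ (unitToNat L hi e u).hom ▷ ext L e (v ≫ L.unitApp a t) ≫
        (α_ _ _ _).hom ≫ u ◁ (unitToNat L hi e v).hom ≫ (α_ _ _ _).inv := by
  subst hi
  have h := unitExt_natural L e (embComp L e' u v).hom
  have h' := unitExt_star L e e' e (u ≫ L.unitApp a y) (v ≫ L.unitApp a t)
  change L.unitApp a x ◁ ((extComp L e e' e e (u ≫ L.unitApp a y) (v ≫ L.unitApp a t)).inv ≫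
        ext₂ L e (embComp L e' u v).hom) ≫ (unitExt L e ((u ≫ v) ≫ L.unitApp a t)).hom =
      (α_ _ _ _).inv ≫ (unitExt L e (u ≫ L.unitApp a y)).hom ▷ ext L e (v ≫ L.unitApp a t) ≫
        (α_ _ _ _).hom ≫ u ◁ (unitExt L e (v ≫ L.unitApp a t)).hom ≫ (α_ _ _ _).inv
  rw [Bicategory.whiskerLeft_comp, Category.assoc, h, h', ← Category.assoc, ← Category.assoc,
    ← Bicategory.whiskerLeft_comp, Iso.inv_hom_id, embComp_hom]
  bicategory

end

section

variable {a b : LocallyDiscrete C} {l : a ⟶ b} (e : 𝟙 a ≫ l = l)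

/-- Composition of `w ≫ unit` with an identity. -/
def unitStarId {x : L.fib a} {y : L.fib b} (w : x ⟶ (L.pull l).obj y) :
    star L e (w ≫ L.unitApp a ((L.pull l).obj y)) (𝟙 ((L.pull l).obj y)) ≅ w :=
  α_ _ _ _ ≪≫ α_ _ _ _ ≪≫ whiskerLeftIso w (unitExt L e (𝟙 ((L.pull l).obj y))) ≪≫ ρ_ w

theorem unitStarId_hom {x : L.fib a} {y : L.fib b} (w : x ⟶ (L.pull l).obj y) :
    (unitStarId L e w).hom = 𝟙 _ ⊗≫ w ◁ (unitExt L e (𝟙 ((L.pull l).obj y))).hom ⊗≫ 𝟙 w := by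
  simp only [unitStarId, Iso.trans_hom, whiskerLeftIso_hom]
  bicategory

theorem unitStarId_natural {x : L.fib a} {y : L.fib b} {w w' : x ⟶ (L.pull l).obj y}
    (φ : w ⟶ w') :
    star₂ L e (φ ▷ L.unitApp a ((L.pull l).obj y)) (𝟙 (𝟙 ((L.pull l).obj y))) ≫
      (unitStarId L e w').hom = (unitStarId L e w).hom ≫ φ := by
  calc
    _ = 𝟙 _ ⊗≫ (φ ▷ (L.unitApp a ((L.pull l).obj y) ≫ ext L e (𝟙 ((L.pull l).obj y))) ≫
          w' ◁ (unitExt L e (𝟙 ((L.pull l).obj y))).hom) ⊗≫ 𝟙 _ := by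
      rw [unitStarId_hom, star₂_id_right]; bicategory
    _ = _ := by
      rw [← whisker_exchange, unitStarId_hom]; bicategory

theorem unitStarId_star {x t : L.fib a} {y : L.fib b} (e' : 𝟙 a ≫ 𝟙 a = 𝟙 a) (w : x ⟶ t)
    (w' : t ⟶ (L.pull l).obj y) :
    (starAssoc L e' e e e (w ≫ L.unitApp a t) (w' ≫ L.unitApp a ((L.pull l).obj y))
        (𝟙 ((L.pull l).obj y))).inv ≫
        star₂ L e (embComp L e' w w').hom (𝟙 (𝟙 ((L.pull l).obj y))) ≫
        (unitStarId L e (w ≫ w')).hom =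
      𝟙 _ ⊗≫ w ◁ (unitExt L e (star L e (w' ≫ L.unitApp a ((L.pull l).obj y))
        (𝟙 ((L.pull l).obj y)))).hom ⊗≫ w ◁ (unitStarId L e w').hom := by
  have h := unitExt_star L e' e e (w' ≫ L.unitApp a ((L.pull l).obj y)) (𝟙 ((L.pull l).obj y))
  rw [h, starAssoc_inv, embComp_hom, unitStarId_hom, unitStarId_hom, star₂_id_right]
  bicategory

end

section

variable {a b c : LocallyDiscrete C} {k : a ⟶ b} {f : b ⟶ c} {l : a ⟶ c} (e : k ≫ f = l)
  (e' : 𝟙 a ≫ l = l)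

/-- The naturality cell of the transformation `J ∘ K ⇒ 1`, on fibre parts. -/
def counitStar {x : L.fib b} {y : L.fib c} (u : x ⟶ (L.pull f).obj y) :
    star L e (𝟙 ((L.pull k).obj x)) u ≅
      star L e' (ext L e u ≫ L.unitApp a ((L.pull l).obj y)) (𝟙 ((L.pull l).obj y)) :=
  (α_ _ _ _ ≪≫ λ_ (ext L e u)) ≪≫ (unitStarId L e' (ext L e u)).symm

/-- After the invertible `unitStarId` the naturality cell becomes a pasting of associativity and
unit constraints. The identities for `counitStar` are all checked after this composition. -/
theorem counitStar_hom {x : L.fib b} {y : L.fib c} (u : x ⟶ (L.pull f).obj y) :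
    (counitStar L e e' u).hom ≫ (unitStarId L e' (ext L e u)).hom = 𝟙 _ ⊗≫ 𝟙 (ext L e u) := by
  simp only [counitStar, Iso.trans_hom, Iso.symm_hom, Category.assoc, Iso.inv_hom_id]
  bicategory

theorem counitStar_natural {x : L.fib b} {y : L.fib c} {u u' : x ⟶ (L.pull f).obj y}
    (φ : u ⟶ u') :
    (counitStar L e e' u).hom ≫ star₂ L e' (ext₂ L e φ ▷ L.unitApp a ((L.pull l).obj y))
        (𝟙 (𝟙 ((L.pull l).obj y))) =
      star₂ L e (𝟙 (𝟙 ((L.pull k).obj x))) φ ≫ (counitStar L e e' u').hom := by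
  rw [← cancel_mono (unitStarId L e' (ext L e u')).hom, Category.assoc, Category.assoc,
    unitStarId_natural, reassoc_of% (counitStar_hom L e e' u), counitStar_hom, star₂_id_left]
  bicategory

theorem counitStar_unit (ek : k ≫ 𝟙 b = k) (ek' : 𝟙 a ≫ k = k) (x : L.fib b) :
    (counitStar L ek ek' (L.unitApp b x)).hom =
      (starRight L ek (𝟙 ((L.pull k).obj x))).hom ≫
        (starLeft L ek' (𝟙 ((L.pull k).obj x))).inv ≫
        star₂ L ek' ((λ_ (L.unitApp a ((L.pull k).obj x))).inv ≫
          (gammaTri L ek x).inv ▷ L.unitApp a ((L.pull k).obj x)) (𝟙 (𝟙 ((L.pull k).obj x))) := by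
  rw [← cancel_mono (unitStarId L ek' (ext L ek (L.unitApp b x))).hom, counitStar_hom]
  have h := unitStarId_natural L ek' (gammaTri L ek x).inv
  have h' : (starLeft L ek' (𝟙 ((L.pull k).obj x))).inv ≫
      star₂ L ek' (λ_ (L.unitApp a ((L.pull k).obj x))).inv (𝟙 _) ≫
      (unitStarId L ek' (𝟙 ((L.pull k).obj x))).hom = 𝟙 _ := by
    rw [Iso.inv_comp_eq, star₂_id_right, unitStarId_hom]
    simp only [starLeft, Iso.trans_hom]
    bicategory
  have h₂ : star₂ L ek' ((λ_ (L.unitApp a ((L.pull k).obj x))).inv ≫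
          (gammaTri L ek x).inv ▷ L.unitApp a ((L.pull k).obj x)) (𝟙 (𝟙 ((L.pull k).obj x))) =
      star₂ L ek' (λ_ (L.unitApp a ((L.pull k).obj x))).inv (𝟙 _) ≫
        star₂ L ek' ((gammaTri L ek x).inv ▷ L.unitApp a ((L.pull k).obj x)) (𝟙 _) := by
    rw [← star₂_comp, Category.comp_id]
  rw [h₂, Category.assoc, Category.assoc, Category.assoc, h, reassoc_of% h', Iso.eq_comp_inv]
  simp only [starRight, Iso.trans_hom, whiskerLeftIso_hom]
  bicategory

end

/-- Everything is compared inside the composite of the two extensions. By `counitStar_hom` the cells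
of `u` and `v` become constraints. The extension comparison from the first associativity constraint
then meets its inverse from the constraint of K. -/
theorem counitStar_comp {a b c d : LocallyDiscrete C} {k : a ⟶ b} {f : b ⟶ c} {g : c ⟶ d}
    {p : a ⟶ c} {q : b ⟶ d} {r : a ⟶ d} (e₁ : k ≫ f = p) (e₂ : f ≫ g = q) (e₃ : p ≫ g = r)
    (e₄ : k ≫ q = r) (ep : 𝟙 a ≫ p = p) (er : 𝟙 a ≫ r = r) (e : 𝟙 a ≫ 𝟙 a = 𝟙 a)
    {x : L.fib b} {y : L.fib c} {t : L.fib d}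
    (u : x ⟶ (L.pull f).obj y) (v : y ⟶ (L.pull g).obj t) :
    (counitStar L e₄ er (star L e₂ u v)).hom =
      (starAssoc L e₁ e₂ e₄ e₃ (𝟙 ((L.pull k).obj x)) u v).inv ≫
      star₂ L e₃ (counitStar L e₁ ep u).hom (𝟙 v) ≫
      (starAssoc L ep e₃ er e₃ (ext L e₁ u ≫ L.unitApp a ((L.pull p).obj y))
        (𝟙 ((L.pull p).obj y)) v).hom ≫
      star₂ L er (𝟙 (ext L e₁ u ≫ L.unitApp a ((L.pull p).obj y)))
        (counitStar L e₃ er v).hom ≫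
      (starAssoc L e er er er (ext L e₁ u ≫ L.unitApp a ((L.pull p).obj y))
        (ext L e₃ v ≫ L.unitApp a ((L.pull r).obj t)) (𝟙 ((L.pull r).obj t))).inv ≫
      star₂ L er ((embComp L e (ext L e₁ u) (ext L e₃ v)).hom ≫
        (extComp L e₁ e₂ e₃ e₄ u v).inv ▷ L.unitApp a ((L.pull r).obj t))
        (𝟙 (𝟙 ((L.pull r).obj t))) := by
  have h₁ := unitStarId_natural L er (extComp L e₁ e₂ e₃ e₄ u v).inv
  have h₂ := unitStarId_star L er e (ext L e₁ u) (ext L e₃ v)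
  have h₃ := unitExt_natural L er (counitStar L e₃ er v).hom
  have h₄ := unitExt_star L ep e₃ er (𝟙 ((L.pull p).obj y)) v
  have h₅ : star₂ L er ((embComp L e (ext L e₁ u) (ext L e₃ v)).hom ≫
        (extComp L e₁ e₂ e₃ e₄ u v).inv ▷ L.unitApp a ((L.pull r).obj t))
        (𝟙 (𝟙 ((L.pull r).obj t))) =
      star₂ L er (embComp L e (ext L e₁ u) (ext L e₃ v)).hom (𝟙 _) ≫
        star₂ L er ((extComp L e₁ e₂ e₃ e₄ u v).inv ▷ L.unitApp a ((L.pull r).obj t))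
        (𝟙 (𝟙 ((L.pull r).obj t))) := by
    rw [← star₂_comp, Category.comp_id]
  have h₆ := counitStar_hom L e₁ ep u
  rw [← cancel_mono (unitStarId L er (ext L e₄ (star L e₂ u v))).hom, counitStar_hom, h₅]
  simp only [Category.assoc]
  rw [h₁, reassoc_of% h₂]
  symm
  calc
    _ = (starAssoc L e₁ e₂ e₄ e₃ (𝟙 ((L.pull k).obj x)) u v).inv ≫
      star₂ L e₃ (counitStar L e₁ ep u).hom (𝟙 v) ≫
      (starAssoc L ep e₃ er e₃ (ext L e₁ u ≫ L.unitApp a ((L.pull p).obj y))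
        (𝟙 ((L.pull p).obj y)) v).hom ⊗≫
        ext L e₁ u ◁ (L.unitApp a _ ◁ ext₂ L er (counitStar L e₃ er v).hom ≫
        (unitExt L er (star L er (ext L e₃ v ≫ L.unitApp a ((L.pull r).obj t))
          (𝟙 ((L.pull r).obj t)))).hom) ⊗≫ ext L e₁ u ◁ (unitStarId L er (ext L e₃ v)).hom ≫
          (extComp L e₁ e₂ e₃ e₄ u v).inv := by
      rw [star₂_id_left]; bicategory
    _ = (starAssoc L e₁ e₂ e₄ e₃ (𝟙 ((L.pull k).obj x)) u v).inv ≫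
      star₂ L e₃ (counitStar L e₁ ep u).hom (𝟙 v) ⊗≫
      (ext L e₁ u ≫ L.unitApp a ((L.pull p).obj y)) ◁
        ((extComp L ep e₃ e₃ er (𝟙 ((L.pull p).obj y)) v).inv ≫
        (extComp L ep e₃ e₃ er (𝟙 ((L.pull p).obj y)) v).hom) ⊗≫
        ext L e₁ u ◁ (unitExt L ep (𝟙 ((L.pull p).obj y))).hom ▷ ext L e₃ v ⊗≫
        ext L e₁ u ◁ ((counitStar L e₃ er v).hom ≫ (unitStarId L er (ext L e₃ v)).hom) ≫
          (extComp L e₁ e₂ e₃ e₄ u v).inv := by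
      rw [h₃, h₄, starAssoc_hom]; bicategory
    _ = (starAssoc L e₁ e₂ e₄ e₃ (𝟙 ((L.pull k).obj x)) u v).inv ⊗≫
      ((counitStar L e₁ ep u).hom ≫ (unitStarId L ep (ext L e₁ u)).hom) ▷ ext L e₃ v ⊗≫
          (extComp L e₁ e₂ e₃ e₄ u v).inv := by
      rw [counitStar_hom, Iso.inv_hom_id, unitStarId_hom, star₂_id_right]; bicategory
    _ = 𝟙 _ ⊗≫ ((extComp L e₁ e₂ e₃ e₄ u v).hom ≫ (extComp L e₁ e₂ e₃ e₄ u v).inv) := by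
      rw [h₆, starAssoc_inv]; bicategory
    _ = _ := by
      rw [Iso.hom_inv_id]

end Transformations
end LaxBidiagrams

/-! ### The transformation 1 ⇒ KJ, and the cells of JK ⇒ 1 -/

namespace LaxBidiagrams

section Transformations

open LaxBidiagramCore LaxBidiagramData Groth

variable {C : Type u₁} [Category.{v₁} C]
  (L : LaxBidiagram.{v₁, w₂, v₁, v₂, u₁, u₂} (LocallyDiscrete C)) {z : C}
  (hz : Limits.IsInitial z)

/-- The homomorphism `J` as a lax functor. -/
abbrev laxJ (a : LocallyDiscrete C) : L.fib a ⥤ᴸ Groth L :=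
  (embeddingJ_isHomomorphism L a).toPseudofunctor.toLax

/-- The homomorphism `K` as a lax functor. -/
abbrev laxK : Groth L ⥤ᴸ L.fib (LocallyDiscrete.mk z) :=
  (retractionK_isHomomorphism L hz).toPseudofunctor.toLax

theorem fromInitial_self : fromInitial hz (LocallyDiscrete.mk z) = 𝟙 (LocallyDiscrete.mk z) :=
  Discrete.ext (hz.hom_ext _ _)

/-- The compatibility of the unit cells with composition, over a free composite `r`, so that it
applies to the actual constraint of J. -/
theorem retractionK_map₂_embTri {r : LocallyDiscrete.mk z ⟶ LocallyDiscrete.mk z}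
    (e : 𝟙 _ ≫ 𝟙 _ = r) (η : r ≅ 𝟙 _)
    {x y t : L.fib (LocallyDiscrete.mk z)} (u : x ⟶ y) (v : y ⟶ t) :
    unitTo L (fromInitial_self hz) x ◁
        ((extComp L (fromInitial_comp hz (𝟙 _)) e (fromInitial_comp hz (𝟙 _))
          (fromInitial_comp hz r) (u ≫ L.unitApp _ y) (v ≫ L.unitApp _ t)).inv ≫
        (retractionK L hz).map₂ (embTri L e η u v).hom) ≫
      (unitToNat L (fromInitial_self hz) (fromInitial_comp hz (𝟙 _)) (u ≫ v)).hom =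
    (α_ _ _ _).inv ≫
      (unitToNat L (fromInitial_self hz) (fromInitial_comp hz (𝟙 _)) u).hom ▷
        ext L (fromInitial_comp hz (𝟙 _)) (v ≫ L.unitApp _ t) ≫ (α_ _ _ _).hom ≫
      u ◁ (unitToNat L (fromInitial_self hz) (fromInitial_comp hz (𝟙 _)) v).hom ≫
        (α_ _ _ _).inv := by
  obtain rfl : r = 𝟙 _ := LocallyDiscrete.eq_of_hom η.hom
  rw [embTri_endo]
  refine Eq.trans ?_ (unitToNat_comp L (fromInitial_self hz) (fromInitial_comp hz (𝟙 _)) e u v)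
  congr 3
  exact retractionK_map₂_vert L hz (X := ⟨_, x⟩) (Y := ⟨_, t⟩) (f := 𝟙 _) (embComp L e u v).hom

/-- The transformation `1 ⇒ K ∘ J`. -/
def unitTrans : Lax.LaxTrans (LaxFunctor.id (L.fib (LocallyDiscrete.mk z)))
    ((laxJ L (LocallyDiscrete.mk z)).comp (laxK L hz)) where
  app x := unitTo L (fromInitial_self hz) x
  naturality u := (unitToNat L (fromInitial_self hz) (fromInitial_comp hz (𝟙 _)) u).hom
  naturality_naturality {x y u v} φ := by
    refine (unitToNat_natural L (fromInitial_self hz) (fromInitial_comp hz (𝟙 _)) φ).trans ?_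
    congr 2
    exact (retractionK_map₂_vert L hz (X := ⟨_, x⟩) (Y := ⟨_, y⟩) (f := 𝟙 _)
      (φ ▷ L.unitApp _ y)).symm
  naturality_id x := by
    have h : (retractionK L hz).map₂ ((embeddingJ L _).mapId x).inv =
        ext₂ L (fromInitial_comp hz (𝟙 _)) (λ_ (L.unitApp _ x)).inv :=
      (congrArg (retractionK L hz).map₂ (embeddingJ_mapId_inv L x)).trans
        (retractionK_map₂_vert L hz (X := ⟨_, x⟩) (Y := ⟨_, x⟩) (f := 𝟙 _) _)
    refine (congrArg (fun κ => unitTo L (fromInitial_self hz) x ◁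
      ((gammaTri L (fromInitial_comp hz (𝟙 _)) x).inv ≫ κ) ≫
      (unitToNat L (fromInitial_self hz) (fromInitial_comp hz (𝟙 _)) (𝟙 x)).hom) h).trans
      ((unitToNat_id L (fromInitial_self hz) (fromInitial_comp hz (𝟙 _)) x).trans ?_)
    -- The source is the identity lax functor, whose unit constraint is an identity 2-cell.
    change _ = (ρ_ (unitTo L (fromInitial_self hz) x)).hom ≫
      (λ_ (unitTo L (fromInitial_self hz) x)).inv ≫ 𝟙 (𝟙 x) ▷ _
    rw [id_whiskerRight, Category.comp_id]
  naturality_comp {x y t} u v := by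
    have h := retractionK_map₂_embTri L hz rfl (ρ_ _) u v
    rw [embTri_rfl] at h
    refine h.trans ?_
    change _ = (α_ _ _ _).inv ≫ _ ≫ (α_ _ _ _).hom ≫ _ ≫
      (α_ u v (unitTo L (fromInitial_self hz) t)).inv ≫ 𝟙 (u ≫ v) ▷ _
    rw [id_whiskerRight, Category.comp_id]
    rfl

section

variable {X Y : Groth L} {a : LocallyDiscrete C} {k : a ⟶ X.base} {f : X.base ⟶ Y.base}
  {l r₁ r₂ : a ⟶ Y.base}

/-- The naturality cell of the transformation `J ∘ K ⇒ 1`. -/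
def counitTri (h₁ : r₁ = l) (h₂ : r₂ = l) (e₁ : k ≫ f = r₁) (e₂ : 𝟙 a ≫ l = r₂) (e : k ≫ f = l)
    (u : X.fiber ⟶ (L.pull f).obj Y.fiber) :
    mk₁ ⟨a, (L.pull k).obj X.fiber⟩ Y r₁ (star L e₁ (𝟙 ((L.pull k).obj X.fiber)) u) ⟶
      mk₁ ⟨a, (L.pull k).obj X.fiber⟩ Y r₂
        (star L e₂ (ext L e u ≫ L.unitApp a ((L.pull l).obj Y.fiber))
          (𝟙 ((L.pull l).obj Y.fiber))) :=
  match r₁, r₂, h₁, h₂ with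
  | _, _, rfl, rfl => vert (counitStar L e₁ e₂ u).hom

theorem counitTri_endo (h : l = l) (e₁ : k ≫ f = l) (e₂ : 𝟙 a ≫ l = l)
    (u : X.fiber ⟶ (L.pull f).obj Y.fiber) :
    counitTri L h h e₁ e₂ e₁ u = vert (counitStar L e₁ e₂ u).hom :=
  rfl

theorem counitTri_natural (h₁ : r₁ = l) (h₂ : r₂ = l) (e₁ : k ≫ f = r₁) (e₂ : 𝟙 a ≫ l = r₂)
    (e : k ≫ f = l) {u u' : X.fiber ⟶ (L.pull f).obj Y.fiber} (φ : u ⟶ u') :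
    counitTri L h₁ h₂ e₁ e₂ e u ≫
        hcompTo (X := ⟨a, (L.pull k).obj X.fiber⟩) (Y := ⟨a, (L.pull l).obj Y.fiber⟩) (Z := Y)
          e₂ e₂ (vert (ext₂ L e φ ▷ L.unitApp a ((L.pull l).obj Y.fiber)))
          (𝟙 (mk₁ ⟨a, (L.pull l).obj Y.fiber⟩ Y l (𝟙 ((L.pull l).obj Y.fiber)))) =
      hcompTo (X := ⟨a, (L.pull k).obj X.fiber⟩) (Y := X) (Z := Y) e₁ e₁
          (𝟙 (mk₁ ⟨a, (L.pull k).obj X.fiber⟩ X k (𝟙 ((L.pull k).obj X.fiber)))) (vert φ) ≫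
        counitTri L h₁ h₂ e₁ e₂ e u' := by
  subst h₁ h₂
  rw [counitTri_endo, counitTri_endo, ← vert_id, ← vert_id, hcompTo_vert, hcompTo_vert,
    ← vert_comp, ← vert_comp, counitStar_natural]

theorem leftTri_endo_inv {X Y : Groth L} {f : X.base ⟶ Y.base} (e : 𝟙 X.base ≫ f = f)
    (η : f ≅ f) (u : X.fiber ⟶ (L.pull f).obj Y.fiber) :
    (leftTri e η u).inv = vert (X := X) (Y := Y) (starLeft L e u).inv := by
  rw [← cancel_epi (leftTri e η u).hom, Iso.hom_inv_id, leftTri_endo, ← vert_comp,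
    Iso.hom_inv_id, vert_id]

theorem assocTet_endo_inv {X Y Z T : Groth L} {f : X.base ⟶ Y.base} {g : Y.base ⟶ Z.base}
    {h : Z.base ⟶ T.base} {q : X.base ⟶ Z.base} {s : Y.base ⟶ T.base} {m : X.base ⟶ T.base}
    (eq : f ≫ g = q) (es : g ≫ h = s) (em₀ : f ≫ s = m) (em₁ : q ≫ h = m) (η : m ≅ m)
    (u : X.fiber ⟶ (L.pull f).obj Y.fiber) (v : Y.fiber ⟶ (L.pull g).obj Z.fiber)
    (w : Z.fiber ⟶ (L.pull h).obj T.fiber) :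
    (assocTet eq es em₀ em₁ η u v w).inv =
      vert (X := X) (Y := T) (starAssoc L eq es em₀ em₁ u v w).inv := by
  rw [← cancel_epi (assocTet eq es em₀ em₁ η u v w).hom, Iso.hom_inv_id, assocTet_endo,
    ← vert_comp, Iso.hom_inv_id, vert_id]

theorem counitTri_id {r₁ r₂ : a ⟶ X.base} (h₁ : r₁ = k) (h₂ : r₂ = k) (e₁ : k ≫ 𝟙 X.base = r₁)
    (e₂ : 𝟙 a ≫ k = r₂) (e : k ≫ 𝟙 X.base = k) (η₁ : r₁ ≅ k) (η₂ : r₂ ≅ k) :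
    counitTri L h₁ h₂ e₁ e₂ e (L.unitApp X.base X.fiber) =
      (rightTri (X := ⟨a, (L.pull k).obj X.fiber⟩) e₁ η₁ (𝟙 ((L.pull k).obj X.fiber))).hom ≫
        (leftTri (X := ⟨a, (L.pull k).obj X.fiber⟩) e₂ η₂ (𝟙 ((L.pull k).obj X.fiber))).inv ≫
        hcompTo (X := ⟨a, (L.pull k).obj X.fiber⟩) (Y := ⟨a, (L.pull k).obj X.fiber⟩) (Z := X)
          e₂ e₂ (vert ((λ_ (L.unitApp a ((L.pull k).obj X.fiber))).inv ≫
            (gammaTri L e X.fiber).inv ▷ L.unitApp a ((L.pull k).obj X.fiber)))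
          (𝟙 (mk₁ ⟨a, (L.pull k).obj X.fiber⟩ X k (𝟙 ((L.pull k).obj X.fiber)))) := by
  subst h₁ h₂
  rw [counitTri_endo, counitStar_unit, rightTri_endo, leftTri_endo_inv, ← vert_id, hcompTo_vert,
    ← vert_comp, ← vert_comp]

-- Every composite of base 1-cells in the compatibility with composition gets its own variable, so
-- that the constraints are the actual ones when the equations are reflexive. Once parallel 1-cells
-- are identified this is `counitStar_comp`.
set_option maxHeartbeats 2000000 in
theorem counitTri_comp {Z : Groth L} {g : Y.base ⟶ Z.base} {q : X.base ⟶ Z.base}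
    {p p₁ p₂ : a ⟶ Y.base} {r p₃ p₄ m₁ m₂ m₃ m₄ m₅ m₆ : a ⟶ Z.base} {w : a ⟶ a}
    (eq : f ≫ g = q) (e₁ : k ≫ f = p) (e₃ : p ≫ g = r) (e₄ : k ≫ q = r)
    (hp₁ : p₁ = p) (hp₂ : p₂ = p) (hp₃ : p₃ = r) (hp₄ : p₄ = r) (hm₁ : m₁ = r)
    (ep₁ : k ≫ f = p₁) (ep₂ : 𝟙 a ≫ p = p₂) (ep₃ : p ≫ g = p₃) (ep₄ : 𝟙 a ≫ r = p₄)
    (em₁ : k ≫ q = m₁) (em₂ : p₁ ≫ g = m₂) (em₃ : p₂ ≫ g = m₃) (em₄ : 𝟙 a ≫ p₃ = m₄)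
    (em₅ : 𝟙 a ≫ p₄ = m₅) (em₆ : w ≫ r = m₆) (ew : 𝟙 a ≫ 𝟙 a = w)
    (ηw : w ≅ 𝟙 a) (η₁ : m₁ ≅ m₂) (η₂ : m₄ ≅ m₃) (η₃ : m₅ ≅ m₆)
    (u : X.fiber ⟶ (L.pull f).obj Y.fiber) (v : Y.fiber ⟶ (L.pull g).obj Z.fiber) :
    counitTri L hm₁ hp₄ em₁ ep₄ e₄ (star L eq u v) =
      (assocTet (X := ⟨a, (L.pull k).obj X.fiber⟩) ep₁ eq em₁ em₂ η₁
        (𝟙 ((L.pull k).obj X.fiber)) u v).inv ≫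
      hcompTo em₂ em₃ (counitTri L hp₁ hp₂ ep₁ ep₂ e₁ u) (𝟙 (mk₁ Y Z g v)) ≫
      (assocTet (X := ⟨a, (L.pull k).obj X.fiber⟩) (Y := ⟨a, (L.pull p).obj Y.fiber⟩)
        ep₂ ep₃ em₄ em₃ η₂ (ext L e₁ u ≫ L.unitApp a ((L.pull p).obj Y.fiber))
        (𝟙 ((L.pull p).obj Y.fiber)) v).hom ≫
      hcompTo (X := ⟨a, (L.pull k).obj X.fiber⟩) (Y := ⟨a, (L.pull p).obj Y.fiber⟩) em₄ em₅
        (𝟙 (mk₁ ⟨a, (L.pull k).obj X.fiber⟩ ⟨a, (L.pull p).obj Y.fiber⟩ (𝟙 a)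
          (ext L e₁ u ≫ L.unitApp a ((L.pull p).obj Y.fiber))))
        (counitTri L hp₃ hp₄ ep₃ ep₄ e₃ v) ≫
      (assocTet (X := ⟨a, (L.pull k).obj X.fiber⟩) (Y := ⟨a, (L.pull p).obj Y.fiber⟩)
        (Z := ⟨a, (L.pull r).obj Z.fiber⟩) ew ep₄ em₅ em₆ η₃
        (ext L e₁ u ≫ L.unitApp a ((L.pull p).obj Y.fiber))
        (ext L e₃ v ≫ L.unitApp a ((L.pull r).obj Z.fiber)) (𝟙 ((L.pull r).obj Z.fiber))).inv ≫
      hcompTo (X := ⟨a, (L.pull k).obj X.fiber⟩) (Y := ⟨a, (L.pull r).obj Z.fiber⟩) em₆ ep₄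
        ((embTri L ew ηw (ext L e₁ u) (ext L e₃ v)).hom ≫
          vert ((extComp L e₁ eq e₃ e₄ u v).inv ▷ L.unitApp a ((L.pull r).obj Z.fiber)))
        (𝟙 (mk₁ ⟨a, (L.pull r).obj Z.fiber⟩ Z r (𝟙 ((L.pull r).obj Z.fiber)))) := by
  obtain rfl : w = 𝟙 a := LocallyDiscrete.eq_of_hom ηw.hom
  subst p₁ p₂ p₃ p₄ m₁
  obtain rfl : r = m₂ := e₃.symm.trans em₂
  obtain rfl : r = m₃ := e₃.symm.trans em₃
  obtain rfl : r = m₄ := ep₄.symm.trans em₄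
  obtain rfl : r = m₅ := ep₄.symm.trans em₅
  obtain rfl : r = m₆ := ep₄.symm.trans em₆
  rw [embTri_endo, counitTri_endo, counitTri_endo, counitTri_endo, assocTet_endo_inv,
    assocTet_endo_inv, assocTet_endo, ← vert_id, ← vert_id, ← vert_id, ← vert_comp, hcompTo_vert,
    hcompTo_vert, hcompTo_vert, ← vert_comp, ← vert_comp, ← vert_comp, ← vert_comp, ← vert_comp]
  exact congrArg _ (counitStar_comp L ep₁ eq e₃ em₁ ep₂ ep₄ ew u v)

end

end Transformations
end LaxBidiagrams

/-! ### The transformation JK ⇒ 1 -/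

namespace LaxBidiagrams

/-- The target of the transformation is the identity lax functor, so its constraints enter the
axioms as whiskered identities. -/
theorem whiskerLeft_id_comp {B : Type u₁} [Bicategory.{w₁, v₁} B] {a b c : B} (p : a ⟶ b)
    {g : b ⟶ c} {h : a ⟶ c} (κ : p ≫ g ⟶ h) : p ◁ 𝟙 g ≫ κ = κ := by
  rw [whiskerLeft_id, Category.id_comp]

section CounitTransformation

open LaxBidiagramCore LaxBidiagramData Groth

variable {C : Type u₁} [Category.{v₁} C]
  (L : LaxBidiagram.{v₁, w₂, v₁, v₂, u₁, u₂} (LocallyDiscrete C)) {z : C}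
  (hz : Limits.IsInitial z)

set_option maxHeartbeats 4000000 in
/-- The transformation `J ∘ K ⇒ 1`. -/
def counitTrans : Lax.LaxTrans ((laxK L hz).comp (laxJ L (LocallyDiscrete.mk z)))
    (LaxFunctor.id (Groth L)) where
  app X := mk₁ ⟨LocallyDiscrete.mk z, (L.pull (fromInitial hz X.base)).obj X.fiber⟩ X
    (fromInitial hz X.base) (𝟙 _)
  naturality {X Y} U := counitTri L (fromInitial_comp hz U.base) (Category.id_comp _) rfl rfl
    (fromInitial_comp hz U.base) U.fiber
  naturality_naturality {X Y U V} Φ := by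
    refine vert_induction (motive := fun U V Φ =>
      counitTri L (fromInitial_comp hz U.base) (Category.id_comp _) rfl rfl
          (fromInitial_comp hz U.base) U.fiber ≫
        ((laxJ L (LocallyDiscrete.mk z)).map₂ ((retractionK L hz).map₂ Φ)) ▷
          mk₁ ⟨LocallyDiscrete.mk z, (L.pull (fromInitial hz Y.base)).obj Y.fiber⟩ Y
            (fromInitial hz Y.base) (𝟙 _) =
      mk₁ ⟨LocallyDiscrete.mk z, (L.pull (fromInitial hz X.base)).obj X.fiber⟩ X
            (fromInitial hz X.base) (𝟙 _) ◁ Φ ≫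
        counitTri L (fromInitial_comp hz V.base) (Category.id_comp _) rfl rfl
          (fromInitial_comp hz V.base) V.fiber) (fun f u u' φ => ?_) Φ
    have h := counitTri_natural L (fromInitial_comp hz f) (Category.id_comp _) rfl rfl
      (fromInitial_comp hz f) φ
    have h' : (laxJ L (LocallyDiscrete.mk z)).map₂ ((retractionK L hz).map₂
        (vert (X := X) (Y := Y) φ)) =
        vert (X := ⟨_, (L.pull (fromInitial hz X.base)).obj X.fiber⟩)
          (Y := ⟨_, (L.pull (fromInitial hz Y.base)).obj Y.fiber⟩)
          (ext₂ L (fromInitial_comp hz f) φ ▷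
            L.unitApp _ ((L.pull (fromInitial hz Y.base)).obj Y.fiber)) :=
      (congrArg (laxJ L (LocallyDiscrete.mk z)).map₂ (retractionK_map₂_vert L hz φ)).trans
        (embeddingJ_map₂ L _)
    rw [h']
    exact h
  naturality_id X := by
    have h := counitTri_id L (fromInitial_comp hz (𝟙 X.base)) (Category.id_comp _) rfl rfl
      (fromInitial_comp hz (𝟙 X.base)) (ρ_ _) (λ_ _)
    rw [leftTri_rfl, rightTri_rfl] at h
    -- The unit constraint of the composite is that of J followed by J applied to that of K, which
    -- is the inverse of γ.
    have hI : ((laxK L hz).comp (laxJ L (LocallyDiscrete.mk z))).mapId X =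
        vert (X := ⟨_, (L.pull (fromInitial hz X.base)).obj X.fiber⟩)
          (Y := ⟨_, (L.pull (fromInitial hz X.base)).obj X.fiber⟩)
          ((λ_ (L.unitApp _ ((L.pull (fromInitial hz X.base)).obj X.fiber))).inv ≫
            (gammaTri L (fromInitial_comp hz (𝟙 X.base)) X.fiber).inv ▷
              L.unitApp _ ((L.pull (fromInitial hz X.base)).obj X.fiber)) := by
      rw [vert_comp]
      exact congrArg (· ≫ _) (embeddingJ_mapId_inv L _)
    rw [hI]
    exact (whiskerLeft_id_comp (mk₁ ⟨_, (L.pull (fromInitial hz X.base)).obj X.fiber⟩ X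
      (fromInitial hz X.base) (𝟙 _)) (g := 𝟙 X) _).trans h
  naturality_comp {X Y Z} U V := by
    have h := counitTri_comp L rfl (fromInitial_comp hz U.base) (fromInitial_comp hz V.base)
      (fromInitial_comp hz (U.base ≫ V.base)) (fromInitial_comp hz U.base) (Category.id_comp _)
      (fromInitial_comp hz V.base) (Category.id_comp _)
      (fromInitial_comp hz (U.base ≫ V.base)) rfl rfl rfl rfl rfl rfl rfl rfl rfl rfl rfl (ρ_ _)
      (α_ _ _ _).symm (α_ _ _ _).symm (α_ _ _ _).symm U.fiber V.fiber
    rw [assocTet_rfl, assocTet_rfl, assocTet_rfl, embTri_rfl] at h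
    exact (whiskerLeft_id_comp (mk₁ ⟨_, (L.pull (fromInitial hz X.base)).obj X.fiber⟩ X
      (fromInitial hz X.base) (𝟙 _)) (g := U ≫ V) _).trans h

end CounitTransformation
end LaxBidiagrams

/-! ### Chains in a finite order and points of a simplex -/

namespace LaxBidiagrams

section Simplices

variable {X Y : Type*} [Fintype X] [Fintype Y]

theorem stdSimplex_map_apply [DecidableEq Y] (f : X → Y) (t : stdSimplex ℝ X) (y : Y) :
    stdSimplex.map f t y = ∑ x with f x = y, t x := by
  rw [stdSimplex.map_coe, FunOnFinite.linearMap_apply_apply]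

theorem stdSimplex_map_apply_of_injective {f : X → Y} (hf : f.Injective) (t : stdSimplex ℝ X)
    (x : X) : stdSimplex.map f t (f x) = t x := by
  classical
  rw [stdSimplex_map_apply, Finset.sum_eq_single x]
  · intro b hb hne
    exact absurd (hf (Finset.mem_filter.1 hb).2) hne
  · intro h
    exact absurd (by simp) h

theorem stdSimplex_map_injective {f : X → Y} (hf : f.Injective) :
    (stdSimplex.map (S := ℝ) f).Injective := by
  intro s t h
  ext x
  rw [← stdSimplex_map_apply_of_injective hf s x, h, stdSimplex_map_apply_of_injective hf]

theorem stdSimplex_map_ne_zero {f : X → Y} {t : stdSimplex ℝ X} {y : Y}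
    (h : stdSimplex.map f t y ≠ 0) : ∃ x, f x = y ∧ t x ≠ 0 := by
  classical
  rw [stdSimplex_map_apply] at h
  obtain ⟨x, hx, hne⟩ := Finset.exists_ne_zero_of_sum_ne_zero h
  exact ⟨x, (Finset.mem_filter.1 hx).2, hne⟩

theorem stdSimplex_map_apply_ne_zero (f : X → Y) {t : stdSimplex ℝ X} {x : X} (h : t x ≠ 0) :
    stdSimplex.map f t (f x) ≠ 0 := by
  classical
  rw [stdSimplex_map_apply]
  have h₁ : t x ≤ ∑ x' with f x' = f x, t x' :=
    Finset.single_le_sum (fun i _ => stdSimplex.zero_le t i)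
      (Finset.mem_filter.2 ⟨Finset.mem_univ x, rfl⟩)
  exact (lt_of_lt_of_le (lt_of_le_of_ne (stdSimplex.zero_le t x) h.symm) h₁).ne'

/-- A point supported on the image of an injection has the restricted coordinates as preimage; they
still sum to 1, because the coordinates outside the image vanish. -/
theorem exists_stdSimplex_map_eq {f : X → Y} (hf : f.Injective) (w : stdSimplex ℝ Y)
    (hw : ∀ y, w y ≠ 0 → y ∈ Set.range f) : ∃ t : stdSimplex ℝ X, stdSimplex.map f t = w := by
  classical
  have hs : ∑ x, w (f x) = 1 := by
    rw [← stdSimplex.sum_eq_one w]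
    refine Fintype.sum_of_injective f hf _ _ (fun y hy => ?_) (fun _ => rfl)
    by_contra h
    exact hy (hw y h)
  refine ⟨⟨fun x => w (f x), fun x => stdSimplex.zero_le w _, hs⟩, ?_⟩
  ext y
  by_cases hy : y ∈ Set.range f
  · obtain ⟨x, rfl⟩ := hy
    exact stdSimplex_map_apply_of_injective hf _ x
  · rw [not_imp_comm.1 (hw y) hy]
    by_contra h
    obtain ⟨x, hx, -⟩ := stdSimplex_map_ne_zero h
    exact hy ⟨x, hx⟩

end Simplices

section Chains

variable {P : Type*} [PartialOrder P] [Fintype P]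

theorem isChain_support_map {m : ℕ} (c : Fin (m + 1) →o P)
    (t : stdSimplex ℝ (Fin (m + 1))) : IsChain (· ≤ ·) {p | stdSimplex.map c t p ≠ 0} := by
  refine c.monotone.isChain_range.mono fun p hp => ?_
  obtain ⟨x, hx, -⟩ := stdSimplex_map_ne_zero hp
  exact ⟨x, hx⟩

/-- A finite chain is a finite linear order. The bound on `k` is what later makes the family of all
chains in a cover finite. -/
theorem exists_orderEmbedding_range_eq {s : Set P} (hs : IsChain (· ≤ ·) s) (hne : s.Nonempty) :
    ∃ (k : ℕ) (_ : k < Fintype.card P) (e : Fin (k + 1) ↪o P), Set.range e = s := by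
  classical
  let _ : LinearOrder s := hs.linearOrder
  have : Nonempty s := hne.to_subtype
  obtain ⟨k, hk⟩ : ∃ k, Fintype.card s = k + 1 :=
    Nat.exists_eq_succ_of_ne_zero Fintype.card_ne_zero
  let i := monoEquivOfFin s hk
  let e : Fin (k + 1) ↪o P := i.toOrderEmbedding.trans (OrderEmbedding.subtype _)
  refine ⟨k, ?_, e, ?_⟩
  · have := Fintype.card_le_of_injective e e.injective
    rwa [Fintype.card_fin] at this
  · ext p
    refine ⟨?_, fun hp => ⟨i.symm ⟨p, hp⟩, ?_⟩⟩
    · rintro ⟨j, rfl⟩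
      exact (i j).2
    · change ((i (i.symm ⟨p, hp⟩) : s) : P) = p
      rw [OrderIso.apply_symm_apply]

theorem stdSimplex_support_nonempty {X : Type*} [Fintype X] (w : stdSimplex ℝ X) :
    {p | w p ≠ 0}.Nonempty := by
  by_contra h
  rw [Set.not_nonempty_iff_eq_empty] at h
  have h₁ := stdSimplex.sum_eq_one w
  rw [Finset.sum_eq_zero fun x _ => by
    by_contra hx
    exact (Set.ext_iff.1 h x).1 hx] at h₁
  exact zero_ne_one h₁

/-- A point of a simplex whose support is a chain lies in the interior of a unique chain. -/
theorem exists_map_orderEmbedding_eq (w : stdSimplex ℝ P) (hw : IsChain (· ≤ ·) {p | w p ≠ 0}) :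
    ∃ (k : ℕ) (_ : k < Fintype.card P) (e : Fin (k + 1) ↪o P) (t : stdSimplex ℝ (Fin (k + 1))),
      Set.range e = {p | w p ≠ 0} ∧ stdSimplex.map e t = w := by
  obtain ⟨k, hk, e, he⟩ := exists_orderEmbedding_range_eq hw (stdSimplex_support_nonempty w)
  obtain ⟨t, ht⟩ := exists_stdSimplex_map_eq e.injective w fun y hy => he ▸ hy
  exact ⟨k, hk, e, t, he, ht⟩

section

variable {Z : Type*} (ρ : ∀ k : ℕ, (Fin (k + 1) →o P) → stdSimplex ℝ (Fin (k + 1)) → Z)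
  (hρ : ∀ {j k : ℕ} (c : Fin (k + 1) →o P) (d : Fin (j + 1) →o Fin (k + 1))
    (t : stdSimplex ℝ (Fin (j + 1))), ρ j (c.comp d) t = ρ k c (stdSimplex.map d t))

include hρ

/-- The value at any point is computed on the chain that supports its image. The point `t` lies
inside a face `i`, on which `c` takes values in that chain; hence `c ∘ i` factors through `e`, and
the compatibility applies once to `i` and once to the factorization. -/
theorem chainMap_eq_of_support {m k : ℕ} (c : Fin (m + 1) →o P) (t : stdSimplex ℝ (Fin (m + 1)))
    (e : Fin (k + 1) ↪o P) (v : stdSimplex ℝ (Fin (k + 1)))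
    (he : Set.range e = {p | stdSimplex.map c t p ≠ 0})
    (hv : stdSimplex.map e v = stdSimplex.map c t) :
    ρ m c t = ρ k (e : Fin (k + 1) →o P) v := by
  obtain ⟨l, -, i, s, hi, hs⟩ := exists_map_orderEmbedding_eq t
    fun a _ b _ _ => le_total a b
  have hc : ∀ j, ∃ j', e j' = c (i j) := fun j => by
    have hj : i j ∈ {p | t p ≠ 0} := hi ▸ ⟨j, rfl⟩
    have : c (i j) ∈ Set.range e := he ▸ stdSimplex_map_apply_ne_zero c hj
    exact this
  choose d hd using hc
  let d' : Fin (l + 1) →o Fin (k + 1) := ⟨d, fun a b hab => by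
    rw [← e.le_iff_le, hd, hd]
    exact c.monotone (i.monotone hab)⟩
  have h₁ : (e : Fin (k + 1) →o P).comp d' = c.comp (i : Fin (l + 1) →o Fin (m + 1)) :=
    OrderHom.ext _ _ (funext hd)
  have h₂ : stdSimplex.map d' s = v := by
    apply stdSimplex_map_injective e.injective
    rw [hv, ← hs, stdSimplex.map_comp_apply, stdSimplex.map_comp_apply]
    exact congrArg (fun f => stdSimplex.map f s) (funext hd)
  rw [← h₂, ← hρ, h₁, hρ]
  exact congrArg _ hs.symm

theorem chainMap_eq_of_map_eq {m m' : ℕ} (c : Fin (m + 1) →o P) (c' : Fin (m' + 1) →o P)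
    (t : stdSimplex ℝ (Fin (m + 1))) (t' : stdSimplex ℝ (Fin (m' + 1)))
    (h : stdSimplex.map c t = stdSimplex.map c' t') : ρ m c t = ρ m' c' t' := by
  obtain ⟨k, -, e, v, he, hv⟩ := exists_map_orderEmbedding_eq _ (isChain_support_map c t)
  rw [chainMap_eq_of_support ρ hρ c t e v he hv,
    chainMap_eq_of_support ρ hρ c' t' e v (h ▸ he) (hv.trans h)]

end

end Chains
end LaxBidiagrams

/-! ### The decomposition of the prism -/

namespace LaxBidiagrams

section Prism

variable {n : ℕ}

/-- The height of a point of the prism. -/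
noncomputable def prismHeight {X : Type*} [Fintype X] (v : stdSimplex ℝ (X × Bool)) :
    unitInterval :=
  ⟨stdSimplex.map Prod.snd v true, stdSimplex.zero_le _ _, stdSimplex.le_one _ _⟩

/-- The comparison of the prism with the product of the simplex and the unit interval. -/
noncomputable def prismProj {X : Type*} [Fintype X] (v : stdSimplex ℝ (X × Bool)) :
    stdSimplex ℝ X × unitInterval :=
  (stdSimplex.map Prod.fst v, prismHeight v)

theorem continuous_prismProj {X : Type*} [Fintype X] : Continuous (prismProj (X := X)) := by
  refine (stdSimplex.continuous_map _).prodMk (Continuous.subtype_mk ?_ _)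
  exact (continuous_apply true).comp
    (continuous_subtype_val.comp (stdSimplex.continuous_map (S := ℝ) (Prod.snd : X × Bool → Bool)))

theorem prismProj_map {X Y : Type*} [Fintype X] [Fintype Y] (f : X → Y)
    (v : stdSimplex ℝ (X × Bool)) : prismProj (stdSimplex.map (Prod.map f id) v) =
      (stdSimplex.map f (prismProj v).1, (prismProj v).2) := by
  refine Prod.ext ?_ (Subtype.ext ?_)
  · change stdSimplex.map _ (stdSimplex.map _ v) = stdSimplex.map _ (stdSimplex.map _ v)
    rw [stdSimplex.map_comp_apply, stdSimplex.map_comp_apply]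
    rfl
  · change stdSimplex.map _ (stdSimplex.map _ v) true = stdSimplex.map _ v true
    rw [stdSimplex.map_comp_apply]
    rfl

theorem prismProj_map_const {X : Type*} [Fintype X] (t : stdSimplex ℝ X) (b : Bool) :
    prismProj (stdSimplex.map (fun x => (x, b)) t) = (t, if b then 1 else 0) := by
  refine Prod.ext ?_ (Subtype.ext ?_)
  · change stdSimplex.map _ (stdSimplex.map _ t) = t
    rw [stdSimplex.map_comp_apply]
    exact stdSimplex.map_id_apply t
  · change stdSimplex.map _ (stdSimplex.map _ t) true = _
    rw [stdSimplex.map_comp_apply, stdSimplex_map_apply]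
    cases b <;> simp

theorem stdSimplex_map_fst_apply {X : Type*} [Fintype X] [DecidableEq X]
    (v : stdSimplex ℝ (X × Bool)) (x : X) :
    stdSimplex.map Prod.fst v x = v (x, true) + v (x, false) := by
  rw [stdSimplex_map_apply, Finset.sum_filter, Fintype.sum_prod_type,
    Finset.sum_eq_single x (fun y _ hy => by simp [hy]) (by simp)]
  simp

theorem prismHeight_eq_sum {X : Type*} [Fintype X] (v : stdSimplex ℝ (X × Bool)) :
    (prismHeight v : ℝ) = ∑ x, v (x, true) := by
  change stdSimplex.map Prod.snd v true = _
  rw [stdSimplex_map_apply, Finset.sum_filter, Fintype.sum_prod_type]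
  simp

/-- The projections fix the weight over each vertex and the total weight at the top. If the top
weights differ, then `v` exceeds `v'` at some `a` and falls below it at some `b`. The chain
condition yields `b ≤ a` for `v` and `a ≤ b` for `v'`, hence `a = b`, a contradiction. -/
theorem prismProj_injOn {v v' : stdSimplex ℝ (Fin (n + 1) × Bool)}
    (hv : IsChain (· ≤ ·) {p | v p ≠ 0}) (hv' : IsChain (· ≤ ·) {p | v' p ≠ 0})
    (h : prismProj v = prismProj v') : v = v' := by
  have h₁ : ∀ i, v (i, true) + v (i, false) = v' (i, true) + v' (i, false) := fun i => by
    have := congrArg (fun p : stdSimplex ℝ (Fin (n + 1)) × unitInterval => p.1 i) h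
    simpa only [prismProj, stdSimplex_map_fst_apply] using this
  have h₂ : ∑ i, v (i, true) = ∑ i, v' (i, true) := by
    rw [← prismHeight_eq_sum, ← prismHeight_eq_sum]
    exact congrArg (fun p : stdSimplex ℝ (Fin (n + 1)) × unitInterval => (p.2 : ℝ)) h
  have key : ∀ (w : stdSimplex ℝ (Fin (n + 1) × Bool)), IsChain (· ≤ ·) {p | w p ≠ 0} →
      ∀ a b : Fin (n + 1), w (a, true) ≠ 0 → w (b, false) ≠ 0 → b ≤ a := fun w hw a b ha hb => by
    rcases hw.total ha hb with h | h
    · exact absurd (show true ≤ false from h.2) (by simp)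
    · exact h.1
  have h₃ : ∀ i, v (i, true) = v' (i, true) := by
    by_contra hne
    have hs : ∑ i, (v (i, true) - v' (i, true)) = 0 := by
      rw [Finset.sum_sub_distrib, h₂, sub_self]
    have hex : ∃ i ∈ Finset.univ, v (i, true) - v' (i, true) ≠ 0 := by
      push Not at hne
      obtain ⟨i, hi⟩ := hne
      exact ⟨i, Finset.mem_univ i, sub_ne_zero.2 hi⟩
    obtain ⟨a, -, ha⟩ := Finset.exists_pos_of_sum_zero_of_exists_nonzero _ hs hex
    obtain ⟨b, -, hb⟩ := Finset.exists_pos_of_sum_zero_of_exists_nonzero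
      (fun i => v' (i, true) - v (i, true)) (by
        rw [Finset.sum_sub_distrib, h₂, sub_self]) (by
        obtain ⟨i, hi, hi'⟩ := hex
        exact ⟨i, hi, fun h0 => hi' (by linarith)⟩)
    have p₁ : v (a, true) ≠ 0 := by linarith [stdSimplex.zero_le v' (a, true)] |> ne_of_gt
    have p₂ : v' (a, false) ≠ 0 :=
      ne_of_gt (by linarith [stdSimplex.zero_le v (a, false), h₁ a])
    have p₃ : v' (b, true) ≠ 0 := ne_of_gt (by linarith [stdSimplex.zero_le v (b, true)])
    have p₄ : v (b, false) ≠ 0 :=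
      ne_of_gt (by linarith [stdSimplex.zero_le v' (b, false), h₁ b])
    have hab : a = b := le_antisymm (key v' hv' b a p₃ p₂) (key v hv a b p₁ p₄)
    subst hab
    linarith
  ext ⟨i, b⟩
  cases b
  · linarith [h₁ i, h₃ i]
  · exact h₃ i

/-- The weights of `t` are laid end to end as intervals in [0, 1], and the segment is cut at 1 - s.
The part of each interval before the cut is placed at the bottom and the part after it at the top.
At most one interval is cut in its interior, so the support is a chain. -/
theorem exists_isChain_prismProj_eq (q : stdSimplex ℝ (Fin (n + 1)) × unitInterval) :
    ∃ v : stdSimplex ℝ (Fin (n + 1) × Bool), IsChain (· ≤ ·) {p | v p ≠ 0} ∧ prismProj v = q := by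
  obtain ⟨t, s⟩ := q
  -- The left end of the interval that belongs to vertex `k`.
  let T : ℕ → ℝ := fun k => ∑ j : Fin (n + 1) with j.val < k, t j
  have hT : ∀ i : Fin (n + 1), T (i + 1) = T i + t i := fun i => by
    have : Finset.univ.filter (fun j : Fin (n + 1) => j.val < i + 1) =
        insert i (Finset.univ.filter fun j : Fin (n + 1) => j.val < i) := by
      ext j
      simp [Fin.ext_iff]
      omega
    simp only [T]
    rw [this, Finset.sum_insert (by simp), add_comm]
  have hT0 : T 0 = 0 := by simp [T]
  have hT1 : T (n + 1) = 1 := by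
    simp only [T]
    rw [Finset.filter_true_of_mem (fun j _ => j.2), stdSimplex.sum_eq_one]
  have hm : Monotone T := fun k l hkl => Finset.sum_le_sum_of_subset_of_nonneg
    (Finset.monotone_filter_right _ fun j _ hj => lt_of_lt_of_le hj hkl)
    fun j _ _ => stdSimplex.zero_le t j
  let a : ℝ := 1 - s
  have ha0 : 0 ≤ a := by simpa [a] using s.2.2
  have ha1 : a ≤ 1 := by simpa [a] using s.2.1
  -- The difference of the minima is the length of the part of the interval from `T i` to `T (i +
  -- 1)` that lies before `a`.
  let v : Fin (n + 1) × Bool → ℝ := fun p =>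
    if p.2 then t p.1 - (min (T (p.1 + 1)) a - min (T p.1) a) else min (T (p.1 + 1)) a - min (T p.1) a
  have hf : ∀ i, v (i, false) = min (T (i + 1)) a - min (T i) a := fun i => rfl
  have ht : ∀ i, v (i, true) = t i - (min (T (i + 1)) a - min (T i) a) := fun i => rfl
  have hsum : ∑ i, v (i, false) = a := by
    have := Finset.sum_range_sub (fun k => min (T k) a) (n + 1)
    rw [hT0, hT1, min_eq_right ha1, min_eq_left ha0, sub_zero,
      ← Fin.sum_univ_eq_sum_range (fun k => min (T (k + 1)) a - min (T k) a)] at this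
    exact this
  have hsum' : ∑ i, v (i, true) = s := by
    have : ∑ i, v (i, true) = ∑ i, t i - ∑ i, v (i, false) := by
      rw [← Finset.sum_sub_distrib]
      rfl
    rw [this, hsum, stdSimplex.sum_eq_one]
    simp [a]
  have hv : v ∈ stdSimplex ℝ (Fin (n + 1) × Bool) := by
    refine ⟨?_, ?_⟩
    · rintro ⟨i, b⟩
      have h₁ := hT i
      have h₂ := stdSimplex.zero_le t i
      cases b
      · rw [hf]
        exact sub_nonneg.2 (min_le_min_right _ (by linarith))
      · rw [ht, h₁]
        rcases le_total (T i) a with h | h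
        · rw [min_eq_left h]
          linarith [min_le_left (T i + t i) a]
        · rw [min_eq_right h, min_eq_right (by linarith)]
          linarith
    · rw [Fintype.sum_prod_type]
      simp only [Fintype.sum_bool]
      rw [Finset.sum_add_distrib, hsum, hsum']
      simp [a]
  -- A vertex with weight at the top ends beyond the cut, so every later interval lies entirely
  -- after it.
  have key : ∀ i j : Fin (n + 1), i < j → v (i, true) ≠ 0 → v (j, false) = 0 := fun i j hij hi => by
    have h₁ : a ≤ T (i + 1) := by
      by_contra h
      push Not at h
      apply hi
      rw [ht, min_eq_left h.le, min_eq_left (by linarith [hT i, stdSimplex.zero_le t i]), hT i]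
      ring
    have h₂ : T (i + 1) ≤ T j := hm hij
    have h₃ : T j ≤ T (j + 1) := hm (Nat.le_succ _)
    rw [hf, min_eq_right (by linarith), min_eq_right (by linarith), sub_self]
  refine ⟨⟨v, hv⟩, ?_, ?_⟩
  · have main : ∀ i j : Fin (n + 1), ∀ b b' : Bool, i < j → v (i, b) ≠ 0 → v (j, b') ≠ 0 →
        (i, b) ≤ (j, b') := fun i j b b' hij hi hj => by
      refine ⟨hij.le, ?_⟩
      cases b
      · exact Bool.false_le b'
      · cases b'
        · exact absurd (key i j hij hi) hj
        · exact le_rfl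
    rintro ⟨i, b⟩ hi ⟨j, b'⟩ hj -
    rcases lt_trichotomy i j with h | rfl | h
    · exact Or.inl (main i j b b' h hi hj)
    · rcases le_total b b' with h | h
      · exact Or.inl ⟨le_rfl, h⟩
      · exact Or.inr ⟨le_rfl, h⟩
    · exact Or.inr (main j i b' b h hj hi)
  · refine Prod.ext ?_ (Subtype.ext ?_)
    · ext i
      change stdSimplex.map Prod.fst _ i = t i
      rw [stdSimplex_map_fst_apply]
      change v (i, true) + v (i, false) = t i
      rw [ht, hf]
      ring
    · exact (prismHeight_eq_sum _).trans hsum'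

end Prism
end LaxBidiagrams

/-! ### Gluing of continuous maps -/

namespace LaxBidiagrams

/-- Compatible continuous maps on a finite compact cover of a Hausdorff space glue. -/
theorem exists_desc_compact_cover {ι : Type*} [Finite ι] {A : ι → Type*}
    [∀ i, TopologicalSpace (A i)] [∀ i, CompactSpace (A i)] {W Z : Type*} [TopologicalSpace W]
    [T2Space W] [TopologicalSpace Z] (q : ∀ i, C(A i, W)) (g : ∀ i, C(A i, Z))
    (hs : ∀ w, ∃ i a, q i a = w) (hc : ∀ i j a b, q i a = q j b → g i a = g j b) :
    ∃ f : C(W, Z), ∀ i a, f (q i a) = g i a := by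
  let Q : C(Sigma A, W) := ⟨fun x => q x.1 x.2, continuous_sigma fun i => (q i).continuous⟩
  let G : C(Sigma A, Z) := ⟨fun x => g x.1 x.2, continuous_sigma fun i => (g i).continuous⟩
  have hQ : Topology.IsQuotientMap Q := Q.continuous.isClosedMap.isQuotientMap Q.continuous
    fun w => (hs w).elim fun i ⟨a, h⟩ => ⟨⟨i, a⟩, h⟩
  have hG : Function.FactorsThrough G Q := fun x y h => hc _ _ _ _ h
  exact ⟨hQ.lift G hG, fun i a => DFunLike.congr_fun (hQ.lift_comp G hG) ⟨i, a⟩⟩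

section ChainGluing

variable {P : Type*} [PartialOrder P] [Fintype P] {W : Type*} [TopologicalSpace W] (π : C(stdSimplex ℝ P, W))
  (hinj : ∀ v v' : stdSimplex ℝ P, IsChain (· ≤ ·) {p | v p ≠ 0} →
    IsChain (· ≤ ·) {p | v' p ≠ 0} → π v = π v' → v = v')
  (hsurj : ∀ w, ∃ v : stdSimplex ℝ P, IsChain (· ≤ ·) {p | v p ≠ 0} ∧ π v = w)

include hsurj

theorem exists_chain_map_eq (w : W) : ∃ (k : ℕ) (_ : k < Fintype.card P) (c : Fin (k + 1) →o P)
    (t : stdSimplex ℝ (Fin (k + 1))), π (stdSimplex.map c t) = w := by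
  obtain ⟨v, hv, rfl⟩ := hsurj w
  obtain ⟨k, hk, e, t, -, rfl⟩ := exists_map_orderEmbedding_eq v hv
  exact ⟨k, hk, e, t, rfl⟩

include hinj

/-- A compatible family of maps on the simplices of an order complex glues to a continuous map. -/
theorem exists_desc_chains [T2Space W] {Z : Type*} [TopologicalSpace Z]
    (ρ : ∀ k : ℕ, (Fin (k + 1) →o P) → C(stdSimplex ℝ (Fin (k + 1)), Z))
    (hρ : ∀ {j k : ℕ} (c : Fin (k + 1) →o P) (d : Fin (j + 1) →o Fin (k + 1))
      (t : stdSimplex ℝ (Fin (j + 1))), ρ j (c.comp d) t = ρ k c (stdSimplex.map d t)) :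
    ∃ f : C(W, Z), ∀ (k : ℕ) (c : Fin (k + 1) →o P) (t : stdSimplex ℝ (Fin (k + 1))),
      f (π (stdSimplex.map c t)) = ρ k c t := by
  have hc : ∀ {k k' : ℕ} (c : Fin (k + 1) →o P) (c' : Fin (k' + 1) →o P)
      (t : stdSimplex ℝ (Fin (k + 1))) (t' : stdSimplex ℝ (Fin (k' + 1))),
      π (stdSimplex.map c t) = π (stdSimplex.map c' t') → ρ k c t = ρ k' c' t' :=
    fun c c' t t' h => chainMap_eq_of_map_eq (fun k c t => ρ k c t) hρ c c' t t'
      (hinj _ _ (isChain_support_map c t) (isChain_support_map c' t') h)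
  have hs := exists_chain_map_eq π hsurj
  -- Only the bound on the length of the chains matters; it makes the index set of the cover finite.
  generalize Fintype.card P = N at hs
  have (k : ℕ) : Finite (Fin (k + 1) →o P) := DFunLike.finite _
  obtain ⟨f, hf⟩ := exists_desc_compact_cover
    (ι := Σ k : Fin N, (Fin (k + 1) →o P)) (A := fun κ => stdSimplex ℝ (Fin (κ.1 + 1)))
    (fun κ => π.comp ⟨stdSimplex.map κ.2, stdSimplex.continuous_map _⟩) (fun κ => ρ κ.1 κ.2)
    (fun w => by
      obtain ⟨k, hk, c, t, h⟩ := hs w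
      exact ⟨⟨⟨k, hk⟩, c⟩, t, h⟩)
    (fun i j a b h => hc i.2 j.2 a b h)
  refine ⟨f, fun k c t => ?_⟩
  -- The chain `c` may be too long to belong to the cover, so its point is compared with a
  -- representative on a chain of bounded length.
  obtain ⟨k', hk', c', t', h⟩ := hs (π (stdSimplex.map c t))
  rw [← h]
  exact (hf ⟨⟨k', hk'⟩, c'⟩ t').trans (hc _ _ _ _ h)

end ChainGluing

/-! ### Maps out of a geometric realization -/

section Realization

open Opposite Simplicial

/-- The characteristic map of a simplex of a simplicial set. -/
noncomputable def cellMap (X : SSet.{u}) {n : SimplexCategory} (x : X.obj (op n)) :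
    C(stdSimplex ℝ (Fin (n.len + 1)), SSet.toTop.obj X) :=
  (SSet.toTop.obj X).toSSetObjEquiv (op n) ((sSetTopAdj.unit.app X).app (op n) x)

theorem cellMap_map (X : SSet.{u}) {m n : SimplexCategory} (f : m ⟶ n) (x : X.obj (op n))
    (t : stdSimplex ℝ (Fin (m.len + 1))) :
    cellMap X (X.map f.op x) t = cellMap X x (stdSimplex.map f.toOrderHom t) := by
  unfold cellMap
  have h := ConcreteCategory.congr_hom ((sSetTopAdj.unit.app X).naturality f.op) x
  refine Eq.trans ?_ (TopCat.toSSetObjEquiv_naturality_apply f _ t)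
  exact congrArg (fun y => (SSet.toTop.obj X).toSSetObjEquiv (op m) y t) h

theorem toTop_map_cellMap {X Y : SSet.{u}} (g : X ⟶ Y) {n : SimplexCategory} (x : X.obj (op n))
    (t : stdSimplex ℝ (Fin (n.len + 1))) :
    (SSet.toTop.map g).hom (cellMap X x t) = cellMap Y (g.app (op n) x) t := by
  have h := ConcreteCategory.congr_hom (congrArg (fun (α : X ⟶ _) => α.app (op n))
    (sSetTopAdj.unit.naturality g)) x
  exact congrArg (fun y => (SSet.toTop.obj Y).toSSetObjEquiv (op n) y t) h.symm

/-- A compatible family of maps on simplices is a simplicial map into the singular complex of `Z`,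
and the adjunction turns it into a map from the realization. -/
theorem exists_desc_cellMap (X : SSet.{u}) (Z : TopCat.{u})
    (f : ∀ n : SimplexCategory, X.obj (op n) → C(stdSimplex ℝ (Fin (n.len + 1)), Z))
    (hf : ∀ {m n : SimplexCategory} (d : m ⟶ n) (x : X.obj (op n)) t,
      f m (X.map d.op x) t = f n x (stdSimplex.map d.toOrderHom t)) :
    ∃ F : C(SSet.toTop.obj X, Z), ∀ n (x : X.obj (op n)) t, F (cellMap X x t) = f n x t := by
  let φ : X ⟶ TopCat.toSSet.obj Z :=
    { app n := ↾fun x => (Z.toSSetObjEquiv n).symm (f n.unop x)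
      naturality m n σ := by
        ext x
        apply (Z.toSSetObjEquiv n).injective
        ext t
        refine (congrArg (fun h => h t) ((Z.toSSetObjEquiv n).apply_symm_apply
          (f n.unop (X.map σ x)))).trans ((hf σ.unop x t).trans ?_)
        refine Eq.trans ?_ (TopCat.toSSetObjEquiv_naturality_apply σ.unop _ t).symm
        exact congrArg (fun h => h (stdSimplex.map σ.unop.toOrderHom t))
          ((Z.toSSetObjEquiv m).apply_symm_apply (f m.unop x)).symm }
  refine ⟨((sSetTopAdj.homEquiv X Z).symm φ).hom, fun n x t => ?_⟩
  have h := (sSetTopAdj.homEquiv X Z).apply_symm_apply φ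
  rw [Adjunction.homEquiv_unit] at h
  have h' := ConcreteCategory.congr_hom (congrArg (fun (α : X ⟶ _) => α.app (op n)) h) x
  exact (congrArg (fun y => Z.toSSetObjEquiv (op n) y t) h').trans
    (congrArg (fun h => h t) ((Z.toSSetObjEquiv (op n)).apply_symm_apply (f n x)))

theorem cellMap_ext {X : SSet.{u}} {Z : TopCat.{u}} {F G : C(SSet.toTop.obj X, Z)}
    (h : ∀ n (x : X.obj (op n)) t, F (cellMap X x t) = G (cellMap X x t)) : F = G := by
  have : TopCat.ofHom F = TopCat.ofHom G := by
    apply (sSetTopAdj.homEquiv X Z).injective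
    ext n x
    rw [Adjunction.homEquiv_unit, Adjunction.homEquiv_unit]
    apply (Z.toSSetObjEquiv n).injective
    ext t
    exact h n.unop x t
  exact congrArg TopCat.Hom.hom this

end Realization
end LaxBidiagrams

/-! ### Simplicial homotopies -/

namespace LaxBidiagrams

section SimplicialHomotopies

open Opposite Simplicial

/-- A monotone map between finite ordinals as a morphism of the simplex category. -/
abbrev simplexHom {k : ℕ} {n : SimplexCategory} (c : Fin (k + 1) →o Fin (n.len + 1)) : ⦋k⦌ ⟶ n :=
  SimplexCategory.Hom.mk c

variable {X Y : SSet.{u}}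
  (H : ∀ n : SimplexCategory, X.obj (op n) → (Fin (n.len + 1) →o Bool) → Y.obj (op n))
  (hH : ∀ {m n : SimplexCategory} (d : m ⟶ n) (x : X.obj (op n)) (φ : Fin (n.len + 1) →o Bool),
    H m (X.map d.op x) (φ.comp d.toOrderHom) = Y.map d.op (H n x φ))

include hH

/-- A chain in [n] × [1] consists of a map to [n], along which `x` is restricted, and a map to [1],
which is passed to `H`. Hypothesis `hH` is the compatibility needed for gluing over the chains of
the prism. -/
theorem exists_prismMap (n : SimplexCategory) (x : X.obj (op n)) :
    ∃ f : C(stdSimplex ℝ (Fin (n.len + 1)) × unitInterval, SSet.toTop.obj Y),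
      ∀ (k : ℕ) (c : Fin (k + 1) →o Fin (n.len + 1) × Bool) (t : stdSimplex ℝ (Fin (k + 1))),
        f (prismProj (stdSimplex.map c t)) =
          cellMap Y (H ⦋k⦌ (X.map (simplexHom (OrderHom.fst.comp c)).op x) (OrderHom.snd.comp c)) t := by
  refine exists_desc_chains ⟨prismProj, continuous_prismProj⟩ (fun v v' hv hv' h =>
    prismProj_injOn hv hv' h) exists_isChain_prismProj_eq (fun k c => cellMap Y (H ⦋k⦌
      (X.map (simplexHom (OrderHom.fst.comp c)).op x)
      (OrderHom.snd.comp c))) fun {j k} c d t => ?_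
  let d' : ⦋j⦌ ⟶ ⦋k⦌ := SimplexCategory.Hom.mk d
  refine Eq.trans ?_ (cellMap_map Y d' _ t)
  rw [← hH]
  exact congrArg (fun y => cellMap Y (H ⦋j⦌ y (OrderHom.snd.comp (c.comp d))) t)
    (ConcreteCategory.congr_hom (X.map_comp
      (simplexHom (n := n) (OrderHom.fst.comp c)).op d'.op) x)

/-- A combinatorial homotopy between simplicial maps, given on the simplices of the cylinder,
induces a homotopy of their realizations. -/
theorem homotopic_toTop_map {F G : X ⟶ Y}
    (h₀ : ∀ n x, H n x (OrderHom.const _ false) = F.app (op n) x)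
    (h₁ : ∀ n x, H n x (OrderHom.const _ true) = G.app (op n) x) :
    ContinuousMap.Homotopic (SSet.toTop.map F).hom (SSet.toTop.map G).hom := by
  choose f hf using exists_prismMap H hH
  -- The maps on prisms are natural in the simplex: each point lies on some chain, and a monotone
  -- map sends chains to chains of the same height.
  have hn : ∀ {m n : SimplexCategory} (d : m ⟶ n) (x : X.obj (op n))
      (t : stdSimplex ℝ (Fin (m.len + 1))) (s : unitInterval),
      f m (X.map d.op x) (t, s) = f n x (stdSimplex.map d.toOrderHom t, s) := by
    intro m n d x t s
    obtain ⟨k, -, c, v, h⟩ := exists_chain_map_eq ⟨prismProj, continuous_prismProj⟩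
      exists_isChain_prismProj_eq (t, s)
    let c' : Fin (k + 1) →o Fin (n.len + 1) × Bool :=
      ((d.toOrderHom.comp OrderHom.fst).prod OrderHom.snd).comp c
    have h' : prismProj (stdSimplex.map c' v) = (stdSimplex.map d.toOrderHom t, s) := by
      have := prismProj_map d.toOrderHom (stdSimplex.map c v)
      rw [stdSimplex.map_comp_apply] at this
      refine Eq.trans this ?_
      rw [show prismProj (stdSimplex.map c v) = (t, s) from h]
    rw [← h', ← show prismProj (stdSimplex.map c v) = (t, s) from h, hf, hf]
    refine congrArg (fun y => cellMap Y (H ⦋k⦌ y (OrderHom.snd.comp c)) v) ?_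
    exact (ConcreteCategory.congr_hom (X.map_comp d.op
      (simplexHom (n := m) (OrderHom.fst.comp c)).op) x).symm
  have hc : ∀ (b : Bool) (n : SimplexCategory) (x : X.obj (op n))
      (t : stdSimplex ℝ (Fin (n.len + 1))),
      f n x (t, if b then 1 else 0) = cellMap Y (H n x (OrderHom.const _ b)) t := by
    intro b n x t
    rw [← prismProj_map_const]
    refine (hf n x n.len (OrderHom.prod OrderHom.id (OrderHom.const _ b)) t).trans ?_
    refine congrArg (fun y => cellMap Y (H n y (OrderHom.const _ b)) t) ?_
    exact ConcreteCategory.congr_hom (X.map_id (op n)) x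
  -- Currying makes the homotopy a map from the realization to a path space, so the adjunction
  -- suffices and no product with the interval has to be compared with a realization.
  obtain ⟨Φ, hΦ⟩ := exists_desc_cellMap X (TopCat.of C(unitInterval, SSet.toTop.obj Y))
    (fun n x => (f n x).curry) (fun d x t => ContinuousMap.ext fun s => hn d x t s)
  have hb : ∀ (b : Bool) (K : X ⟶ Y), (∀ n x, H n x (OrderHom.const _ b) = K.app (op n) x) →
      ∀ p, (Φ p : C(unitInterval, SSet.toTop.obj Y)) (if b then 1 else 0) =
        (SSet.toTop.map K).hom p := by
    intro b K hK
    let E : C(SSet.toTop.obj X, SSet.toTop.obj Y) :=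
      ⟨fun p => (Φ p : C(unitInterval, SSet.toTop.obj Y)) (if b then 1 else 0),
        (continuous_eval_const _).comp Φ.continuous⟩
    have hE : E = (SSet.toTop.map K).hom := cellMap_ext fun n x t => by
      rw [toTop_map_cellMap, ← hK, ← hc]
      exact congrArg (fun (g : C(unitInterval, SSet.toTop.obj Y)) => g (if b then 1 else 0))
        (hΦ n x t)
    exact fun p => DFunLike.congr_fun hE p
  exact ⟨{
    toFun := fun q => (Φ q.2 : C(unitInterval, SSet.toTop.obj Y)) q.1
    continuous_toFun := (Φ.continuous.comp continuous_snd).eval continuous_fst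
    map_zero_left := hb false F h₀
    map_one_left := hb true G h₁ }⟩

end SimplicialHomotopies
end LaxBidiagrams

/-! ### The cylinder on a lax transformation -/

namespace LaxBidiagrams

universe w₃ v₃ u₃

section Cylinder

variable {S : Type u₁} [Bicategory.{w₁, v₁} S] {B : Type u₂} [Bicategory.{w₂, v₂} B]
  {F G : S ⥤ᴸ B} (θ : Lax.LaxTrans F G)

/-- The objects of the cylinder on a lax transformation. -/
def cylObj (F G : S ⥤ᴸ B) (b : Bool) (i : S) : B :=
  match b with
  | false => F.obj i
  | true => G.obj i

/-- The 1-cells of the cylinder on a lax transformation. -/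
def cylMap {b b' : Bool} (h : b ≤ b') {i j : S} (f : i ⟶ j) :
    cylObj F G b i ⟶ cylObj F G b' j :=
  match b, b', h with
  | false, false, _ => F.map f
  | false, true, _ => F.map f ≫ θ.app j
  | true, true, _ => G.map f

/-- The action of the cylinder on 2-cells. -/
def cylMap₂ {b b' : Bool} (h : b ≤ b') {i j : S} {f g : i ⟶ j} (η : f ⟶ g) :
    cylMap θ h f ⟶ cylMap θ h g :=
  match b, b', h with
  | false, false, _ => F.map₂ η
  | false, true, _ => F.map₂ η ▷ θ.app j
  | true, true, _ => G.map₂ η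

/-- The unit constraint of the cylinder. -/
def cylId {b : Bool} (h : b ≤ b) (i : S) : 𝟙 (cylObj F G b i) ⟶ cylMap θ h (𝟙 i) :=
  match b, h with
  | false, _ => F.mapId i
  | true, _ => G.mapId i

/-- The composition constraint of the cylinder. -/
def cylComp {b b' b'' : Bool} (h : b ≤ b') (h' : b' ≤ b'') (h'' : b ≤ b'') {i j k : S}
    (f : i ⟶ j) (g : j ⟶ k) : cylMap θ h f ≫ cylMap θ h' g ⟶ cylMap θ h'' (f ≫ g) :=
  match b, b', b'', h, h', h'' with
  | false, false, false, _, _, _ => F.mapComp f g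
  | false, false, true, _, _, _ => (α_ _ _ _).inv ≫ F.mapComp f g ▷ θ.app k
  | false, true, true, _, _, _ =>
    (α_ _ _ _).hom ≫ F.map f ◁ θ.naturality g ≫ (α_ _ _ _).inv ≫ F.mapComp f g ▷ θ.app k
  | true, true, true, _, _, _ => G.mapComp f g

theorem cylMap₂_id {b b' : Bool} (h : b ≤ b') {i j : S} (f : i ⟶ j) :
    cylMap₂ θ h (𝟙 f) = 𝟙 (cylMap θ h f) :=
  match b, b', h with
  | false, false, _ => F.map₂_id f
  | false, true, _ =>
    (congrArg (· ▷ θ.app j) (F.map₂_id f)).trans (id_whiskerRight (F.map f) (θ.app j))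
  | true, true, _ => G.map₂_id f

theorem cylMap₂_comp {b b' : Bool} (h : b ≤ b') {i j : S} {f f' f'' : i ⟶ j} (η : f ⟶ f')
    (κ : f' ⟶ f'') : cylMap₂ θ h (η ≫ κ) = cylMap₂ θ h η ≫ cylMap₂ θ h κ :=
  match b, b', h with
  | false, false, _ => F.map₂_comp η κ
  | false, true, _ => (congrArg (· ▷ θ.app j) (F.map₂_comp η κ)).trans
      (comp_whiskerRight (F.map₂ η) (F.map₂ κ) (θ.app j))
  | true, true, _ => G.map₂_comp η κ

theorem cylComp_naturality_left {b b' b'' : Bool} (h : b ≤ b') (h' : b' ≤ b'') (h'' : b ≤ b'')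
    {i j k : S} {f f' : i ⟶ j} (η : f ⟶ f') (g : j ⟶ k) :
    cylComp θ h h' h'' f g ≫ cylMap₂ θ h'' (η ▷ g) =
      cylMap₂ θ h η ▷ cylMap θ h' g ≫ cylComp θ h h' h'' f' g := by
  match b, b', b'', h, h', h'' with
  | false, false, false, _, _, _ => exact F.mapComp_naturality_left η g
  | true, true, true, _, _, _ => exact G.mapComp_naturality_left η g
  | false, false, true, _, _, _ =>
    dsimp only [cylComp, cylMap₂, cylMap, cylObj]
    calc _ = (α_ _ _ _).inv ≫ (F.mapComp f g ≫ F.map₂ (η ▷ g)) ▷ θ.app k := by bicategory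
      _ = _ := by
        rw [F.mapComp_naturality_left]
        bicategory
  | false, true, true, _, _, _ =>
    dsimp only [cylComp, cylMap₂, cylMap, cylObj]
    calc _ = (α_ (F.map f) (θ.app j) (G.map g)).hom ≫ F.map f ◁ θ.naturality g ≫
          (α_ _ _ _).inv ≫ (F.mapComp f g ≫ F.map₂ (η ▷ g)) ▷ θ.app k := by bicategory
      _ = (α_ (F.map f) (θ.app j) (G.map g)).hom ≫
          (F.map f ◁ θ.naturality g ≫ F.map₂ η ▷ (F.map g ≫ θ.app k)) ≫
          (α_ _ _ _).inv ≫ F.mapComp f' g ▷ θ.app k := by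
        rw [F.mapComp_naturality_left]
        bicategory
      _ = _ := by
        rw [whisker_exchange]
        bicategory

theorem cylComp_naturality_right {b b' b'' : Bool} (h : b ≤ b') (h' : b' ≤ b'') (h'' : b ≤ b'')
    {i j k : S} (f : i ⟶ j) {g g' : j ⟶ k} (η : g ⟶ g') :
    cylComp θ h h' h'' f g ≫ cylMap₂ θ h'' (f ◁ η) =
      cylMap θ h f ◁ cylMap₂ θ h' η ≫ cylComp θ h h' h'' f g' := by
  match b, b', b'', h, h', h'' with
  | false, false, false, _, _, _ => exact F.mapComp_naturality_right f η
  | true, true, true, _, _, _ => exact G.mapComp_naturality_right f η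
  | false, false, true, _, _, _ =>
    dsimp only [cylComp, cylMap₂, cylMap, cylObj]
    calc _ = (α_ _ _ _).inv ≫ (F.mapComp f g ≫ F.map₂ (f ◁ η)) ▷ θ.app k := by bicategory
      _ = _ := by
        rw [F.mapComp_naturality_right]
        bicategory
  | false, true, true, _, _, _ =>
    dsimp only [cylComp, cylMap₂, cylMap, cylObj]
    calc _ = (α_ (F.map f) (θ.app j) (G.map g)).hom ≫ F.map f ◁ θ.naturality g ≫
          (α_ _ _ _).inv ≫ (F.mapComp f g ≫ F.map₂ (f ◁ η)) ▷ θ.app k := by bicategory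
      _ = (α_ (F.map f) (θ.app j) (G.map g)).hom ≫
          F.map f ◁ (θ.naturality g ≫ F.map₂ η ▷ θ.app k) ≫
          (α_ _ _ _).inv ≫ F.mapComp f g' ▷ θ.app k := by
        rw [F.mapComp_naturality_right]
        bicategory
      _ = _ := by
        rw [θ.naturality_naturality]
        bicategory

/-- There is one case for each place where the sequence of levels jumps. Without a jump this is
associativity of `F` or `G`; a jump in the last step whiskers that of `F`; a jump in the middle adds
an interchange; a jump in the first step needs `θ.naturality_comp`. -/
theorem cylComp_assoc {b b' b'' c : Bool} (h₁ : b ≤ b') (h₂ : b' ≤ b'') (h₃ : b'' ≤ c)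
    (h₁₂ : b ≤ b'') (h₂₃ : b' ≤ c) (h₁₂₃ : b ≤ c) {i j k l : S} (f : i ⟶ j) (g : j ⟶ k)
    (h : k ⟶ l) :
    cylComp θ h₁ h₂ h₁₂ f g ▷ cylMap θ h₃ h ≫ cylComp θ h₁₂ h₃ h₁₂₃ (f ≫ g) h ≫
        cylMap₂ θ h₁₂₃ (α_ f g h).hom =
      (α_ _ _ _).hom ≫ cylMap θ h₁ f ◁ cylComp θ h₂ h₃ h₂₃ g h ≫
        cylComp θ h₁ h₂₃ h₁₂₃ f (g ≫ h) := by
  match b, b', b'', c, h₁, h₂, h₃, h₁₂, h₂₃, h₁₂₃ with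
  | false, false, false, false, _, _, _, _, _, _ => exact F.map₂_associator f g h
  | true, true, true, true, _, _, _, _, _, _ => exact G.map₂_associator f g h
  | false, false, false, true, _, _, _, _, _, _ =>
    dsimp only [cylComp, cylMap₂, cylMap, cylObj]
    have e := congrArg (· ▷ θ.app l) (F.map₂_associator f g h)
    simp only [comp_whiskerRight] at e
    calc _ = (α_ (F.map f ≫ F.map g) (F.map h) (θ.app l)).inv ≫
          (F.mapComp f g ▷ F.map h ▷ θ.app l ≫ F.mapComp (f ≫ g) h ▷ θ.app l ≫
          F.map₂ (α_ f g h).hom ▷ θ.app l) := by bicategory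
      _ = _ := by
        rw [e]
        bicategory
  | false, false, true, true, _, _, _, _, _, _ =>
    dsimp only [cylComp, cylMap₂, cylMap, cylObj]
    have e := congrArg (· ▷ θ.app l) (F.map₂_associator f g h)
    simp only [comp_whiskerRight] at e
    calc _ = (α_ _ _ _).inv ▷ G.map h ≫ (α_ _ _ _).hom ≫
          (F.mapComp f g ▷ (θ.app k ≫ G.map h) ≫ F.map (f ≫ g) ◁ θ.naturality h) ≫
          (α_ _ _ _).inv ≫ F.mapComp (f ≫ g) h ▷ θ.app l ≫
          F.map₂ (α_ f g h).hom ▷ θ.app l := by bicategory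
      _ = (α_ _ _ _).inv ▷ G.map h ≫ (α_ _ _ _).hom ≫
          (F.map f ≫ F.map g) ◁ θ.naturality h ≫ (α_ _ _ _).inv ≫
          (F.mapComp f g ▷ F.map h ▷ θ.app l ≫ F.mapComp (f ≫ g) h ▷ θ.app l ≫
          F.map₂ (α_ f g h).hom ▷ θ.app l) := by
        rw [← whisker_exchange]
        bicategory
      _ = _ := by
        rw [e]
        bicategory
  | false, true, true, true, _, _, _, _, _, _ =>
    dsimp only [cylComp, cylMap₂, cylMap, cylObj]
    have e := congrArg (· ▷ θ.app l) (F.map₂_associator f g h)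
    simp only [comp_whiskerRight] at e
    calc _ = 𝟙 (((F.map f ≫ θ.app j) ≫ G.map g) ≫ G.map h) ⊗≫
          F.map f ◁ θ.naturality g ▷ G.map h ⊗≫
          (F.mapComp f g ▷ (θ.app k ≫ G.map h) ≫ F.map (f ≫ g) ◁ θ.naturality h) ≫
          (α_ _ _ _).inv ≫ F.mapComp (f ≫ g) h ▷ θ.app l ≫
          F.map₂ (α_ f g h).hom ▷ θ.app l := by bicategory
      _ = 𝟙 (((F.map f ≫ θ.app j) ≫ G.map g) ≫ G.map h) ⊗≫
          F.map f ◁ θ.naturality g ▷ G.map h ⊗≫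
          (F.map f ≫ F.map g) ◁ θ.naturality h ≫ (α_ _ _ _).inv ≫
          (F.mapComp f g ▷ F.map h ▷ θ.app l ≫ F.mapComp (f ≫ g) h ▷ θ.app l ≫
          F.map₂ (α_ f g h).hom ▷ θ.app l) := by
        rw [← whisker_exchange]
        bicategory
      _ = 𝟙 (((F.map f ≫ θ.app j) ≫ G.map g) ≫ G.map h) ⊗≫
          F.map f ◁ ((α_ _ _ _).inv ≫ θ.naturality g ▷ G.map h ≫ (α_ _ _ _).hom ≫
            F.map g ◁ θ.naturality h ≫ (α_ _ _ _).inv ≫ F.mapComp g h ▷ θ.app l) ⊗≫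
          F.mapComp f (g ≫ h) ▷ θ.app l := by
        rw [e]
        bicategory
      _ = _ := by
        rw [← θ.naturality_comp]
        bicategory

theorem cylMap₂_leftUnitor {b b' : Bool} (h : b ≤ b') (hb : b ≤ b) {i j : S} (f : i ⟶ j) :
    cylMap₂ θ h (λ_ f).inv =
      (λ_ _).inv ≫ cylId θ hb i ▷ cylMap θ h f ≫ cylComp θ hb h h (𝟙 i) f := by
  match b, b', h with
  | false, false, _ => exact F.map₂_leftUnitor f
  | true, true, _ => exact G.map₂_leftUnitor f
  | false, true, _ =>
    dsimp only [cylComp, cylMap₂, cylMap, cylObj, cylId]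
    rw [F.map₂_leftUnitor]
    bicategory

/-- For a 1-cell that crosses over, the unit at the target belongs to `G` and has to pass `θ`, which
is `θ.naturality_id`. The unit at the source belongs to `F` and needs no such argument. -/
theorem cylMap₂_rightUnitor {b b' : Bool} (h : b ≤ b') (hb : b' ≤ b') {i j : S} (f : i ⟶ j) :
    cylMap₂ θ h (ρ_ f).inv =
      (ρ_ _).inv ≫ cylMap θ h f ◁ cylId θ hb j ≫ cylComp θ h hb h f (𝟙 j) := by
  match b, b', h with
  | false, false, _ => exact F.map₂_rightUnitor f
  | true, true, _ => exact G.map₂_rightUnitor f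
  | false, true, _ =>
    dsimp only [cylComp, cylMap₂, cylMap, cylObj, cylId]
    calc _ = F.map₂ (ρ_ f).inv ▷ θ.app j := rfl
      _ = 𝟙 (F.map f ≫ θ.app j) ⊗≫ F.map f ◁ ((ρ_ (θ.app j)).hom ≫ (λ_ (θ.app j)).inv ≫
          F.mapId j ▷ θ.app j) ⊗≫ F.mapComp f (𝟙 j) ▷ θ.app j := by
        rw [F.map₂_rightUnitor]
        bicategory
      _ = _ := by
        rw [← θ.naturality_id]
        bicategory

/-- The cylinder on a lax transformation, restricted along a map to the interval. -/
def cylinder (φ : S → Bool) (hφ : ∀ {i j : S}, (i ⟶ j) → φ i ≤ φ j) : S ⥤ᴸ B where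
  obj i := cylObj F G (φ i) i
  map f := cylMap θ (hφ f) f
  map₂ {_ _ f _} η := cylMap₂ θ (hφ f) η
  mapId i := cylId θ _ i
  mapComp f g := cylComp θ (hφ f) (hφ g) (hφ (f ≫ g)) f g
  map₂_id f := cylMap₂_id θ _ f
  map₂_comp η κ := cylMap₂_comp θ _ η κ
  mapComp_naturality_left η g := cylComp_naturality_left θ _ _ _ η g
  mapComp_naturality_right f _ _ η := cylComp_naturality_right θ _ _ _ f η
  map₂_associator f g h := cylComp_assoc θ _ _ _ _ _ _ f g h
  map₂_leftUnitor f := cylMap₂_leftUnitor θ _ _ f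
  map₂_rightUnitor f := cylMap₂_rightUnitor θ _ _ f

/-- Restriction of a lax transformation along a lax functor. -/
def laxTransRestrict {R : Type u₃} [Bicategory.{w₃, v₃} R] (X : R ⥤ᴸ S) :
    Lax.LaxTrans (X.comp F) (X.comp G) where
  app i := θ.app (X.obj i)
  naturality f := θ.naturality (X.map f)
  naturality_naturality η := θ.naturality_naturality (X.map₂ η)
  naturality_id i := by
    change θ.app _ ◁ (G.mapId _ ≫ G.map₂ (X.mapId i)) ≫ _ = _ ≫ _ ≫ (F.mapId _ ≫ F.map₂ _) ▷ _
    rw [whiskerLeft_comp, comp_whiskerRight, Category.assoc, ← θ.naturality_naturality,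
      θ.naturality_id_assoc]
    rfl
  naturality_comp f g := by
    change θ.app _ ◁ (G.mapComp _ _ ≫ G.map₂ (X.mapComp f g)) ≫ _ =
      _ ≫ _ ≫ _ ≫ _ ≫ _ ≫ (F.mapComp _ _ ≫ F.map₂ _) ▷ _
    rw [whiskerLeft_comp, comp_whiskerRight, Category.assoc, ← θ.naturality_naturality,
      θ.naturality_comp_assoc]
    rfl

end Cylinder

/-! ### Homotopies of classifying maps -/

section Homotopy

variable {A B : Type u} [Bicategory.{u, u} A] [Bicategory.{u, u} B]

/-- The cylinder on a lax transformation between the images of a simplex of the nerve. -/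
def nerveCylinder {F G : A ⥤ᴸ B} (θ : Lax.LaxTrans F G) {n : ℕ}
    (X : LocallyDiscrete (Fin (n + 1)) ⥤ᴸ A) (φ : Fin (n + 1) →o Bool) :
    LocallyDiscrete (Fin (n + 1)) ⥤ᴸ B :=
  cylinder (laxTransRestrict θ X) (fun i => φ i.as) fun f => φ.monotone (leOfHom f.as)

/-- The cylinders on the restrictions of `θ` to simplices form a simplicial homotopy. Restriction
along monotone maps and the values at the two ends agree by definition. -/
theorem homotopic_classifyingMap {F G : A ⥤ᴸ B} (θ : Lax.LaxTrans F G) :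
    ContinuousMap.Homotopic (classifyingMap F) (classifyingMap G) :=
  homotopic_toTop_map (fun _ X φ => nerveCylinder θ X φ)
    (fun _ _ _ => rfl) (fun _ _ => rfl) (fun _ _ => rfl)

theorem laxFunctor_ext {S : Type u₁} [Bicategory.{w₁, v₁} S] {B : Type u₂}
    [Bicategory.{w₂, v₂} B] {F G : S ⥤ᴸ B} (h : F.toPrelaxFunctor = G.toPrelaxFunctor)
    (hI : HEq F.mapId G.mapId)
    (hC : HEq (@LaxFunctor.mapComp _ _ _ _ F) (@LaxFunctor.mapComp _ _ _ _ G)) : F = G := by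
  cases F
  cases G
  cases h
  cases hI
  cases hC
  rfl

theorem laxFunctor_comp_id {S : Type u₁} [Bicategory.{w₁, v₁} S] {B : Type u₂}
    [Bicategory.{w₂, v₂} B] (X : S ⥤ᴸ B) : X.comp (LaxFunctor.id B) = X :=
  laxFunctor_ext rfl (heq_of_eq (funext fun _ => Category.id_comp _))
    (heq_of_eq (by funext i j k f g; exact Category.id_comp _))

/-- Strict associativity: the constraints of the two composites differ only by the functoriality of
`G` on 2-cells. -/
theorem laxFunctor_comp_assoc {S : Type u₁} [Bicategory.{w₁, v₁} S] (X : S ⥤ᴸ A) (F : A ⥤ᴸ B)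
    {C : Type u} [Bicategory.{u, u} C] (G : B ⥤ᴸ C) :
    X.comp (F.comp G) = (X.comp F).comp G := by
  refine laxFunctor_ext rfl (heq_of_eq ?_) (heq_of_eq ?_)
  · funext i
    exact (Category.assoc _ _ _).trans (congrArg (_ ≫ ·) (G.map₂_comp _ _).symm)
  · funext i j k f g
    exact (Category.assoc _ _ _).trans (congrArg (_ ≫ ·) (G.map₂_comp _ _).symm)

theorem classifyingMap_id : classifyingMap (LaxFunctor.id A) = ContinuousMap.id _ := by
  have h : geometricNerveMap (LaxFunctor.id A) = 𝟙 _ := by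
    ext n X
    exact laxFunctor_comp_id X
  rw [classifyingMap, h, CategoryTheory.Functor.map_id]
  rfl

theorem classifyingMap_comp {C : Type u} [Bicategory.{u, u} C] (F : A ⥤ᴸ B) (G : B ⥤ᴸ C) :
    classifyingMap (F.comp G) = (classifyingMap G).comp (classifyingMap F) := by
  have h : geometricNerveMap (F.comp G) = geometricNerveMap F ≫ geometricNerveMap G := by
    ext n X
    exact laxFunctor_comp_assoc X F G
  rw [classifyingMap, h, CategoryTheory.Functor.map_comp]
  rfl

end Homotopy

end LaxBidiagrams

/-! ### The homotopy equivalence -/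

theorem mainTheorem9 {C : Type u} [SmallCategory C] {z : C} (hz : Limits.IsInitial z)
    (L : LaxBidiagrams.LaxBidiagram.{u, u, u, u, u, u} (LocallyDiscrete C)) :
    ∃ hG : (LaxBidiagrams.grothData L).IsBicategory,
      letI : Bicategory (LaxBidiagrams.Groth L) := hG.toBicategory
      ∃ (hJ : (LaxBidiagrams.embeddingJ L (LocallyDiscrete.mk z)).IsHomomorphism)
        (hK : (LaxBidiagrams.retractionK L hz).IsHomomorphism)
        (e : ContinuousMap.HomotopyEquiv
          (LaxBidiagrams.classifyingSpace (L.fib (LocallyDiscrete.mk z)))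
          (LaxBidiagrams.classifyingSpace (LaxBidiagrams.Groth L))),
        e.toFun = LaxBidiagrams.classifyingMap hJ.toPseudofunctor.toLax ∧
          e.invFun = LaxBidiagrams.classifyingMap hK.toPseudofunctor.toLax := by
  refine ⟨LaxBidiagrams.Groth.isBicategory L, LaxBidiagrams.embeddingJ_isHomomorphism L _,
    LaxBidiagrams.retractionK_isHomomorphism L hz,
    ⟨LaxBidiagrams.classifyingMap (LaxBidiagrams.laxJ L _),
      LaxBidiagrams.classifyingMap (LaxBidiagrams.laxK L hz), ?_, ?_⟩, rfl, rfl⟩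
  -- Both composites become classifying maps of lax functors. The transformation 1 ⇒ KJ points away
  -- from the identity, hence the symmetry here; JK ⇒ 1 already has the required direction.
  · rw [← LaxBidiagrams.classifyingMap_comp, ← LaxBidiagrams.classifyingMap_id]
    exact (LaxBidiagrams.homotopic_classifyingMap (LaxBidiagrams.unitTrans L hz)).symm
  · rw [← LaxBidiagrams.classifyingMap_comp, ← LaxBidiagrams.classifyingMap_id]
    exact LaxBidiagrams.homotopic_classifyingMap (LaxBidiagrams.counitTrans L hz)
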